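/- Let $(M,g)$ be a compact connected oriented two-dimensional smooth Riemannian manifold, possibly with boundary, let $d(\cdot,\cdot)$ be its Riemannian distance, $dx_g$ its area form, $R$ its scalar curvature, and $\mathbf A$ a smooth real 1-form on $M$ (smooth up to the boundary). Write $d\mathbf A=b\,dx_g$, and let $H^h=(ih\,d+\mathbf A)^*(ih\,d+\mathbf A)$, $h>0$, be the magnetic Schrödinger operator (with Dirichlet boundary conditions if $\partial M\neq\emptyset$); $(\cdot,\cdot)$ and $\|\cdot\|$ denote the scalar product and norm of $L^2(M,dx_g)$, and $C_c^\infty(M)$ the smooth complex functions with compact support in the interior of $M$. Assume that $b_0=\min_M|b|>0$, that $\gamma=\{x\in M:|b(x)|=b_0\}$ is a smooth simple closed curve contained in the interior of $M$, and that for some $C>0$ $$C^{-1}d(x,\gamma)^2\le |b(x)|-b_0\le C\,d(x,\gamma)^2$$ for all $x$ in a neighborhood of $\gamma$. For $x\in\gamma$ let $\beta_2(x)$ be the second derivative at $x$ of $|b|$ along the unit speed geodesic through $x$ normal to $\gamma$. Fix an integer $k\ge 0$, put $$V_k(x)=(2k^2+2k+1)\frac{\beta_2(x)}{4b_0}+\tfrac12(k^2+k)R(x),\qquad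 x\in\gamma,$$ and assume that $V_k$ has on $\gamma$ a unique minimum point $x_0$, and that this minimum is nondegenerate: for some $C>0$, $C\,d(x,x_0)^2\le V_k(x)-V_k(x_0)\le C^{-1}d(x,x_0)^2$ for all $x\in\gamma$ near $x_0$. Derivatives of $V_k$ are taken with respect to the arc length of $\gamma$. Then there are functions $u^h_{jk}\in C_c^\infty(M)$ ($j=0,1,2,\dots$, $h>0$) such that: 1. for all $j_1,j_2\ge0$, $(u^h_{j_1k},u^h_{j_2k})=\delta_{j_1j_2}+\mathcal O_{j_1,j_2,k}(h)$ as $h\to0^+$; 2. for every $j\ge0$ there are $C_{jk}>0$ and $h_{jk}>0$ such that for all $h\in(0,h_{jk}]$ $$\|H^hu^h_{jk}-\mu^h_{jk}u^h_{jk}\|\le C_{jk}\,h^{11/4}\,\|u^h_{jk}\|,$$ where $$\mu^h_{jk}=(2k+1)b_0\,h+V_k(x_0)\,h^2+\frac1{2b_0}V_k''(x_0)^{1/2}\beta_2(x_0)^{1/2}(2k+1)^{1/2}(2j+1)\,h^{5/2}.$$ -/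

import Mathlib

open Set Filter Topology MeasureTheory Bundle Manifold
open scoped ContDiff

noncomputable section

namespace MagneticWell

/-- The model plane `ℝ²`. -/
abbrev Plane : Type := EuclideanSpace ℝ (Fin 2)

/-- The `i`-th standard basis vector of the model plane. -/
def basisVec (i : Fin 2) : Plane := EuclideanSpace.single i 1

section Geometry

variable {H : Type*} [TopologicalSpace H] (I : ModelWithCorners ℝ Plane H)

/-- Partial derivative in the direction `i` of a function of the chart coordinates. The coordinates
of a manifold with boundary range in subsets of `range I`, so derivatives are taken within it. -/
def partialDeriv (i : Fin 2) (f : Plane → ℝ) (y : Plane) : ℝ :=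
  fderivWithin ℝ f (range I) y (basisVec i)

section Forms

variable {M : Type*} [TopologicalSpace M] [ChartedSpace H M]

/-- The coordinate vector field `∂ᵢ` of the chart around `p`, at the point of coordinates `y`. -/
def coordVec (p : M) (y : Plane) (i : Fin 2) :
    TangentSpace I ((extChartAt I p).symm y) :=
  mfderivWithin 𝓘(ℝ, Plane) I (extChartAt I p).symm (range I) y (basisVec i)

instance (x : M) : FiniteDimensional ℝ (TangentSpace I x) :=
  inferInstanceAs (FiniteDimensional ℝ Plane)

/-- The components `Aᵢ` of a 1-form in the coordinates of the chart around `p`. -/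
def coordForm (A : ∀ x : M, TangentSpace I x →L[ℝ] ℝ) (p : M) (i : Fin 2) (y : Plane) : ℝ :=
  A ((extChartAt I p).symm y) (coordVec I p y i)

/-- A smooth real 1-form: a smooth section of the cotangent bundle. -/
def IsSmoothForm [IsManifold I ∞ M] (A : ∀ x : M, TangentSpace I x →L[ℝ] ℝ) : Prop :=
  ContMDiff I (I.prod 𝓘(ℝ, Plane →L[ℝ] ℝ)) ∞
    (fun x => TotalSpace.mk' (Plane →L[ℝ] ℝ)
      (E := fun x : M => TangentSpace I x →L[ℝ] ℝ) x (A x))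

/-- `u ∈ C_c^∞(M)`: a smooth complex function vanishing near the boundary. (It is used on a compact
`M`, where the support is automatically compact.) -/
structure IsTestFunction (u : M → ℂ) : Prop where
  smooth : ContMDiff I 𝓘(ℝ, ℂ) ∞ u
  support_subset : tsupport u ⊆ I.interior M

/-- The vector `c'(t)` tangent to a curve `c`. -/
def velocity (c : ℝ → M) (t : ℝ) : TangentSpace I (c t) :=
  mfderiv 𝓘(ℝ, ℝ) I c t (1 : ℝ)

end Forms

variable {M : Type*} [TopologicalSpace M] [ChartedSpace H M]
  [RiemannianBundle (fun x : M => TangentSpace I x)]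

/-- The matrix `(gᵢⱼ)` of the metric in the coordinates of the chart around `p`. -/
def gram (p : M) (y : Plane) : Matrix (Fin 2) (Fin 2) ℝ :=
  Matrix.of fun i j => inner ℝ (coordVec I p y i) (coordVec I p y j)

/-- The function `b` with `dA = b dx_g`, where the area form `dx_g = √(det g) dx¹ ∧ dx²` is the one of
the orientation for which the preferred chart around `x` is positive. On an oriented manifold this
is `b` up to sign; only `|b|` is used. -/
def fieldStrength (A : ∀ x : M, TangentSpace I x →L[ℝ] ℝ) (x : M) : ℝ :=
  (partialDeriv I 0 (coordForm I A x 1) (extChartAt I x x)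
    - partialDeriv I 1 (coordForm I A x 0) (extChartAt I x x))
    / Real.sqrt (gram I x (extChartAt I x x)).det

/-- The Christoffel symbol `Γᵏᵢⱼ` of the Levi-Civita connection in the chart around `p`. -/
def christoffel (p : M) (k i j : Fin 2) (y : Plane) : ℝ :=
  ∑ l : Fin 2, (1 / 2) * (gram I p y)⁻¹ k l *
    (partialDeriv I i (fun z => gram I p z j l) y + partialDeriv I j (fun z => gram I p z i l) y
      - partialDeriv I l (fun z => gram I p z i j) y)

/-- The components `Rⁱ_{ljk}` of the curvature of the Levi-Civita connection,
`R(∂ⱼ, ∂ₖ) ∂ₗ = ∑ᵢ Rⁱ_{ljk} ∂ᵢ`, in the chart around `p`. -/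
def curvature (p : M) (i l j k : Fin 2) (y : Plane) : ℝ :=
  partialDeriv I j (christoffel I p i k l) y - partialDeriv I k (christoffel I p i j l) y
    + ∑ m : Fin 2, christoffel I p m k l y * christoffel I p i j m y
    - ∑ m : Fin 2, christoffel I p m j l y * christoffel I p i k m y

/-- The Ricci tensor `Ric_{ac} = ∑ᵢ Rⁱ_{aic}` in the chart around `p`. -/
def ricci (p : M) (a c : Fin 2) (y : Plane) : ℝ :=
  ∑ i : Fin 2, curvature I p i a i c y

/-- The scalar curvature `R = ∑ gᵃᶜ Ric_{ac}` (twice the Gauss curvature) at the point `x`. -/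
def scalarCurvature (x : M) : ℝ :=
  ∑ a : Fin 2, ∑ c : Fin 2,
    (gram I x (extChartAt I x x))⁻¹ a c * ricci I x a c (extChartAt I x x)

/-- The curve `c`, defined near time `0`, is a unit speed geodesic that starts at `γ s` in a direction
orthogonal to the curve `γ`. The geodesic equation is written in the chart around `c 0`. -/
structure IsNormalGeodesic (γ : ℝ → M) (s : ℝ) (c : ℝ → M) : Prop where
  start : c 0 = γ s
  smooth : ContMDiffAt 𝓘(ℝ, ℝ) I ∞ c 0
  unit : ‖velocity I c 0‖ = 1
  normal : inner ℝ (E := TangentSpace I (γ s)) (velocity I c 0) (velocity I γ s) = 0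
  geodesic : ∀ᶠ t in 𝓝 (0 : ℝ), ∀ k : Fin 2,
    iteratedDeriv 2 (fun r => extChartAt I (c 0) (c r) k) t
      + ∑ i : Fin 2, ∑ j : Fin 2, christoffel I (c 0) k i j (extChartAt I (c 0) (c t))
        * deriv (fun r => extChartAt I (c 0) (c r) i) t
        * deriv (fun r => extChartAt I (c 0) (c r) j) t = 0

open Classical in
/-- `Ñ² f` at the point `γ s`, where `Ñ` is the unit vector field whose integral curves are the
geodesics normal to `γ`: the second derivative of `f` along the normal geodesic from `γ s`. (That
geodesic is unique near time `0` up to `t ↦ -t`, which does not change the second derivative.) -/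
def secondNormalDeriv (γ : ℝ → M) (f : M → ℝ) (s : ℝ) : ℝ :=
  if hc : ∃ c : ℝ → M, IsNormalGeodesic I γ s c then
    iteratedDeriv 2 (fun t => f (hc.choose t)) 0
  else 0

/-- The Riemannian area of the domain of the chart around `p`, as a measure on `M`: the image of
`√(det g) dy` under the inverse chart. -/
def chartVolume [MeasurableSpace M] (p : M) : Measure M :=
  (((volume : Measure Plane).restrict (extChartAt I p).target).withDensity
    (fun y => ENNReal.ofReal (Real.sqrt (gram I p y).det))).map (extChartAt I p).symm

variable (M) in
/-- The Riemannian area measure `dx_g`: the least measure that is at least `√(det g) dy` in each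
chart. -/
def riemannianVolume [MeasurableSpace M] : Measure M :=
  ⨆ p : M, chartVolume I p

/-- The scalar product `∫ u v̄ dx_g` of complex functions. -/
def l2Inner [MeasurableSpace M] (u v : M → ℂ) : ℂ :=
  ∫ x, u x * (starRingEnd ℂ) (v x) ∂(riemannianVolume I M)

/-- The norm `(∫ |u|² dx_g)^{1/2}`. -/
def l2Norm [MeasurableSpace M] (u : M → ℂ) : ℝ :=
  Real.sqrt (∫ x, ‖u x‖ ^ 2 ∂(riemannianVolume I M))

/-- The complex 1-form `i h du + A u`. -/
def magneticDifferential (A : ∀ x : M, TangentSpace I x →L[ℝ] ℝ) (h : ℝ) (u : M → ℂ)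
    (x : M) (v : TangentSpace I x) : ℂ :=
  letI du : ℂ := mfderiv I 𝓘(ℝ, ℂ) u x v
  Complex.I * (h : ℂ) * du + (A x v : ℂ) * u x

/-- The scalar product at `x` of complex 1-forms, `∑ₐ α(eₐ) (β(eₐ))̄` in an orthonormal basis `(eₐ)` of
the tangent space. -/
def formInner (α β : ∀ x : M, TangentSpace I x → ℂ) (x : M) : ℂ :=
  ∑ a, α x (stdOrthonormalBasis ℝ (TangentSpace I x) a)
    * (starRingEnd ℂ) (β x (stdOrthonormalBasis ℝ (TangentSpace I x) a))

/-- `f = H^h u` for the magnetic Schrödinger operator `H^h = (i h d + A)^* (i h d + A)` and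
`u ∈ C_c^∞(M)`: the smooth function `f` satisfies
`(f, v) = ((i h d + A) u, (i h d + A) v)` for all `v ∈ C_c^∞(M)`. -/
structure IsMagneticSchrodinger [MeasurableSpace M] (A : ∀ x : M, TangentSpace I x →L[ℝ] ℝ) (h : ℝ)
    (u f : M → ℂ) : Prop where
  smooth : ContMDiff I 𝓘(ℝ, ℂ) ∞ f
  adjoint : ∀ v : M → ℂ, IsTestFunction I v →
    l2Inner I f v =
      ∫ x, formInner I (magneticDifferential I A h u) (magneticDifferential I A h v) x
        ∂(riemannianVolume I M)

end Geometry

section Wells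

variable {H : Type*} [TopologicalSpace H] (I : ModelWithCorners ℝ Plane H)
  {M : Type*} [MetricSpace M] [ChartedSpace H M]
  [RiemannianBundle (fun x : M => TangentSpace I x)]

/-- `γ` is the parametrization by arc length of a smooth simple closed curve of length `L`. -/
structure IsClosedCurve (γ : ℝ → M) (L : ℝ) : Prop where
  length_pos : 0 < L
  smooth : ContMDiff 𝓘(ℝ, ℝ) I ∞ γ
  unit_speed : ∀ s, ‖velocity I γ s‖ = 1
  periodic : Function.Periodic γ L
  injective : InjOn γ (Ico 0 L)

/-- The standing assumptions on the magnetic field: `b₀ = min |b|` is positive, it is attained exactly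
on a smooth closed curve `γ` in the interior of `M`, and `|b| - b₀` is comparable with the squared
distance to `γ` near `γ`. -/
structure IsDegenerateWell (A : ∀ x : M, TangentSpace I x →L[ℝ] ℝ) (b₀ : ℝ) (γ : ℝ → M) (L : ℝ) :
    Prop where
  isLeast : IsLeast (range fun x => |fieldStrength I A x|) b₀
  pos : 0 < b₀
  curve : IsClosedCurve I γ L
  range_eq : range γ = {x | |fieldStrength I A x| = b₀}
  subset_interior : range γ ⊆ I.interior M
  quadratic : ∃ C > (0 : ℝ), ∀ᶠ x in 𝓝ˢ (range γ),
    C⁻¹ * Metric.infDist x (range γ) ^ 2 ≤ |fieldStrength I A x| - b₀ ∧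
      |fieldStrength I A x| - b₀ ≤ C * Metric.infDist x (range γ) ^ 2

/-- The function `β₂ = Ñ² |b|` on `γ`, in terms of the arc length `s`. -/
def beta₂ (A : ∀ x : M, TangentSpace I x →L[ℝ] ℝ) (γ : ℝ → M) (s : ℝ) : ℝ :=
  secondNormalDeriv I γ (fun x => |fieldStrength I A x|) s

/-- The function `V_k = (2k² + 2k + 1) β₂ / (4 b₀) + (k² + k) R / 2` on `γ`, in terms of the arc
length `s`. -/
def potential (A : ∀ x : M, TangentSpace I x →L[ℝ] ℝ) (b₀ : ℝ) (γ : ℝ → M) (k : ℕ) (s : ℝ) : ℝ :=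
  (2 * (k : ℝ) ^ 2 + 2 * k + 1) * (beta₂ I A γ s / (4 * b₀))
    + (1 / 2) * ((k : ℝ) ^ 2 + k) * scalarCurvature I (γ s)

/-- The function `V` (of the arc length) has on `γ` a unique minimum, at the point `γ s₀`, and
`V - V(s₀)` is comparable near this point with the squared distance to it. -/
structure IsUniqueNondegenerateMin (γ : ℝ → M) (V : ℝ → ℝ) (s₀ : ℝ) : Prop where
  unique_min : ∀ s, γ s ≠ γ s₀ → V s₀ < V s
  nondegenerate : ∃ C > (0 : ℝ), ∀ᶠ x in 𝓝 (γ s₀), ∀ s, γ s = x →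
    C * dist x (γ s₀) ^ 2 ≤ V s - V s₀ ∧ V s - V s₀ ≤ C⁻¹ * dist x (γ s₀) ^ 2

/-- The approximate eigenvalue
`μ = (2k+1) b₀ h + V_k(x₀) h² + (2 b₀)⁻¹ V_k''(x₀)^{1/2} β₂(x₀)^{1/2} (2k+1)^{1/2} (2j+1) h^{5/2}`;
the second derivative is with respect to the arc length. -/
def approxEigenvalue (A : ∀ x : M, TangentSpace I x →L[ℝ] ℝ) (b₀ : ℝ) (γ : ℝ → M) (s₀ : ℝ)
    (j k : ℕ) (h : ℝ) : ℝ :=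
  (2 * (k : ℝ) + 1) * b₀ * h + potential I A b₀ γ k s₀ * h ^ 2
    + 1 / (2 * b₀) * Real.sqrt (iteratedDeriv 2 (potential I A b₀ γ k) s₀)
      * Real.sqrt (beta₂ I A γ s₀) * Real.sqrt (2 * (k : ℝ) + 1) * (2 * (j : ℝ) + 1)
      * h ^ (5 / 2 : ℝ)

end Wells

end MagneticWell

end

noncomputable section

namespace MagneticWell

open Metric (ball closedBall)

local notation "Mat" => Matrix (Fin 2) (Fin 2) ℝ

/-- A vector space with a central parameter `e`, a ladder pair `u, d` with `[d, u] = 1/2` and a Weyl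
pair `Z, δ` with `[δ, Z] = 1` that commutes with it. -/
structure WeylModel (W : Type*) [AddCommGroup W] [Module ℂ W] where
  e : Module.End ℂ W
  u : Module.End ℂ W
  d : Module.End ℂ W
  Z : Module.End ℂ W
  δ : Module.End ℂ W
  u_e : ∀ v, u (e v) = e (u v)
  d_e : ∀ v, d (e v) = e (d v)
  Z_e : ∀ v, Z (e v) = e (Z v)
  δ_e : ∀ v, δ (e v) = e (δ v)
  d_u : ∀ v, d (u v) = u (d v) + (1 / 2 : ℂ) • v
  δ_Z : ∀ v, δ (Z v) = Z (δ v) + v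
  Z_u : ∀ v, Z (u v) = u (Z v)
  Z_d : ∀ v, Z (d v) = d (Z v)
  δ_u : ∀ v, δ (u v) = u (δ v)
  δ_d : ∀ v, δ (d v) = d (δ v)

namespace WeylModel

variable {W : Type*} [AddCommGroup W] [Module ℂ W] (A : WeylModel W)

/-- The operators `Π₁` and `Π₂`, up to scaling. -/
def p₁ : Module.End ℂ W := A.u + A.d

def p₂ : Module.End ℂ W := Complex.I • (A.d - A.u)

lemma p₁_apply (v : W) : A.p₁ v = A.u v + A.d v := rfl

lemma p₂_apply (v : W) : A.p₂ v = Complex.I • (A.d v - A.u v) := rfl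

/-- The slow variable. -/
def X : Module.End ℂ W := A.e * A.Z

/-- The operator of multiplication by a polynomial in the slow variable. -/
def slow (p : Polynomial ℂ) : Module.End ℂ W := Polynomial.aeval A.X p

lemma X_apply (v : W) : A.X v = A.e (A.Z v) := rfl

lemma slow_induction {motive : Module.End ℂ W → Prop} (p : Polynomial ℂ)
    (hc : ∀ c : ℂ, motive (c • 1)) (hadd : ∀ f g, motive f → motive g → motive (f + g))
    (hmul : ∀ f, motive f → motive (f * A.X)) : motive (A.slow p) := by
  induction p using Polynomial.induction_on with
  | C a => simpa [slow, Algebra.algebraMap_eq_smul_one] using hc a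
  | add p q hp hq => simpa [slow] using hadd _ _ hp hq
  | monomial n a h =>
    have := hmul _ h
    rw [slow, map_mul, Polynomial.aeval_C, map_pow, Polynomial.aeval_X] at this ⊢
    rwa [pow_succ, ← mul_assoc]

lemma slow_comm {f : Module.End ℂ W} (hf : ∀ v, f (A.X v) = A.X (f v)) (p : Polynomial ℂ) (v : W) :
    f (A.slow p v) = A.slow p (f v) := by
  have : ∀ v, f (A.slow p v) = A.slow p (f v) := by
    refine A.slow_induction (motive := fun g => ∀ v, f (g v) = g (f v)) p ?_ ?_ ?_
    · intro c v; simp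
    · intro a b ha hb v; simp [ha, hb]
    · intro a ha v; simp [ha, hf]
  exact this v

lemma u_slow (p : Polynomial ℂ) (v : W) : A.u (A.slow p v) = A.slow p (A.u v) :=
  A.slow_comm (fun v => by simp [X_apply, A.u_e, A.Z_u]) p v

lemma d_slow (p : Polynomial ℂ) (v : W) : A.d (A.slow p v) = A.slow p (A.d v) :=
  A.slow_comm (fun v => by simp [X_apply, A.d_e, A.Z_d]) p v

lemma e_slow (p : Polynomial ℂ) (v : W) : A.e (A.slow p v) = A.slow p (A.e v) :=
  A.slow_comm (fun v => by simp [X_apply, A.Z_e]) p v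

lemma slow_slow (p q : Polynomial ℂ) (v : W) : A.slow p (A.slow q v) = A.slow (p * q) v := by
  simp [slow]

lemma δ_slow (p : Polynomial ℂ) (v : W) :
    A.δ (A.slow p v) = A.slow p (A.δ v) + A.e (A.slow (Polynomial.derivative p) v) := by
  induction p using Polynomial.induction_on generalizing v with
  | C a => simp [slow]
  | add p q hp hq =>
    have h1 := hp v
    have h2 := hq v
    simp only [slow, map_add, LinearMap.add_apply] at h1 h2 ⊢
    rw [h1, h2]; abel
  | monomial n a h =>
    have key : ∀ v, A.slow (Polynomial.C a * Polynomial.X ^ (n + 1)) v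
        = A.slow (Polynomial.C a * Polynomial.X ^ n) (A.X v) := by
      intro v; rw [pow_succ, ← mul_assoc, ← slow_slow]; simp [slow]
    have hX : ∀ p (v : W), A.slow p (A.X v) = A.slow (p * Polynomial.X) v := by
      intro p v; rw [← slow_slow]; simp [slow]
    rw [key, h, key]
    have hδX : A.δ (A.X v) = A.X (A.δ v) + A.e v := by
      simp [X_apply, A.δ_e, A.δ_Z]
    rw [hδX, map_add, add_assoc, ← A.e_slow, ← map_add, hX]
    congr 2
    rw [hX, pow_succ, ← mul_assoc, Polynomial.derivative_mul]
    simp [slow]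
    abel

/-- The eigenspaces of the number operator `2ud`. -/
def level (n : ℤ) : Submodule ℂ W where
  carrier := {v | A.u (A.d v) = ((n : ℂ) / 2) • v}
  add_mem' := by intro a b ha hb; simp only [mem_ofPred_eq] at *; simp [ha, hb]
  zero_mem' := by simp
  smul_mem' := by intro c v hv; simp only [mem_ofPred_eq] at *; simp [hv, smul_comm c]

lemma mem_level {n : ℤ} {v : W} : v ∈ A.level n ↔ A.u (A.d v) = ((n : ℂ) / 2) • v := Iff.rfl

lemma u_mem_level {n : ℤ} {v : W} (hv : v ∈ A.level n) : A.u v ∈ A.level (n + 1) := by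
  rw [mem_level] at *
  rw [A.d_u, map_add, hv]; push_cast; simp only [map_smul]; module

lemma d_mem_level {n : ℤ} {v : W} (hv : v ∈ A.level n) : A.d v ∈ A.level (n - 1) := by
  rw [mem_level] at *
  have h : A.d (A.u (A.d v)) = _ := A.d_u (A.d v)
  rw [hv, map_smul] at h
  have : A.u (A.d (A.d v)) = ((n : ℂ) / 2) • A.d v - (1 / 2 : ℂ) • A.d v := by rw [h]; abel
  rw [this]; push_cast; module

lemma map_mem_level {f : Module.End ℂ W} (hu : ∀ v, f (A.u v) = A.u (f v))
    (hd : ∀ v, f (A.d v) = A.d (f v)) {n : ℤ} {v : W} (hv : v ∈ A.level n) :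
    f v ∈ A.level n := by
  rw [mem_level] at *
  rw [← hd, ← hu, hv, map_smul]

lemma δ_mem_level {n : ℤ} {v : W} (hv : v ∈ A.level n) : A.δ v ∈ A.level n :=
  A.map_mem_level A.δ_u A.δ_d hv

lemma slow_mem_level (p : Polynomial ℂ) {n : ℤ} {v : W} (hv : v ∈ A.level n) :
    A.slow p v ∈ A.level n :=
  A.map_mem_level (fun v => (A.u_slow p v).symm) (fun v => (A.d_slow p v).symm) hv

/-- The leading operator `4ud - 2k`. -/
def lead (k : ℕ) (v : W) : W := (4 : ℂ) • A.u (A.d v) - (2 * k : ℂ) • v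

/-- The span of the levels `k + m` for the integers `m ∈ S`. -/
def levels (k : ℕ) (S : Set ℤ) : Submodule ℂ W := Submodule.span ℂ (⋃ m ∈ S, (A.level (k + m) : Set W))

lemma mem_levels {k : ℕ} {S : Set ℤ} {m : ℤ} (hm : m ∈ S) {v : W} (hv : v ∈ A.level (k + m)) :
    v ∈ A.levels k S :=
  Submodule.subset_span (mem_biUnion hm hv)

lemma levels_mono {k : ℕ} {S T : Set ℤ} (h : S ⊆ T) : A.levels k S ≤ A.levels k T :=
  Submodule.span_mono (biUnion_subset_biUnion_left h)

lemma map_mem_levels {k : ℕ} {S T : Set ℤ} {f : Module.End ℂ W}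
    (h : ∀ m ∈ S, ∀ v ∈ A.level (k + m), f v ∈ A.levels k T) {v : W} (hv : v ∈ A.levels k S) :
    f v ∈ A.levels k T := by
  refine Submodule.span_induction (p := fun v _ => f v ∈ A.levels k T) ?_ ?_ ?_ ?_ hv
  · intro x hx
    simp only [mem_iUnion] at hx
    obtain ⟨m, hm, hx⟩ := hx
    exact h m hm x hx
  · simp
  · intro x y _ _ hx hy; rw [map_add]; exact add_mem hx hy
  · intro c x _ hx; rw [map_smul]; exact Submodule.smul_mem _ _ hx

/-- The even, odd and nonzero even integers. -/
abbrev evens : Set ℤ := {m | Even m}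
abbrev odds : Set ℤ := {m | Odd m}
abbrev evens' : Set ℤ := {m | Even m ∧ m ≠ 0}

variable {A} {k : ℕ}

lemma exists_lead_eq {S : Set ℤ} (hS : (0 : ℤ) ∉ S) {v : W} (hv : v ∈ A.levels k S) :
    ∃ w ∈ A.levels k S, A.lead k w = -v := by
  refine Submodule.span_induction (p := fun v _ => ∃ w ∈ A.levels k S, A.lead k w = -v)
    ?_ ?_ ?_ ?_ hv
  · intro x hx
    simp only [mem_iUnion] at hx
    obtain ⟨m, hm, hx⟩ := hx
    have hm0 : (m : ℂ) ≠ 0 := by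
      intro h; apply hS; have : m = 0 := by exact_mod_cast h
      rwa [this] at hm
    refine ⟨-(1 / (2 * m) : ℂ) • x, Submodule.smul_mem _ _ (A.mem_levels hm hx), ?_⟩
    have hx' := A.mem_level.1 hx
    simp only [lead, map_smul, hx', smul_smul]
    push_cast
    rw [← sub_smul, ← neg_one_smul ℂ x]
    congr 1
    field_simp
    ring
  · exact ⟨0, zero_mem _, by simp [lead]⟩
  · rintro x y _ _ ⟨a, ha, hax⟩ ⟨b, hb, hby⟩
    refine ⟨a + b, add_mem ha hb, ?_⟩
    have : A.lead k (a + b) = A.lead k a + A.lead k b := by simp [lead]; abel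
    rw [this, hax, hby]; abel
  · rintro c x _ ⟨a, ha, hax⟩
    refine ⟨c • a, Submodule.smul_mem _ _ ha, ?_⟩
    have : A.lead k (c • a) = c • A.lead k a := by simp [lead, smul_sub, smul_comm c]
    rw [this, hax, smul_neg]

lemma u_odd {v : W} (hv : v ∈ A.levels k evens) : A.u v ∈ A.levels k odds :=
  A.map_mem_levels (fun m hm v hv => A.mem_levels (m := m + 1) (Even.add_one hm)
    (by rw [← add_assoc]; exact A.u_mem_level hv)) hv

lemma u_even {v : W} (hv : v ∈ A.levels k odds) : A.u v ∈ A.levels k evens :=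
  A.map_mem_levels (fun m hm v hv => A.mem_levels (m := m + 1) (Odd.add_one hm)
    (by rw [← add_assoc]; exact A.u_mem_level hv)) hv

lemma d_odd {v : W} (hv : v ∈ A.levels k evens) : A.d v ∈ A.levels k odds :=
  A.map_mem_levels (fun m hm v hv => A.mem_levels (m := m - 1) (Even.sub_odd hm odd_one)
    (by rw [← add_sub_assoc]; exact A.d_mem_level hv)) hv

lemma d_even {v : W} (hv : v ∈ A.levels k odds) : A.d v ∈ A.levels k evens :=
  A.map_mem_levels (fun m hm v hv => A.mem_levels (m := m - 1) (Odd.sub_odd hm odd_one)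
    (by rw [← add_sub_assoc]; exact A.d_mem_level hv)) hv

lemma p₁_odd {v : W} (hv : v ∈ A.levels k evens) : A.p₁ v ∈ A.levels k odds :=
  add_mem (u_odd hv) (d_odd hv)

lemma p₁_even {v : W} (hv : v ∈ A.levels k odds) : A.p₁ v ∈ A.levels k evens :=
  add_mem (u_even hv) (d_even hv)

lemma p₂_odd {v : W} (hv : v ∈ A.levels k evens) : A.p₂ v ∈ A.levels k odds :=
  Submodule.smul_mem _ _ (sub_mem (d_odd hv) (u_odd hv))

lemma p₂_even {v : W} (hv : v ∈ A.levels k odds) : A.p₂ v ∈ A.levels k evens :=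
  Submodule.smul_mem _ _ (sub_mem (d_even hv) (u_even hv))

lemma slow_mem {S : Set ℤ} (p : Polynomial ℂ) {v : W} (hv : v ∈ A.levels k S) :
    A.slow p v ∈ A.levels k S :=
  A.map_mem_levels (fun _ hm _ hv => A.mem_levels hm (A.slow_mem_level p hv)) hv

lemma δ_mem {S : Set ℤ} {v : W} (hv : v ∈ A.levels k S) : A.δ v ∈ A.levels k S :=
  A.map_mem_levels (fun _ hm _ hv => A.mem_levels hm (A.δ_mem_level hv)) hv

lemma mem_evens {v : W} (hv : v ∈ A.level k) : v ∈ A.levels k evens :=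
  A.mem_levels (m := 0) (by simp) (by simpa using hv)

section Words

variable {v : W} (hv : v ∈ A.level k)
include hv

lemma u_d_word : A.u (A.d v) = ((k : ℂ) / 2) • v := by simpa [mem_level] using hv

lemma u_dd_word : A.u (A.d (A.d v)) = (((k : ℂ) - 1) / 2) • A.d v := by
  simpa [mem_level] using A.d_mem_level hv

lemma u_ddd_word : A.u (A.d (A.d (A.d v))) = (((k : ℂ) - 2) / 2) • A.d (A.d v) := by
  have := A.mem_level.1 (A.d_mem_level (A.d_mem_level hv))
  rw [this]; push_cast; congr 2; ring

lemma d_u_word : A.d (A.u v) = (((k : ℂ) + 1) / 2) • v := by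
  rw [A.d_u, u_d_word hv]; module

lemma d_uu_word : A.d (A.u (A.u v)) = (((k : ℂ) + 2) / 2) • A.u v := by
  rw [A.d_u, d_u_word hv, map_smul]; module

lemma d_uuu_word : A.d (A.u (A.u (A.u v))) = (((k : ℂ) + 3) / 2) • A.u (A.u v) := by
  rw [A.d_u, d_uu_word hv, map_smul]; module

lemma d_uuuu_word : A.d (A.u (A.u (A.u (A.u v)))) = (((k : ℂ) + 4) / 2) • A.u (A.u (A.u v)) := by
  rw [A.d_u, d_uuu_word hv, map_smul]; module

lemma d_uuuuu_word :
    A.d (A.u (A.u (A.u (A.u (A.u v))))) = (((k : ℂ) + 5) / 2) • A.u (A.u (A.u (A.u v))) := by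
  rw [A.d_u, d_uuuu_word hv, map_smul]; module

end Words

end WeylModel
namespace WeylModel
variable {W : Type*} [AddCommGroup W] [Module ℂ W] {A : WeylModel W} {k : ℕ}

section Diagonal

variable {v : W} (hv : v ∈ A.level k)
include hv

lemma uu_mem : A.u (A.u v) ∈ A.levels k evens' :=
  A.mem_levels (m := 2) (by decide) (by simpa [add_assoc] using A.u_mem_level (A.u_mem_level hv))

lemma uuuu_mem : A.u (A.u (A.u (A.u v))) ∈ A.levels k evens' :=
  A.mem_levels (m := 4) (by decide) (by
    simpa [add_assoc] using A.u_mem_level (A.u_mem_level (A.u_mem_level (A.u_mem_level hv))))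

lemma dd_mem : A.d (A.d v) ∈ A.levels k evens' :=
  A.mem_levels (m := -2) (by decide) (by
    have := A.d_mem_level (A.d_mem_level hv)
    rwa [sub_sub] at this)

lemma dddd_mem : A.d (A.d (A.d (A.d v))) ∈ A.levels k evens' :=
  A.mem_levels (m := -4) (by decide) (by
    have := A.d_mem_level (A.d_mem_level (A.d_mem_level (A.d_mem_level hv)))
    rwa [sub_sub, sub_sub, sub_sub] at this)

lemma uuuuuu_mem : A.u (A.u (A.u (A.u (A.u (A.u v))))) ∈ A.levels k evens' :=
  A.mem_levels (m := 6) (by decide) (by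
    simpa [add_assoc] using A.u_mem_level (A.u_mem_level (A.u_mem_level (A.u_mem_level
      (A.u_mem_level (A.u_mem_level hv))))))

lemma dddddd_mem : A.d (A.d (A.d (A.d (A.d (A.d v))))) ∈ A.levels k evens' :=
  A.mem_levels (m := -6) (by decide) (by
    have := A.d_mem_level (A.d_mem_level (A.d_mem_level (A.d_mem_level
      (A.d_mem_level (A.d_mem_level hv)))))
    rwa [sub_sub, sub_sub, sub_sub, sub_sub, sub_sub] at this)

lemma u_ddd_word' : A.u (A.d (A.d (A.d (A.d v)))) = (((k : ℂ) - 3) / 2) • A.d (A.d (A.d v)) := by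
  have := A.mem_level.1 (A.d_mem_level (A.d_mem_level (A.d_mem_level hv)))
  rw [this]; push_cast; congr 2; ring

lemma combination_mem (a₆ a₄ a₂ b₂ b₄ b₆ : ℂ) :
    a₆ • A.u (A.u (A.u (A.u (A.u (A.u v))))) + a₄ • A.u (A.u (A.u (A.u v))) + a₂ • A.u (A.u v)
      + b₂ • A.d (A.d v) + b₄ • A.d (A.d (A.d (A.d v)))
      + b₆ • A.d (A.d (A.d (A.d (A.d (A.d v))))) ∈ A.levels k evens' :=
  add_mem (add_mem (add_mem (add_mem (add_mem (Submodule.smul_mem _ _ (uuuuuu_mem hv))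
    (Submodule.smul_mem _ _ (uuuu_mem hv))) (Submodule.smul_mem _ _ (uu_mem hv)))
    (Submodule.smul_mem _ _ (dd_mem hv))) (Submodule.smul_mem _ _ (dddd_mem hv)))
    (Submodule.smul_mem _ _ (dddddd_mem hv))

lemma cubic_apply : A.p₂ (A.p₁ (A.p₂ v)) - A.p₁ (A.p₁ (A.p₁ v))
    = (-2 : ℂ) • A.u (A.u (A.u v)) + (-(k : ℂ) - 1) • A.u v + (-(k : ℂ)) • A.d v
      + (-2 : ℂ) • A.d (A.d (A.d v)) := by
  simp only [p₁_apply, p₂_apply, map_add, map_sub, map_smul, u_d_word hv, u_dd_word hv,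
    d_u_word hv, d_uu_word hv]
  match_scalars <;> ring_nf <;> simp [Complex.I_sq] <;> ring

/-- The first corrector for the cubic perturbation. -/
def cubicCorrector (k : ℕ) (v : W) : W :=
  (1 / 3 : ℂ) • A.u (A.u (A.u v)) + (((k : ℂ) + 1) / 2) • A.u v + (-(k : ℂ) / 2) • A.d v
    + (-(1 / 3) : ℂ) • A.d (A.d (A.d v))

lemma lead_cubicCorrector : A.lead k (A.cubicCorrector k v)
    = -(A.p₂ (A.p₁ (A.p₂ v)) - A.p₁ (A.p₁ (A.p₁ v))) := by
  rw [cubic_apply hv]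
  simp only [lead, cubicCorrector, map_add, map_smul, u_dd_word hv,
    u_ddd_word' hv, d_u_word hv, d_uuu_word hv]
  match_scalars <;> ring

lemma cubicCorrector_odd : A.cubicCorrector k v ∈ A.levels k odds := by
  have h := mem_evens hv
  exact add_mem (add_mem (add_mem
    (Submodule.smul_mem _ _ (u_odd (u_even (u_odd h)))) (Submodule.smul_mem _ _ (u_odd h)))
    (Submodule.smul_mem _ _ (d_odd h))) (Submodule.smul_mem _ _ (d_odd (d_even (d_odd h))))

lemma quadratic_diag : A.p₁ (A.p₁ v) - ((k : ℂ) + 1 / 2) • v ∈ A.levels k evens' := by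
  convert combination_mem hv 0 0 1 1 0 0 using 1
  simp only [p₁_apply, map_add, u_d_word hv, d_u_word hv]
  match_scalars <;> ring

lemma quadratic_diag' : A.p₂ (A.p₂ v) - ((k : ℂ) + 1 / 2) • v ∈ A.levels k evens' := by
  convert combination_mem hv 0 0 (-1) (-1) 0 0 using 1
  simp only [p₂_apply, map_sub, map_smul, u_d_word hv, d_u_word hv]
  match_scalars <;> ring_nf <;> simp [Complex.I_sq]

lemma mixed_diag : A.p₁ (A.p₂ v) + A.p₂ (A.p₁ v) ∈ A.levels k evens' := by
  convert combination_mem hv 0 0 (-2 * Complex.I) (2 * Complex.I) 0 0 using 1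
  simp only [p₁_apply, p₂_apply, map_add, map_sub, map_smul, u_d_word hv, d_u_word hv]
  match_scalars <;> ring

lemma traceless_apply : A.p₂ (A.p₂ v) - A.p₁ (A.p₁ v)
    = (-2 : ℂ) • A.u (A.u v) + (-2 : ℂ) • A.d (A.d v) := by
  simp only [p₁_apply, p₂_apply, map_add, map_sub, map_smul, u_d_word hv, d_u_word hv]
  match_scalars <;> ring_nf <;> simp [Complex.I_sq] <;> ring

/-- The corrector for the traceless quadratic perturbation. -/
def quadraticCorrector (v : W) : W := (1 / 2 : ℂ) • (A.u (A.u v) - A.d (A.d v))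

lemma lead_quadraticCorrector : A.lead k (A.quadraticCorrector v)
    = -(A.p₂ (A.p₂ v) - A.p₁ (A.p₁ v)) := by
  rw [traceless_apply hv]
  simp only [lead, quadraticCorrector, map_sub, map_smul,
    u_ddd_word hv, d_uu_word hv]
  match_scalars <;> ring

lemma quadraticCorrector_even : A.quadraticCorrector v ∈ A.levels k evens := by
  have h := mem_evens hv
  exact Submodule.smul_mem _ _ (sub_mem (u_even (u_odd h)) (d_even (d_odd h)))

lemma traceless_corrector_diag :
    A.p₂ (A.p₂ (A.quadraticCorrector v)) - A.p₁ (A.p₁ (A.quadraticCorrector v))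
      + ((k : ℂ) + 1 / 2) • v ∈ A.levels k evens' := by
  convert combination_mem hv 0 (-1) 0 0 1 0 using 1
  simp only [p₁_apply, p₂_apply, quadraticCorrector, map_add, map_sub, map_smul, u_d_word hv,
    u_dd_word hv, u_ddd_word hv, d_u_word hv, d_uu_word hv, d_uuu_word hv]
  match_scalars <;> ring_nf <;> simp [Complex.I_sq] <;> ring

lemma twisted_quartic_diag :
    -A.p₂ (A.p₂ (A.p₁ (A.p₂ v))) + A.p₁ (A.p₂ (A.p₁ (A.p₁ v))) ∈ A.levels k evens' := by
  convert combination_mem hv 0 (-2 * Complex.I) Complex.I Complex.I (2 * Complex.I) 0 using 1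
  simp only [p₁_apply, p₂_apply, map_add, map_sub, map_smul, u_d_word hv,
    u_dd_word hv, u_ddd_word hv, d_u_word hv, d_uu_word hv, d_uuu_word hv]
  match_scalars <;> ring_nf <;> simp [Complex.I_pow_three] <;> ring

lemma quartic_diag : A.p₁ (A.p₁ (A.p₁ (A.p₁ v)))
    - (3 / 4 * (2 * (k : ℂ) ^ 2 + 2 * k + 1)) • v ∈ A.levels k evens' := by
  convert combination_mem hv 0 1 (2 * k + 3) (2 * k - 1) 1 0 using 1
  simp only [p₁_apply, map_add, map_smul, u_d_word hv,
    u_dd_word hv, u_ddd_word hv, d_u_word hv, d_uu_word hv, d_uuu_word hv]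
  match_scalars <;> ring

lemma quartic_diag' : A.p₂ (A.p₁ (A.p₁ (A.p₂ v)))
    - (1 / 4 * (2 * (k : ℂ) ^ 2 + 2 * k + 3)) • v ∈ A.levels k evens' := by
  convert combination_mem hv 0 (-1) 0 0 (-1) 0 using 1
  simp only [p₁_apply, p₂_apply, map_add, map_sub, map_smul, u_d_word hv,
    u_dd_word hv, u_ddd_word hv, d_u_word hv, d_uu_word hv, d_uuu_word hv]
  match_scalars <;> ring_nf <;> simp [Complex.I_sq]

lemma mixed_quartic_diag :
    A.p₁ (A.p₁ (A.p₁ (A.p₂ v))) + A.p₂ (A.p₁ (A.p₁ (A.p₁ v))) ∈ A.levels k evens' := by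
  convert combination_mem hv 0 (-2 * Complex.I) (-(2 * k + 3) * Complex.I)
    ((2 * k - 1) * Complex.I) (2 * Complex.I) 0 using 1
  simp only [p₁_apply, p₂_apply, map_add, map_sub, map_smul, u_d_word hv,
    u_dd_word hv, u_ddd_word hv, d_u_word hv, d_uu_word hv, d_uuu_word hv]
  match_scalars <;> ring

lemma cubic_corrector_diag :
    A.p₂ (A.p₁ (A.p₂ (A.cubicCorrector k v))) - A.p₁ (A.p₁ (A.p₁ (A.cubicCorrector k v)))
      + (3 / 4 * (2 * (k : ℂ) ^ 2 + 2 * k + 1)) • v ∈ A.levels k evens' := by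
  convert combination_mem hv (-2 / 3) (-4 / 3 * k - 7 / 3) (-1 / 6 * k ^ 2 - 5 / 2 * k - 5 / 2)
    (1 / 6 * k ^ 2 - 13 / 6 * k + 1 / 6) (4 / 3 * k - 1) (2 / 3) using 1
  simp only [p₁_apply, p₂_apply, cubicCorrector, map_add, map_sub, map_smul, u_d_word hv,
    u_dd_word hv, u_ddd_word hv, u_ddd_word' hv, d_u_word hv, d_uu_word hv, d_uuu_word hv,
    d_uuuu_word hv, d_uuuuu_word hv]
  match_scalars <;> ring_nf <;> simp [Complex.I_sq] <;> ring

end Diagonal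
end WeylModel
namespace WeylModel
variable {W : Type*} [AddCommGroup W] [Module ℂ W] (A : WeylModel W) {k : ℕ}

lemma pow_comm {f : Module.End ℂ W} (hf : ∀ v, f (A.e v) = A.e (f v)) (n : ℕ) (v : W) :
    f ((A.e ^ n) v) = (A.e ^ n) (f v) := by
  induction n generalizing v with
  | zero => simp
  | succ n ih => rw [pow_succ, Module.End.mul_apply, Module.End.mul_apply, ih, hf]

lemma e_pow_e_pow (m n : ℕ) (v : W) : (A.e ^ m) ((A.e ^ n) v) = (A.e ^ (m + n)) v := by
  rw [pow_add, Module.End.mul_apply]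

lemma e_eq_pow (v : W) : A.e v = (A.e ^ 1) v := by simp

lemma p₁_e (v : W) : A.p₁ (A.e v) = A.e (A.p₁ v) := by simp [p₁_apply, A.u_e, A.d_e]

lemma p₂_e (v : W) : A.p₂ (A.e v) = A.e (A.p₂ v) := by simp [p₂_apply, A.u_e, A.d_e]

lemma X_e (v : W) : A.X (A.e v) = A.e (A.X v) := by simp [X_apply, A.Z_e]

lemma X_p₁ (v : W) : A.X (A.p₁ v) = A.p₁ (A.X v) := by
  simp [p₁_apply, X_apply, A.u_e, A.d_e, A.Z_u, A.Z_d]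

lemma X_p₂ (v : W) : A.X (A.p₂ v) = A.p₂ (A.X v) := by
  simp [p₂_apply, X_apply, A.u_e, A.d_e, A.Z_u, A.Z_d]

lemma p₁_slow (p : Polynomial ℂ) (v : W) : A.p₁ (A.slow p v) = A.slow p (A.p₁ v) :=
  A.slow_comm (fun v => (A.X_p₁ v).symm) p v

lemma p₂_slow (p : Polynomial ℂ) (v : W) : A.p₂ (A.slow p v) = A.slow p (A.p₂ v) :=
  A.slow_comm (fun v => (A.X_p₂ v).symm) p v

lemma δ_p₁ (v : W) : A.δ (A.p₁ v) = A.p₁ (A.δ v) := by simp [p₁_apply, A.δ_u, A.δ_d]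

lemma δ_p₂ (v : W) : A.δ (A.p₂ v) = A.p₂ (A.δ v) := by simp [p₂_apply, A.δ_u, A.δ_d]

/-- The operators of multiplication by the coordinates. -/
def x : Module.End ℂ W := A.X - A.e ^ 2 * A.p₂

def y : Module.End ℂ W := A.e ^ 2 * (A.p₁ - Complex.I • (A.e * A.δ))

lemma x_apply (v : W) : A.x v = A.X v - (A.e ^ 2) (A.p₂ v) := rfl

lemma y_apply (v : W) : A.y v = (A.e ^ 2) (A.p₁ v) - Complex.I • (A.e ^ 3) (A.δ v) := by
  simp [y, pow_succ]

/-- The operator of multiplication by `g₀ + g₁(x) y + g₂(x) y² + g₃ y³`. -/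
def entry (g₀ : ℂ) (g₁ g₂ : Polynomial ℂ) (g₃ : ℂ) : Module.End ℂ W :=
  g₀ • 1 + Polynomial.aeval A.x g₁ * A.y + Polynomial.aeval A.x g₂ * A.y ^ 2 + g₃ • A.y ^ 3

lemma aeval_x_expansion (p : Polynomial ℂ) : ∃ (q : Polynomial ℂ) (R : Module.End ℂ W),
    (∀ v, R (A.e v) = A.e (R v)) ∧ ∀ v, Polynomial.aeval A.x p v = A.slow p v - (A.e ^ 2) (A.p₂ (A.slow (Polynomial.derivative p) v))
      + (A.e ^ 4) (A.p₂ (A.p₂ (A.slow q v))) + (A.e ^ 6) (R v) := by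
  induction p using Polynomial.induction_on with
  | C a => exact ⟨0, 0, by simp, fun v => by simp [slow]⟩
  | add p q hp hq =>
    obtain ⟨p', R, hc, h⟩ := hp
    obtain ⟨q', R', hc', h'⟩ := hq
    refine ⟨p' + q', R + R', fun v => by simp [hc, hc'], fun v => ?_⟩
    have e1 : ∀ a b : Polynomial ℂ, ∀ v, A.slow (a + b) v = A.slow a v + A.slow b v := by
      intro a b v; simp [slow]
    simp only [map_add, LinearMap.add_apply, e1, h, h']
    abel
  | monomial n a hp =>
    obtain ⟨p', R, hc, h⟩ := hp
    set p := Polynomial.C a * Polynomial.X ^ n with hpdef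
    refine ⟨Polynomial.derivative p + p' * Polynomial.X, R * A.x - A.p₂ * A.p₂ * A.p₂ * A.slow p',
      fun v => ?_, fun v => ?_⟩
    · simp [x, hc, A.X_e, A.p₂_e, ← A.e_slow, pow_two]
    have e1 : ∀ a b : Polynomial ℂ, ∀ v, A.slow (a + b) v = A.slow a v + A.slow b v := by
      intro a b v; simp [slow]
    have hX : ∀ p (v : W), A.slow (p * Polynomial.X) v = A.slow p (A.X v) := by
      intro p v; rw [← slow_slow]; simp [slow]
    have e2 : ∀ p : Polynomial ℂ, ∀ n v, A.slow p ((A.e ^ n) v) = (A.e ^ n) (A.slow p v) :=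
      fun p n v => A.pow_comm (fun v => (A.e_slow p v).symm) n v
    have e3 := A.pow_comm A.p₂_e
    rw [pow_succ, ← mul_assoc, ← hpdef, Polynomial.derivative_mul, map_mul, Module.End.mul_apply, h]
    simp only [Polynomial.derivative_X, mul_one, Polynomial.aeval_X, e1, hX, LinearMap.sub_apply,
      Module.End.mul_apply, map_add, map_sub, x_apply, e2, e3, e_pow_e_pow, p₂_slow]
    norm_num
    abel

/-- The coefficients of the expansion of `entry` in powers of `e`. -/
def entry₅ (g₁ g₂ : Polynomial ℂ) : Module.End ℂ W :=
  Complex.I • (A.p₂ * A.slow (Polynomial.derivative g₁) * A.δ)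
    - (2 * Complex.I) • (A.slow g₂ * A.p₁ * A.δ)

def entry₆ (h g₂ : Polynomial ℂ) (g₃ : ℂ) : Module.End ℂ W :=
  A.p₂ * A.p₂ * A.slow h * A.p₁ - A.p₂ * A.slow (Polynomial.derivative g₂) * A.p₁ * A.p₁
    + g₃ • (A.p₁ * A.p₁ * A.p₁)

lemma entry_expansion (g₀ : ℂ) (g₁ g₂ : Polynomial ℂ) (g₃ : ℂ) :
    ∃ (h : Polynomial ℂ) (R : Module.End ℂ W), ∀ v, A.entry g₀ g₁ g₂ g₃ v
      = g₀ • v + (A.e ^ 2) (A.slow g₁ (A.p₁ v)) - Complex.I • (A.e ^ 3) (A.slow g₁ (A.δ v))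
        + (A.e ^ 4) (A.slow g₂ (A.p₁ (A.p₁ v))
          - A.p₂ (A.slow (Polynomial.derivative g₁) (A.p₁ v)))
        + (A.e ^ 5) (A.entry₅ g₁ g₂ v)
        + (A.e ^ 6) (A.entry₆ h g₂ g₃ v - A.slow g₂ (A.δ (A.δ v))) + (A.e ^ 7) (R v) := by
  obtain ⟨h, R, hc, hR⟩ := A.aeval_x_expansion g₁
  obtain ⟨h', R', hc', hR'⟩ := A.aeval_x_expansion g₂
  set D : Module.End ℂ W := A.p₁ - Complex.I • (A.e * A.δ) with hD
  refine ⟨h, -Complex.I • (A.p₂ * A.p₂ * A.slow h * A.δ) + A.e * R * D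
    + (2 * Complex.I) • (A.p₂ * A.slow (Polynomial.derivative g₂) * A.p₁ * A.δ)
    + A.e * A.p₂ * A.slow (Polynomial.derivative g₂) * A.δ * A.δ
    + A.e * A.p₂ * A.p₂ * A.slow h' * D * D + A.e ^ 3 * R' * D * D
    - (3 * Complex.I * g₃) • (A.p₁ * A.p₁ * A.δ) - (3 * g₃) • (A.e * A.p₁ * A.δ * A.δ)
    + (Complex.I * g₃) • (A.e ^ 2 * A.δ * A.δ * A.δ), fun v => ?_⟩
  have hy : ∀ v, A.y v = (A.e ^ 2) (D v) := fun v => rfl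
  have e2 : ∀ p : Polynomial ℂ, ∀ n v, A.slow p ((A.e ^ n) v) = (A.e ^ n) (A.slow p v) :=
    fun p n v => A.pow_comm (fun v => (A.e_slow p v).symm) n v
  have e3 := A.pow_comm A.p₂_e
  have e4 := A.pow_comm A.p₁_e
  have e5 := A.pow_comm A.δ_e
  have e6 := A.pow_comm hc
  have e7 := A.pow_comm hc'
  have hDv : ∀ v, D v = A.p₁ v - Complex.I • (A.e ^ 1) (A.δ v) := fun v => by simp [hD]
  have hD_e : ∀ n v, D ((A.e ^ n) v) = (A.e ^ n) (D v) := by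
    intro n v
    simp only [hDv, e4, e5, e_pow_e_pow, map_sub, map_smul, add_comm]
  simp only [entry, entry₅, entry₆, LinearMap.add_apply, LinearMap.smul_apply, LinearMap.sub_apply,
    Module.End.mul_apply, Module.End.one_apply, pow_two A.y, pow_three A.y, hy, hR, hR', hD_e,
    e_pow_e_pow, e2, e3, e6, e7, map_add, map_sub, map_smul, LinearMap.neg_apply, neg_smul, map_neg]
  simp only [hDv, e_pow_e_pow, map_sub, map_smul, e2, e3, e4, e5, e6, e7, A.δ_p₁, A.e_eq_pow]
  norm_num only
  match_scalars <;> ring_nf <;> simp [Complex.I_sq, Complex.I_pow_three]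

end WeylModel
namespace WeylModel
variable {W : Type*} [AddCommGroup W] [Module ℂ W] {A : WeylModel W} {k : ℕ}

/-- Operators that exchange the even and the odd levels. -/
def Flips (A : WeylModel W) (k : ℕ) (f : Module.End ℂ W) : Prop :=
  (∀ v ∈ A.levels k evens, f v ∈ A.levels k odds) ∧ ∀ v ∈ A.levels k odds, f v ∈ A.levels k evens

/-- Operators that preserve the even and the odd levels. -/
def Keeps (A : WeylModel W) (k : ℕ) (f : Module.End ℂ W) : Prop :=
  (∀ v ∈ A.levels k evens, f v ∈ A.levels k evens) ∧ ∀ v ∈ A.levels k odds, f v ∈ A.levels k odds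

lemma flips_p₁ : A.Flips k A.p₁ := ⟨fun _ => p₁_odd, fun _ => p₁_even⟩
lemma flips_p₂ : A.Flips k A.p₂ := ⟨fun _ => p₂_odd, fun _ => p₂_even⟩
lemma keeps_slow (p : Polynomial ℂ) : A.Keeps k (A.slow p) :=
  ⟨fun _ => slow_mem p, fun _ => slow_mem p⟩
lemma keeps_δ : A.Keeps k A.δ := ⟨fun _ => δ_mem, fun _ => δ_mem⟩

lemma Flips.mul_keeps {f g : Module.End ℂ W} (hf : A.Flips k f) (hg : A.Keeps k g) :
    A.Flips k (f * g) := ⟨fun v hv => hf.1 _ (hg.1 v hv), fun v hv => hf.2 _ (hg.2 v hv)⟩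
lemma Keeps.mul_flips {f g : Module.End ℂ W} (hf : A.Keeps k f) (hg : A.Flips k g) :
    A.Flips k (f * g) := ⟨fun v hv => hf.2 _ (hg.1 v hv), fun v hv => hf.1 _ (hg.2 v hv)⟩
lemma Flips.mul {f g : Module.End ℂ W} (hf : A.Flips k f) (hg : A.Flips k g) :
    A.Keeps k (f * g) := ⟨fun v hv => hf.2 _ (hg.1 v hv), fun v hv => hf.1 _ (hg.2 v hv)⟩
lemma Keeps.mul {f g : Module.End ℂ W} (hf : A.Keeps k f) (hg : A.Keeps k g) :
    A.Keeps k (f * g) := ⟨fun v hv => hf.1 _ (hg.1 v hv), fun v hv => hf.2 _ (hg.2 v hv)⟩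
lemma Flips.add {f g : Module.End ℂ W} (hf : A.Flips k f) (hg : A.Flips k g) :
    A.Flips k (f + g) := ⟨fun v hv => add_mem (hf.1 v hv) (hg.1 v hv),
      fun v hv => add_mem (hf.2 v hv) (hg.2 v hv)⟩
lemma Flips.sub {f g : Module.End ℂ W} (hf : A.Flips k f) (hg : A.Flips k g) :
    A.Flips k (f - g) := ⟨fun v hv => sub_mem (hf.1 v hv) (hg.1 v hv),
      fun v hv => sub_mem (hf.2 v hv) (hg.2 v hv)⟩
lemma Flips.smul {f : Module.End ℂ W} (c : ℂ) (hf : A.Flips k f) :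
    A.Flips k (c • f) := ⟨fun v hv => Submodule.smul_mem _ _ (hf.1 v hv),
      fun v hv => Submodule.smul_mem _ _ (hf.2 v hv)⟩

lemma flips_entry₅ (g₁ g₂ : Polynomial ℂ) : A.Flips k (A.entry₅ g₁ g₂) :=
  Flips.sub (Flips.smul _ ((flips_p₂.mul_keeps (keeps_slow _)).mul_keeps keeps_δ))
    (Flips.smul _ (((keeps_slow _).mul_flips flips_p₁).mul_keeps keeps_δ))

lemma flips_entry₆ (h g₂ : Polynomial ℂ) (g₃ : ℂ) : A.Flips k (A.entry₆ h g₂ g₃) :=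
  Flips.add (Flips.sub ((((flips_p₂.mul flips_p₂).mul (keeps_slow _))).mul_flips flips_p₁)
    (((flips_p₂.mul_keeps (keeps_slow _)).mul flips_p₁).mul_flips flips_p₁))
    (Flips.smul _ ((flips_p₁.mul flips_p₁).mul_flips flips_p₁))

lemma lead_eq (v : W) : A.p₁ (A.p₁ v) + A.p₂ (A.p₂ v) - (2 * k + 1 : ℂ) • v = A.lead k v := by
  simp only [p₁_apply, p₂_apply, lead, map_add, map_sub, map_smul, A.d_u]
  match_scalars <;> ring_nf <;> simp [Complex.I_sq] <;> ring

/-- The nonzero integers. -/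
abbrev nonzero : Set ℤ := {m | m ≠ 0}

lemma evens'_le : A.levels k evens' ≤ A.levels k nonzero := A.levels_mono fun _ h => h.2

lemma odds_le : A.levels k odds ≤ A.levels k nonzero := A.levels_mono fun m h h0 => by
  have h : Odd m := h
  rw [h0] at h; exact absurd h (by decide)

lemma evens'_le_evens : A.levels k evens' ≤ A.levels k evens := A.levels_mono fun _ h => h.1

/-- The symbolic form of the operator `Σ Π_i G^{ij} Π_j - μ / |b|`, divided by `e⁴`, where
`μ = e⁴ (m₀ + e⁴ m₄ + e⁶ m₆)`. -/
def magnetic (A : WeylModel W) (P c q β : Polynomial ℂ) (a₃ q₃ c₃ β₃ b m₀ m₄ m₆ : ℂ) :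
    Module.End ℂ W :=
  A.p₁ * A.entry 1 (-P) (P ^ 2 - c) a₃ * A.p₁ + A.p₁ * A.entry 0 0 q q₃ * A.p₂
    + A.p₂ * A.entry 0 0 q q₃ * A.p₁ + A.p₂ * A.entry 1 P c c₃ * A.p₂
    - (m₀ • 1 + m₄ • A.e ^ 4 + m₆ • A.e ^ 6) * A.entry b⁻¹ 0 (-β) (-β₃)

section Expansion

variable (A) (P c q β : Polynomial ℂ) (a₃ q₃ c₃ β₃ b m₀ m₄ m₆ : ℂ)

def magnetic₄ : Module.End ℂ W :=
  A.p₁ * A.slow (P ^ 2 - c) * A.p₁ * A.p₁ * A.p₁ + A.p₁ * A.p₂ * A.slow P.derivative * A.p₁ * A.p₁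
    + (A.p₁ * A.slow q * A.p₁ * A.p₁ * A.p₂ + A.p₂ * A.slow q * A.p₁ * A.p₁ * A.p₁)
    + (A.p₂ * A.slow c * A.p₁ * A.p₁ * A.p₂ - A.p₂ * A.p₂ * A.slow P.derivative * A.p₁ * A.p₂)
    + m₀ • (A.slow β * A.p₁ * A.p₁) - (m₄ * b⁻¹) • 1

def magnetic₆ : Module.End ℂ W :=
  -(A.p₁ * A.slow (P ^ 2 - c) * A.δ * A.δ * A.p₁ + A.p₁ * A.slow q * A.δ * A.δ * A.p₂
    + A.p₂ * A.slow q * A.δ * A.δ * A.p₁ + A.p₂ * A.slow c * A.δ * A.δ * A.p₂)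
    - m₀ • (A.slow β * A.δ * A.δ) - (m₆ * b⁻¹) • 1

lemma magnetic_expansion (hm : m₀ * b⁻¹ = 2 * k + 1) :
    ∃ M₅ M₆ R : Module.End ℂ W, A.Flips k M₅ ∧ A.Flips k M₆ ∧ ∀ v,
      A.magnetic P c q β a₃ q₃ c₃ β₃ b m₀ m₄ m₆ v = A.lead k v
        + (A.e ^ 2) (A.slow P (A.p₂ (A.p₁ (A.p₂ v)) - A.p₁ (A.p₁ (A.p₁ v))))
        + (A.e ^ 3) (-Complex.I • A.slow P (A.p₂ (A.p₂ (A.δ v)) - A.p₁ (A.p₁ (A.δ v))))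
        + (A.e ^ 4) (A.magnetic₄ P c q β b m₀ m₄ v) + (A.e ^ 5) (M₅ v)
        + (A.e ^ 6) (M₆ v + A.magnetic₆ P c q β b m₀ m₆ v) + (A.e ^ 7) (R v) := by
  obtain ⟨h₁, R₁, H₁⟩ := A.entry_expansion 1 (-P) (P ^ 2 - c) a₃
  obtain ⟨h₂, R₂, H₂⟩ := A.entry_expansion 0 0 q q₃
  obtain ⟨h₃, R₃, H₃⟩ := A.entry_expansion 1 P c c₃
  obtain ⟨h₄, R₄, H₄⟩ := A.entry_expansion b⁻¹ 0 (-β) (-β₃)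
  set F : Module.End ℂ W := A.entry₅ 0 (-β) with hF
  set F' : Module.End ℂ W := A.entry₆ h₄ (-β) (-β₃) with hF'
  set S : Module.End ℂ W := -(A.slow β * A.p₁ * A.p₁) + A.e * F
    + A.e ^ 2 * (F' + A.slow β * A.δ * A.δ) + A.e ^ 3 * R₄ with hS
  refine ⟨A.p₁ * A.entry₅ (-P) (P ^ 2 - c) * A.p₁ + A.p₁ * A.entry₅ 0 q * A.p₂
      + A.p₂ * A.entry₅ 0 q * A.p₁ + A.p₂ * A.entry₅ P c * A.p₂ - m₀ • F,
    A.p₁ * A.entry₆ h₁ (P ^ 2 - c) a₃ * A.p₁ + A.p₁ * A.entry₆ h₂ q q₃ * A.p₂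
      + A.p₂ * A.entry₆ h₂ q q₃ * A.p₁ + A.p₂ * A.entry₆ h₃ c c₃ * A.p₂ - m₀ • F',
    A.p₁ * R₁ * A.p₁ + A.p₁ * R₂ * A.p₂ + A.p₂ * R₂ * A.p₁ + A.p₂ * R₃ * A.p₂ - m₀ • R₄
      - m₄ • (A.e * S) - m₆ • (A.e ^ 3 * S), ?_, ?_, fun v => ?_⟩
  · exact ((((flips_p₁.mul (flips_entry₅ _ _)).mul_flips flips_p₁).add
      ((flips_p₁.mul (flips_entry₅ _ _)).mul_flips flips_p₂)).add
      ((flips_p₂.mul (flips_entry₅ _ _)).mul_flips flips_p₁)).add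
      ((flips_p₂.mul (flips_entry₅ _ _)).mul_flips flips_p₂) |>.sub ((flips_entry₅ _ _).smul _)
  · exact ((((flips_p₁.mul (flips_entry₆ _ _ _)).mul_flips flips_p₁).add
      ((flips_p₁.mul (flips_entry₆ _ _ _)).mul_flips flips_p₂)).add
      ((flips_p₂.mul (flips_entry₆ _ _ _)).mul_flips flips_p₁)).add
      ((flips_p₂.mul (flips_entry₆ _ _ _)).mul_flips flips_p₂) |>.sub ((flips_entry₆ _ _ _).smul _)
  · have e3 := A.pow_comm A.p₂_e
    have e4 := A.pow_comm A.p₁_e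
    have s0 : ∀ v, A.slow 0 v = 0 := by simp [slow]
    have sn : ∀ p v, A.slow (-p) v = -A.slow p v := by simp [slow]
    have hB : ∀ v, A.entry b⁻¹ 0 (-β) (-β₃) v = b⁻¹ • v + (A.e ^ 4) (S v) := by
      intro v
      rw [H₄]
      simp only [hS, s0, sn, LinearMap.add_apply, LinearMap.neg_apply,
        Module.End.mul_apply, map_add, map_neg, map_sub, e_pow_e_pow, map_zero, A.e_eq_pow]
      norm_num only
      module
    have hB' := H₄ v
    simp only [magnetic, magnetic₄, magnetic₆, LinearMap.add_apply, LinearMap.sub_apply,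
      LinearMap.neg_apply, LinearMap.smul_apply, Module.End.mul_apply, Module.End.one_apply, H₁, H₂,
      H₃, map_add, map_sub, map_neg, map_smul, add_mul]
    rw [show m₀ • A.entry b⁻¹ 0 (-β) (-β₃) v = _ from congrArg (m₀ • ·) hB']
    rw [← lead_eq]
    simp only [hB, s0, sn, e3, e4, A.p₁_slow,
      A.p₂_slow, A.δ_p₁, A.δ_p₂, A.e_eq_pow, map_add, map_sub, map_neg, map_smul, e_pow_e_pow,
      map_zero, ← hm]
    norm_num only
    match_scalars <;> ring

end Expansion

section Diagonal

variable (P c q β : Polynomial ℂ) (b m₀ m₄ m₆ : ℂ) {w : W} (hw : w ∈ A.level k)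
include hw

lemma magnetic₄_diag {V : Polynomial ℂ}
    (hV : -((k : ℂ) ^ 2 + k) • c + (m₀ * (k + 1 / 2)) • β - Polynomial.C (m₄ * b⁻¹) = V) :
    A.magnetic₄ P c q β b m₀ m₄ w
      + A.slow P (A.p₂ (A.p₁ (A.p₂ (A.slow P (A.cubicCorrector k w))))
        - A.p₁ (A.p₁ (A.p₁ (A.slow P (A.cubicCorrector k w))))) - A.slow V w
      ∈ A.levels k evens' := by
  have h1 := slow_mem P.derivative (twisted_quartic_diag hw)
  have h2 := slow_mem (P ^ 2 - c) (quartic_diag hw)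
  have h3 := slow_mem c (quartic_diag' hw)
  have h4 := slow_mem q (mixed_quartic_diag hw)
  have h5 := Submodule.smul_mem _ m₀ (slow_mem β (quadratic_diag hw))
  have h6 := slow_mem (P ^ 2) (cubic_corrector_diag hw)
  have h := add_mem (add_mem (add_mem (add_mem (add_mem h1 h2) h3) h4) h5) h6
  convert h using 1
  have hsub : ∀ p q : Polynomial ℂ, ∀ v, A.slow (p - q) v = A.slow p v - A.slow q v := by
    intro p q v; simp [slow]
  have hadd : ∀ p q : Polynomial ℂ, ∀ v, A.slow (p + q) v = A.slow p v + A.slow q v := by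
    intro p q v; simp [slow]
  have hsm : ∀ (a : ℂ) (p : Polynomial ℂ), ∀ v, A.slow (a • p) v = a • A.slow p v := by
    intro p q v; simp [slow]
  have hC : ∀ (a : ℂ), ∀ v, A.slow (Polynomial.C a) v = a • v := by
    intro p v; simp [slow, Algebra.algebraMap_eq_smul_one]
  rw [← hV]
  simp only [magnetic₄, LinearMap.add_apply, LinearMap.sub_apply, LinearMap.smul_apply,
    Module.End.mul_apply, Module.End.one_apply, p₁_slow, p₂_slow, hsub, hadd, hsm, hC, slow_slow,
    map_add, map_sub, map_smul, map_neg, pow_two P]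
  match_scalars <;> ring

lemma magnetic₆_diag : ∃ s, A.magnetic₆ P c q β b m₀ m₆ w
      - Complex.I • A.slow P (A.p₂ (A.p₂ (A.δ (-Complex.I • A.slow P (A.quadraticCorrector (A.δ w)))))
        - A.p₁ (A.p₁ (A.δ (-Complex.I • A.slow P (A.quadraticCorrector (A.δ w))))))
      + (m₀ * β.coeff 0) • A.δ (A.δ w) + (m₆ * b⁻¹) • w - A.e s ∈ A.levels k evens' := by
  have hδ : A.δ (A.δ w) ∈ A.level k := A.δ_mem_level (A.δ_mem_level hw)
  have h2 := slow_mem (P ^ 2 - c) (quadratic_diag hδ)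
  have h3 := slow_mem c (quadratic_diag' hδ)
  have h4 := slow_mem q (mixed_diag hδ)
  have h6 := slow_mem (P ^ 2) (traceless_corrector_diag hδ)
  set T : W → W := fun v => A.p₂ (A.p₂ v) - A.p₁ (A.p₁ v) with hT
  refine ⟨-(m₀ • A.Z (A.slow β.divX (A.δ (A.δ w))))
    - A.slow P (A.slow P.derivative (T (A.quadraticCorrector (A.δ w)))), ?_⟩
  have h := neg_mem (add_mem (add_mem (add_mem h2 h3) h4) h6)
  convert h using 1
  have hsub : ∀ p q : Polynomial ℂ, ∀ v, A.slow (p - q) v = A.slow p v - A.slow q v := by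
    intro p q v; simp [slow]
  have hβ : ∀ v, A.slow β v = A.e (A.Z (A.slow β.divX v)) + β.coeff 0 • v := by
    intro v
    have : A.slow β = A.slow (Polynomial.X * β.divX + Polynomial.C (β.coeff 0)) := by
      rw [Polynomial.X_mul_divX_add]
    rw [this]
    simp only [slow, map_add, map_mul, Polynomial.aeval_X, Polynomial.aeval_C, LinearMap.add_apply,
      Module.End.mul_apply, Algebra.algebraMap_eq_smul_one, X_apply, LinearMap.smul_apply,
      Module.End.one_apply]
  have hQ : A.δ (A.quadraticCorrector (A.δ w)) = A.quadraticCorrector (A.δ (A.δ w)) := by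
    simp [quadraticCorrector, A.δ_u, A.δ_d]
  simp only [magnetic₆, hT, LinearMap.add_apply, LinearMap.sub_apply, LinearMap.smul_apply,
    LinearMap.neg_apply, hQ,
    Module.End.mul_apply, Module.End.one_apply, δ_slow, δ_p₁, δ_p₂, p₁_slow, p₂_slow, p₁_e, p₂_e,
    hsub, hβ, ← e_slow, slow_slow,
    map_add, map_sub, map_smul, map_neg, pow_two P]
  match_scalars <;> ring_nf <;> simp [Complex.I_sq]

end Diagonal

/-- A formal quasimode of the magnetic operator. -/
theorem exists_formal_quasimode (P c q β : Polynomial ℂ) (a₃ q₃ c₃ β₃ b m₀ m₄ m₆ v₂ : ℂ)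
    (hm : m₀ * b⁻¹ = 2 * k + 1)
    (hV : -((k : ℂ) ^ 2 + k) • c + (m₀ * (k + 1 / 2)) • β - Polynomial.C (m₄ * b⁻¹)
      = Polynomial.C v₂ * Polynomial.X ^ 2)
    {w : W} (hw : w ∈ A.level k) {r₀ : W}
    (hosc : -(m₀ * β.coeff 0) • A.δ (A.δ w) + v₂ • A.Z (A.Z w) - (m₆ * b⁻¹) • w = A.e r₀) :
    ∃ w' r, A.magnetic P c q β a₃ q₃ c₃ β₃ b m₀ m₄ m₆ (w + A.e w') = (A.e ^ 7) r := by
  obtain ⟨M₅, M₆, R, h₅, h₆, hM⟩ := A.magnetic_expansion (k := k) P c q β a₃ q₃ c₃ β₃ b m₀ m₄ m₆ hm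
  have ev := mem_evens hw
  set w₂ := A.slow P (A.cubicCorrector k w) with hw₂
  set w₃ := -Complex.I • A.slow P (A.quadraticCorrector (A.δ w)) with hw₃
  have ow₂ : w₂ ∈ A.levels k odds := slow_mem P (cubicCorrector_odd hw)
  have ew₃ : w₃ ∈ A.levels k evens :=
    Submodule.smul_mem _ _ (slow_mem P (quadraticCorrector_even (A.δ_mem_level hw)))
  have i₀ : A.lead k w = 0 := by
    rw [lead, u_d_word hw]; module
  set T₂ : W → W := fun v => A.slow P (A.p₂ (A.p₁ (A.p₂ v)) - A.p₁ (A.p₁ (A.p₁ v))) with hT₂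
  set T₃ : W → W := fun v => -Complex.I • A.slow P (A.p₂ (A.p₂ (A.δ v)) - A.p₁ (A.p₁ (A.δ v)))
    with hT₃
  have lead_slow : ∀ p v, A.lead k (A.slow p v) = A.slow p (A.lead k v) := by
    intro p v; simp [lead, A.u_slow, A.d_slow]
  have i₂ : A.lead k w₂ = -T₂ w := by
    rw [hw₂, lead_slow, lead_cubicCorrector hw, map_neg]
  have i₃ : A.lead k w₃ = -T₃ w := by
    have : ∀ (a : ℂ) (v : W), A.lead k (a • v) = a • A.lead k v := by
      intro a v; simp only [lead, map_smul]; module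
    rw [hw₃, this, lead_slow, lead_quadraticCorrector (A.δ_mem_level hw), map_neg, smul_neg]
  obtain ⟨w₄, ew₄, i₄⟩ := exists_lead_eq (by simp) (magnetic₄_diag P c q β b m₀ m₄ hw hV)
  have ew₄' := evens'_le_evens ew₄
  have T₂_odd : ∀ v ∈ A.levels k evens, T₂ v ∈ A.levels k odds := fun v hv =>
    slow_mem P (sub_mem (p₂_odd (p₁_even (p₂_odd hv))) (p₁_odd (p₁_even (p₁_odd hv))))
  have T₃_odd : ∀ v ∈ A.levels k odds, T₃ v ∈ A.levels k odds := fun v hv =>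
    Submodule.smul_mem _ _ (slow_mem P (sub_mem (p₂_odd (p₂_even (δ_mem hv)))
      (p₁_odd (p₁_even (δ_mem hv)))))
  have M₄_odd : A.magnetic₄ P c q β b m₀ m₄ w₂ ∈ A.levels k odds := by
    have h := ow₂
    refine sub_mem (add_mem (add_mem (add_mem (add_mem ?_ ?_) (add_mem ?_ ?_)) (sub_mem ?_ ?_)) ?_)
      (Submodule.smul_mem _ _ h)
    · exact p₁_odd (slow_mem _ (p₁_even (p₁_odd (p₁_even h))))
    · exact p₁_odd (p₂_even (slow_mem _ (p₁_odd (p₁_even h))))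
    · exact p₁_odd (slow_mem _ (p₁_even (p₁_odd (p₂_even h))))
    · exact p₂_odd (slow_mem _ (p₁_even (p₁_odd (p₁_even h))))
    · exact p₂_odd (slow_mem _ (p₁_even (p₁_odd (p₂_even h))))
    · exact p₂_odd (p₂_even (slow_mem _ (p₁_odd (p₂_even h))))
    · exact Submodule.smul_mem _ _ (slow_mem _ (p₁_odd (p₁_even h)))
  obtain ⟨w₅, -, i₅⟩ := exists_lead_eq (S := odds) (by simp)
    (add_mem (add_mem (h₅.1 w ev) (T₃_odd w₂ ow₂)) (T₂_odd w₃ ew₃))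
  obtain ⟨s, hs⟩ := magnetic₆_diag P c q β b m₀ m₆ hw
  obtain ⟨w₆, -, i₆⟩ := exists_lead_eq (S := nonzero) (by simp)
    (add_mem (evens'_le hs) (odds_le (add_mem (add_mem (h₆.1 w ev) M₄_odd) (T₂_odd w₄ ew₄'))))
  have hV2 : A.slow (Polynomial.C v₂ * Polynomial.X ^ 2) w = (A.e ^ 2) (v₂ • A.Z (A.Z w)) := by
    simp [slow, pow_two, X_apply, A.Z_e, Algebra.algebraMap_eq_smul_one]
  rw [hV2] at i₄
  have hMlin : ∀ n v, A.magnetic P c q β a₃ q₃ c₃ β₃ b m₀ m₄ m₆ ((A.e ^ n) v)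
      = (A.e ^ n) (A.magnetic P c q β a₃ q₃ c₃ β₃ b m₀ m₄ m₆ v) := by
    apply A.pow_comm
    have hx : ∀ v, A.x (A.e v) = A.e (A.x v) := fun v => by
      simp [x_apply, X_e, p₂_e, pow_two]
    have hy : ∀ v, A.y (A.e v) = A.e (A.y v) := fun v => by
      simp [y_apply, p₁_e, A.δ_e, pow_succ]
    have hp : ∀ (p : Polynomial ℂ) v, Polynomial.aeval A.x p (A.e v)
        = A.e (Polynomial.aeval A.x p v) := by
      intro p v
      have : Commute (Polynomial.aeval A.x p) A.e := by
        have hc : Commute A.x A.e := LinearMap.ext hx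
        induction p using Polynomial.induction_on' with
        | add p q hp hq => rw [map_add]; exact hp.add_left hq
        | monomial n a =>
          rw [Polynomial.aeval_monomial]
          exact (Commute.mul_left (Algebra.commutes a A.e) (hc.pow_left n))
      exact LinearMap.congr_fun this v
    have hen : ∀ a b c d v, A.entry a b c d (A.e v) = A.e (A.entry a b c d v) := by
      intro a b c d v
      simp [entry, hy, hp, pow_two, pow_three]
    intro v
    have e1 : ∀ n v, (A.e ^ n) (A.e v) = A.e ((A.e ^ n) v) := by
      intro n v; rw [e_eq_pow, e_pow_e_pow, e_eq_pow, e_pow_e_pow, add_comm]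
    simp only [magnetic, LinearMap.add_apply, LinearMap.sub_apply, LinearMap.smul_apply,
      Module.End.mul_apply, Module.End.one_apply, hen, p₁_e, p₂_e, e1, map_add, map_sub, map_smul]
  refine ⟨A.e w₂ + (A.e ^ 2) w₃ + (A.e ^ 3) w₄ + (A.e ^ 4) w₅ + (A.e ^ 5) w₆, ?_⟩
  set M₄ := A.magnetic₄ P c q β b m₀ m₄
  set N₆ := A.magnetic₆ P c q β b m₀ m₆
  refine ⟨s + r₀ + R w
    + (M₅ w₂ + A.e (M₆ w₂ + N₆ w₂) + (A.e ^ 2) (R w₂))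
    + (M₄ w₃ + A.e (M₅ w₃) + (A.e ^ 2) (M₆ w₃ + N₆ w₃) + (A.e ^ 3) (R w₃))
    + (T₃ w₄ + A.e (M₄ w₄) + (A.e ^ 2) (M₅ w₄) + (A.e ^ 3) (M₆ w₄ + N₆ w₄) + (A.e ^ 4) (R w₄))
    + (T₂ w₅ + A.e (T₃ w₅) + (A.e ^ 2) (M₄ w₅) + (A.e ^ 3) (M₅ w₅)
      + (A.e ^ 4) (M₆ w₅ + N₆ w₅) + (A.e ^ 5) (R w₅))
    + (A.e (T₂ w₆) + (A.e ^ 2) (T₃ w₆) + (A.e ^ 3) (M₄ w₆) + (A.e ^ 4) (M₅ w₆)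
      + (A.e ^ 5) (M₆ w₆ + N₆ w₆) + (A.e ^ 6) (R w₆)), ?_⟩
  have hM' : ∀ v, A.magnetic P c q β a₃ q₃ c₃ β₃ b m₀ m₄ m₆ v = A.lead k v
        + (A.e ^ 2) (T₂ v) + (A.e ^ 3) (T₃ v) + (A.e ^ 4) (M₄ v) + (A.e ^ 5) (M₅ v)
        + (A.e ^ 6) (M₆ v + N₆ v) + (A.e ^ 7) (R v) := hM
  have hT₃w : T₃ w₃ = -Complex.I • A.slow P (A.p₂ (A.p₂ (A.δ w₃)) - A.p₁ (A.p₁ (A.δ w₃))) := rfl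
  have key : A.lead k w₆ + M₆ w + N₆ w + M₄ w₂ + T₃ w₃ + T₂ w₄ + v₂ • A.Z (A.Z w)
      = A.e (s + r₀) := by
    rw [i₆, map_add, ← hosc, hT₃w]
    module
  have key' : (A.e ^ 6) (A.lead k w₆) = (A.e ^ 7) (s + r₀) - (A.e ^ 6) (M₆ w + N₆ w + M₄ w₂ + T₃ w₃
      + T₂ w₄ + v₂ • A.Z (A.Z w)) := by
    rw [show (A.e ^ 7) (s + r₀) = (A.e ^ 6) (A.e (s + r₀)) by rw [A.e_eq_pow, e_pow_e_pow],
      ← key, ← map_sub]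
    congr 1; abel
  have hT₂' : T₂ w₂ = A.slow P (A.p₂ (A.p₁ (A.p₂ w₂)) - A.p₁ (A.p₁ (A.p₁ w₂))) := rfl
  rw [← hT₂'] at i₄
  simp only [map_add, e_eq_pow, e_pow_e_pow, hMlin]
  norm_num only
  simp only [hM', i₀, i₂, i₃, i₄, i₅, key', map_add, map_neg, map_sub, e_pow_e_pow]
  norm_num only
  abel

end WeylModel

/-- Polynomials in the variables `ε, σ, τ`. -/
abbrev ScaledPoly : Type := MvPolynomial (Fin 3) ℂ

namespace ScaledPoly
open MvPolynomial

lemma pderiv_comm (i j : Fin 3) (v : ScaledPoly) : pderiv i (pderiv j v) = pderiv j (pderiv i v) := by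
  have h : ⁅(pderiv i : Derivation ℂ ScaledPoly ScaledPoly),
      (pderiv j : Derivation ℂ ScaledPoly ScaledPoly)⁆ = 0 := by
    apply MvPolynomial.derivation_ext
    intro k
    simp [Derivation.commutator_apply, pderiv_X, Pi.single_apply]
    split_ifs <;> simp
  have := congrArg (fun D : Derivation ℂ ScaledPoly ScaledPoly => D v) h
  simpa [Derivation.commutator_apply, sub_eq_zero] using this

/-- Multiplication by a polynomial. -/
abbrev M (p : ScaledPoly) : Module.End ℂ ScaledPoly := LinearMap.mulLeft ℂ p

abbrev D (i : Fin 3) : Module.End ℂ ScaledPoly := (pderiv i : Derivation ℂ _ _).toLinearMap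

/-- The complex variable `σ - i ε τ`. -/
def zeta : ScaledPoly := X 1 - C Complex.I * X 0 * X 2

def delta (κ : ℝ) : Module.End ℂ ScaledPoly := D 1 - (κ : ℂ) • M zeta

def lower : Module.End ℂ ScaledPoly := (1 / 2 : ℂ) • (D 2 + Complex.I • (M (X 0) * D 1))

def raise (κ : ℝ) : Module.End ℂ ScaledPoly := M (X 2) + Complex.I • (M (X 0) * delta κ) - lower

lemma delta_apply (κ : ℝ) (v : ScaledPoly) : delta κ v = pderiv 1 v - C (κ : ℂ) * (zeta * v) := by
  simp [delta, C_mul']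

lemma lower_apply (v : ScaledPoly) :
    lower v = C (1 / 2) * (pderiv 2 v + C Complex.I * (X 0 * pderiv 1 v)) := by
  simp [lower, C_mul', -one_div]

lemma raise_apply (κ : ℝ) (v : ScaledPoly) :
    raise κ v = X 2 * v + C Complex.I * (X 0 * delta κ v) - lower v := by
  simp [raise, C_mul']

lemma C_half_add : (C (1 / 2) : ScaledPoly) + C (1 / 2) = 1 := by
  rw [← C_add]; norm_num

lemma C_I_mul : (C Complex.I : ScaledPoly) * C Complex.I = -1 := by
  rw [← C_mul, Complex.I_mul_I]; simp

lemma lower_raise (κ : ℝ) (v : ScaledPoly) :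
    lower (raise κ v) = raise κ (lower v) + (1 / 2 : ℂ) • v := by
  simp only [raise_apply, lower_apply, delta_apply, zeta, pderiv_mul,
    pderiv_X, map_sub, map_add, pderiv_C, Pi.single_apply, pderiv_comm 2 1, ← C_mul']
  simp only [Fin.isValue, ↓reduceIte, zero_mul, zero_add, mul_one, mul_zero, add_zero,
    Fin.reduceEq, one_mul, sub_zero, zero_sub]
  ring

/-- The Weyl model on polynomials for the Gaussian `exp (-τ² / 2 - κ (σ - i ε τ)² / 2)`. -/
def model (κ : ℝ) : WeylModel ScaledPoly where
  e := M (X 0)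
  u := raise κ
  d := lower
  Z := M (X 1) + Complex.I • (M (X 0) * (lower - raise κ))
  δ := delta κ
  u_e v := by
    simp only [LinearMap.mulLeft_apply, raise_apply, lower_apply, delta_apply, zeta, pderiv_mul,
      pderiv_X, map_sub, map_add, Pi.single_apply]
    simp; ring
  d_e v := by
    simp only [LinearMap.mulLeft_apply, lower_apply, pderiv_mul, pderiv_X, Pi.single_apply]
    simp; ring
  Z_e v := by
    simp only [LinearMap.add_apply, LinearMap.smul_apply, LinearMap.sub_apply, Module.End.mul_apply,
      LinearMap.mulLeft_apply, raise_apply, lower_apply, delta_apply, zeta, pderiv_mul,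
      pderiv_X, map_sub, map_add, Pi.single_apply, ← C_mul']
    simp; ring
  δ_e v := by
    simp only [LinearMap.mulLeft_apply, delta_apply, zeta, pderiv_mul, pderiv_X, Pi.single_apply]
    simp; ring
  d_u := lower_raise κ
  Z_u v := by
    have h1 := lower_raise κ v
    have h2 : raise κ (X 1 * v) = X 1 * raise κ v + C (1 / 2) * C Complex.I * (X 0 * v) := by
      simp only [raise_apply, lower_apply, delta_apply, zeta, pderiv_mul,
        pderiv_X, Pi.single_apply]
      simp only [Fin.isValue, ↓reduceIte, zero_mul, zero_add, one_mul, Fin.reduceEq]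
      linear_combination -(C Complex.I * X 0 * v) * C_half_add
    have h3 : ∀ w, raise κ (X 0 * w) = X 0 * raise κ w := fun w => by
      simp only [raise_apply, lower_apply, delta_apply, zeta, pderiv_mul, pderiv_X, Pi.single_apply]
      simp; ring
    simp only [LinearMap.add_apply, LinearMap.smul_apply, LinearMap.sub_apply, Module.End.mul_apply,
      LinearMap.mulLeft_apply, map_add, map_smul, map_sub, h1, h2, h3]
    simp only [← C_mul']
    ring
  Z_d v := by
    simp only [LinearMap.add_apply, LinearMap.smul_apply, LinearMap.sub_apply, Module.End.mul_apply,
      LinearMap.mulLeft_apply, raise_apply, lower_apply, delta_apply, zeta, pderiv_mul,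
      pderiv_X, map_sub, map_add, pderiv_C, Pi.single_apply, pderiv_comm 2 1, ← C_mul']
    simp only [Fin.isValue, ↓reduceIte, zero_mul, zero_add, mul_one, mul_zero, add_zero,
      Fin.reduceEq, one_mul, sub_zero, zero_sub]
    ring
  δ_Z v := by
    simp only [LinearMap.add_apply, LinearMap.smul_apply, LinearMap.sub_apply, Module.End.mul_apply,
      LinearMap.mulLeft_apply, raise_apply, lower_apply, delta_apply, zeta, pderiv_mul,
      pderiv_X, map_sub, map_add, pderiv_C, Pi.single_apply, pderiv_comm 2 1, ← C_mul']
    simp only [Fin.isValue, ↓reduceIte, zero_mul, zero_add, mul_one, mul_zero, add_zero,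
      Fin.reduceEq, one_mul, sub_zero, zero_sub]
    ring
  δ_u v := by
    simp only [raise_apply, lower_apply, delta_apply, zeta, pderiv_mul,
      pderiv_X, map_sub, map_add, pderiv_C, Pi.single_apply, pderiv_comm 2 1]
    simp; ring
  δ_d v := by
    simp only [lower_apply, delta_apply, zeta, pderiv_mul,
      pderiv_X, map_sub, map_add, pderiv_C, Pi.single_apply, pderiv_comm 2 1]
    simp; ring

/-- Evaluation at real values of `ε, σ, τ`. -/
def ev (ε σ τ : ℝ) : ScaledPoly →+* ℂ := eval ![(ε : ℂ), σ, τ]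

@[simp] lemma ev_C (ε σ τ : ℝ) (c : ℂ) : ev ε σ τ (C c) = c := by simp [ev]
@[simp] lemma ev_X0 (ε σ τ : ℝ) : ev ε σ τ (X 0) = ε := by simp [ev]
@[simp] lemma ev_X1 (ε σ τ : ℝ) : ev ε σ τ (X 1) = σ := by simp [ev]
@[simp] lemma ev_X2 (ε σ τ : ℝ) : ev ε σ τ (X 2) = τ := by simp [ev]
@[simp] lemma ev_zeta (ε σ τ : ℝ) : ev ε σ τ zeta = σ - Complex.I * ε * τ := by simp [zeta]
lemma ev_smul (ε σ τ : ℝ) (c : ℂ) (Q : ScaledPoly) : ev ε σ τ (c • Q) = c * ev ε σ τ Q := by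
  rw [← C_mul', map_mul, ev_C]

lemma hasDerivAt_ev (ε : ℝ) {s t : ℝ → ℝ} {s' t' r : ℝ} (hs : HasDerivAt s s' r)
    (ht : HasDerivAt t t' r) (Q : ScaledPoly) :
    HasDerivAt (fun r => ev ε (s r) (t r) Q)
      (s' * ev ε (s r) (t r) (pderiv 1 Q) + t' * ev ε (s r) (t r) (pderiv 2 Q)) r := by
  induction Q using MvPolynomial.induction_on with
  | C a => simpa using hasDerivAt_const r a
  | add p q hp hq =>
    simp only [map_add]
    convert! hp.add hq using 1
    ring
  | mul_X p i hp =>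
    have hi : HasDerivAt (fun r => ev ε (s r) (t r) (X i))
        (s' * ev ε (s r) (t r) (pderiv 1 (X i)) + t' * ev ε (s r) (t r) (pderiv 2 (X i))) r := by
      fin_cases i
      · simpa using hasDerivAt_const r (ε : ℂ)
      · simpa using hs.ofReal_comp
      · simpa using ht.ofReal_comp
    simp only [map_mul, pderiv_mul, map_add]
    convert! hp.mul hi using 1
    ring

lemma norm_ev_le (Q : ScaledPoly) : ∃ C > (0 : ℝ), ∃ N : ℕ, ∀ ε ∈ Icc (0 : ℝ) 1, ∀ σ τ : ℝ,
    ‖ev ε σ τ Q‖ ≤ C * (1 + |σ| + |τ|) ^ N := by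
  have h1 : ∀ σ τ : ℝ, 1 ≤ 1 + |σ| + |τ| := fun σ τ => by
    have := abs_nonneg σ
    have := abs_nonneg τ
    linarith
  induction Q using MvPolynomial.induction_on with
  | C a => exact ⟨‖a‖ + 1, by positivity, 0, fun ε _ σ τ => by simp⟩
  | add p q hp hq =>
    obtain ⟨C₁, h₁, N₁, H₁⟩ := hp
    obtain ⟨C₂, h₂, N₂, H₂⟩ := hq
    refine ⟨C₁ + C₂, by positivity, N₁ + N₂, fun ε hε σ τ => ?_⟩
    rw [map_add]
    refine (norm_add_le _ _).trans ?_
    have a₁ : (1 + |σ| + |τ|) ^ N₁ ≤ (1 + |σ| + |τ|) ^ (N₁ + N₂) :=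
      pow_le_pow_right₀ (h1 σ τ) (Nat.le_add_right _ _)
    have a₂ : (1 + |σ| + |τ|) ^ N₂ ≤ (1 + |σ| + |τ|) ^ (N₁ + N₂) :=
      pow_le_pow_right₀ (h1 σ τ) (Nat.le_add_left _ _)
    rw [add_mul]
    exact add_le_add ((H₁ ε hε σ τ).trans (by gcongr)) ((H₂ ε hε σ τ).trans (by gcongr))
  | mul_X p i hp =>
    obtain ⟨C₁, h₁, N₁, H₁⟩ := hp
    refine ⟨C₁, h₁, N₁ + 1, fun ε hε σ τ => ?_⟩
    rw [map_mul, norm_mul, pow_succ, ← mul_assoc]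
    refine mul_le_mul (H₁ ε hε σ τ) ?_ (norm_nonneg _) (by positivity)
    have b1 := abs_nonneg σ
    have b2 := abs_nonneg τ
    fin_cases i
    · simp [abs_of_nonneg hε.1]; linarith [hε.2]
    · simp; linarith
    · simp; linarith

/-- The excited states `(2κζ - ∂_σ)^j 1` of the tangential oscillator. -/
def excited (κ : ℝ) : ℕ → ScaledPoly
  | 0 => 1
  | j + 1 => C (2 * κ : ℂ) * (zeta * excited κ j) - pderiv 1 (excited κ j)

lemma pderiv_one_zeta : pderiv 1 zeta = 1 := by
  simp [zeta, pderiv_X]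

lemma lower_zeta_mul (v : ScaledPoly) : lower (zeta * v) = zeta * lower v := by
  simp only [lower_apply, zeta, pderiv_mul, map_sub, pderiv_X, pderiv_C, Pi.single_apply]
  simp; ring

lemma lower_pderiv (v : ScaledPoly) : lower (pderiv 1 v) = pderiv 1 (lower v) := by
  simp only [lower_apply, pderiv_mul, map_add, pderiv_X, pderiv_C, Pi.single_apply,
    pderiv_comm 2 1]
  simp

lemma lower_excited (κ : ℝ) (j : ℕ) : lower (excited κ j) = 0 := by
  induction j with
  | zero => simp [excited, lower_apply]
  | succ j ih => rw [excited, map_sub, C_mul', map_smul, lower_zeta_mul, lower_pderiv, ih]; simp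

lemma excited_oscillator (κ : ℝ) (j : ℕ) :
    -delta κ (delta κ (excited κ j)) + C ((κ : ℂ) ^ 2) * (zeta * (zeta * excited κ j))
      = C ((κ : ℂ) * (2 * j + 1)) * excited κ j := by
  induction j with
  | zero =>
    simp only [excited, delta_apply, map_sub, pderiv_mul, pderiv_one_zeta, pderiv_C]
    simp; ring
  | succ j ih =>
    have key : -delta κ (delta κ (excited κ (j + 1)))
        + C ((κ : ℂ) ^ 2) * (zeta * (zeta * excited κ (j + 1)))
        = C (2 * κ : ℂ) * (zeta * (-delta κ (delta κ (excited κ j)) + C ((κ : ℂ) ^ 2) * (zeta * (zeta * excited κ j))))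
          - pderiv 1 (-delta κ (delta κ (excited κ j)) + C ((κ : ℂ) ^ 2) * (zeta * (zeta * excited κ j)))
          + C (2 * κ : ℂ) * excited κ (j + 1) := by
      simp only [excited, delta_apply, map_sub, map_add, map_neg, pderiv_mul, pderiv_one_zeta,
        pderiv_C, pderiv_one, map_zero]
      simp only [map_mul, map_pow, map_ofNat]
      ring
    rw [key, ih]
    have h2 : pderiv 1 (C ((κ : ℂ) * (2 * j + 1)) * excited κ j)
        = C ((κ : ℂ) * (2 * j + 1)) * pderiv 1 (excited κ j) := pderiv_C_mul
    rw [h2]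
    simp only [excited, map_mul, map_add, map_natCast, map_ofNat, map_one]
    push_cast
    ring

lemma pderiv_excited (κ : ℝ) (j : ℕ) :
    pderiv 1 (excited κ (j + 1)) = C (2 * κ * (j + 1) : ℂ) * excited κ j := by
  induction j with
  | zero => simp [excited, pderiv_one_zeta]
  | succ j ih =>
    rw [excited, map_sub, pderiv_mul, pderiv_C, pderiv_mul, pderiv_one_zeta, ih, pderiv_mul,
      pderiv_C]
    conv_rhs => rw [excited]
    rw [show (excited κ (j + 1)) = C (2 * κ : ℂ) * (zeta * excited κ j) - pderiv 1 (excited κ j)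
      from rfl]
    simp only [map_mul, map_add, map_natCast, map_one, map_ofNat]
    push_cast
    ring

lemma lower_delta (κ : ℝ) (v : ScaledPoly) : lower (delta κ v) = delta κ (lower v) := by
  rw [delta_apply, delta_apply, map_sub, C_mul', map_smul, lower_zeta_mul, lower_pderiv, C_mul']

lemma model_Z_apply_of_lower_eq_zero (κ : ℝ) {f : ScaledPoly} (hf : lower f = 0) :
    (model κ).Z f = zeta * f + X 0 * (X 0 * delta κ f) := by
  simp only [model, LinearMap.add_apply, LinearMap.smul_apply, LinearMap.sub_apply,
    Module.End.mul_apply, LinearMap.mulLeft_apply, raise_apply, hf, ← C_mul', zeta]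
  linear_combination (-X 0 * X 0 * delta κ f) * C_I_mul

lemma model_x_apply (κ : ℝ) (v : ScaledPoly) : (model κ).x v = (X 0 * X 1) * v := by
  rw [WeylModel.x_apply, WeylModel.X_apply, WeylModel.p₂_apply]
  simp only [model, pow_two, LinearMap.add_apply, LinearMap.smul_apply, LinearMap.sub_apply,
    Module.End.mul_apply, LinearMap.mulLeft_apply, ← C_mul']
  ring

lemma model_y_apply (κ : ℝ) (v : ScaledPoly) : (model κ).y v = (X 0 ^ 2 * X 2) * v := by
  rw [WeylModel.y_apply, WeylModel.p₁_apply]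
  simp only [model, pow_succ, pow_zero, one_mul,
    Module.End.mul_apply, LinearMap.mulLeft_apply, raise_apply, ← C_mul']
  ring

/-- The function `g₀ + g₁(x) y + g₂(x) y² + g₃ y³`. -/
def jet (g₀ : ℂ) (g₁ g₂ : Polynomial ℂ) (g₃ : ℂ) (x y : ℝ) : ℂ :=
  g₀ + g₁.eval (x : ℂ) * y + g₂.eval (x : ℂ) * y ^ 2 + g₃ * y ^ 3

lemma ev_entry (κ : ℝ) (g₀ : ℂ) (g₁ g₂ : Polynomial ℂ) (g₃ : ℂ) (v : ScaledPoly) (ε σ τ : ℝ) :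
    ev ε σ τ ((model κ).entry g₀ g₁ g₂ g₃ v)
      = jet g₀ g₁ g₂ g₃ (ε * σ) (ε ^ 2 * τ) * ev ε σ τ v := by
  have hy : (model κ).y = LinearMap.mulLeft ℂ (X 0 ^ 2 * X 2) := LinearMap.ext (model_y_apply κ)
  have hp : ∀ (p : Polynomial ℂ) v, ev ε σ τ (Polynomial.aeval (model κ).x p v)
      = p.eval ((ε * σ : ℝ) : ℂ) * ev ε σ τ v := by
    intro p
    induction p using Polynomial.induction_on with
    | C a => intro v; simp [Algebra.algebraMap_eq_smul_one, ev_smul]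
    | add p q hp hq => intro v; simp [hp, hq, add_mul]
    | monomial n a h =>
      intro v
      rw [pow_succ, ← mul_assoc, map_mul, Polynomial.aeval_X, Module.End.mul_apply, h,
        model_x_apply, map_mul, map_mul, ev_X0, ev_X1,
        Polynomial.eval_mul (q := Polynomial.X), Polynomial.eval_X]
      push_cast; ring
  simp only [WeylModel.entry, LinearMap.add_apply, LinearMap.smul_apply, Module.End.one_apply,
    Module.End.mul_apply, map_add, hp, ev_smul, hy, pow_succ, pow_zero, one_mul,
    LinearMap.mulLeft_apply, map_mul, ev_X0, ev_X2, jet]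
  push_cast; ring

lemma pow_raise_mem_level (κ : ℝ) {f : ScaledPoly} (hf : lower f = 0) (k : ℕ) :
    (raise κ ^ k) f ∈ (model κ).level k := by
  induction k with
  | zero =>
    rw [WeylModel.mem_level]
    simp [model, hf]
  | succ k ih =>
    rw [pow_succ', Module.End.mul_apply]
    have := (model κ).u_mem_level ih
    exact_mod_cast this

/-- The polynomials that vanish for `ε = 0`. -/
def Vanishing (Q : ScaledPoly) : Prop := ∀ σ τ : ℝ, ev 0 σ τ Q = 0

lemma Vanishing.pderiv_one {Q : ScaledPoly} (h : Vanishing Q) : Vanishing (pderiv 1 Q) := by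
  intro σ τ
  have h1 : HasDerivAt (fun r : ℝ => ev 0 r τ Q) (((1 : ℝ) : ℂ) * ev 0 σ τ (pderiv 1 Q)
      + ((0 : ℝ) : ℂ) * ev 0 σ τ (pderiv 2 Q)) σ :=
    hasDerivAt_ev 0 (hasDerivAt_id' σ) (hasDerivAt_const σ τ) Q
  have h2 : HasDerivAt (fun r : ℝ => ev 0 r τ Q) 0 σ := by
    have h0 : ∀ r, ev 0 r τ Q = 0 := fun r => h r τ
    simp only [h0]
    exact hasDerivAt_const σ (0 : ℂ)
  have h3 := h1.unique h2
  rwa [Complex.ofReal_one, one_mul, Complex.ofReal_zero, zero_mul, add_zero] at h3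

lemma Vanishing.pderiv_two {Q : ScaledPoly} (h : Vanishing Q) : Vanishing (pderiv 2 Q) := by
  intro σ τ
  have h1 : HasDerivAt (fun r : ℝ => ev 0 σ r Q) (((0 : ℝ) : ℂ) * ev 0 σ τ (pderiv 1 Q)
      + ((1 : ℝ) : ℂ) * ev 0 σ τ (pderiv 2 Q)) τ :=
    hasDerivAt_ev 0 (hasDerivAt_const τ σ) (hasDerivAt_id' τ) Q
  have h2 : HasDerivAt (fun r : ℝ => ev 0 σ r Q) 0 τ := by
    have h0 : ∀ r, ev 0 σ r Q = 0 := fun r => h σ r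
    simp only [h0]
    exact hasDerivAt_const τ (0 : ℂ)
  have h3 := h1.unique h2
  rwa [Complex.ofReal_one, one_mul, Complex.ofReal_zero, zero_mul, zero_add] at h3

lemma Vanishing.lower {Q : ScaledPoly} (h : Vanishing Q) : Vanishing (lower Q) := by
  intro σ τ
  rw [lower_apply]
  simp [h.pderiv_two σ τ]

lemma Vanishing.of_pow_raise (κ : ℝ) {f : ScaledPoly} (hf : ScaledPoly.lower f = 0) (k : ℕ)
    (h : Vanishing ((raise κ ^ k) f)) : Vanishing f := by
  induction k with
  | zero => simpa using h
  | succ k ih =>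
    apply ih
    have h1 := h.lower
    rw [pow_succ', Module.End.mul_apply, lower_raise] at h1
    have h2 : raise κ (ScaledPoly.lower ((raise κ ^ k) f)) = ((k : ℂ) / 2) • (raise κ ^ k) f := by
      have := (model κ).mem_level.1 (pow_raise_mem_level κ hf k)
      simpa [model] using this
    rw [h2, ← add_smul] at h1
    intro σ τ
    have h3 := h1 σ τ
    rw [ev_smul] at h3
    refine (mul_eq_zero.1 h3).resolve_left ?_
    have : ((k : ℂ) + 1) ≠ 0 := by exact_mod_cast Nat.succ_ne_zero k
    intro h0; apply this; linear_combination 2 * h0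

lemma not_vanishing_excited {κ : ℝ} (hκ : κ ≠ 0) (j : ℕ) : ¬ Vanishing (excited κ j) := by
  induction j with
  | zero => intro h; simpa [excited] using h 0 0
  | succ j ih =>
    intro h
    apply ih
    intro σ τ
    have h1 := h.pderiv_one σ τ
    rw [pderiv_excited, map_mul, ev_C] at h1
    refine (mul_eq_zero.1 h1).resolve_left ?_
    have h2 : ((j : ℂ) + 1) ≠ 0 := by exact_mod_cast Nat.succ_ne_zero j
    have h3 : (κ : ℂ) ≠ 0 := by exact_mod_cast hκ
    exact mul_ne_zero (mul_ne_zero two_ne_zero h3) h2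

/-- A polynomial quasimode of the magnetic operator with polynomial coefficients. -/
theorem exists_quasimode (k j : ℕ) {κ : ℝ} (hκ : κ ≠ 0) (P c q β : Polynomial ℂ)
    (a₃ q₃ c₃ β₃ b m₀ m₄ m₆ : ℂ) (hm : m₀ * b⁻¹ = 2 * k + 1)
    (hV : -((k : ℂ) ^ 2 + k) • c + (m₀ * (k + 1 / 2)) • β - Polynomial.C (m₄ * b⁻¹)
      = Polynomial.C (m₀ * β.coeff 0 * κ ^ 2) * Polynomial.X ^ 2)
    (hm₆ : m₆ * b⁻¹ = m₀ * β.coeff 0 * (κ * (2 * j + 1))) :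
    ∃ Q r : ScaledPoly, ¬ Vanishing Q ∧
      (model κ).magnetic P c q β a₃ q₃ c₃ β₃ b m₀ m₄ m₆ Q = X 0 ^ 7 * r := by
  set f := excited κ j with hf
  have hlf : lower f = 0 := lower_excited κ j
  have hδ : ∀ n, ∀ v, delta κ ((raise κ ^ n) v) = (raise κ ^ n) (delta κ v) := by
    intro n
    induction n with
    | zero => simp
    | succ n ih => intro v; rw [pow_succ', Module.End.mul_apply, Module.End.mul_apply, ← ih]; exact (model κ).δ_u _
  have hZ : ∀ n, ∀ v, (model κ).Z ((raise κ ^ n) v) = (raise κ ^ n) ((model κ).Z v) := by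
    intro n
    induction n with
    | zero => simp
    | succ n ih => intro v; rw [pow_succ', Module.End.mul_apply, Module.End.mul_apply, ← ih]; exact (model κ).Z_u _
  have hX : ∀ n, ∀ v, (raise κ ^ n) (X 0 * v) = X 0 * (raise κ ^ n) v := by
    intro n
    induction n with
    | zero => simp
    | succ n ih => intro v; rw [pow_succ', Module.End.mul_apply, Module.End.mul_apply, ih]; exact (model κ).u_e _
  have hZf : (model κ).Z f = zeta * f + X 0 * (X 0 * delta κ f) :=
    model_Z_apply_of_lower_eq_zero κ hlf
  have hl2 : lower (zeta * f + X 0 * (X 0 * delta κ f)) = 0 := by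
    have : ∀ v, lower (X 0 * v) = X 0 * lower v := (model κ).d_e
    rw [map_add, lower_zeta_mul, hlf, this, this, lower_delta, hlf]; simp
  have hZZ : (model κ).Z ((model κ).Z f) = zeta * (zeta * f) + X 0 * (X 0 * (zeta * delta κ f
      + delta κ (zeta * f) + X 0 * (X 0 * delta κ (delta κ f)))) := by
    have : ∀ v, delta κ (X 0 * v) = X 0 * delta κ v := (model κ).δ_e
    rw [hZf, model_Z_apply_of_lower_eq_zero κ hl2, map_add, this, this]
    ring
  obtain ⟨w', r, h⟩ := (model κ).exists_formal_quasimode P c q β a₃ q₃ c₃ β₃ b m₀ m₄ m₆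
    (m₀ * β.coeff 0 * κ ^ 2) (k := k) (w := (raise κ ^ k) f)
    (r₀ := (raise κ ^ k) (C (m₀ * β.coeff 0 * κ ^ 2) * (X 0 * (zeta * delta κ f
      + delta κ (zeta * f) + X 0 * (X 0 * delta κ (delta κ f)))))) hm hV
    (pow_raise_mem_level κ hlf k) (by
      have e1 : (model κ).δ = delta κ := rfl
      have e2 : ∀ v, (model κ).e v = X 0 * v := fun v => rfl
      rw [e1, e2, hδ, hδ, hZ, hZ, ← hX, ← map_smul (raise κ ^ k), ← map_smul (raise κ ^ k),
        ← map_smul (raise κ ^ k), ← map_add (raise κ ^ k), ← map_sub (raise κ ^ k)]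
      congr 1
      rw [hZZ, hm₆]
      have := excited_oscillator κ j
      rw [← hf] at this
      simp only [← C_mul', map_neg, map_mul, map_pow] at this ⊢
      linear_combination (C m₀ * C (β.coeff 0)) * this)
  refine ⟨_, r, fun hv => ?_, h.trans ?_⟩
  · refine not_vanishing_excited hκ j (Vanishing.of_pow_raise κ hlf k fun σ τ => ?_)
    have := hv σ τ
    rw [map_add, show (model κ).e w' = X 0 * w' from rfl, map_mul, ev_X0] at this
    simpa using this
  · have : (model κ).e = LinearMap.mulLeft ℂ (X 0) := rfl
    rw [this, LinearMap.pow_mulLeft, LinearMap.mulLeft_apply]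

end ScaledPoly

section PartialDerivatives

variable {F : Type*} [NormedAddCommGroup F] [NormedSpace ℝ F]

/-- The partial derivative of a function on the plane. -/
def pd (i : Fin 2) (f : Plane → F) (z : Plane) : F := fderiv ℝ f z (basisVec i)

/-- The point with coordinates `x, y`. -/
def pt (x y : ℝ) : Plane := !₂[x, y]

@[simp] lemma pt_zero (x y : ℝ) : pt x y 0 = x := rfl
@[simp] lemma pt_one (x y : ℝ) : pt x y 1 = y := rfl

lemma pt_eta (z : Plane) : pt (z 0) (z 1) = z := by
  ext i; fin_cases i <;> rfl

lemma pt_zero_zero : pt 0 0 = 0 := by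
  ext i; fin_cases i <;> rfl

lemma pt_add_smul_zero (x y t : ℝ) : pt x y + t • basisVec 0 = pt (x + t) y := by
  ext i; fin_cases i <;> simp [pt, basisVec]

lemma pt_add_smul_one (x y t : ℝ) : pt x y + t • basisVec 1 = pt x (y + t) := by
  ext i; fin_cases i <;> simp [pt, basisVec]

lemma contDiff_pt : ContDiff ℝ ∞ fun p : ℝ × ℝ => pt p.1 p.2 := by
  rw [contDiff_euclidean]
  intro i; fin_cases i
  · exact contDiff_fst
  · exact contDiff_snd

lemma contDiff_coord (i : Fin 2) : ContDiff ℝ ∞ fun z : Plane => z i :=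
  (contDiff_euclidean (n := ∞) (f := fun z : Plane => z)).1 contDiff_id i

lemma pd_coord (i j : Fin 2) (z : Plane) : pd i (fun z : Plane => z j) z = if i = j then 1 else 0 := by
  have : fderiv ℝ (fun z : Plane => z j) z = (EuclideanSpace.proj j : Plane →L[ℝ] ℝ) :=
    (EuclideanSpace.proj j : Plane →L[ℝ] ℝ).hasFDerivAt.fderiv
  rw [pd, this]
  simp [basisVec, eq_comm]

lemma _root_.ContDiff.pd {f : Plane → F} (hf : ContDiff ℝ ∞ f) (i : Fin 2) : ContDiff ℝ ∞ (MagneticWell.pd i f) := by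
  have h : ContDiff ℝ ∞ (fderiv ℝ f) := hf.fderiv_right (by simp)
  exact h.clm_apply contDiff_const

lemma _root_.ContDiff.diffAt_top {E : Type*} [NormedAddCommGroup E] [NormedSpace ℝ E]
    {f : E → F} (hf : ContDiff ℝ ∞ f) (z : E) :
    DifferentiableAt ℝ f z := (hf.differentiable (by simp)) z

lemma pd_add {f g : Plane → F} {z : Plane} (hf : DifferentiableAt ℝ f z)
    (hg : DifferentiableAt ℝ g z) (i : Fin 2) :
    pd i (fun z => f z + g z) z = pd i f z + pd i g z := by
  rw [pd, fderiv_fun_add hf hg]; rfl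

lemma pd_sub {f g : Plane → F} {z : Plane} (hf : DifferentiableAt ℝ f z)
    (hg : DifferentiableAt ℝ g z) (i : Fin 2) :
    pd i (fun z => f z - g z) z = pd i f z - pd i g z := by
  rw [pd, fderiv_fun_sub hf hg]; rfl

lemma pd_mul {𝔸 : Type*} [NormedCommRing 𝔸] [NormedAlgebra ℝ 𝔸] {f g : Plane → 𝔸} {z : Plane}
    (hf : DifferentiableAt ℝ f z) (hg : DifferentiableAt ℝ g z) (i : Fin 2) :
    pd i (fun z => f z * g z) z = pd i f z * g z + f z * pd i g z := by
  rw [pd, fderiv_fun_mul hf hg]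
  simp [pd]; ring

lemma pd_const (c : F) (i : Fin 2) (z : Plane) : pd i (fun _ => c) z = 0 := by
  simp [pd]

lemma pd_ofReal {f : Plane → ℝ} {z : Plane} (hf : DifferentiableAt ℝ f z) (i : Fin 2) :
    pd i (fun z => (f z : ℂ)) z = ((pd i f z : ℝ) : ℂ) := by
  have h := (Complex.ofRealCLM.hasFDerivAt (x := f z)).comp z hf.hasFDerivAt
  have h2 : fderiv ℝ (fun z => (f z : ℂ)) z = Complex.ofRealCLM.comp (fderiv ℝ f z) := h.fderiv
  rw [pd, h2]; rfl

lemma pd_congr {f g : Plane → F} {z : Plane} (h : f =ᶠ[𝓝 z] g) (i : Fin 2) : pd i f z = pd i g z := by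
  rw [pd, h.fderiv_eq]; rfl

lemma pd_comm {f : Plane → F} {z : Plane} (hf : ContDiffAt ℝ ∞ f z) (i j : Fin 2) :
    pd i (pd j f) z = pd j (pd i f) z := by
  have hs : IsSymmSndFDerivAt ℝ f z := hf.isSymmSndFDerivAt (by simp; norm_cast)
  have hd : DifferentiableAt ℝ (fderiv ℝ f) z :=
    (hf.fderiv_right (m := 1) (by norm_cast)).differentiableAt (by simp)
  have h : ∀ i j, pd i (pd j f) z = fderiv ℝ (fderiv ℝ f) z (basisVec i) (basisVec j) := by
    intro i j
    have : pd j f = fun w => (fderiv ℝ f w) (basisVec j) := rfl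
    rw [this, pd, fderiv_clm_apply hd (differentiableAt_const _)]
    simp
  rw [h, h, hs.eq]

lemma hasDerivAt_pt_zero {f : Plane → F} {x y : ℝ} (hf : DifferentiableAt ℝ f (pt x y)) :
    HasDerivAt (fun t => f (pt t y)) (pd 0 f (pt x y)) x := by
  have h1 : HasDerivAt (fun t : ℝ => pt t y) (basisVec 0) x := by
    have : (fun t : ℝ => pt t y) = fun t => pt 0 y + t • basisVec 0 := by
      funext t; rw [pt_add_smul_zero, zero_add]
    rw [this]
    simpa using ((hasDerivAt_id' x).smul_const (basisVec 0)).const_add (pt 0 y)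
  exact hf.hasFDerivAt.comp_hasDerivAt x h1

lemma hasDerivAt_pt_one {f : Plane → F} {x y : ℝ} (hf : DifferentiableAt ℝ f (pt x y)) :
    HasDerivAt (fun t => f (pt x t)) (pd 1 f (pt x y)) y := by
  have h1 : HasDerivAt (fun t : ℝ => pt x t) (basisVec 1) y := by
    have : (fun t : ℝ => pt x t) = fun t => pt x 0 + t • basisVec 1 := by
      funext t; rw [pt_add_smul_one, zero_add]
    rw [this]
    simpa using ((hasDerivAt_id' y).smul_const (basisVec 1)).const_add (pt x 0)
  exact hf.hasFDerivAt.comp_hasDerivAt y h1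

end PartialDerivatives

section Flatness

/-- All derivatives of order less than `n` vanish at the origin. -/
def FlatLine : ℕ → (ℝ → ℝ) → Prop
  | 0, _ => True
  | n + 1, f => f 0 = 0 ∧ FlatLine n (deriv f)

/-- All derivatives of weighted order less than `n` vanish at the origin, where `∂₀` has weight `1`
and `∂₁` has weight `2`. -/
def Flat : ℕ → (Plane → ℝ) → Prop
  | 0, _ => True
  | 1, f => f 0 = 0
  | n + 2, f => f 0 = 0 ∧ Flat (n + 1) (pd 0 f) ∧ Flat n (pd 1 f)

lemma FlatLine.congr {n : ℕ} {f g : ℝ → ℝ} (hf : FlatLine n f) (h : f =ᶠ[𝓝 0] g) :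
    FlatLine n g := by
  induction n generalizing f g with
  | zero => trivial
  | succ n ih => exact ⟨h.eq_of_nhds ▸ hf.1, ih hf.2 h.deriv⟩

lemma flatLine_zero (n : ℕ) : FlatLine n fun _ => 0 := by
  induction n with
  | zero => trivial
  | succ n ih => exact ⟨rfl, by simpa using ih⟩

lemma FlatLine.pred {n : ℕ} {f : ℝ → ℝ} (hf : FlatLine (n + 1) f) : FlatLine n f := by
  induction n generalizing f with
  | zero => trivial
  | succ n ih => exact ⟨hf.1, ih hf.2⟩

lemma _root_.ContDiff.deriv_top {f : ℝ → ℝ} (hf : ContDiff ℝ ∞ f) : ContDiff ℝ ∞ (deriv f) :=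
  (contDiff_infty_iff_deriv.1 hf).2

lemma FlatLine.add {n : ℕ} {f g : ℝ → ℝ} (hf : FlatLine n f) (hg : FlatLine n g)
    (hf' : ContDiff ℝ ∞ f) (hg' : ContDiff ℝ ∞ g) : FlatLine n (fun x => f x + g x) := by
  induction n generalizing f g with
  | zero => trivial
  | succ n ih =>
    refine ⟨by simp [hf.1, hg.1], ?_⟩
    have : deriv (fun x => f x + g x) = fun x => deriv f x + deriv g x := by
      funext x; exact deriv_fun_add (hf'.diffAt_top x) (hg'.diffAt_top x)
    rw [this]
    exact ih hf.2 hg.2 hf'.deriv_top hg'.deriv_top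

lemma FlatLine.mul {n : ℕ} {f g : ℝ → ℝ} (hf : FlatLine n f)
    (hf' : ContDiff ℝ ∞ f) (hg' : ContDiff ℝ ∞ g) : FlatLine n (fun x => f x * g x) := by
  induction n generalizing f g with
  | zero => trivial
  | succ n ih =>
    refine ⟨by simp [hf.1], ?_⟩
    have : deriv (fun x => f x * g x) = fun x => deriv f x * g x + f x * deriv g x := by
      funext x; exact deriv_fun_mul (hf'.diffAt_top x) (hg'.diffAt_top x)
    rw [this]
    exact (ih hf.2 hf'.deriv_top hg').add (ih hf.pred hf' hg'.deriv_top) (hf'.deriv_top.mul hg')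
      (hf'.mul hg'.deriv_top)

lemma flatLine_sub_eval {n : ℕ} {g : ℝ → ℝ} (hg : ContDiff ℝ ∞ g) (p : Polynomial ℝ)
    (h : ∀ i < n, iteratedDeriv i g 0 = i.factorial * p.coeff i) :
    FlatLine n (fun x => g x - p.eval x) := by
  induction n generalizing g p with
  | zero => trivial
  | succ n ih =>
    refine ⟨?_, ?_⟩
    · have := h 0 (by omega)
      simp at this
      simp [this, Polynomial.coeff_zero_eq_eval_zero]
    · have e : deriv (fun x => g x - p.eval x) = fun x => deriv g x - p.derivative.eval x := by
        funext x
        rw [deriv_fun_sub (hg.diffAt_top x) p.differentiableAt, Polynomial.deriv]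
      rw [e]
      refine ih hg.deriv_top _ fun i hi => ?_
      rw [← iteratedDeriv_succ', h (i + 1) (by omega), Polynomial.coeff_derivative,
        Nat.factorial_succ]
      push_cast; ring

/-- The Taylor polynomial of degree less than `n` at the origin. -/
def taylorPoly (n : ℕ) (g : ℝ → ℝ) : Polynomial ℝ :=
  ∑ i ∈ Finset.range n, Polynomial.monomial i (iteratedDeriv i g 0 / i.factorial)

lemma coeff_taylorPoly (n : ℕ) (g : ℝ → ℝ) (i : ℕ) :
    (taylorPoly n g).coeff i = if i < n then iteratedDeriv i g 0 / i.factorial else 0 := by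
  simp [taylorPoly, Polynomial.coeff_monomial]

lemma flatLine_sub_taylorPoly (n : ℕ) {g : ℝ → ℝ} (hg : ContDiff ℝ ∞ g) :
    FlatLine n (fun x => g x - (taylorPoly n g).eval x) := by
  refine flatLine_sub_eval hg _ fun i hi => ?_
  rw [coeff_taylorPoly, if_pos hi, mul_div_cancel₀ _ (by positivity)]

lemma contDiff_axis {f : Plane → ℝ} (hf : ContDiff ℝ ∞ f) : ContDiff ℝ ∞ fun x => f (pt x 0) :=
  hf.comp (contDiff_pt.comp (contDiff_id.prodMk contDiff_const))

lemma flat_of_axis_zero {n : ℕ} {f : Plane → ℝ} (hf : ContDiff ℝ ∞ f)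
    (h : FlatLine n fun x => f (pt x 0)) (hn : n ≤ 2) : Flat n f := by
  have h0 : 0 < n → f 0 = 0 := by
    intro hn
    obtain ⟨m, rfl⟩ : ∃ m, n = m + 1 := ⟨n - 1, by omega⟩
    have := h.1
    simpa only [pt_zero_zero] using this
  have hd : deriv (fun x => f (pt x 0)) = fun x => pd 0 f (pt x 0) :=
    funext fun x => (hasDerivAt_pt_zero (hf.diffAt_top _)).deriv
  interval_cases n
  · trivial
  · exact h0 (by norm_num)
  · refine ⟨h0 (by norm_num), ?_, trivial⟩
    have := h.2.1
    rw [hd] at this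
    change pd 0 f 0 = 0
    simpa only [pt_zero_zero] using this

lemma Flat.zero_eq {n : ℕ} {f : Plane → ℝ} (h : Flat (n + 1) f) : f 0 = 0 := by
  cases n with
  | zero => exact h
  | succ n => exact h.1

lemma flat_of_axis {n : ℕ} {f : Plane → ℝ} (hf : ContDiff ℝ ∞ f)
    (h : FlatLine (n + 2) fun x => f (pt x 0)) (h1 : Flat n (pd 1 f)) : Flat (n + 2) f := by
  induction n generalizing f with
  | zero => exact flat_of_axis_zero hf h le_rfl
  | succ n ih =>
    have hd : deriv (fun x => f (pt x 0)) = fun x => pd 0 f (pt x 0) :=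
      funext fun x => (hasDerivAt_pt_zero (hf.diffAt_top _)).deriv
    refine ⟨?_, ?_, h1⟩
    · have := h.1
      simpa only [pt_zero_zero] using this
    · refine ih (hf.pd 0) (hd ▸ h.2) ?_
      have hc : pd 1 (pd 0 f) = pd 0 (pd 1 f) := funext fun z => pd_comm hf.contDiffAt 1 0
      rw [hc]
      cases n with
      | zero => trivial
      | succ n => exact h1.2.1

lemma Flat.congr {n : ℕ} {f g : Plane → ℝ} (hf : Flat n f) (h : f =ᶠ[𝓝 0] g) : Flat n g := by
  induction n using Nat.strong_induction_on generalizing f g with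
  | _ n ih =>
  have hpd : ∀ i, pd i f =ᶠ[𝓝 0] pd i g := fun i =>
    h.eventuallyEq_nhds.mono fun z hz => pd_congr hz i
  match n, hf, ih with
  | 0, _, _ => trivial
  | 1, hf, _ => exact (h.eq_of_nhds.symm.trans hf : g 0 = 0)
  | n + 2, hf, ih =>
    exact ⟨h.eq_of_nhds ▸ hf.1, ih (n + 1) (by omega) hf.2.1 (hpd 0), ih n (by omega) hf.2.2 (hpd 1)⟩

lemma flat_zero (n : ℕ) : Flat n fun _ => 0 := by
  induction n using Nat.strong_induction_on with
  | _ n ih =>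
  have hpd : ∀ i, pd i (fun _ : Plane => (0 : ℝ)) = fun _ => 0 := fun i =>
    funext fun z => pd_const _ i z
  match n, ih with
  | 0, _ => trivial
  | 1, _ => rfl
  | n + 2, ih =>
    exact ⟨rfl, by rw [hpd]; exact ih (n + 1) (by omega), by rw [hpd]; exact ih n (by omega)⟩

lemma Flat.pred {n : ℕ} {f : Plane → ℝ} (hf : Flat (n + 1) f) : Flat n f := by
  induction n using Nat.strong_induction_on generalizing f with
  | _ n ih =>
  match n, hf, ih with
  | 0, _, _ => trivial
  | 1, hf, _ => exact hf.1
  | n + 2, hf, ih =>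
    exact ⟨hf.1, ih (n + 1) (by omega) hf.2.1, ih n (by omega) hf.2.2⟩

lemma Flat.partial {n : ℕ} {f : Plane → ℝ} (hf : Flat (n + 2) f) (i : Fin 2) : Flat n (pd i f) := by
  fin_cases i
  · exact hf.2.1.pred
  · exact hf.2.2

/-- The weighted size of a point. -/
def wnorm (z : Plane) : ℝ := |z 0| + √|z 1|

lemma wnorm_nonneg (z : Plane) : 0 ≤ wnorm z := by unfold wnorm; positivity

def unitBox : Set Plane := {z | |z 0| ≤ 1 ∧ |z 1| ≤ 1}

lemma pt_mem_unitBox {x y : ℝ} : pt x y ∈ unitBox ↔ |x| ≤ 1 ∧ |y| ≤ 1 := Iff.rfl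

lemma isCompact_unitBox : IsCompact unitBox := by
  have : unitBox = (fun p : ℝ × ℝ => pt p.1 p.2) '' (Icc (-1) 1 ×ˢ Icc (-1) 1) := by
    ext z
    simp only [unitBox, mem_ofPred_eq, abs_le, mem_image, mem_prod, mem_Icc, Prod.exists]
    constructor
    · intro h; exact ⟨z 0, z 1, h, pt_eta z⟩
    · rintro ⟨a, b, h, rfl⟩; exact h
  rw [this]
  exact (isCompact_Icc.prod isCompact_Icc).image contDiff_pt.continuous

lemma exists_abs_le_on_unitBox {f : Plane → ℝ} (hf : Continuous f) :
    ∃ C, 0 ≤ C ∧ ∀ z ∈ unitBox, |f z| ≤ C := by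
  obtain ⟨C, hC⟩ := isCompact_unitBox.exists_bound_of_continuousOn hf.continuousOn
  exact ⟨max C 0, le_max_right _ _, fun z hz => (hC z hz).trans (le_max_left _ _)⟩

lemma wnorm_pt (x y : ℝ) : wnorm (pt x y) = |x| + √|y| := rfl

/-- Taylor's formula with weights. -/
theorem Flat.exists_abs_le {n : ℕ} {f : Plane → ℝ} (h : Flat n f) (hf : ContDiff ℝ ∞ f) :
    ∃ C, 0 ≤ C ∧ ∀ z ∈ unitBox, |f z| ≤ C * wnorm z ^ n := by
  induction n using Nat.strong_induction_on generalizing f with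
  | _ n ih =>
  match n, h, ih with
  | 0, _, _ => simpa using exists_abs_le_on_unitBox hf.continuous
  | n + 1, h, ih =>
    have hx : ∃ C, 0 ≤ C ∧ ∀ z ∈ unitBox, |pd 0 f z| ≤ C * wnorm z ^ n := by
      cases n with
      | zero => simpa using exists_abs_le_on_unitBox (hf.pd 0).continuous
      | succ n => exact ih (n + 1) (by omega) h.2.1 (hf.pd 0)
    have hy : ∃ C, 0 ≤ C ∧ ∀ z ∈ unitBox, |pd 1 f z| ≤ C * wnorm z ^ (n - 1) := by
      cases n with
      | zero => simpa using exists_abs_le_on_unitBox (hf.pd 1).continuous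
      | succ n => exact ih n (by omega) h.2.2 (hf.pd 1)
    obtain ⟨C₀, hC₀, H₀⟩ := hx
    obtain ⟨C₁, hC₁, H₁⟩ := hy
    refine ⟨C₀ + 2 * C₁, by positivity, fun z hz => ?_⟩
    obtain ⟨x, y, rfl⟩ : ∃ x y, z = pt x y := ⟨z 0, z 1, (pt_eta z).symm⟩
    rw [pt_mem_unitBox] at hz
    set w := wnorm (pt x y) with hw
    have hw' : w = |x| + √|y| := rfl
    have hxw : |x| ≤ w := by rw [hw']; have := Real.sqrt_nonneg |y|; linarith
    have hyw : √|y| ≤ w := by rw [hw']; have := abs_nonneg x; linarith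
    have hw0 : 0 ≤ w := wnorm_nonneg _
    have hw2 : w ≤ 2 := by
      rw [hw']
      have : √|y| ≤ 1 := Real.sqrt_le_one.2 hz.2
      linarith [hz.1]
    have habs : ∀ {a t : ℝ}, t ∈ uIcc 0 a → |t| ≤ |a| := fun {a t} ht => by
      simpa using abs_sub_left_of_mem_uIcc ht
    have b0 : |f (pt x 0) - f (pt 0 0)| ≤ C₀ * w ^ n * |x| := by
      have := (convex_uIcc (0 : ℝ) x).norm_image_sub_le_of_norm_hasDerivWithin_le
        (f := fun t => f (pt t 0)) (f' := fun t => pd 0 f (pt t 0)) (C := C₀ * w ^ n)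
        (fun t _ => (hasDerivAt_pt_zero (hf.diffAt_top _)).hasDerivWithinAt)
        (fun t ht => (H₀ _ (pt_mem_unitBox.2 ⟨(habs ht).trans hz.1, by simp⟩)).trans (by
          rw [wnorm_pt]
          have : |t| + √|(0 : ℝ)| ≤ w := by simpa using (habs ht).trans hxw
          gcongr)) left_mem_uIcc right_mem_uIcc
      simpa using this
    have b1 : |f (pt x y) - f (pt x 0)| ≤ C₁ * w ^ (n - 1) * |y| := by
      have := (convex_uIcc (0 : ℝ) y).norm_image_sub_le_of_norm_hasDerivWithin_le
        (f := fun t => f (pt x t)) (f' := fun t => pd 1 f (pt x t)) (C := C₁ * w ^ (n - 1))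
        (fun t _ => (hasDerivAt_pt_one (hf.diffAt_top _)).hasDerivWithinAt)
        (fun t ht => (H₁ _ (pt_mem_unitBox.2 ⟨hz.1, (habs ht).trans hz.2⟩)).trans (by
          rw [wnorm_pt]
          have : |x| + √|t| ≤ w := by
            rw [hw']; exact add_le_add le_rfl (Real.sqrt_le_sqrt (habs ht))
          gcongr)) left_mem_uIcc right_mem_uIcc
      simpa using this
    have hy2 : w ^ (n - 1) * |y| ≤ 2 * w ^ (n + 1) := by
      have e : |y| = √|y| * √|y| := (Real.mul_self_sqrt (abs_nonneg y)).symm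
      have : |y| ≤ w * w := by rw [e]; gcongr
      cases n with
      | zero => simp; nlinarith
      | succ n =>
        calc w ^ (n + 1 - 1) * |y| ≤ w ^ n * (w * w) := by simp; gcongr
          _ = w ^ (n + 1 + 1) := by ring
          _ ≤ 2 * w ^ (n + 1 + 1) := by
            have : 0 ≤ w ^ (n + 1 + 1) := by positivity
            linarith
    have hf0 : f (pt 0 0) = 0 := by rw [pt_zero_zero]; exact h.zero_eq
    calc |f (pt x y)| = |(f (pt x y) - f (pt x 0)) + (f (pt x 0) - f (pt 0 0))| := by
          rw [hf0]; congr 1; ring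
      _ ≤ C₁ * w ^ (n - 1) * |y| + C₀ * w ^ n * |x| := (abs_add_le _ _).trans (add_le_add b1 b0)
      _ ≤ C₁ * (2 * w ^ (n + 1)) + C₀ * w ^ n * w := by
        rw [mul_assoc C₁]; gcongr
      _ = (C₀ + 2 * C₁) * w ^ (n + 1) := by ring

end Flatness

section Waves

open ScaledPoly
open MvPolynomial (C X pderiv)

/-- The Gaussian `exp (-τ² / 2 - κ (σ - i ε τ)² / 2)`. -/
def gaussian (κ ε σ τ : ℝ) : ℂ :=
  Complex.exp (-((τ : ℂ) ^ 2 / 2) - κ * ((σ : ℂ) - Complex.I * ε * τ) ^ 2 / 2)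

/-- A polynomial in the rescaled variables `x / ε` and `y / ε²` times the Gaussian. -/
def wave (κ ε : ℝ) (Q : ScaledPoly) (z : Plane) : ℂ :=
  ev ε (z 0 / ε) (z 1 / ε ^ 2) Q * gaussian κ ε (z 0 / ε) (z 1 / ε ^ 2)

lemma wave_add (κ ε : ℝ) (Q R : ScaledPoly) (z : Plane) :
    wave κ ε (Q + R) z = wave κ ε Q z + wave κ ε R z := by
  simp [wave, add_mul]

lemma wave_sub (κ ε : ℝ) (Q R : ScaledPoly) (z : Plane) :
    wave κ ε (Q - R) z = wave κ ε Q z - wave κ ε R z := by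
  simp [wave, sub_mul]

lemma wave_smul (κ ε : ℝ) (c : ℂ) (Q : ScaledPoly) (z : Plane) :
    wave κ ε (c • Q) z = c * wave κ ε Q z := by
  simp [wave, ev_smul, mul_assoc]

lemma wave_pow_mul (κ ε : ℝ) (n : ℕ) (Q : ScaledPoly) (z : Plane) :
    wave κ ε (X 0 ^ n * Q) z = ε ^ n * wave κ ε Q z := by
  simp [wave, mul_assoc]

lemma contDiff_wave (κ ε : ℝ) (Q : ScaledPoly) : ContDiff ℝ ∞ (wave κ ε Q) := by
  have h0 : ContDiff ℝ ∞ fun z : Plane => ((z 0 / ε : ℝ) : ℂ) :=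
    Complex.ofRealCLM.contDiff.comp ((contDiff_coord 0).div_const ε)
  have h1 : ContDiff ℝ ∞ fun z : Plane => ((z 1 / ε ^ 2 : ℝ) : ℂ) :=
    Complex.ofRealCLM.contDiff.comp ((contDiff_coord 1).div_const (ε ^ 2))
  have hQ : ContDiff ℝ ∞ fun z : Plane => ev ε (z 0 / ε) (z 1 / ε ^ 2) Q := by
    induction Q using MvPolynomial.induction_on with
    | C a => simp only [ev_C]; exact contDiff_const
    | add p q hp hq => simp only [map_add]; exact hp.add hq
    | mul_X p i hp =>
      simp only [map_mul]
      refine hp.mul ?_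
      fin_cases i
      · simp only [Fin.zero_eta, ev_X0]; exact contDiff_const
      · simp only [Fin.mk_one, ev_X1]; exact h0
      · simp only [Fin.reduceFinMk, ev_X2]; exact h1
  refine hQ.mul ?_
  unfold gaussian
  exact (((h1.pow 2).div_const 2).neg.sub ((contDiff_const.mul
    ((h0.sub (contDiff_const.mul h1)).pow 2)).div_const 2)).cexp

lemma hasDerivAt_gaussian (κ ε : ℝ) {s t : ℝ → ℝ} {s' t' r : ℝ} (hs : HasDerivAt s s' r)
    (ht : HasDerivAt t t' r) :
    HasDerivAt (fun r => gaussian κ ε (s r) (t r))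
      ((-(t' * t r) - κ * ((s r : ℂ) - Complex.I * ε * t r) * (s' - Complex.I * ε * t'))
        * gaussian κ ε (s r) (t r)) r := by
  have hs' := hs.ofReal_comp
  have ht' := ht.ofReal_comp
  have := ((((ht'.pow 2).div_const 2).neg).sub
    ((((hs'.sub (ht'.const_mul (Complex.I * ε))).pow 2).const_mul (κ : ℂ)).div_const 2)).cexp
  unfold gaussian
  convert! this using 1
  simp only [Pi.sub_apply, Pi.neg_apply, Pi.pow_apply]
  push_cast
  ring

lemma pd_zero_wave (κ : ℝ) {ε : ℝ} (Q : ScaledPoly) (z : Plane) :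
    pd 0 (wave κ ε Q) z = (ε⁻¹ : ℝ) * wave κ ε (delta κ Q) z := by
  obtain ⟨x, y, rfl⟩ : ∃ x y, z = pt x y := ⟨z 0, z 1, (pt_eta z).symm⟩
  have h := hasDerivAt_pt_zero ((contDiff_wave κ ε Q).diffAt_top (pt x y))
  have hs : HasDerivAt (fun t : ℝ => t / ε) ε⁻¹ x := by simpa using (hasDerivAt_id' x).div_const ε
  have ht : HasDerivAt (fun _ : ℝ => y / ε ^ 2) 0 x := hasDerivAt_const x _
  have h2 := (hasDerivAt_ev ε hs ht Q).mul (hasDerivAt_gaussian κ ε hs ht)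
  rw [h.unique h2]
  simp only [wave, delta_apply, map_sub, map_mul, ev_C, ev_zeta, pt_zero, pt_one]
  push_cast
  ring

lemma pd_one_wave (κ : ℝ) {ε : ℝ} (Q : ScaledPoly) (z : Plane) :
    pd 1 (wave κ ε Q) z = ((ε ^ 2)⁻¹ : ℝ) *
      wave κ ε (pderiv 2 Q - X 2 * Q + C (Complex.I * κ) * (X 0 * (zeta * Q))) z := by
  obtain ⟨x, y, rfl⟩ : ∃ x y, z = pt x y := ⟨z 0, z 1, (pt_eta z).symm⟩
  have h := hasDerivAt_pt_one ((contDiff_wave κ ε Q).diffAt_top (pt x y))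
  have ht : HasDerivAt (fun t : ℝ => t / ε ^ 2) (ε ^ 2)⁻¹ y := by
    simpa using (hasDerivAt_id' y).div_const (ε ^ 2)
  have hs : HasDerivAt (fun _ : ℝ => x / ε) 0 y := hasDerivAt_const y _
  have h2 := (hasDerivAt_ev ε hs ht Q).mul (hasDerivAt_gaussian κ ε hs ht)
  rw [h.unique h2]
  simp only [wave, map_sub, map_add, map_mul, ev_C, ev_zeta, ev_X0, ev_X2, pt_zero, pt_one]
  push_cast
  ring

/-- The components `i h ∂₀ + y` and `i h ∂₁` of the magnetic momentum for the potential `y dx`. -/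
def momentum (h : ℝ) (i : Fin 2) (f : Plane → ℂ) (z : Plane) : ℂ :=
  Complex.I * h * pd i f z + (if i = 0 then (z 1 : ℂ) else 0) * f z

/-- The rescaled momentum on polynomials. -/
def polyMomentum (κ : ℝ) (i : Fin 2) : Module.End ℂ ScaledPoly :=
  if i = 0 then (model κ).p₁ else (model κ).p₂

lemma momentum_wave (κ : ℝ) {ε : ℝ} (hε : ε ≠ 0) (i : Fin 2) (Q : ScaledPoly) (z : Plane) :
    momentum (ε ^ 4) i (wave κ ε Q) z = (ε : ℂ) ^ 2 * wave κ ε (polyMomentum κ i Q) z := by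
  have hε' : (ε : ℂ) ≠ 0 := by exact_mod_cast hε
  fin_cases i
  · simp only [momentum, polyMomentum, Fin.zero_eta, if_true, pd_zero_wave, WeylModel.p₁_apply]
    simp only [model, raise_apply, wave, map_add, map_sub, map_mul, ev_X2, ev_X0, ev_C]
    push_cast
    field_simp
    ring
  · simp only [momentum, polyMomentum, Fin.mk_one, one_ne_zero, if_false, pd_one_wave,
      WeylModel.p₂_apply]
    have : Complex.I • (lower Q - raise κ Q)
        = C Complex.I * (pderiv 2 Q - X 2 * Q + C (Complex.I * κ) * (X 0 * (zeta * Q))) := by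
      simp only [raise_apply, lower_apply, delta_apply, ← MvPolynomial.C_mul', map_mul]
      linear_combination (C Complex.I * pderiv 2 Q + C Complex.I * C Complex.I * X 0 * pderiv 1 Q)
        * C_half_add
    simp only [model, this, wave, map_add, map_sub, map_mul, ev_X2, ev_X0, ev_C]
    push_cast
    field_simp
    ring

/-- The function `g₀ + g₁(x) y + g₂(x) y² + g₃ y³`. -/
def realJet (g₀ : ℝ) (g₁ g₂ : Polynomial ℝ) (g₃ : ℝ) (z : Plane) : ℝ :=
  g₀ + g₁.eval (z 0) * z 1 + g₂.eval (z 0) * z 1 ^ 2 + g₃ * z 1 ^ 3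

/-- A real polynomial as a complex polynomial. -/
abbrev cpoly (p : Polynomial ℝ) : Polynomial ℂ := p.map (algebraMap ℝ ℂ)

lemma eval_cpoly (p : Polynomial ℝ) (x : ℝ) : (cpoly p).eval (x : ℂ) = (p.eval x : ℝ) := by
  rw [cpoly, Polynomial.eval_map_algebraMap]
  simpa using Polynomial.aeval_algebraMap_apply ℂ x p

lemma contDiff_eval_coord (p : Polynomial ℝ) (i : Fin 2) :
    ContDiff ℝ ∞ fun z : Plane => p.eval (z i) := by
  have h : ContDiff ℝ ∞ fun x : ℝ => p.eval x := by simpa using p.contDiff_aeval (𝕜 := ℝ) ∞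
  exact h.comp (contDiff_coord i)

lemma contDiff_realJet (g₀ : ℝ) (g₁ g₂ : Polynomial ℝ) (g₃ : ℝ) :
    ContDiff ℝ ∞ (realJet g₀ g₁ g₂ g₃) :=
  ((contDiff_const.add ((contDiff_eval_coord g₁ 0).mul (contDiff_coord 1))).add
    ((contDiff_eval_coord g₂ 0).mul ((contDiff_coord 1).pow 2))).add
    (contDiff_const.mul ((contDiff_coord 1).pow 3))

lemma wave_entry (κ : ℝ) {ε : ℝ} (hε : ε ≠ 0) (g₀ : ℝ) (g₁ g₂ : Polynomial ℝ) (g₃ : ℝ)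
    (Q : ScaledPoly) (z : Plane) :
    wave κ ε ((model κ).entry g₀ (cpoly g₁) (cpoly g₂) g₃ Q) z
      = (realJet g₀ g₁ g₂ g₃ z : ℂ) * wave κ ε Q z := by
  rw [wave, ev_entry, mul_div_cancel₀ _ hε, mul_div_cancel₀ _ (pow_ne_zero 2 hε), jet, eval_cpoly,
    eval_cpoly, wave, realJet]
  push_cast
  ring

end Waves

section Momentum

lemma contDiff_ofReal {f : Plane → ℝ} (hf : ContDiff ℝ ∞ f) : ContDiff ℝ ∞ fun z => (f z : ℂ) :=
  Complex.ofRealCLM.contDiff.comp hf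

lemma contDiff_momentum {f : Plane → ℂ} (hf : ContDiff ℝ ∞ f) (h : ℝ) (i : Fin 2) :
    ContDiff ℝ ∞ (momentum h i f) := by
  refine (contDiff_const.mul (hf.pd i)).add (ContDiff.mul ?_ hf)
  split_ifs
  · exact contDiff_ofReal (contDiff_coord 1)
  · exact contDiff_const

lemma momentum_add {f g : Plane → ℂ} (hf : ContDiff ℝ ∞ f) (hg : ContDiff ℝ ∞ g) (h : ℝ) (i : Fin 2)
    (z : Plane) : momentum h i (fun w => f w + g w) z = momentum h i f z + momentum h i g z := by
  rw [momentum, pd_add (hf.diffAt_top z) (hg.diffAt_top z), momentum, momentum]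
  ring

lemma momentum_const_mul {f : Plane → ℂ} (hf : ContDiff ℝ ∞ f) (c : ℂ) (h : ℝ) (i : Fin 2)
    (z : Plane) : momentum h i (fun w => c * f w) z = c * momentum h i f z := by
  rw [momentum, pd_mul (differentiableAt_const c) (hf.diffAt_top z), pd_const, momentum]
  ring

lemma momentum_ofReal_mul {f : Plane → ℝ} {g : Plane → ℂ} (hf : ContDiff ℝ ∞ f)
    (hg : ContDiff ℝ ∞ g) (h : ℝ) (i : Fin 2) (z : Plane) :
    momentum h i (fun w => (f w : ℂ) * g w) z
      = f z * momentum h i g z + Complex.I * h * (pd i f z * g z) := by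
  rw [momentum, pd_mul ((contDiff_ofReal hf).diffAt_top z) (hg.diffAt_top z),
    pd_ofReal (hf.diffAt_top z), momentum]
  ring

/-- The operator `∑ Pᵢ Gᵢⱼ Pⱼ`. -/
def magneticOp (h : ℝ) (G : Fin 2 → Fin 2 → Plane → ℝ) (u : Plane → ℂ) (z : Plane) : ℂ :=
  ∑ i, ∑ j, momentum h i (fun w => (G i j w : ℂ) * momentum h j u w) z

/-- Cutting off and replacing a coefficient produces terms with small coefficients. -/
lemma momentum_mul_momentum_cutoff {χ g p : Plane → ℝ} {w : Plane → ℂ} (hχ : ContDiff ℝ ∞ χ)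
    (hg : ContDiff ℝ ∞ g) (hp : ContDiff ℝ ∞ p) (hw : ContDiff ℝ ∞ w) (h : ℝ) (i j : Fin 2)
    (z : Plane) :
    momentum h i (fun z => (g z : ℂ) * momentum h j (fun z => (χ z : ℂ) * w z) z) z
      = χ z * momentum h i (fun z => (p z : ℂ) * momentum h j w z) z
        + (χ z * (g z - p z) : ℝ) * momentum h i (momentum h j w) z
        + Complex.I * h * ((pd i (fun z => χ z * (g z - p z)) z : ℝ) * momentum h j w z)
        + Complex.I * h * ((pd i χ z * p z : ℝ) * momentum h j w z)
        + Complex.I * h * ((g z * pd j χ z : ℝ) * momentum h i w z)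
        + (Complex.I * h) ^ 2 * ((pd i (fun z => g z * pd j χ z) z : ℝ) * w z) := by
  have hm := contDiff_momentum hw h j
  have e1 : (fun z => (g z : ℂ) * momentum h j (fun z => (χ z : ℂ) * w z) z)
      = fun z => (((χ z * p z : ℝ) : ℂ) * momentum h j w z
        + ((χ z * (g z - p z) : ℝ) : ℂ) * momentum h j w z)
        + (Complex.I * h) * (((g z * pd j χ z : ℝ) : ℂ) * w z) := by
    funext z
    rw [momentum_ofReal_mul hχ hw]
    push_cast
    ring
  have c1 := hχ.mul hp
  have c2 := hχ.mul (hg.sub hp)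
  have c3 := hg.mul (hχ.pd j)
  have d1 := (contDiff_ofReal c1).mul hm
  have d2 := (contDiff_ofReal c2).mul hm
  have d3 := (contDiff_ofReal c3).mul hw
  rw [e1, momentum_add (d1.add d2) (contDiff_const.mul d3), momentum_add d1 d2,
    momentum_const_mul d3, momentum_ofReal_mul c1 hm, momentum_ofReal_mul c2 hm,
    momentum_ofReal_mul c3 hw, momentum_ofReal_mul hp hm,
    pd_mul (hχ.diffAt_top z) (hp.diffAt_top z)]
  push_cast
  ring

end Momentum

section Envelope

open ScaledPoly

/-- The Gaussian weight `exp (-a (σ² + τ²))`. -/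
def envelope (a ε : ℝ) (z : Plane) : ℝ := Real.exp (-a * ((z 0 / ε) ^ 2 + (z 1 / ε ^ 2) ^ 2))

def decayRate (κ : ℝ) : ℝ := min (1 / 8) (κ / 4)

lemma decayRate_pos {κ : ℝ} (hκ : 0 < κ) : 0 < decayRate κ := by unfold decayRate; positivity

/-- The admissible values of the semiclassical parameter. -/
def smallScales (κ : ℝ) : Set ℝ := {ε | 0 < ε ∧ ε ≤ 1 ∧ κ * ε ^ 2 ≤ 1 / 2}

lemma norm_gaussian (κ ε σ τ : ℝ) :
    ‖gaussian κ ε σ τ‖ = Real.exp (-(τ ^ 2 / 2) - κ * (σ ^ 2 - ε ^ 2 * τ ^ 2) / 2) := by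
  rw [gaussian, Complex.norm_exp]
  congr 1
  have : (-((τ : ℂ) ^ 2 / 2) - κ * ((σ : ℂ) - Complex.I * ε * τ) ^ 2 / 2)
      = ((-(τ ^ 2 / 2) - κ * (σ ^ 2 - ε ^ 2 * τ ^ 2) / 2 : ℝ) : ℂ)
        + ((κ * σ * ε * τ : ℝ) : ℂ) * Complex.I := by
    push_cast
    linear_combination (-(κ : ℂ) * ε ^ 2 * τ ^ 2 / 2) * Complex.I_sq
  rw [this, Complex.add_re, Complex.ofReal_re, Complex.re_ofReal_mul, Complex.I_re]
  ring

lemma norm_gaussian_le {κ ε : ℝ} (hε : ε ∈ smallScales κ) (σ τ : ℝ) :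
    ‖gaussian κ ε σ τ‖ ≤ Real.exp (-(2 * decayRate κ) * (σ ^ 2 + τ ^ 2)) := by
  rw [norm_gaussian]
  apply Real.exp_le_exp.2
  have h1 : decayRate κ ≤ 1 / 8 := min_le_left _ _
  have h2 : decayRate κ ≤ κ / 4 := min_le_right _ _
  have := hε.2.2
  nlinarith [sq_nonneg σ, sq_nonneg τ, mul_le_mul_of_nonneg_right this (sq_nonneg τ),
    mul_le_mul_of_nonneg_right h1 (sq_nonneg τ), mul_le_mul_of_nonneg_right h2 (sq_nonneg σ)]

lemma exists_pow_mul_exp_le {a : ℝ} (ha : 0 < a) (n : ℕ) : ∃ C, 0 ≤ C ∧ ∀ σ τ : ℝ,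
    (1 + |σ| + |τ|) ^ n * Real.exp (-(2 * a) * (σ ^ 2 + τ ^ 2))
      ≤ C * Real.exp (-a * (σ ^ 2 + τ ^ 2)) := by
  refine ⟨Real.exp (n ^ 2 / (2 * a)), by positivity, fun σ τ => ?_⟩
  set s := |σ| + |τ|
  have h1 : (1 + |σ| + |τ|) ^ n ≤ Real.exp (n * s) := by
    rw [Real.exp_nat_mul]
    have : 1 + |σ| + |τ| ≤ Real.exp s := by
      have := Real.add_one_le_exp s
      simp only [s] at this ⊢; linarith
    gcongr
  have hs : s ^ 2 ≤ 2 * (σ ^ 2 + τ ^ 2) := by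
    have e1 := sq_abs σ
    have e2 := sq_abs τ
    nlinarith [sq_nonneg (|σ| - |τ|)]
  have h2 : n * s ≤ a / 2 * s ^ 2 + n ^ 2 / (2 * a) := by
    have : a / 2 * s ^ 2 + n ^ 2 / (2 * a) - n * s = (a * s - n) ^ 2 / (2 * a) := by
      field_simp; ring
    have : 0 ≤ (a * s - n) ^ 2 / (2 * a) := by positivity
    linarith
  refine (mul_le_mul_of_nonneg_right h1 (Real.exp_pos _).le).trans ?_
  rw [← Real.exp_add, ← Real.exp_add]
  apply Real.exp_le_exp.2
  nlinarith

/-- A family of functions on the plane bounded by `C εⁿ exp (-a (σ² + τ²))`. -/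
def IsSmall (κ : ℝ) (n : ℕ) (F : ℝ → Plane → ℂ) : Prop :=
  ∃ C, 0 ≤ C ∧ ∀ ε ∈ smallScales κ, ∀ z, ‖F ε z‖ ≤ C * ε ^ n * envelope (decayRate κ) ε z

lemma envelope_pos (a ε : ℝ) (z : Plane) : 0 < envelope a ε z := Real.exp_pos _

lemma IsSmall.add {κ : ℝ} {n : ℕ} {F G : ℝ → Plane → ℂ} (hF : IsSmall κ n F) (hG : IsSmall κ n G) :
    IsSmall κ n fun ε z => F ε z + G ε z := by
  obtain ⟨C, hC, H⟩ := hF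
  obtain ⟨D, hD, K⟩ := hG
  exact ⟨C + D, by positivity, fun ε hε z => (norm_add_le _ _).trans
    ((add_le_add (H ε hε z) (K ε hε z)).trans_eq (by ring))⟩

lemma IsSmall.sum {κ : ℝ} {n : ℕ} {F : Fin 2 → ℝ → Plane → ℂ} (hF : ∀ i, IsSmall κ n (F i)) :
    IsSmall κ n fun ε z => ∑ i, F i ε z := by
  simp only [Fin.sum_univ_two]
  exact (hF 0).add (hF 1)

lemma IsSmall.const_mul {κ : ℝ} {n m N : ℕ} {F : ℝ → Plane → ℂ} (hF : IsSmall κ n F) {c : ℝ → ℂ}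
    {K : ℝ} (hK : 0 ≤ K) (hc : ∀ ε ∈ smallScales κ, ‖c ε‖ ≤ K * ε ^ m) (hN : N ≤ m + n) :
    IsSmall κ N fun ε z => c ε * F ε z := by
  obtain ⟨C, hC, H⟩ := hF
  refine ⟨K * C, by positivity, fun ε hε z => ?_⟩
  rw [norm_mul]
  have h0 := hε.1.le
  have e0 := (envelope_pos (decayRate κ) ε z).le
  calc ‖c ε‖ * ‖F ε z‖ ≤ (K * ε ^ m) * (C * ε ^ n * envelope (decayRate κ) ε z) :=
        mul_le_mul (hc ε hε) (H ε hε z) (norm_nonneg _) (by positivity)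
    _ = K * C * ε ^ (m + n) * envelope (decayRate κ) ε z := by ring
    _ ≤ _ := by
      have : ε ^ (m + n) ≤ ε ^ N := pow_le_pow_of_le_one h0 hε.2.1 hN
      gcongr

lemma wnorm_eq {ε : ℝ} (hε : 0 < ε) (z : Plane) :
    wnorm z = ε * (|z 0 / ε| + √|z 1 / ε ^ 2|) := by
  have : √|z 1 / ε ^ 2| = √|z 1| / ε := by
    rw [abs_div, abs_of_pos (by positivity : 0 < ε ^ 2), Real.sqrt_div (abs_nonneg _),
      Real.sqrt_sq hε.le]
  rw [this, abs_div, abs_of_pos hε, wnorm]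
  field_simp

/-- A coefficient that vanishes to weighted order `n` contributes a factor `εⁿ`. -/
lemma isSmall_flat_mul_wave {κ : ℝ} (hκ : 0 < κ) {n : ℕ} {f : Plane → ℝ} (hf : ContDiff ℝ ∞ f)
    (hn : Flat n f) (h0 : ∀ z ∉ unitBox, f z = 0) (Q : ScaledPoly) :
    IsSmall κ n fun ε z => (f z : ℂ) * wave κ ε Q z := by
  obtain ⟨C₁, hC₁, H₁⟩ := hn.exists_abs_le hf
  obtain ⟨C₂, hC₂, N, H₂⟩ := norm_ev_le Q
  obtain ⟨C₃, hC₃, H₃⟩ := exists_pow_mul_exp_le (decayRate_pos hκ) (n + N)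
  refine ⟨C₁ * C₂ * C₃, by positivity, fun ε hε z => ?_⟩
  have hε0 := hε.1
  have e0 := (envelope_pos (decayRate κ) ε z).le
  by_cases hz : z ∈ unitBox
  · rw [norm_mul, wave, norm_mul, Complex.norm_real, Real.norm_eq_abs]
    set σ := z 0 / ε
    set τ := z 1 / ε ^ 2
    have hw : wnorm z ≤ ε * (1 + |σ| + |τ|) := by
      rw [wnorm_eq hε0]
      have : √|τ| ≤ 1 + |τ| := by
        rw [Real.sqrt_le_left (by positivity)]
        nlinarith [abs_nonneg τ]
      have h3 := mul_le_mul_of_nonneg_left this hε0.le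
      simp only [σ, τ] at h3 ⊢
      linarith
    have b1 : |f z| ≤ C₁ * (ε * (1 + |σ| + |τ|)) ^ n := (H₁ z hz).trans (by
      have := wnorm_nonneg z
      gcongr)
    have b2 := H₂ ε ⟨hε0.le, hε.2.1⟩ σ τ
    have b3 := norm_gaussian_le hε σ τ
    calc |f z| * (‖ev ε σ τ Q‖ * ‖gaussian κ ε σ τ‖)
        ≤ (C₁ * (ε * (1 + |σ| + |τ|)) ^ n) * ((C₂ * (1 + |σ| + |τ|) ^ N)
          * Real.exp (-(2 * decayRate κ) * (σ ^ 2 + τ ^ 2))) := by gcongr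
      _ = C₁ * C₂ * ε ^ n * ((1 + |σ| + |τ|) ^ (n + N)
          * Real.exp (-(2 * decayRate κ) * (σ ^ 2 + τ ^ 2))) := by rw [mul_pow, pow_add]; ring
      _ ≤ C₁ * C₂ * ε ^ n * (C₃ * Real.exp (-decayRate κ * (σ ^ 2 + τ ^ 2))) := by
        exact mul_le_mul_of_nonneg_left (H₃ σ τ) (by positivity)
      _ = _ := by rw [envelope]; ring
  · simp only [h0 z hz, Complex.ofReal_zero, zero_mul, norm_zero]
    have := hε0.le
    positivity

lemma pd_eq_zero_of_notMem {f : Plane → ℝ} (h0 : ∀ z ∉ unitBox, f z = 0) (i : Fin 2) :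
    ∀ z ∉ unitBox, pd i f z = 0 := by
  intro z hz
  have : f =ᶠ[𝓝 z] fun _ => 0 :=
    Filter.mem_of_superset (isCompact_unitBox.isClosed.isOpen_compl.mem_nhds hz) fun w hw => h0 w hw
  rw [pd_congr this, pd_const]

/-- The residual of a cut-off wave whose polynomial solves the formal eigenvalue equation. -/
theorem isSmall_residual {κ : ℝ} (hκ : 0 < κ) {G J : Fin 2 → Fin 2 → Plane → ℝ} {β Jβ χ : Plane → ℝ}
    (hG : ∀ i j, ContDiff ℝ ∞ (G i j)) (hJ : ∀ i j, ContDiff ℝ ∞ (J i j)) (hβ : ContDiff ℝ ∞ β)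
    (hJβ : ContDiff ℝ ∞ Jβ) (hGJ : ∀ i j, Flat 7 fun z => G i j z - J i j z)
    (hβJ : Flat 7 fun z => β z - Jβ z) (hχ : ContDiff ℝ ∞ χ) (hχ1 : ∀ᶠ z in 𝓝 0, χ z = 1)
    (hχ0 : ∀ z ∉ unitBox, χ z = 0) {E : Fin 2 → Fin 2 → Module.End ℂ ScaledPoly}
    {Eβ : Module.End ℂ ScaledPoly}
    (hE : ∀ i j, ∀ ε ≠ 0, ∀ Q z, wave κ ε (E i j Q) z = J i j z * wave κ ε Q z)
    (hEβ : ∀ ε ≠ 0, ∀ Q z, wave κ ε (Eβ Q) z = Jβ z * wave κ ε Q z)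
    {m₀ m₄ m₆ : ℝ} {Q r : ScaledPoly}
    (hQ : ∑ i, ∑ j, polyMomentum κ i (E i j (polyMomentum κ j Q))
      - (m₀ • Eβ Q + m₄ • (MvPolynomial.X 0 ^ 4 * Eβ Q) + m₆ • (MvPolynomial.X 0 ^ 6 * Eβ Q))
      = MvPolynomial.X 0 ^ 7 * r) :
    IsSmall κ 11 fun ε z => magneticOp (ε ^ 4) G (fun w => (χ w : ℂ) * wave κ ε Q w) z
      - (m₀ * ε ^ 4 + m₄ * ε ^ 8 + m₆ * ε ^ 10 : ℝ) * (β z * (χ z * wave κ ε Q z)) := by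
  have hone : ∀ i, pd i χ =ᶠ[𝓝 0] fun _ => 0 := by
    intro i
    have h1 : χ =ᶠ[𝓝 0] fun _ => 1 := hχ1
    refine h1.eventuallyEq_nhds.mono fun z hz => ?_
    rw [pd_congr hz, pd_const]
  have sm : ∀ n {f : Plane → ℝ}, ContDiff ℝ ∞ f → (∀ z ∉ unitBox, f z = 0) →
      f =ᶠ[𝓝 0] (fun _ => 0) → ∀ Q, IsSmall κ n fun ε z => (f z : ℂ) * wave κ ε Q z :=
    fun n f hf h0 h Q => isSmall_flat_mul_wave hκ hf ((flat_zero n).congr h.symm) h0 Q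
  have flatχ : ∀ {n} {f : Plane → ℝ}, Flat n f → Flat n fun z => χ z * f z := by
    intro n f hf
    exact hf.congr (hχ1.mono fun z hz => by simp [hz])
  have hmw : ∀ ε ∈ smallScales κ, ∀ i Q, momentum (ε ^ 4) i (wave κ ε Q)
      = fun z => (ε : ℂ) ^ 2 * wave κ ε (polyMomentum κ i Q) z := fun ε hε i Q =>
    funext fun z => momentum_wave κ hε.1.ne' i Q z
  have key : ∀ ε ∈ smallScales κ, ∀ z, magneticOp (ε ^ 4) G (fun w => (χ w : ℂ) * wave κ ε Q w) z
      - (m₀ * ε ^ 4 + m₄ * ε ^ 8 + m₆ * ε ^ 10 : ℝ) * (β z * (χ z * wave κ ε Q z))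
      = (ε : ℂ) ^ 11 * (χ z * wave κ ε r z)
        + (-(m₀ * ε ^ 4 + m₄ * ε ^ 8 + m₆ * ε ^ 10 : ℝ)) *
          ((χ z * (β z - Jβ z) : ℝ) * wave κ ε Q z)
        + ∑ i, ∑ j, ((ε : ℂ) ^ 4 * ((χ z * (G i j z - J i j z) : ℝ)
            * wave κ ε (polyMomentum κ i (polyMomentum κ j Q)) z)
          + (Complex.I * (ε ^ 4 * ε ^ 2)) * ((pd i (fun z => χ z * (G i j z - J i j z)) z : ℝ)
            * wave κ ε (polyMomentum κ j Q) z)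
          + (Complex.I * (ε ^ 4 * ε ^ 2)) * ((pd i χ z * J i j z : ℝ)
            * wave κ ε (polyMomentum κ j Q) z)
          + (Complex.I * (ε ^ 4 * ε ^ 2)) * ((G i j z * pd j χ z : ℝ)
            * wave κ ε (polyMomentum κ i Q) z)
          + ((Complex.I * ε ^ 4) ^ 2) * ((pd i (fun z => G i j z * pd j χ z) z : ℝ)
            * wave κ ε Q z)) := by
    intro ε hε z
    have hpoly : ∀ i j, momentum (ε ^ 4) i (fun z => (J i j z : ℂ) *
        momentum (ε ^ 4) j (wave κ ε Q) z) z
        = (ε : ℂ) ^ 4 * wave κ ε (polyMomentum κ i (E i j (polyMomentum κ j Q))) z := by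
      intro i j
      have : (fun z => (J i j z : ℂ) * momentum (ε ^ 4) j (wave κ ε Q) z)
          = fun z => (ε : ℂ) ^ 2 * wave κ ε (E i j (polyMomentum κ j Q)) z := by
        funext z
        rw [hmw ε hε, hE i j ε hε.1.ne']
        ring
      rw [this, momentum_const_mul (contDiff_wave κ ε _), hmw ε hε]
      ring
    have hterm : ∀ i j, momentum (ε ^ 4) i (fun w => (G i j w : ℂ)
        * momentum (ε ^ 4) j (fun w => (χ w : ℂ) * wave κ ε Q w) w) z
        = χ z * ((ε : ℂ) ^ 4 * wave κ ε (polyMomentum κ i (E i j (polyMomentum κ j Q))) z)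
          + ((ε : ℂ) ^ 4 * ((χ z * (G i j z - J i j z) : ℝ)
            * wave κ ε (polyMomentum κ i (polyMomentum κ j Q)) z)
          + (Complex.I * (ε ^ 4 * ε ^ 2)) * ((pd i (fun z => χ z * (G i j z - J i j z)) z : ℝ)
            * wave κ ε (polyMomentum κ j Q) z)
          + (Complex.I * (ε ^ 4 * ε ^ 2)) * ((pd i χ z * J i j z : ℝ)
            * wave κ ε (polyMomentum κ j Q) z)
          + (Complex.I * (ε ^ 4 * ε ^ 2)) * ((G i j z * pd j χ z : ℝ)
            * wave κ ε (polyMomentum κ i Q) z)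
          + ((Complex.I * ε ^ 4) ^ 2) * ((pd i (fun z => G i j z * pd j χ z) z : ℝ)
            * wave κ ε Q z)) := by
      intro i j
      rw [momentum_mul_momentum_cutoff hχ (hG i j) (hJ i j) (contDiff_wave κ ε Q), hpoly]
      simp only [hmw ε hε, momentum_const_mul (contDiff_wave κ ε _)]
      push_cast
      ring
    have hQw := congrArg (fun P => wave κ ε P z) hQ
    simp only [Fin.sum_univ_two, wave_sub, wave_add, wave_pow_mul, ← Complex.coe_smul, wave_smul,
      hEβ ε hε.1.ne'] at hQw
    simp only [magneticOp, hterm, Fin.sum_univ_two]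
    push_cast
    linear_combination (χ z * (ε : ℂ) ^ 4) * hQw
  have hs : IsSmall κ 11 fun ε z => (ε : ℂ) ^ 11 * (χ z * wave κ ε r z)
        + (-(m₀ * ε ^ 4 + m₄ * ε ^ 8 + m₆ * ε ^ 10 : ℝ)) *
          ((χ z * (β z - Jβ z) : ℝ) * wave κ ε Q z)
        + ∑ i, ∑ j, ((ε : ℂ) ^ 4 * ((χ z * (G i j z - J i j z) : ℝ)
            * wave κ ε (polyMomentum κ i (polyMomentum κ j Q)) z)
          + (Complex.I * (ε ^ 4 * ε ^ 2)) * ((pd i (fun z => χ z * (G i j z - J i j z)) z : ℝ)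
            * wave κ ε (polyMomentum κ j Q) z)
          + (Complex.I * (ε ^ 4 * ε ^ 2)) * ((pd i χ z * J i j z : ℝ)
            * wave κ ε (polyMomentum κ j Q) z)
          + (Complex.I * (ε ^ 4 * ε ^ 2)) * ((G i j z * pd j χ z : ℝ)
            * wave κ ε (polyMomentum κ i Q) z)
          + ((Complex.I * ε ^ 4) ^ 2) * ((pd i (fun z => G i j z * pd j χ z) z : ℝ)
            * wave κ ε Q z)) := by
    have hI6 : ∀ ε ∈ smallScales κ, ‖Complex.I * ((ε : ℂ) ^ 4 * ε ^ 2)‖ ≤ 1 * ε ^ 6 := by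
      intro ε hε
      simp [abs_of_pos hε.1, ← pow_add]
    have hI8 : ∀ ε ∈ smallScales κ, ‖(Complex.I * (ε : ℂ) ^ 4) ^ 2‖ ≤ 1 * ε ^ 8 := by
      intro ε hε
      simp [abs_of_pos hε.1, mul_pow, ← pow_mul]
    have hp : ∀ n, ∀ ε ∈ smallScales κ, ‖(ε : ℂ) ^ n‖ ≤ 1 * ε ^ n := by
      intro n ε hε
      simp [abs_of_pos hε.1]
    have hz : ∀ {f g : Plane → ℝ}, (∀ z ∉ unitBox, f z = 0) → ∀ z ∉ unitBox, f z * g z = 0 :=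
      fun h z hz => by rw [h z hz, zero_mul]
    refine IsSmall.add (IsSmall.add ?_ ?_) (IsSmall.sum fun i => IsSmall.sum fun j =>
      IsSmall.add (IsSmall.add (IsSmall.add (IsSmall.add ?_ ?_) ?_) ?_) ?_)
    · exact (isSmall_flat_mul_wave (n := 0) hκ hχ trivial hχ0 r).const_mul zero_le_one (hp 11)
        (by norm_num)
    · refine (isSmall_flat_mul_wave hκ (hχ.mul (hβ.sub hJβ)) (flatχ hβJ) (hz hχ0) Q).const_mul
        (m := 4) (K := |m₀| + |m₄| + |m₆|) (by positivity) (fun ε hε => ?_) (by norm_num)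
      have h0 := hε.1.le
      rw [norm_neg, Complex.norm_real, Real.norm_eq_abs]
      have e8 : ε ^ 8 ≤ ε ^ 4 := pow_le_pow_of_le_one h0 hε.2.1 (by norm_num)
      have e10 : ε ^ 10 ≤ ε ^ 4 := pow_le_pow_of_le_one h0 hε.2.1 (by norm_num)
      calc |m₀ * ε ^ 4 + m₄ * ε ^ 8 + m₆ * ε ^ 10|
          ≤ |m₀ * ε ^ 4| + |m₄ * ε ^ 8| + |m₆ * ε ^ 10| := abs_add_three _ _ _
        _ = |m₀| * ε ^ 4 + |m₄| * ε ^ 8 + |m₆| * ε ^ 10 := by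
          simp only [abs_mul, abs_pow, abs_of_nonneg h0]
        _ ≤ |m₀| * ε ^ 4 + |m₄| * ε ^ 4 + |m₆| * ε ^ 4 := by gcongr
        _ = _ := by ring
    · exact (isSmall_flat_mul_wave hκ (hχ.mul ((hG i j).sub (hJ i j))) (flatχ (hGJ i j)) (hz hχ0)
        _).const_mul zero_le_one (hp 4) (by norm_num)
    · exact (isSmall_flat_mul_wave hκ ((hχ.mul ((hG i j).sub (hJ i j))).pd i)
        ((flatχ (hGJ i j)).partial i) (pd_eq_zero_of_notMem (hz hχ0) i)
        _).const_mul zero_le_one hI6 (by norm_num)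
    · exact (sm 11 ((hχ.pd i).mul (hJ i j)) (hz (pd_eq_zero_of_notMem hχ0 i))
        ((hone i).mono fun z hz => by simp [hz]) _).const_mul zero_le_one hI6 (by norm_num)
    · exact (sm 11 ((hG i j).mul (hχ.pd j))
        (fun z hz => by simp [pd_eq_zero_of_notMem hχ0 j z hz])
        ((hone j).mono fun z hz => by simp [hz]) _).const_mul zero_le_one hI6 (by norm_num)
    · refine (sm 11 (((hG i j).mul (hχ.pd j)).pd i)
        (pd_eq_zero_of_notMem (fun z hz => by simp [pd_eq_zero_of_notMem hχ0 j z hz]) i)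
        ?_ _).const_mul zero_le_one hI8 (by norm_num)
      have : (fun z => G i j z * pd j χ z) =ᶠ[𝓝 0] fun _ => 0 := (hone j).mono fun z hz => by simp [hz]
      exact this.eventuallyEq_nhds.mono fun z hz => by rw [pd_congr hz, pd_const]
  obtain ⟨C, hC, H⟩ := hs
  exact ⟨C, hC, fun ε hε z => (congrArg norm (key ε hε z)).trans_le (H ε hε z)⟩

end Envelope

section Scaling

open ScaledPoly

/-- The anisotropic dilation `(σ, τ) ↦ (ε σ, ε² τ)`. -/
def dilation (ε : ℝ) (z : Plane) : Plane := pt (ε * z 0) (ε ^ 2 * z 1)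

lemma integral_comp_dilation {ε : ℝ} (hε : 0 < ε) (f : Plane → ℝ) :
    ∫ z, f z = ε ^ 3 * ∫ z, f (dilation ε z) := by
  let b := (EuclideanSpace.basisFun (Fin 2) ℝ).toBasis
  let L : Plane →ₗ[ℝ] Plane := Matrix.toLin b b (Matrix.diagonal ![ε, ε ^ 2])
  have hL : ∀ z, L z = dilation ε z := by
    intro z
    ext i
    have : L z = ∑ j, ((Matrix.diagonal ![ε, ε ^ 2]).mulVec (b.repr z)) j • b j :=
      Matrix.toLin_apply b b _ z
    rw [this]
    fin_cases i <;>
      simp [b, dilation, pt, Matrix.mulVec_diagonal, Fin.sum_univ_two]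
  have hdet : LinearMap.det L = ε ^ 3 := by
    rw [LinearMap.det_toLin, Matrix.det_diagonal]
    simp [Fin.prod_univ_two]; ring
  have hdet0 : LinearMap.det L ≠ 0 := by rw [hdet]; positivity
  have hmap := Measure.map_linearMap_addHaar_eq_smul_addHaar (volume : Measure Plane) hdet0
  have hemb : MeasurableEmbedding L :=
    ((LinearEquiv.ofIsUnitDet (f := L) (v := b) (v' := b) (by
      rw [LinearMap.det_toMatrix]; exact isUnit_iff_ne_zero.2 hdet0)).toContinuousLinearEquiv.toHomeomorph).measurableEmbedding
  have h := hemb.integral_map (μ := (volume : Measure Plane)) f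
  rw [hmap, integral_smul_measure, hdet] at h
  simp only [hL] at h
  rw [← h, ENNReal.toReal_ofReal (abs_nonneg _), abs_of_pos (by positivity), smul_eq_mul,
    mul_inv_cancel_left₀ (by positivity)]

lemma dilation_apply_zero (ε : ℝ) (z : Plane) : dilation ε z 0 = ε * z 0 := rfl
lemma dilation_apply_one (ε : ℝ) (z : Plane) : dilation ε z 1 = ε ^ 2 * z 1 := rfl

lemma norm_sq_plane (z : Plane) : ‖z‖ ^ 2 = z 0 ^ 2 + z 1 ^ 2 := by
  rw [EuclideanSpace.norm_sq_eq]; simp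

lemma integrable_exp_neg_mul_norm_sq {a : ℝ} (ha : 0 < a) :
    Integrable fun z : Plane => Real.exp (-a * (z 0 ^ 2 + z 1 ^ 2)) := by
  have h := (GaussianFourier.integrable_cexp_neg_mul_sq_norm_add (V := Plane) (b := (a : ℂ))
    (by simpa using ha) 0 0).norm
  refine h.congr (ae_of_all _ fun z => ?_)
  simp only [Complex.norm_exp]
  rw [← norm_sq_plane]
  simp [← Complex.ofReal_pow]

lemma integrable_envelope {a ε : ℝ} (ha : 0 < a) (hε : 0 < ε) : Integrable (envelope a ε) := by
  have hc : Continuous (envelope a ε) := by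
    unfold envelope
    have h0 : Continuous fun z : Plane => z 0 := (contDiff_coord 0).continuous
    have h1 : Continuous fun z : Plane => z 1 := (contDiff_coord 1).continuous
    fun_prop
  by_cases hε1 : ε ≤ 1
  · refine (integrable_exp_neg_mul_norm_sq ha).mono' hc.aestronglyMeasurable (ae_of_all _ fun z => ?_)
    rw [Real.norm_of_nonneg (envelope_pos a ε z).le, envelope]
    apply Real.exp_le_exp.2
    have e1 : z 0 ^ 2 ≤ (z 0 / ε) ^ 2 := by
      rw [div_pow]; exact le_div_self (sq_nonneg _) (by positivity) (pow_le_one₀ hε.le hε1)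
    have e2 : z 1 ^ 2 ≤ (z 1 / ε ^ 2) ^ 2 := by
      rw [div_pow]
      exact le_div_self (sq_nonneg _) (by positivity) (pow_le_one₀ (by positivity)
        (pow_le_one₀ hε.le hε1))
    nlinarith
  · have hε1 : 1 ≤ ε := (not_le.1 hε1).le
    have hpos : 0 < a / ε ^ 4 := by positivity
    refine (integrable_exp_neg_mul_norm_sq hpos).mono' hc.aestronglyMeasurable
      (ae_of_all _ fun z => ?_)
    rw [Real.norm_of_nonneg (envelope_pos a ε z).le, envelope]
    apply Real.exp_le_exp.2
    have e1 : z 0 ^ 2 / ε ^ 4 ≤ (z 0 / ε) ^ 2 := by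
      rw [div_pow]
      exact div_le_div_of_nonneg_left (sq_nonneg _) (by positivity)
        (pow_le_pow_right₀ hε1 (by norm_num))
    have e2 : z 1 ^ 2 / ε ^ 4 = (z 1 / ε ^ 2) ^ 2 := by rw [div_pow, ← pow_mul]
    have : -(a / ε ^ 4) * (z 0 ^ 2 + z 1 ^ 2) = -a * (z 0 ^ 2 / ε ^ 4 + z 1 ^ 2 / ε ^ 4) := by ring
    rw [this]
    nlinarith

lemma integral_envelope {a ε : ℝ} (hε : 0 < ε) :
    ∫ z, envelope a ε z = ε ^ 3 * ∫ z : Plane, Real.exp (-a * (z 0 ^ 2 + z 1 ^ 2)) := by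
  rw [integral_comp_dilation hε]
  simp only [envelope, dilation_apply_zero, dilation_apply_one, mul_div_cancel_left₀ _ hε.ne',
    mul_div_cancel_left₀ _ (pow_ne_zero 2 hε.ne')]

lemma IsSmall.exists_integral_le {κ : ℝ} (hκ : 0 < κ) {n : ℕ} {F : ℝ → Plane → ℂ}
    (hF : IsSmall κ n F) : ∃ C, 0 ≤ C ∧ ∀ ε ∈ smallScales κ, ∀ (w : Plane → ℝ) (B : ℝ),
      (∀ z, 0 ≤ w z) → (∀ z, w z ≤ B) →
      ∫ z, ‖F ε z‖ ^ 2 * w z ≤ C * B * ε ^ (2 * n) * ε ^ 3 := by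
  obtain ⟨C, hC, H⟩ := hF
  have ha := decayRate_pos hκ
  refine ⟨C ^ 2 * ∫ z : Plane, Real.exp (-(2 * decayRate κ) * (z 0 ^ 2 + z 1 ^ 2)), ?_, ?_⟩
  · have : 0 ≤ ∫ z : Plane, Real.exp (-(2 * decayRate κ) * (z 0 ^ 2 + z 1 ^ 2)) :=
      integral_nonneg fun z => (Real.exp_pos _).le
    positivity
  intro ε hε w B hw hB
  have hsq : ∀ z, envelope (decayRate κ) ε z ^ 2 = envelope (2 * decayRate κ) ε z := by
    intro z
    rw [envelope, envelope, ← Real.exp_nat_mul]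
    congr 1; push_cast; ring
  have h0 := hε.1.le
  calc ∫ z, ‖F ε z‖ ^ 2 * w z
      ≤ ∫ z, C ^ 2 * B * ε ^ (2 * n) * envelope (2 * decayRate κ) ε z := by
        refine integral_mono_of_nonneg (ae_of_all _ fun z => mul_nonneg (sq_nonneg _) (hw z))
          ((integrable_envelope (by positivity) hε.1).const_mul _) (ae_of_all _ fun z => ?_)
        have e0 := (envelope_pos (decayRate κ) ε z).le
        calc ‖F ε z‖ ^ 2 * w z ≤ (C * ε ^ n * envelope (decayRate κ) ε z) ^ 2 * B :=
              mul_le_mul (pow_le_pow_left₀ (norm_nonneg _) (H ε hε z) 2) (hB z) (hw z)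
                (by positivity)
          _ = C ^ 2 * B * ε ^ (2 * n) * envelope (decayRate κ) ε z ^ 2 := by ring
          _ = _ := by rw [hsq]
    _ = _ := by rw [integral_const_mul, integral_envelope hε.1]; ring

lemma continuous_ev (Q : ScaledPoly) :
    Continuous fun p : ℝ × Plane => ev p.1 (p.2 0) (p.2 1) Q := by
  have h0 : Continuous fun z : Plane => z 0 := (contDiff_coord 0).continuous
  have h1 : Continuous fun z : Plane => z 1 := (contDiff_coord 1).continuous
  refine (MvPolynomial.continuous_eval Q).comp (continuous_pi fun i => ?_)
  fin_cases i
  · exact Complex.continuous_ofReal.comp continuous_fst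
  · exact Complex.continuous_ofReal.comp (h0.comp continuous_snd)
  · exact Complex.continuous_ofReal.comp (h1.comp continuous_snd)

lemma continuous_gaussian (κ : ℝ) :
    Continuous fun p : ℝ × Plane => gaussian κ p.1 (p.2 0) (p.2 1) := by
  have h0 : Continuous fun z : Plane => z 0 := (contDiff_coord 0).continuous
  have h1 : Continuous fun z : Plane => z 1 := (contDiff_coord 1).continuous
  unfold gaussian
  fun_prop

lemma wave_dilation (κ : ℝ) {ε : ℝ} (hε : ε ≠ 0) (Q : ScaledPoly) (z : Plane) :
    wave κ ε Q (dilation ε z) = ev ε (z 0) (z 1) Q * gaussian κ ε (z 0) (z 1) := by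
  rw [wave, dilation_apply_zero, dilation_apply_one, mul_div_cancel_left₀ _ hε,
    mul_div_cancel_left₀ _ (pow_ne_zero 2 hε)]

/-- Mass of a cut-off wave. -/
lemma exists_le_integral_wave {κ : ℝ} {Q : ScaledPoly} (hQ : ¬ Vanishing Q) {χ w : Plane → ℝ}
    (hχ : Continuous χ) (hχc : HasCompactSupport χ) (hχ1 : ∀ᶠ z in 𝓝 0, χ z = 1)
    (hw : Continuous w) {c : ℝ} (hc : 0 < c) (hcw : ∀ z, c ≤ w z) :
    ∃ m > (0 : ℝ), ∃ ε₀ > (0 : ℝ), ∀ ε ∈ Ioc 0 ε₀,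
      m * ε ^ 3 ≤ ∫ z, ‖(χ z : ℂ) * wave κ ε Q z‖ ^ 2 * w z := by
  obtain ⟨σ, τ, hστ⟩ : ∃ σ τ, ev 0 σ τ Q ≠ 0 := by
    by_contra! h; exact hQ h
  set F : ℝ × Plane → ℝ := fun p => ‖ev p.1 (p.2 0) (p.2 1) Q * gaussian κ p.1 (p.2 0) (p.2 1)‖
  have hF : Continuous F := ((continuous_ev Q).mul (continuous_gaussian κ)).norm
  have hF0 : 0 < F (0, pt σ τ) := norm_pos_iff.2 (mul_ne_zero hστ (Complex.exp_ne_zero _))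
  have hD : Continuous fun p : ℝ × Plane => dilation p.1 p.2 := by
    have h0 : Continuous fun z : Plane => z 0 := (contDiff_coord 0).continuous
    have h1 : Continuous fun z : Plane => z 1 := (contDiff_coord 1).continuous
    exact contDiff_pt.continuous.comp (f := fun p : ℝ × Plane => (p.1 * p.2 0, p.1 ^ 2 * p.2 1))
      (by fun_prop)
  have hD0 : dilation 0 (pt σ τ) = 0 := by
    rw [dilation, zero_mul, zero_pow two_ne_zero, zero_mul, pt_zero_zero]
  have ev1 : ∀ᶠ p in 𝓝 ((0 : ℝ), pt σ τ), F (0, pt σ τ) / 2 < F p :=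
    hF.continuousAt.eventually (lt_mem_nhds (by linarith))
  have ev2 : ∀ᶠ p in 𝓝 ((0 : ℝ), pt σ τ), χ (dilation p.1 p.2) = 1 := by
    have := hD.continuousAt (x := ((0 : ℝ), pt σ τ))
    rw [ContinuousAt, hD0] at this
    exact this.eventually hχ1
  obtain ⟨U, hU, V, hV, hUV⟩ := Filter.mem_prod_iff.1 (nhds_prod_eq (x := (0 : ℝ)) (y := pt σ τ) ▸ (ev1.and ev2))
  obtain ⟨δ, hδ, hδU⟩ := Metric.mem_nhds_iff.1 hU
  obtain ⟨ρ, hρ, hρV⟩ := Metric.mem_nhds_iff.1 hV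
  have hvol : 0 < (volume (ball (pt σ τ) ρ)).toReal :=
    ENNReal.toReal_pos (Metric.measure_ball_pos _ _ hρ).ne' measure_ball_lt_top.ne
  refine ⟨(F (0, pt σ τ) / 2) ^ 2 * c * (volume (ball (pt σ τ) ρ)).toReal, by positivity,
    δ / 2, by positivity, fun ε hε => ?_⟩
  have hint : Integrable fun z => ‖(χ (dilation ε z) : ℂ) * wave κ ε Q (dilation ε z)‖ ^ 2
      * w (dilation ε z) := by
    have hd : Continuous (dilation ε) := hD.comp (continuous_const.prodMk continuous_id)
    have hcont : Continuous fun z => ‖(χ (dilation ε z) : ℂ) * wave κ ε Q (dilation ε z)‖ ^ 2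
        * w (dilation ε z) :=
      ((((Complex.continuous_ofReal.comp (hχ.comp hd)).mul
        ((contDiff_wave κ ε Q).continuous.comp hd)).norm.pow 2).mul (hw.comp hd))
    refine hcont.integrable_of_hasCompactSupport ?_
    let e : Plane → Plane := dilation ε⁻¹
    have he : ∀ z, e (dilation ε z) = z := by
      intro z
      rw [← pt_eta z]
      simp only [e, dilation, pt_zero, pt_one]
      congr 1
      · field_simp [hε.1.ne']
      · field_simp [hε.1.ne']
    have hce : Continuous e := hD.comp (continuous_const.prodMk continuous_id)
    refine HasCompactSupport.intro (hχc.isCompact.image hce) fun z hz => ?_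
    have : χ (dilation ε z) = 0 := by
      by_contra h
      exact hz ⟨dilation ε z, subset_tsupport _ h, he z⟩
    simp [this]
  rw [integral_comp_dilation hε.1, mul_comm (ε ^ 3)]
  refine mul_le_mul_of_nonneg_right ?_ (pow_nonneg hε.1.le 3)
  calc (F (0, pt σ τ) / 2) ^ 2 * c * (volume (ball (pt σ τ) ρ)).toReal
      = ∫ _ in ball (pt σ τ) ρ, (F (0, pt σ τ) / 2) ^ 2 * c := by
        rw [setIntegral_const]; simp [Measure.real, mul_comm]
    _ ≤ ∫ z in ball (pt σ τ) ρ, ‖(χ (dilation ε z) : ℂ) * wave κ ε Q (dilation ε z)‖ ^ 2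
          * w (dilation ε z) := by
        refine setIntegral_mono_on (integrableOn_const measure_ball_lt_top.ne)
          hint.integrableOn measurableSet_ball fun z hz => ?_
        have hp := hUV (show ((ε, z) : ℝ × Plane) ∈ U ×ˢ V from ⟨hδU (by
          rw [Metric.mem_ball, Real.dist_eq, sub_zero, abs_of_pos hε.1]; linarith [hε.2]), hρV hz⟩)
        have h2 : χ (dilation ε z) = 1 := hp.2
        have h1 : F (0, pt σ τ) / 2 < F (ε, z) := hp.1
        rw [h2, wave_dilation κ hε.1.ne', Complex.ofReal_one, one_mul]
        exact mul_le_mul (pow_le_pow_left₀ (by positivity) h1.le 2) (hcw _) hc.le (by positivity)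
    _ ≤ _ := setIntegral_le_integral hint (ae_of_all _ fun z =>
        mul_nonneg (sq_nonneg _) (hc.le.trans (hcw _)))

end Scaling

section NormalForm

open ScaledPoly

lemma pd_one_realJet (g₀ : ℝ) (g₁ g₂ : Polynomial ℝ) (g₃ : ℝ) :
    pd 1 (realJet g₀ g₁ g₂ g₃)
      = fun z => g₁.eval (z 0) + 2 * g₂.eval (z 0) * z 1 + 3 * g₃ * z 1 ^ 2 := by
  funext z
  obtain ⟨x, y, rfl⟩ : ∃ x y, z = pt x y := ⟨z 0, z 1, (pt_eta z).symm⟩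
  have h := hasDerivAt_pt_one ((contDiff_realJet g₀ g₁ g₂ g₃).diffAt_top (pt x y))
  have h2 := ((((hasDerivAt_const y g₀).add ((hasDerivAt_id' y).const_mul (g₁.eval x))).add
    (((hasDerivAt_id' y).pow 2).const_mul (g₂.eval x))).add
    (((hasDerivAt_id' y).pow 3).const_mul g₃))
  refine h.unique (h2.congr_deriv ?_)
  simp
  ring

lemma contDiff_linear_jet (g₁ g₂ : Polynomial ℝ) (a b c : ℝ) :
    ContDiff ℝ ∞ fun z : Plane => a * g₁.eval (z 0) + b * g₂.eval (z 0) * z 1 + c * z 1 ^ 2 :=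
  ((contDiff_const.mul (contDiff_eval_coord g₁ 0)).add ((contDiff_const.mul
    (contDiff_eval_coord g₂ 0)).mul (contDiff_coord 1))).add
    (contDiff_const.mul ((contDiff_coord 1).pow 2))

lemma pd_one_linear_jet (g₁ g₂ : Polynomial ℝ) (a b c : ℝ) :
    pd 1 (fun z : Plane => a * g₁.eval (z 0) + b * g₂.eval (z 0) * z 1 + c * z 1 ^ 2)
      = fun z => b * g₂.eval (z 0) + 2 * c * z 1 := by
  funext z
  obtain ⟨x, y, rfl⟩ : ∃ x y, z = pt x y := ⟨z 0, z 1, (pt_eta z).symm⟩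
  have h := hasDerivAt_pt_one ((contDiff_linear_jet g₁ g₂ a b c).diffAt_top (pt x y))
  have h2 := (((hasDerivAt_const y (a * g₁.eval x)).add
    ((hasDerivAt_id' y).const_mul (b * g₂.eval x))).add
    (((hasDerivAt_id' y).pow 2).const_mul c))
  refine h.unique (h2.congr_deriv ?_)
  simp
  ring

lemma flatLine_mono {m n : ℕ} (h : m ≤ n) {f : ℝ → ℝ} (hf : FlatLine n f) : FlatLine m f := by
  induction h with
  | refl => exact hf
  | step _ ih => exact ih hf.pred

/-- A function is approximated by its weighted Taylor polynomial along the axis. -/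
lemma flat_sub_realJet {f : Plane → ℝ} (hf : ContDiff ℝ ∞ f) {g₀ : ℝ} {g₁ g₂ : Polynomial ℝ}
    {g₃ : ℝ} (h0 : ∀ᶠ x in 𝓝 (0 : ℝ), f (pt x 0) = g₀)
    (h1 : FlatLine 5 fun x => pd 1 f (pt x 0) - g₁.eval x)
    (h2 : FlatLine 3 fun x => pd 1 (pd 1 f) (pt x 0) - 2 * g₂.eval x)
    (h3 : pd 1 (pd 1 (pd 1 f)) 0 = 6 * g₃) :
    Flat 7 fun z => f z - realJet g₀ g₁ g₂ g₃ z := by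
  have hJ := contDiff_realJet g₀ g₁ g₂ g₃
  have e1 : pd 1 (fun z => f z - realJet g₀ g₁ g₂ g₃ z)
      = fun z => pd 1 f z - (1 * g₁.eval (z 0) + 2 * g₂.eval (z 0) * z 1 + 3 * g₃ * z 1 ^ 2) := by
    funext z
    rw [pd_sub (hf.diffAt_top z) (hJ.diffAt_top z), pd_one_realJet]
    ring
  have c1 := (hf.pd 1).sub (contDiff_linear_jet g₁ g₂ 1 2 (3 * g₃))
  have e2 : pd 1 (fun z => pd 1 f z - (1 * g₁.eval (z 0) + 2 * g₂.eval (z 0) * z 1 + 3 * g₃ * z 1 ^ 2))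
      = fun z => pd 1 (pd 1 f) z - (2 * g₂.eval (z 0) + (6 * g₃) * (1 : Polynomial ℝ).eval (z 0) * z 1
        + 0 * z 1 ^ 2) := by
    funext z
    rw [pd_sub ((hf.pd 1).diffAt_top z)
      ((contDiff_linear_jet g₁ g₂ 1 2 (3 * g₃)).diffAt_top z), pd_one_linear_jet]
    simp only [Polynomial.eval_one]; ring
  have c2 := ((hf.pd 1).pd 1).sub (contDiff_linear_jet g₂ 1 2 (6 * g₃) 0)
  refine flat_of_axis (hf.sub hJ) ?_ ?_
  · refine (flatLine_zero 7).congr (h0.mono fun x hx => ?_)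
    simp [hx, realJet]
  rw [e1]
  refine flat_of_axis c1 (by simpa using h1) ?_
  rw [e2]
  refine flat_of_axis c2 (by simpa using h2) ?_
  change pd 1 _ 0 = 0
  rw [pd_sub (((hf.pd 1).pd 1).diffAt_top 0)
      ((contDiff_linear_jet g₂ 1 2 (6 * g₃) 0).diffAt_top 0), pd_one_linear_jet, h3]
  simp

lemma continuous_pt_zero : Continuous fun x : ℝ => pt x 0 :=
  (contDiff_pt.comp (contDiff_id.prodMk (contDiff_const (c := (0 : ℝ))))).continuous

/-- Quasimodes in the plane for coefficients in normal form along the axis `y = 0`. -/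
theorem exists_plane_quasimode {G : Fin 2 → Fin 2 → Plane → ℝ} {β : Plane → ℝ}
    (hG : ∀ i j, ContDiff ℝ ∞ (G i j)) (hβ : ContDiff ℝ ∞ β) {c₀ b₀ : ℝ} (hc₀ : 0 < c₀)
    (hcβ : ∀ z, c₀ ≤ β z) (hsymm : G 1 0 = G 0 1)
    (hdet : ∀ᶠ z in 𝓝 0, G 0 0 z * G 1 1 z - G 0 1 z ^ 2 = 1) (hb₀ : 0 < b₀)
    (h00 : ∀ᶠ x in 𝓝 (0 : ℝ), G 0 0 (pt x 0) = 1) (h11 : ∀ᶠ x in 𝓝 (0 : ℝ), G 1 1 (pt x 0) = 1)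
    (h01 : ∀ᶠ x in 𝓝 (0 : ℝ), G 0 1 (pt x 0) = 0)
    (hd01 : ∀ᶠ x in 𝓝 (0 : ℝ), pd 1 (G 0 1) (pt x 0) = 0)
    (hβ0 : ∀ᶠ x in 𝓝 (0 : ℝ), β (pt x 0) = b₀⁻¹) (hdβ : ∀ᶠ x in 𝓝 (0 : ℝ), pd 1 β (pt x 0) = 0)
    (k : ℕ) {V : ℝ → ℝ} (hV : V =ᶠ[𝓝 0] fun x =>
      b₀ * (-((k : ℝ) ^ 2 + k) * (pd 1 (pd 1 (G 1 1)) (pt x 0) / 2)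
        + (2 * k + 1) * b₀ * (k + 1 / 2) * (-(pd 1 (pd 1 β) (pt x 0)) / 2)))
    (hV1 : deriv V 0 = 0) (hV2 : 0 < iteratedDeriv 2 V 0) (hβ2 : pd 1 (pd 1 β) 0 < 0)
    (j : ℕ) {ρ : ℝ} (hρ : 0 < ρ) :
    ∃ v : ℝ → Plane → ℂ, (∀ ε, ContDiff ℝ ∞ (v ε) ∧ tsupport (v ε) ⊆ ball 0 ρ) ∧
      ∃ C, ∃ ε₀ > (0 : ℝ), ∀ ε ∈ Ioc 0 ε₀, 0 < ∫ z, ‖v ε z‖ ^ 2 * β z ∧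
        ∫ z, ‖((β z)⁻¹ : ℂ) * magneticOp (ε ^ 4) G (v ε) z
          - ((2 * k + 1) * b₀ * ε ^ 4 + V 0 * ε ^ 8
            + √((2 * k + 1) * b₀ ^ 2 * (-(pd 1 (pd 1 β) 0) / 2) * iteratedDeriv 2 V 0 / 2)
              * (2 * j + 1) * ε ^ 10 : ℝ) * v ε z‖ ^ 2 * β z
          ≤ C * ε ^ 22 * ∫ z, ‖v ε z‖ ^ 2 * β z := by
  set fP : ℝ → ℝ := fun x => pd 1 (G 1 1) (pt x 0) with hfP
  set fc : ℝ → ℝ := fun x => pd 1 (pd 1 (G 1 1)) (pt x 0) / 2 with hfc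
  set fq : ℝ → ℝ := fun x => pd 1 (pd 1 (G 0 1)) (pt x 0) / 2 with hfq
  set fβ : ℝ → ℝ := fun x => -(pd 1 (pd 1 β) (pt x 0)) / 2 with hfβ
  have sP : ContDiff ℝ ∞ fP := contDiff_axis ((hG 1 1).pd 1)
  have sc : ContDiff ℝ ∞ fc := (contDiff_axis (((hG 1 1).pd 1).pd 1)).div_const 2
  have sq' : ContDiff ℝ ∞ fq := (contDiff_axis (((hG 0 1).pd 1).pd 1)).div_const 2
  have sβ : ContDiff ℝ ∞ fβ := (contDiff_axis ((hβ.pd 1).pd 1)).neg.div_const 2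
  set P := taylorPoly 5 fP
  set c := taylorPoly 3 fc
  set q := taylorPoly 3 fq
  set b := taylorPoly 3 fβ
  set a₃ := pd 1 (pd 1 (pd 1 (G 0 0))) 0 / 6
  set q₃ := pd 1 (pd 1 (pd 1 (G 0 1))) 0 / 6
  set c₃ := pd 1 (pd 1 (pd 1 (G 1 1))) 0 / 6
  set β₃ := -(pd 1 (pd 1 (pd 1 β)) 0) / 6
  have tP := flatLine_sub_taylorPoly 5 sP
  have tc := flatLine_sub_taylorPoly 3 sc
  have tq := flatLine_sub_taylorPoly 3 sq'
  have tb := flatLine_sub_taylorPoly 3 sβ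
  have sp : ∀ p : Polynomial ℝ, ContDiff ℝ ∞ fun x => p.eval x := fun p => by
    simpa using p.contDiff_aeval (𝕜 := ℝ) ∞
  have hcm : ∀ {n : ℕ} {f : ℝ → ℝ} (a : ℝ), FlatLine n f → ContDiff ℝ ∞ f →
      FlatLine n fun x => f x * a := fun a hf hf' => hf.mul hf' contDiff_const
  have hpt : Tendsto (fun x : ℝ => pt x 0) (𝓝 0) (𝓝 0) := by
    simpa [pt_zero_zero] using continuous_pt_zero.tendsto 0
  have J11 : Flat 7 fun z => G 1 1 z - realJet 1 P c c₃ z := by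
    refine flat_sub_realJet (hG 1 1) h11 tP ?_ (by ring)
    refine (hcm 2 tc (sc.sub (sp _))).congr (Eventually.of_forall fun x => ?_)
    simp only [hfc]; ring
  have J01 : Flat 7 fun z => G 0 1 z - realJet 0 0 q q₃ z := by
    refine flat_sub_realJet (hG 0 1) h01 ?_ ?_ (by ring)
    · exact (flatLine_zero 5).congr (hd01.mono fun x hx => by simp [hx])
    · refine (hcm 2 tq (sq'.sub (sp _))).congr (Eventually.of_forall fun x => ?_)
      simp only [hfq]; ring
  have Jβ : Flat 7 fun z => β z - realJet b₀⁻¹ 0 (-b) (-β₃) z := by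
    refine flat_sub_realJet hβ hβ0 ?_ ?_ (by ring)
    · exact (flatLine_zero 5).congr (hdβ.mono fun x hx => by simp [hx])
    · refine (hcm (-2) tb (sβ.sub (sp _))).congr (Eventually.of_forall fun x => ?_)
      simp only [hfβ, Polynomial.eval_neg]; ring
  have d : ∀ z i j, DifferentiableAt ℝ (G i j) z := fun z i j => (hG i j).diffAt_top z
  have d1 : ∀ z i j, DifferentiableAt ℝ (pd 1 (G i j)) z := fun z i j => ((hG i j).pd 1).diffAt_top z
  have hd1 : ∀ᶠ z in 𝓝 (0 : Plane), pd 1 (G 0 0) z * G 1 1 z + G 0 0 z * pd 1 (G 1 1) z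
      = 2 * G 0 1 z * pd 1 (G 0 1) z := by
    have h : (fun z => G 0 0 z * G 1 1 z - G 0 1 z * G 0 1 z) =ᶠ[𝓝 0] fun _ => 1 :=
      hdet.mono fun z hz => by rw [← hz]; ring
    refine h.eventuallyEq_nhds.mono fun z hz => ?_
    have := pd_congr hz 1
    rw [pd_const, pd_sub ((d z 0 0).fun_mul (d z 1 1)) ((d z 0 1).fun_mul (d z 0 1)),
      pd_mul (d z 0 0) (d z 1 1), pd_mul (d z 0 1) (d z 0 1)] at this
    linear_combination this
  have hd2 : ∀ᶠ z in 𝓝 (0 : Plane), pd 1 (pd 1 (G 0 0)) z * G 1 1 z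
      + 2 * pd 1 (G 0 0) z * pd 1 (G 1 1) z + G 0 0 z * pd 1 (pd 1 (G 1 1)) z
      = 2 * (pd 1 (G 0 1) z) ^ 2 + 2 * G 0 1 z * pd 1 (pd 1 (G 0 1)) z := by
    have h : (fun z => (pd 1 (G 0 0) z * G 1 1 z + G 0 0 z * pd 1 (G 1 1) z)
        - (G 0 1 z * pd 1 (G 0 1) z + G 0 1 z * pd 1 (G 0 1) z)) =ᶠ[𝓝 0] fun _ => 0 :=
      hd1.mono fun z hz => by linear_combination hz
    refine h.eventuallyEq_nhds.mono fun z hz => ?_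
    have := pd_congr hz 1
    have dm := (d z 0 1).fun_mul (d1 z 0 1)
    have e1 := (d1 z 0 0).fun_mul (d z 1 1)
    have e2 := (d z 0 0).fun_mul (d1 z 1 1)
    rw [pd_const, pd_sub (e1.fun_add e2) (dm.fun_add dm), pd_add e1 e2, pd_add dm dm,
      pd_mul (d1 z 0 0) (d z 1 1), pd_mul (d z 0 0) (d1 z 1 1), pd_mul (d z 0 1) (d1 z 0 1)] at this
    linear_combination this
  have hG1 : ∀ᶠ x in 𝓝 (0 : ℝ), pd 1 (G 0 0) (pt x 0) = -fP x := by
    filter_upwards [hpt.eventually hd1, h00, h11, h01] with x hx e0 e1 e2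
    rw [e0, e1, e2] at hx
    simp only [hfP]
    linarith
  have hG2 : ∀ᶠ x in 𝓝 (0 : ℝ), pd 1 (pd 1 (G 0 0)) (pt x 0) = 2 * fP x ^ 2 - 2 * fc x := by
    filter_upwards [hpt.eventually hd2, h00, h11, h01, hd01, hG1] with x hx e0 e1 e2 e3 e4
    rw [e0, e1, e2, e3, e4] at hx
    simp only [hfP, hfc] at hx ⊢
    linarith
  have J00 : Flat 7 fun z => G 0 0 z - realJet 1 (-P) (P ^ 2 - c) a₃ z := by
    refine flat_sub_realJet (hG 0 0) h00 ?_ ?_ (by ring)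
    · refine (hcm (-1) tP (sP.sub (sp _))).congr (hG1.mono fun x hx => ?_)
      simp only [hx, Polynomial.eval_neg]; ring
    · have t1 : FlatLine 3 fun x => (fP x - P.eval x) * (2 * (fP x + P.eval x)) :=
        (flatLine_mono (by norm_num) tP).mul (sP.sub (sp _)) (contDiff_const.mul (sP.add (sp _)))
      have t2 := hcm (-2) tc (sc.sub (sp _))
      refine (t1.add t2 ((sP.sub (sp _)).mul (contDiff_const.mul (sP.add (sp _))))
        ((sc.sub (sp _)).mul contDiff_const)).congr (hG2.mono fun x hx => ?_)
      simp only [hx, Polynomial.eval_sub, Polynomial.eval_pow]; ring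
  set B := -(pd 1 (pd 1 β) 0) / 2 with hB
  have hBpos : 0 < B := by rw [hB]; linarith
  have hb_coeff : b.coeff 0 = B := by
    rw [coeff_taylorPoly]; simp [hfβ, hB, pt_zero_zero]
  set m₀ : ℝ := (2 * k + 1) * b₀ with hm₀
  have hm₀pos : 0 < m₀ := by positivity
  set v₂ := iteratedDeriv 2 V 0 / (2 * b₀) with hv₂
  have hv₂pos : 0 < v₂ := by positivity
  set κ := √(v₂ / (m₀ * B)) with hκ
  have hκpos : 0 < κ := Real.sqrt_pos.2 (by positivity)
  have hκsq : m₀ * B * κ ^ 2 = v₂ := by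
    rw [hκ, Real.sq_sqrt (by positivity)]; field_simp
  set m₆ : ℝ := √((2 * k + 1) * b₀ ^ 2 * B * iteratedDeriv 2 V 0 / 2) * (2 * j + 1) with hm₆
  have hm₆' : m₆ * b₀⁻¹ = m₀ * B * (κ * (2 * j + 1)) := by
    have : √((2 * k + 1) * b₀ ^ 2 * B * iteratedDeriv 2 V 0 / 2) = b₀ * (m₀ * B * κ) := by
      rw [Real.sqrt_eq_iff_eq_sq (by positivity) (by positivity), mul_pow, mul_pow, mul_pow,
        show m₀ ^ 2 * B ^ 2 * κ ^ 2 = m₀ * B * (m₀ * B * κ ^ 2) by ring, hκsq, hv₂, hm₀]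
      field_simp
    rw [hm₆, this]; field_simp
  have hVpoly : -((k : ℝ) ^ 2 + k) • c + (m₀ * (k + 1 / 2)) • b - Polynomial.C (V 0 * b₀⁻¹)
      = Polynomial.C v₂ * Polynomial.X ^ 2 := by
    have hW : ContDiff ℝ ∞ fun x => b₀ * (-((k : ℝ) ^ 2 + k) * fc x + (2 * k + 1) * b₀ * (k + 1 / 2)
        * fβ x) := by fun_prop
    have hi : ∀ i, iteratedDeriv i V 0 = b₀ * (-((k : ℝ) ^ 2 + k) * iteratedDeriv i fc 0
        + (2 * k + 1) * b₀ * (k + 1 / 2) * iteratedDeriv i fβ 0) := by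
      intro i
      have hci : ContDiffAt ℝ i fc 0 := (sc.of_le (by norm_cast; exact le_top)).contDiffAt
      have hβi : ContDiffAt ℝ i fβ 0 := (sβ.of_le (by norm_cast; exact le_top)).contDiffAt
      rw [hV.iteratedDeriv_eq, iteratedDeriv_const_mul_field, iteratedDeriv_fun_add
        (contDiffAt_const.mul hci) (contDiffAt_const.mul hβi), iteratedDeriv_const_mul_field,
        iteratedDeriv_const_mul_field]
    ext i
    have hcoef : (-((k : ℝ) ^ 2 + k) • c + (m₀ * (k + 1 / 2)) • b).coeff i
        = if i < 3 then iteratedDeriv i V 0 / (i.factorial * b₀) else 0 := by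
      simp only [Polynomial.coeff_add, Polynomial.coeff_smul, c, b, coeff_taylorPoly, smul_eq_mul]
      split_ifs with h3
      · rw [hi, hm₀]; field_simp
      · simp
    rw [Polynomial.coeff_sub, hcoef, Polynomial.coeff_C_mul, Polynomial.coeff_X_pow,
      Polynomial.coeff_C]
    rcases lt_or_ge i 3 with h3 | h3
    · interval_cases i
      · simp; field_simp; simp
      · simp [hV1]
      · simp [hv₂, Nat.factorial]
    · have e1 : ¬ i < 3 := by omega
      have e2 : i ≠ 0 := by omega
      have e3 : i ≠ 2 := by omega
      simp [e1, e2, e3]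
  have hVpolyC : -((k : ℂ) ^ 2 + k) • cpoly c + ((m₀ : ℂ) * (k + 1 / 2)) • cpoly b
      - Polynomial.C ((V 0 : ℂ) * (b₀ : ℂ)⁻¹)
      = Polynomial.C ((m₀ : ℂ) * (cpoly b).coeff 0 * κ ^ 2) * Polynomial.X ^ 2 := by
    have := congrArg cpoly hVpoly
    rw [← hκsq, ← hb_coeff] at this
    simpa [cpoly, Polynomial.smul_eq_C_mul] using this
  obtain ⟨Q, r, hQ, hr⟩ := exists_quasimode k j hκpos.ne' (cpoly P) (cpoly c) (cpoly q) (cpoly b)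
    a₃ q₃ c₃ β₃ b₀ m₀ (V 0) m₆ (by
      rw [hm₀]; push_cast
      have : (b₀ : ℂ) ≠ 0 := by exact_mod_cast hb₀.ne'
      field_simp) hVpolyC (by
      rw [Polynomial.coeff_map, hb_coeff]
      simp only [Complex.coe_algebraMap]
      exact_mod_cast hm₆')
  let χ : ContDiffBump (0 : Plane) := ⟨min ρ 1 / 4, min ρ 1 / 2, by positivity, by
    have : 0 < min ρ 1 := by positivity
    linarith⟩
  have hχ : ContDiff ℝ ∞ χ := χ.contDiff
  have hχ1 : ∀ᶠ z in 𝓝 0, χ z = 1 := χ.eventuallyEq_one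
  have hmin : 0 < min ρ 1 := by positivity
  have hts : tsupport χ ⊆ ball 0 (min ρ 1) := by
    rw [χ.tsupport_eq]
    exact Metric.closedBall_subset_ball (by change min ρ 1 / 2 < _; linarith)
  have hχ0 : ∀ z ∉ unitBox, χ z = 0 := by
    intro z hz
    by_contra h
    have h1 := hts (subset_tsupport _ h)
    rw [mem_ball_zero_iff] at h1
    have h2 := h1.trans_le (min_le_right ρ 1)
    exact hz ⟨(PiLp.norm_apply_le z 0).trans h2.le, (PiLp.norm_apply_le z 1).trans h2.le⟩
  let J : Fin 2 → Fin 2 → Plane → ℝ := ![![realJet 1 (-P) (P ^ 2 - c) a₃, realJet 0 0 q q₃],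
    ![realJet 0 0 q q₃, realJet 1 P c c₃]]
  let E : Fin 2 → Fin 2 → Module.End ℂ ScaledPoly :=
    ![![(model κ).entry (1 : ℝ) (cpoly (-P)) (cpoly (P ^ 2 - c)) a₃,
        (model κ).entry (0 : ℝ) (cpoly 0) (cpoly q) q₃],
      ![(model κ).entry (0 : ℝ) (cpoly 0) (cpoly q) q₃,
        (model κ).entry (1 : ℝ) (cpoly P) (cpoly c) c₃]]
  have hres := isSmall_residual (κ := κ) hκpos (G := G) (J := J) (β := β)
    (Jβ := realJet b₀⁻¹ 0 (-b) (-β₃)) (χ := χ) hG (by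
      intro i j
      fin_cases i <;> fin_cases j <;> exact contDiff_realJet _ _ _ _) hβ
    (contDiff_realJet _ _ _ _) (by
      intro i j
      fin_cases i <;> fin_cases j
      · exact J00
      · exact J01
      · change Flat 7 fun z => G 1 0 z - _
        rw [hsymm]; exact J01
      · exact J11) Jβ hχ hχ1 hχ0 (E := E)
    (Eβ := (model κ).entry (b₀⁻¹ : ℝ) (cpoly 0) (cpoly (-b)) (-β₃ : ℝ))
    (by
      intro i j ε hε Q z
      fin_cases i <;> fin_cases j <;> exact wave_entry κ hε _ _ _ _ Q z)
    (fun ε hε Q z => wave_entry κ hε _ _ _ _ Q z) (m₀ := m₀) (m₄ := V 0) (m₆ := m₆) (Q := Q) (r := r)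
    (by
      rw [← hr]
      have hs : ∀ (a : ℝ) (v : ScaledPoly), a • v = (a : ℂ) • v := fun a v => rfl
      have hpow : ∀ n v, ((model κ).e ^ n) v = MvPolynomial.X 0 ^ n * v := by
        intro n v
        have : (model κ).e = LinearMap.mulLeft ℂ (MvPolynomial.X 0) := rfl
        rw [this, LinearMap.pow_mulLeft, LinearMap.mulLeft_apply]
      simp only [Fin.sum_univ_two, hs, WeylModel.magnetic, LinearMap.add_apply, LinearMap.sub_apply,
        LinearMap.smul_apply, Module.End.mul_apply, Module.End.one_apply, hpow, E, polyMomentum,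
        Matrix.cons_val_zero, Matrix.cons_val_one, cpoly, Polynomial.map_neg, Polynomial.map_zero,
        Polynomial.map_sub, Polynomial.map_pow]
      simp
      abel)
  obtain ⟨C₁, hC₁, H₁⟩ := hres.exists_integral_le hκpos
  obtain ⟨m, hm, ε₁, hε₁, H₂⟩ := exists_le_integral_wave (κ := κ) hQ (χ := χ) (w := β)
    hχ.continuous χ.hasCompactSupport hχ1 hβ.continuous hc₀ hcβ
  obtain ⟨ε₂, hε₂, hε₂1, hε₂κ⟩ : ∃ ε₂ > (0 : ℝ), ε₂ ≤ 1 ∧ κ * ε₂ ^ 2 ≤ 1 / 2 := by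
    refine ⟨min 1 (1 / (2 * κ)), by positivity, min_le_left _ _, ?_⟩
    have h1 : min 1 (1 / (2 * κ)) ≤ 1 := min_le_left _ _
    have h2 : min 1 (1 / (2 * κ)) ≤ 1 / (2 * κ) := min_le_right _ _
    have h3 : 0 < min 1 (1 / (2 * κ)) := by positivity
    calc κ * min 1 (1 / (2 * κ)) ^ 2 ≤ κ * (1 / (2 * κ) * 1) := by
          rw [sq]; gcongr
      _ = 1 / 2 := by field_simp
  have hv : ∀ ε, ContDiff ℝ ∞ fun z => (χ z : ℂ) * wave κ ε Q z := fun ε =>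
    (contDiff_ofReal hχ).mul (contDiff_wave κ ε Q)
  refine ⟨fun ε z => (χ z : ℂ) * wave κ ε Q z, fun ε => ⟨hv ε, ?_⟩, C₁ * c₀⁻¹ / m, min ε₁ ε₂,
    by positivity, fun ε hε => ?_⟩
  · refine (closure_mono fun z hz => ?_).trans (hts.trans (Metric.ball_subset_ball (min_le_left _ _)))
    intro h0
    apply hz
    simp [h0]
  have hε1 : ε ≤ ε₁ := hε.2.trans (min_le_left _ _)
  have hε2 : ε ≤ ε₂ := hε.2.trans (min_le_right _ _)
  have hε0 := hε.1
  have hsm : ε ∈ smallScales κ := ⟨hε.1, hε2.trans hε₂1, le_trans (by gcongr) hε₂κ⟩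
  have hlow := H₂ ε ⟨hε.1, hε1⟩
  have hup := H₁ ε hsm (fun z => (β z)⁻¹) c₀⁻¹ (fun z => inv_nonneg.2 (hc₀.le.trans (hcβ z)))
    (fun z => inv_anti₀ hc₀ (hcβ z))
  refine ⟨lt_of_lt_of_le (by positivity) hlow, ?_⟩
  have hcongr : ∀ (z : Plane) (a v : ℂ) (μ : ℝ), ‖((β z)⁻¹ : ℂ) * a - μ * v‖ ^ 2 * β z
      = ‖a - μ * (β z * v)‖ ^ 2 * (β z)⁻¹ := by
    intro z a v μ
    have hβz : 0 < β z := hc₀.trans_le (hcβ z)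
    have hβC : (β z : ℂ) ≠ 0 := by exact_mod_cast hβz.ne'
    have : ((β z)⁻¹ : ℂ) * a - μ * v = ((β z)⁻¹ : ℝ) * (a - μ * (β z * v)) := by
      push_cast; field_simp
    rw [this, norm_mul, Complex.norm_real, Real.norm_of_nonneg (by positivity), mul_pow]
    field_simp
  calc _ = _ := integral_congr_ae (ae_of_all _ fun z => hcongr z _ _ _)
    _ ≤ C₁ * c₀⁻¹ * ε ^ (2 * 11) * ε ^ 3 := hup
    _ = C₁ * c₀⁻¹ / m * ε ^ 22 * (m * ε ^ 3) := by field_simp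
    _ ≤ _ := by gcongr

end NormalForm

section GramSchmidt

variable {D : Type*} [SeminormedAddCommGroup D] [InnerProductSpace ℂ D]

local notation "⟪" x ", " y "⟫" => inner ℂ x y

/-- Gram-Schmidt orthonormalization. -/
def orthonormalize (v : ℕ → D) (j : ℕ) : D :=
  letI w := v j - ∑ i : Fin j, ⟪orthonormalize v i, v j⟫ • orthonormalize v i
  ((‖w‖⁻¹ : ℝ) : ℂ) • w
termination_by j
decreasing_by all_goals exact i.2

/-- Gram-Schmidt orthonormalization of quasimodes with separated approximate eigenvalues. -/
theorem orthonormalize_quasimodes (H : ℝ → D →ₗ[ℂ] D) (hH : ∀ ε, (H ε).IsSymmetric)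
    (v : ℕ → ℝ → D) (μ : ℕ → ℝ → ℝ) {g : ℝ} (hg : 0 < g)
    (hμ : ∀ i j ε, μ i ε - μ j ε = ((i : ℝ) - j) * g * ε ^ 10)
    (hv : ∀ j, ∃ C, 0 ≤ C ∧ ∀ᶠ ε in 𝓝[>] (0 : ℝ), ‖v j ε‖ = 1 ∧
      ‖H ε (v j ε) - (μ j ε : ℂ) • v j ε‖ ≤ C * ε ^ 11) (j : ℕ) :
    ∃ C, 0 ≤ C ∧ ∀ᶠ ε in 𝓝[>] (0 : ℝ), ‖orthonormalize (fun j => v j ε) j‖ = 1 ∧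
      (∀ i < j, ⟪orthonormalize (fun j => v j ε) i, orthonormalize (fun j => v j ε) j⟫ = 0) ∧
      ‖H ε (orthonormalize (fun j => v j ε) j) - (μ j ε : ℂ) • orthonormalize (fun j => v j ε) j‖
        ≤ C * ε ^ 11 := by
  induction j using Nat.strong_induction_on with
  | _ j ih =>
  choose! C hC hCe using ih
  obtain ⟨C₀, hC₀, hve⟩ := hv j
  set S := ∑ i ∈ Finset.range j, C i
  have hS : 0 ≤ S := Finset.sum_nonneg fun i hi => hC i (Finset.mem_range.1 hi)
  have hCS : ∀ i < j, C i ≤ S := fun i hi =>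
    Finset.single_le_sum (f := C) (fun i hi => hC i (Finset.mem_range.1 hi)) (Finset.mem_range.2 hi)
  set K := (C₀ + S) / g
  have hK : 0 ≤ K := by positivity
  have hsmall : ∀ᶠ ε in 𝓝[>] (0 : ℝ), 0 < ε ∧ ε ≤ 1 ∧ j * (K * ε) ≤ 1 / 2 := by
    have h1 : ∀ᶠ ε in 𝓝[>] (0 : ℝ), ε ∈ Ioc 0 (1 / (2 * (j * K + 1))) := Ioc_mem_nhdsGT (by positivity)
    have h2 : ∀ᶠ ε in 𝓝[>] (0 : ℝ), ε ∈ Ioc (0 : ℝ) 1 := Ioc_mem_nhdsGT one_pos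
    filter_upwards [h1, h2] with ε e1 e2
    refine ⟨e1.1, e2.2, ?_⟩
    have h0 : (0 : ℝ) ≤ j * K := by positivity
    calc j * (K * ε) = (j * K) * ε := by ring
      _ ≤ (j * K + 1) * (1 / (2 * (j * K + 1))) := by
        have := e1.2
        have := e1.1.le
        gcongr
        linarith
      _ = 1 / 2 := by field_simp
  have hall : ∀ᶠ ε in 𝓝[>] (0 : ℝ), ∀ i ∈ Finset.range j,
      ‖orthonormalize (fun j => v j ε) i‖ = 1 ∧
      (∀ l < i, ⟪orthonormalize (fun j => v j ε) l, orthonormalize (fun j => v j ε) i⟫ = 0) ∧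
      ‖H ε (orthonormalize (fun j => v j ε) i) - (μ i ε : ℂ) • orthonormalize (fun j => v j ε) i‖
        ≤ C i * ε ^ 11 :=
    (Finset.eventually_all _).2 fun i hi => hCe i (Finset.mem_range.1 hi)
  refine ⟨2 * (C₀ + j * (K * (S + j * g))), by positivity, ?_⟩
  filter_upwards [hsmall, hall, hve] with ε ⟨hε, hε1, hεK⟩ hu ⟨hv1, hvr⟩
  set u : ℕ → D := orthonormalize fun j => v j ε with hudef
  set x := v j ε
  have hu1 : ∀ i < j, ‖u i‖ = 1 := fun i hi => (hu i (Finset.mem_range.2 hi)).1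
  have hur : ∀ i < j, ‖H ε (u i) - (μ i ε : ℂ) • u i‖ ≤ S * ε ^ 11 := fun i hi =>
    (hu i (Finset.mem_range.2 hi)).2.2.trans (by have := hCS i hi; gcongr)
  have huo : ∀ i < j, ∀ l < j, ⟪u i, u l⟫ = if i = l then 1 else 0 := by
    intro i hi l hl
    rcases lt_trichotomy i l with h | h | h
    · rw [if_neg h.ne]; exact (hu l (Finset.mem_range.2 hl)).2.1 i h
    · subst h
      rw [if_pos rfl, inner_self_eq_norm_sq_to_K, hu1 i hi]; simp
    · rw [if_neg h.ne', inner_eq_zero_symm]; exact (hu i (Finset.mem_range.2 hi)).2.1 l h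
  have ha : ∀ i < j, ‖⟪u i, x⟫‖ ≤ K * ε := by
    intro i hi
    have e1 : ((μ j ε - μ i ε : ℝ) : ℂ) * ⟪u i, x⟫
        = ⟪H ε (u i) - (μ i ε : ℂ) • u i, x⟫ - ⟪u i, H ε x - (μ j ε : ℂ) • x⟫ := by
      rw [inner_sub_left, inner_sub_right, hH ε (u i) x, inner_smul_left, inner_smul_right,
        Complex.conj_ofReal]
      push_cast; ring
    have e2 : ‖⟪H ε (u i) - (μ i ε : ℂ) • u i, x⟫ - ⟪u i, H ε x - (μ j ε : ℂ) • x⟫‖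
        ≤ (C₀ + S) * ε ^ 11 := by
      refine (norm_sub_le_of_le (norm_inner_le_norm _ x) (norm_inner_le_norm _ _)).trans ?_
      rw [hv1, hu1 i hi, mul_one, one_mul]
      linarith [hur i hi]
    rw [← e1, norm_mul, Complex.norm_real, Real.norm_eq_abs, hμ, abs_mul, abs_mul,
      abs_of_pos hg, abs_of_pos (by positivity : 0 < ε ^ 10)] at e2
    have e3 : (1 : ℝ) ≤ |(j : ℝ) - i| := by
      have : (i : ℝ) + 1 ≤ j := by exact_mod_cast hi
      rw [abs_of_pos (by linarith)]; linarith
    have e4 : g * ε ^ 10 * ‖⟪u i, x⟫‖ ≤ (C₀ + S) * ε ^ 11 := by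
      refine le_trans ?_ e2
      have : 0 ≤ g * ε ^ 10 * ‖⟪u i, x⟫‖ := by positivity
      calc g * ε ^ 10 * ‖⟪u i, x⟫‖ = 1 * (g * ε ^ 10 * ‖⟪u i, x⟫‖) := by ring
        _ ≤ |(j : ℝ) - i| * (g * ε ^ 10 * ‖⟪u i, x⟫‖) := by gcongr
        _ = _ := by ring
    have e5 : (g * ε ^ 10) * ‖⟪u i, x⟫‖ ≤ (g * ε ^ 10) * (K * ε) := by
      refine e4.trans_eq ?_
      simp only [K]; field_simp
    exact le_of_mul_le_mul_left e5 (by positivity)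
  set w := x - ∑ i : Fin j, ⟪u i, x⟫ • u i with hw
  have huj : u j = ((‖w‖⁻¹ : ℝ) : ℂ) • w := by
    rw [hudef, orthonormalize]
  have hcard : ∀ b : ℝ, ∑ _i : Fin j, b = j * b := fun b => by simp
  have hwn : 1 / 2 ≤ ‖w‖ := by
    have h1 : ‖∑ i : Fin j, ⟪u i, x⟫ • u i‖ ≤ j * (K * ε) := by
      rw [← hcard]
      refine norm_sum_le_of_le _ fun i _ => ?_
      rw [norm_smul, hu1 i i.2, mul_one]; exact ha i i.2
    have h2 := norm_sub_norm_le x (∑ i : Fin j, ⟪u i, x⟫ • u i)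
    rw [hv1] at h2
    rw [hw]; linarith
  have hw0 : 0 < ‖w‖ := by linarith
  have hinv : ‖w‖⁻¹ ≤ 2 := by
    rw [inv_le_comm₀ hw0 two_pos]; linarith
  refine ⟨?_, ?_, ?_⟩
  · rw [huj, norm_smul, Complex.norm_real, norm_inv, norm_norm, inv_mul_cancel₀ hw0.ne']
  · intro i hi
    have : ⟪u i, w⟫ = 0 := by
      rw [hw, inner_sub_right, inner_sum]
      simp only [inner_smul_right]
      rw [Finset.sum_eq_single (⟨i, hi⟩ : Fin j)]
      · rw [huo i hi i hi, if_pos rfl, mul_one, sub_self]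
      · intro l _ hl
        rw [huo i hi l l.2, if_neg (fun h => hl (Fin.ext h.symm)), mul_zero]
      · simp
    rw [huj, inner_smul_right, this, mul_zero]
  · have e1 : H ε w - (μ j ε : ℂ) • w = (H ε x - (μ j ε : ℂ) • x) - ∑ i : Fin j, ⟪u i, x⟫ •
        ((H ε (u i) - (μ i ε : ℂ) • u i) + ((μ i ε - μ j ε : ℝ) : ℂ) • u i) := by
      have : ∀ i : Fin j, ⟪u i, x⟫ • ((H ε (u i) - (μ i ε : ℂ) • u i)
          + ((μ i ε - μ j ε : ℝ) : ℂ) • u i)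
          = ⟪u i, x⟫ • H ε (u i) - (μ j ε : ℂ) • ⟪u i, x⟫ • u i := by
        intro i; push_cast; module
      simp only [this, Finset.sum_sub_distrib, ← Finset.smul_sum]
      rw [hw, map_sub, map_sum]
      simp only [map_smul]
      module
    have e2 : ‖H ε w - (μ j ε : ℂ) • w‖ ≤ (C₀ + j * (K * (S + j * g))) * ε ^ 11 := by
      rw [e1]
      refine (norm_sub_le _ _).trans ?_
      have h3 : ‖∑ i : Fin j, ⟪u i, x⟫ • ((H ε (u i) - (μ i ε : ℂ) • u i)
          + ((μ i ε - μ j ε : ℝ) : ℂ) • u i)‖ ≤ j * ((K * ε) * (S * ε ^ 11 + j * g * ε ^ 10)) := by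
        rw [← hcard]
        refine norm_sum_le_of_le _ fun i _ => ?_
        rw [norm_smul]
        refine mul_le_mul (ha i i.2) ((norm_add_le _ _).trans (add_le_add (hur i i.2) ?_))
          (norm_nonneg _) (by positivity)
        rw [norm_smul, hu1 i i.2, mul_one, Complex.norm_real, Real.norm_eq_abs, hμ, abs_mul,
          abs_mul, abs_of_pos hg, abs_of_pos (by positivity : 0 < ε ^ 10)]
        have : |((i : ℕ) : ℝ) - j| ≤ j := by
          have h4 : ((i : ℕ) : ℝ) ≤ j := by exact_mod_cast i.2.le
          have h5 : (0 : ℝ) ≤ ((i : ℕ) : ℝ) := by positivity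
          rw [abs_of_nonpos (by linarith)]; linarith
        gcongr
      have h6 : (K * ε) * (S * ε ^ 11 + j * g * ε ^ 10) ≤ K * (S + j * g) * ε ^ 11 := by
        have h7 : ε * ε ^ 11 ≤ 1 * ε ^ 11 := by gcongr
        calc (K * ε) * (S * ε ^ 11 + j * g * ε ^ 10)
            = K * (S * (ε * ε ^ 11) + j * g * ε ^ 11) := by ring
          _ ≤ K * (S * (1 * ε ^ 11) + j * g * ε ^ 11) := by gcongr
          _ = _ := by ring
      have h8 : (j : ℝ) * ((K * ε) * (S * ε ^ 11 + j * g * ε ^ 10))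
          ≤ j * (K * (S + j * g) * ε ^ 11) := by gcongr
      linarith [h3.trans h8]
    have e3 : H ε (u j) - (μ j ε : ℂ) • u j
        = ((‖w‖⁻¹ : ℝ) : ℂ) • (H ε w - (μ j ε : ℂ) • w) := by
      rw [huj, map_smul]; module
    rw [e3, norm_smul, Complex.norm_real, Real.norm_of_nonneg (by positivity)]
    calc ‖w‖⁻¹ * ‖H ε w - (μ j ε : ℂ) • w‖ ≤ 2 * ((C₀ + j * (K * (S + j * g))) * ε ^ 11) := by gcongr
      _ = _ := by ring

end GramSchmidt

section Symmetry

lemma momentum_eq_zero_of_notMem_tsupport {f : Plane → ℂ} (h : ℝ) (i : Fin 2) {z : Plane}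
    (hz : z ∉ tsupport f) : momentum h i f z = 0 := by
  have h1 : f =ᶠ[𝓝 z] fun _ => 0 := notMem_tsupport_iff_eventuallyEq.1 hz
  rw [momentum, pd_congr h1, pd_const, h1.eq_of_nhds]; simp

lemma tsupport_momentum_subset (f : Plane → ℂ) (h : ℝ) (i : Fin 2) :
    tsupport (momentum h i f) ⊆ tsupport f := by
  refine closure_minimal (fun z hz => ?_) (isClosed_tsupport f)
  by_contra hz'
  exact hz (momentum_eq_zero_of_notMem_tsupport h i hz')

lemma tsupport_magneticOp_subset (h : ℝ) (G : Fin 2 → Fin 2 → Plane → ℝ) (f : Plane → ℂ) :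
    tsupport (magneticOp h G f) ⊆ tsupport f := by
  refine closure_minimal (fun z hz => ?_) (isClosed_tsupport f)
  by_contra hz'
  refine hz ?_
  refine Finset.sum_eq_zero fun i _ => Finset.sum_eq_zero fun j _ => ?_
  refine momentum_eq_zero_of_notMem_tsupport h i fun h1 => hz' ?_
  exact tsupport_momentum_subset f h j (tsupport_mul_subset_right h1)

lemma contDiff_magneticOp {f : Plane → ℂ} (hf : ContDiff ℝ ∞ f) (h : ℝ)
    {G : Fin 2 → Fin 2 → Plane → ℝ} (hG : ∀ i j, ContDiff ℝ ∞ (G i j)) :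
    ContDiff ℝ ∞ (magneticOp h G f) :=
  ContDiff.sum fun i _ => ContDiff.sum fun j _ =>
    contDiff_momentum ((contDiff_ofReal (hG i j)).mul (contDiff_momentum hf h j)) h i

lemma contDiff_conj {f : Plane → ℂ} (hf : ContDiff ℝ ∞ f) :
    ContDiff ℝ ∞ fun z => (starRingEnd ℂ) (f z) :=
  Complex.conjCLE.contDiff.comp hf

lemma pd_conj {f : Plane → ℂ} (hf : ContDiff ℝ ∞ f) (i : Fin 2) (z : Plane) :
    pd i (fun z => (starRingEnd ℂ) (f z)) z = (starRingEnd ℂ) (pd i f z) := by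
  have h := (Complex.conjCLE.toContinuousLinearMap.hasFDerivAt (x := f z)).comp z
    (hf.diffAt_top z).hasFDerivAt
  have h2 : fderiv ℝ (fun z => (starRingEnd ℂ) (f z)) z
      = Complex.conjCLE.toContinuousLinearMap.comp (fderiv ℝ f z) := h.fderiv
  rw [pd, h2]; rfl

lemma integrable_mul_conj {f g : Plane → ℂ} (hf : Continuous f) (hg : Continuous g)
    (hc : HasCompactSupport g) : Integrable fun z => f z * (starRingEnd ℂ) (g z) := by
  refine (hf.mul (Complex.continuous_conj.comp hg)).integrable_of_hasCompactSupport ?_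
  exact HasCompactSupport.mul_left (f := f) (hc.comp_left (map_zero (starRingEnd ℂ)))

lemma hasCompactSupport_momentum {g : Plane → ℂ} (hc : HasCompactSupport g) (h : ℝ) (i : Fin 2) :
    HasCompactSupport (momentum h i g) :=
  hc.mono' ((subset_tsupport _).trans (tsupport_momentum_subset g h i))

/-- The momentum operators are symmetric. -/
lemma integral_momentum_mul_conj {f g : Plane → ℂ} (hf : ContDiff ℝ ∞ f) (hg : ContDiff ℝ ∞ g)
    (hc : HasCompactSupport g) (h : ℝ) (i : Fin 2) :
    ∫ z, momentum h i f z * (starRingEnd ℂ) (g z) = ∫ z, f z * (starRingEnd ℂ) (momentum h i g z) := by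
  have hcg : Continuous fun z => (starRingEnd ℂ) (g z) := (contDiff_conj hg).continuous
  have hcc : HasCompactSupport fun z => (starRingEnd ℂ) (g z) := hc.comp_left (map_zero _)
  have hpd : HasCompactSupport fun z => pd i (fun z => (starRingEnd ℂ) (g z)) z := by
    refine hcc.mono' fun z hz => ?_
    by_contra h1
    exact hz ((pd_congr (notMem_tsupport_iff_eventuallyEq.1 h1) i).trans (pd_const 0 i z))
  have i1 : Integrable fun z => pd i f z * (starRingEnd ℂ) (g z) :=
    integrable_mul_conj (hf.pd i).continuous hg.continuous hc
  have i2 : Integrable fun z => f z * pd i (fun z => (starRingEnd ℂ) (g z)) z :=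
    (hf.continuous.mul ((contDiff_conj hg).pd i).continuous).integrable_of_hasCompactSupport
      (HasCompactSupport.mul_left (f := f) hpd)
  have ibp := integral_mul_fderiv_eq_neg_fderiv_mul_of_integrable (v := basisVec i) (μ := volume)
    (f := f) (g := fun z => (starRingEnd ℂ) (g z)) i1 i2
    (integrable_mul_conj hf.continuous hg.continuous hc)
    (fun x _ => hf.diffAt_top x) (fun x _ => (contDiff_conj hg).diffAt_top x)
  have hcoef : Continuous fun z : Plane => (if i = 0 then (z 1 : ℂ) else 0) := by
    split_ifs
    · exact (contDiff_ofReal (contDiff_coord 1)).continuous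
    · exact continuous_const
  have i3 : Integrable fun z => ((if i = 0 then (z 1 : ℂ) else 0) * f z) * (starRingEnd ℂ) (g z) :=
    integrable_mul_conj (hcoef.mul hf.continuous) hg.continuous hc
  have e1 : ∀ z, momentum h i f z * (starRingEnd ℂ) (g z)
      = Complex.I * h * (pd i f z * (starRingEnd ℂ) (g z))
        + ((if i = 0 then (z 1 : ℂ) else 0) * f z) * (starRingEnd ℂ) (g z) := by
    intro z; rw [momentum]; ring
  have e2 : ∀ z, f z * (starRingEnd ℂ) (momentum h i g z)
      = -(Complex.I * h) * (f z * pd i (fun z => (starRingEnd ℂ) (g z)) z)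
        + ((if i = 0 then (z 1 : ℂ) else 0) * f z) * (starRingEnd ℂ) (g z) := by
    intro z
    rw [momentum, pd_conj hg, map_add, map_mul, map_mul, map_mul, Complex.conj_I,
      Complex.conj_ofReal, apply_ite (starRingEnd ℂ), Complex.conj_ofReal, map_zero]
    ring
  simp only [e1, e2]
  rw [integral_add (i1.const_mul _) i3, integral_add (i2.const_mul _) i3, integral_const_mul,
    integral_const_mul]
  congr 1
  change _ = -(Complex.I * h) * ∫ z, f z * fderiv ℝ (fun z => (starRingEnd ℂ) (g z)) z (basisVec i)
  rw [ibp]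
  simp only [pd]
  ring

/-- The quadratic form of the magnetic operator. -/
lemma integral_magneticOp_mul_conj {f g : Plane → ℂ} (hf : ContDiff ℝ ∞ f) (hg : ContDiff ℝ ∞ g)
    (hc : HasCompactSupport g) (h : ℝ) {G : Fin 2 → Fin 2 → Plane → ℝ}
    (hG : ∀ i j, ContDiff ℝ ∞ (G i j)) :
    ∫ z, magneticOp h G f z * (starRingEnd ℂ) (g z)
      = ∫ z, ∑ i, ∑ j, (G i j z : ℂ) * momentum h j f z * (starRingEnd ℂ) (momentum h i g z) := by
  have hs : ∀ i j, ContDiff ℝ ∞ fun z => (G i j z : ℂ) * momentum h j f z := fun i j =>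
    (contDiff_ofReal (hG i j)).mul (contDiff_momentum hf h j)
  simp only [magneticOp, Finset.sum_mul]
  have i1 : ∀ i j, Integrable fun z => momentum h i (fun w => (G i j w : ℂ) * momentum h j f w) z
      * (starRingEnd ℂ) (g z) := fun i j =>
    integrable_mul_conj (contDiff_momentum (hs i j) h i).continuous hg.continuous hc
  have i2 : ∀ i j, Integrable fun z => (G i j z : ℂ) * momentum h j f z
      * (starRingEnd ℂ) (momentum h i g z) := fun i j =>
    integrable_mul_conj (hs i j).continuous (contDiff_momentum hg h i).continuous
      (hasCompactSupport_momentum hc h i)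
  rw [integral_finsetSum _ fun i _ => integrable_finsetSum _ fun j _ => i1 i j,
    integral_finsetSum _ fun i _ => integrable_finsetSum _ fun j _ => i2 i j]
  refine Finset.sum_congr rfl fun i _ => ?_
  rw [integral_finsetSum _ fun j _ => i1 i j, integral_finsetSum _ fun j _ => i2 i j]
  refine Finset.sum_congr rfl fun j _ => ?_
  exact integral_momentum_mul_conj (hs i j) hg hc h i

lemma integral_magneticOp_symm {f g : Plane → ℂ} (hf : ContDiff ℝ ∞ f) (hg : ContDiff ℝ ∞ g)
    (hcf : HasCompactSupport f) (hc : HasCompactSupport g) (h : ℝ) {G : Fin 2 → Fin 2 → Plane → ℝ}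
    (hG : ∀ i j, ContDiff ℝ ∞ (G i j)) (hsymm : ∀ i j, G i j = G j i) :
    ∫ z, magneticOp h G f z * (starRingEnd ℂ) (g z)
      = ∫ z, f z * (starRingEnd ℂ) (magneticOp h G g z) := by
  have h1 := integral_magneticOp_mul_conj hf hg hc h hG
  have h2 := integral_magneticOp_mul_conj hg hf hcf h hG
  have h3 : ∫ z, f z * (starRingEnd ℂ) (magneticOp h G g z)
      = (starRingEnd ℂ) (∫ z, magneticOp h G g z * (starRingEnd ℂ) (f z)) := by
    rw [← integral_conj]
    refine integral_congr_ae (ae_of_all _ fun z => ?_)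
    simp [mul_comm]
  rw [h1, h3, h2, ← integral_conj]
  refine integral_congr_ae (ae_of_all _ fun z => ?_)
  simp only [map_sum, map_mul, Complex.conj_ofReal, Complex.conj_conj]
  rw [Finset.sum_comm]
  refine Finset.sum_congr rfl fun i _ => Finset.sum_congr rfl fun j _ => ?_
  rw [hsymm j i]; ring

/-- Smooth functions supported in a ball. -/
def testSpace (ρ : ℝ) : Submodule ℂ (Plane → ℂ) where
  carrier := {f | ContDiff ℝ ∞ f ∧ tsupport f ⊆ closedBall 0 ρ}
  add_mem' := fun ha hb => ⟨ha.1.add hb.1, (tsupport_add _ _).trans (union_subset ha.2 hb.2)⟩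
  zero_mem' := ⟨contDiff_const, by simp [tsupport]⟩
  smul_mem' := fun c f hf => ⟨contDiff_const.smul hf.1, (closure_mono (by
    intro z hz h0; exact hz (by simp [h0]))).trans hf.2⟩

lemma hasCompactSupport_of_mem_testSpace {ρ : ℝ} {f : Plane → ℂ} (hf : f ∈ testSpace ρ) :
    HasCompactSupport f :=
  HasCompactSupport.of_support_subset_isCompact (isCompact_closedBall 0 ρ)
    ((subset_tsupport _).trans hf.2)

/-- The scalar product of `L²(β dx dy)` on test functions. -/
@[reducible] def weightedCore (ρ : ℝ) {β : Plane → ℝ} (hβ : Continuous β) (hpos : ∀ z, 0 ≤ β z) :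
    PreInnerProductSpace.Core ℂ (testSpace ρ) where
  inner f g := ∫ z, (g.1 z * (starRingEnd ℂ) (f.1 z)) * β z
  conj_inner_symm f g := by
    rw [← integral_conj]
    refine integral_congr_ae (ae_of_all _ fun z => ?_)
    simp [mul_comm]
  re_inner_nonneg f := by
    have : ∀ z, (f.1 z * (starRingEnd ℂ) (f.1 z)) * (β z : ℂ) = ((‖f.1 z‖ ^ 2 * β z : ℝ) : ℂ) := by
      intro z
      rw [Complex.mul_conj, Complex.normSq_eq_norm_sq]; push_cast; ring
    simp only [this, integral_complex_ofReal]
    exact integral_nonneg fun z => mul_nonneg (sq_nonneg _) (hpos z)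
  add_left f g k := by
    have hint : ∀ a b : testSpace ρ, Integrable fun z => (a.1 z * (starRingEnd ℂ) (b.1 z)) * (β z : ℂ) := by
      intro a b
      have : ∀ z, (a.1 z * (starRingEnd ℂ) (b.1 z)) * (β z : ℂ)
          = (a.1 z * β z) * (starRingEnd ℂ) (b.1 z) := fun z => by ring
      simp only [this]
      exact integrable_mul_conj (a.2.1.continuous.mul (Complex.continuous_ofReal.comp hβ))
        b.2.1.continuous (hasCompactSupport_of_mem_testSpace b.2)
    rw [← integral_add (hint _ _) (hint _ _)]
    refine integral_congr_ae (ae_of_all _ fun z => ?_)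
    simp [mul_add, add_mul]
  smul_left f g r := by
    rw [← integral_const_mul]
    refine integral_congr_ae (ae_of_all _ fun z => ?_)
    simp; ring

end Symmetry

section Orthonormal

lemma contDiff_inv_ofReal {β : Plane → ℝ} (hβ : ContDiff ℝ ∞ β) (hpos : ∀ z, 0 < β z) :
    ContDiff ℝ ∞ fun z => ((β z)⁻¹ : ℂ) := by
  have := contDiff_ofReal (hβ.inv fun z => (hpos z).ne')
  simpa using this

/-- The operator `β⁻¹ ∑ Pᵢ Gᵢⱼ Pⱼ` on test functions. -/
def magneticEnd (ρ : ℝ) {β : Plane → ℝ} (hβ : ContDiff ℝ ∞ β) (hpos : ∀ z, 0 < β z)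
    {G : Fin 2 → Fin 2 → Plane → ℝ} (hG : ∀ i j, ContDiff ℝ ∞ (G i j)) (h : ℝ) :
    testSpace ρ →ₗ[ℂ] testSpace ρ where
  toFun f := ⟨fun z => ((β z)⁻¹ : ℂ) * magneticOp h G f.1 z,
    (contDiff_inv_ofReal hβ hpos).mul (contDiff_magneticOp f.2.1 h hG),
    (tsupport_mul_subset_right.trans (tsupport_magneticOp_subset h G f.1)).trans f.2.2⟩
  map_add' f g := by
    ext z
    have hm : ∀ i, momentum h i (f.1 + g.1) = fun z => momentum h i f.1 z + momentum h i g.1 z :=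
      fun i => funext fun z => momentum_add f.2.1 g.2.1 h i z
    have hs : ∀ i j (f : testSpace ρ), ContDiff ℝ ∞ fun z => (G i j z : ℂ) * momentum h j f.1 z :=
      fun i j f => (contDiff_ofReal (hG i j)).mul (contDiff_momentum f.2.1 h j)
    change _ * magneticOp h G (f.1 + g.1) z = _ * _ + _ * _
    rw [← mul_add]
    congr 1
    simp only [magneticOp, hm, mul_add, ← Finset.sum_add_distrib]
    exact Finset.sum_congr rfl fun i _ => Finset.sum_congr rfl fun j _ =>
      momentum_add (hs i j f) (hs i j g) h i z
  map_smul' c f := by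
    ext z
    have hm : ∀ i, momentum h i (c • f.1) = fun z => c * momentum h i f.1 z :=
      fun i => funext fun z => momentum_const_mul f.2.1 c h i z
    have hs : ∀ i j (f : testSpace ρ), ContDiff ℝ ∞ fun z => (G i j z : ℂ) * momentum h j f.1 z :=
      fun i j f => (contDiff_ofReal (hG i j)).mul (contDiff_momentum f.2.1 h j)
    change _ * magneticOp h G (c • f.1) z = c * (_ * magneticOp h G f.1 z)
    simp only [magneticOp, hm, Finset.mul_sum]
    refine Finset.sum_congr rfl fun i _ => Finset.sum_congr rfl fun j _ => ?_
    have : (fun w => (G i j w : ℂ) * (c * momentum h j f.1 w))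
        = fun w => c * ((G i j w : ℂ) * momentum h j f.1 w) := by funext w; ring
    rw [this, momentum_const_mul (hs i j f)]
    ring

/-- Quasimodes with separated approximate eigenvalues can be orthonormalized. -/
theorem exists_orthonormal_plane_quasimodes {G : Fin 2 → Fin 2 → Plane → ℝ} {β : Plane → ℝ}
    (hG : ∀ i j, ContDiff ℝ ∞ (G i j)) (hsymm : ∀ i j, G i j = G j i) (hβ : ContDiff ℝ ∞ β)
    (hpos : ∀ z, 0 < β z) {ρ : ℝ} (μ : ℕ → ℝ → ℝ) {g : ℝ} (hg : 0 < g)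
    (hμ : ∀ i j ε, μ i ε - μ j ε = ((i : ℝ) - j) * g * ε ^ 10)
    (hv : ∀ j, ∃ v : ℝ → Plane → ℂ, (∀ ε, ContDiff ℝ ∞ (v ε) ∧ tsupport (v ε) ⊆ ball 0 ρ) ∧
      ∃ C, ∃ ε₀ > (0 : ℝ), ∀ ε ∈ Ioc 0 ε₀, 0 < ∫ z, ‖v ε z‖ ^ 2 * β z ∧
        ∫ z, ‖((β z)⁻¹ : ℂ) * magneticOp (ε ^ 4) G (v ε) z - (μ j ε : ℂ) * v ε z‖ ^ 2 * β z
          ≤ C * ε ^ 22 * ∫ z, ‖v ε z‖ ^ 2 * β z) :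
    ∃ u : ℕ → ℝ → Plane → ℂ, (∀ j ε, u j ε ∈ testSpace ρ) ∧ ∀ j, ∃ C, 0 ≤ C ∧ ∃ ε₀ > (0 : ℝ),
      ∀ ε ∈ Ioc 0 ε₀, ∫ z, ‖u j ε z‖ ^ 2 * β z = 1 ∧
        (∀ i < j, ∫ z, (u j ε z * (starRingEnd ℂ) (u i ε z)) * β z = 0) ∧
        ∫ z, ‖((β z)⁻¹ : ℂ) * magneticOp (ε ^ 4) G (u j ε) z - (μ j ε : ℂ) * u j ε z‖ ^ 2 * β z
          ≤ (C * ε ^ 11) ^ 2 := by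
  let core := weightedCore ρ hβ.continuous fun z => (hpos z).le
  let _ : SeminormedAddCommGroup (testSpace ρ) :=
    InnerProductSpace.Core.toSeminormedAddCommGroup (𝕜 := ℂ) (F := testSpace ρ) (c := core)
  let _ : InnerProductSpace ℂ (testSpace ρ) := InnerProductSpace.ofCore core
  have hinner : ∀ f g : testSpace ρ, inner ℂ f g = ∫ z, (g.1 z * (starRingEnd ℂ) (f.1 z)) * β z :=
    fun f g => rfl
  have hnorm : ∀ f : testSpace ρ, ‖f‖ ^ 2 = ∫ z, ‖f.1 z‖ ^ 2 * β z := by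
    intro f
    have h1 : ((‖f‖ ^ 2 : ℝ) : ℂ) = inner ℂ f f := by
      rw [inner_self_eq_norm_sq_to_K]; push_cast; rfl
    have h2 : ∀ z, (f.1 z * (starRingEnd ℂ) (f.1 z)) * (β z : ℂ) = ((‖f.1 z‖ ^ 2 * β z : ℝ) : ℂ) := by
      intro z
      rw [Complex.mul_conj, Complex.normSq_eq_norm_sq]; push_cast; ring
    rw [hinner] at h1
    simp only [h2, integral_complex_ofReal] at h1
    exact_mod_cast h1
  let H : ℝ → testSpace ρ →ₗ[ℂ] testSpace ρ := fun ε => magneticEnd ρ hβ hpos hG (ε ^ 4)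
  have hH : ∀ ε, (H ε).IsSymmetric := by
    intro ε f g
    rw [hinner, hinner]
    have hc := hasCompactSupport_of_mem_testSpace f.2
    have hc' := hasCompactSupport_of_mem_testSpace g.2
    have hs := integral_magneticOp_symm g.2.1 f.2.1 hc' hc (ε ^ 4) hG hsymm
    have e1 : ∀ z, (g.1 z * (starRingEnd ℂ) ((H ε f).1 z)) * (β z : ℂ)
        = g.1 z * (starRingEnd ℂ) (magneticOp (ε ^ 4) G f.1 z) := by
      intro z
      have hb : (β z : ℂ) ≠ 0 := by exact_mod_cast (hpos z).ne'
      change (g.1 z * (starRingEnd ℂ) (((β z)⁻¹ : ℂ) * magneticOp (ε ^ 4) G f.1 z)) * (β z : ℂ) = _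
      rw [map_mul, map_inv₀, Complex.conj_ofReal]
      field_simp
    have e2 : ∀ z, ((H ε g).1 z * (starRingEnd ℂ) (f.1 z)) * (β z : ℂ)
        = magneticOp (ε ^ 4) G g.1 z * (starRingEnd ℂ) (f.1 z) := by
      intro z
      have hb : (β z : ℂ) ≠ 0 := by exact_mod_cast (hpos z).ne'
      change ((((β z)⁻¹ : ℂ) * magneticOp (ε ^ 4) G g.1 z) * (starRingEnd ℂ) (f.1 z)) * (β z : ℂ) = _
      field_simp
    simp only [e1, e2]
    exact hs.symm
  choose v hv1 C ε₀ hε₀ hv2 using hv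
  let V : ℕ → ℝ → testSpace ρ := fun j ε =>
    ⟨v j ε, (hv1 j ε).1, (hv1 j ε).2.trans Metric.ball_subset_closedBall⟩
  let V' : ℕ → ℝ → testSpace ρ := fun j ε => ((‖V j ε‖⁻¹ : ℝ) : ℂ) • V j ε
  have key := orthonormalize_quasimodes H hH V' μ hg hμ (fun j => by
    refine ⟨√(C j), Real.sqrt_nonneg _, ?_⟩
    filter_upwards [Ioc_mem_nhdsGT (hε₀ j)] with ε hε
    obtain ⟨h1, h2⟩ := hv2 j ε hε
    have hn : ‖V j ε‖ ^ 2 = ∫ z, ‖v j ε z‖ ^ 2 * β z := hnorm _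
    have hn0 : 0 < ‖V j ε‖ := by
      rw [← hn] at h1
      refine lt_of_le_of_ne (norm_nonneg _) fun h0 => ?_
      rw [← h0] at h1
      norm_num at h1
    have hr : ‖H ε (V j ε) - (μ j ε : ℂ) • V j ε‖ ^ 2 ≤ C j * ε ^ 22 * ‖V j ε‖ ^ 2 := by
      rw [hnorm, hn]; exact h2
    refine ⟨?_, ?_⟩
    · rw [norm_smul, Complex.norm_real, norm_inv, norm_norm, inv_mul_cancel₀ hn0.ne']
    · have e : H ε (V' j ε) - (μ j ε : ℂ) • V' j ε
          = ((‖V j ε‖⁻¹ : ℝ) : ℂ) • (H ε (V j ε) - (μ j ε : ℂ) • V j ε) := by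
        simp only [V', map_smul]; module
      rw [e, norm_smul, Complex.norm_real, norm_inv, norm_norm, inv_mul_le_iff₀ hn0]
      have hC0 : 0 ≤ C j := by
        by_contra hneg
        have h3 : C j * ε ^ 22 * ‖V j ε‖ ^ 2 < 0 :=
          mul_neg_of_neg_of_pos (mul_neg_of_neg_of_pos (not_le.1 hneg) (pow_pos hε.1 _))
            (by positivity)
        exact absurd (hr.trans_lt h3) (not_lt.2 (sq_nonneg _))
      refine le_of_sq_le_sq ?_ (by have := hε.1; positivity)
      rw [mul_pow, mul_pow, Real.sq_sqrt hC0]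
      calc _ ≤ _ := hr
        _ = _ := by ring)
  refine ⟨fun j ε => (orthonormalize (fun j => V' j ε) j).1, fun j ε =>
    (orthonormalize (fun j => V' j ε) j).2, fun j => ?_⟩
  obtain ⟨C', hC', hev⟩ := key j
  obtain ⟨δ, hδ, hδ'⟩ := mem_nhdsGT_iff_exists_Ioc_subset.1 hev
  refine ⟨C', hC', δ, hδ, fun ε hε => ?_⟩
  obtain ⟨k1, k2, k3⟩ := hδ' hε
  refine ⟨?_, fun i hi => ?_, ?_⟩
  · rw [← hnorm, k1, one_pow]
  · rw [← hinner]; exact k2 i hi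
  · have := pow_le_pow_left₀ (norm_nonneg _) k3 2
    rw [hnorm] at this
    exact this

end Orthonormal

section MatrixCalculus

lemma _root_.ContDiffAt.pd {F : Type*} [NormedAddCommGroup F] [NormedSpace ℝ F] {f : Plane → F}
    {z : Plane} (hf : ContDiffAt ℝ ∞ f z) (i : Fin 2) : ContDiffAt ℝ ∞ (MagneticWell.pd i f) z := by
  have h : ContDiffAt ℝ ∞ (fderiv ℝ f) z := hf.fderiv_right (by simp)
  exact h.clm_apply contDiffAt_const

lemma _root_.ContDiffAt.diffAt_top {E F : Type*} [NormedAddCommGroup E] [NormedSpace ℝ E]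
    [NormedAddCommGroup F] [NormedSpace ℝ F] {f : E → F} {z : E} (hf : ContDiffAt ℝ ∞ f z) :
    DifferentiableAt ℝ f z := hf.differentiableAt (by simp)

/-- The entries of a matrix-valued function are smooth at a point. -/
def MatSmooth (A : Plane → Mat) (z : Plane) : Prop := ∀ a b, ContDiffAt ℝ ∞ (fun w => A w a b) z

/-- Entrywise partial derivative. -/
def mpd (i : Fin 2) (A : Plane → Mat) (z : Plane) : Mat := Matrix.of fun a b => pd i (fun w => A w a b) z

lemma mpd_apply (i : Fin 2) (A : Plane → Mat) (z : Plane) (a b : Fin 2) :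
    mpd i A z a b = pd i (fun w => A w a b) z := rfl

variable {A B : Plane → Mat} {z : Plane}

lemma MatSmooth.mpd (hA : MatSmooth A z) (i : Fin 2) : MatSmooth (mpd i A) z :=
  fun a b => (hA a b).pd i

lemma MatSmooth.mul (hA : MatSmooth A z) (hB : MatSmooth B z) : MatSmooth (fun w => A w * B w) z := by
  intro a b
  simp only [Matrix.mul_apply]
  exact ContDiffAt.sum fun k _ => (hA a k).mul (hB k b)

lemma MatSmooth.add (hA : MatSmooth A z) (hB : MatSmooth B z) : MatSmooth (fun w => A w + B w) z :=
  fun a b => (hA a b).add (hB a b)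

lemma MatSmooth.transpose (hA : MatSmooth A z) : MatSmooth (fun w => (A w).transpose) z :=
  fun a b => hA b a

lemma MatSmooth.smul {f : Plane → ℝ} (hf : ContDiffAt ℝ ∞ f z) (hA : MatSmooth A z) :
    MatSmooth (fun w => f w • A w) z :=
  fun a b => hf.mul (hA a b)

lemma MatSmooth.det (hA : MatSmooth A z) : ContDiffAt ℝ ∞ (fun w => (A w).det) z := by
  simp only [Matrix.det_fin_two]
  exact ((hA 0 0).mul (hA 1 1)).sub ((hA 0 1).mul (hA 1 0))

lemma inv_apply_eq (N : Mat) (a b : Fin 2) : N⁻¹ a b = N.det⁻¹ * N.adjugate a b := by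
  rw [Matrix.inv_def, Ring.inverse_eq_inv', Matrix.smul_apply, smul_eq_mul]

lemma MatSmooth.inv (hA : MatSmooth A z) (h : (A z).det ≠ 0) : MatSmooth (fun w => (A w)⁻¹) z := by
  intro a b
  simp only [inv_apply_eq]
  refine (hA.det.inv h).mul ?_
  simp only [Matrix.adjugate_fin_two]
  fin_cases a <;> fin_cases b <;> simp
  · exact hA 1 1
  · exact (hA 0 1).neg
  · exact (hA 1 0).neg
  · exact hA 0 0

lemma mpd_mul (hA : MatSmooth A z) (hB : MatSmooth B z) (i : Fin 2) :
    mpd i (fun w => A w * B w) z = mpd i A z * B z + A z * mpd i B z := by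
  ext a b
  have d : ∀ k, DifferentiableAt ℝ (fun w => A w a k * B w k b) z := fun k =>
    ((hA a k).mul (hB k b)).diffAt_top
  simp only [mpd_apply, Matrix.add_apply, Matrix.mul_apply, Fin.sum_univ_two]
  rw [pd_add (d 0) (d 1), pd_mul (hA a 0).diffAt_top (hB 0 b).diffAt_top,
    pd_mul (hA a 1).diffAt_top (hB 1 b).diffAt_top]
  ring

lemma mpd_add (hA : MatSmooth A z) (hB : MatSmooth B z) (i : Fin 2) :
    mpd i (fun w => A w + B w) z = mpd i A z + mpd i B z := by
  ext a b
  exact pd_add (hA a b).diffAt_top (hB a b).diffAt_top i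

lemma mpd_smul {f : Plane → ℝ} (hf : ContDiffAt ℝ ∞ f z) (hA : MatSmooth A z) (i : Fin 2) :
    mpd i (fun w => f w • A w) z = pd i f z • A z + f z • mpd i A z := by
  ext a b
  exact pd_mul hf.diffAt_top (hA a b).diffAt_top i

lemma mpd_transpose (i : Fin 2) : mpd i (fun w => (A w).transpose) z = (mpd i A z).transpose := rfl

lemma mpd_congr (h : A =ᶠ[𝓝 z] B) (i : Fin 2) : mpd i A z = mpd i B z := by
  ext a b
  exact pd_congr (h.mono fun w hw => by simp only [hw]) i

lemma mpd_comm (hA : MatSmooth A z) (i j : Fin 2) : mpd i (mpd j A) z = mpd j (mpd i A) z := by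
  ext a b
  exact pd_comm (hA a b) i j

/-- The Jacobian matrix of a map of the plane. -/
def jacobian (τ : Plane → Plane) (z : Plane) : Mat := Matrix.of fun a i => pd i (fun w => τ w a) z

lemma jacobian_apply (τ : Plane → Plane) (z : Plane) (a i : Fin 2) :
    jacobian τ z a i = pd i (fun w => τ w a) z := rfl

lemma contDiffAt_component {τ : Plane → Plane} (hτ : ContDiffAt ℝ ∞ τ z) (a : Fin 2) :
    ContDiffAt ℝ ∞ (fun w => τ w a) z :=
  (contDiff_coord a).contDiffAt.comp z hτ

lemma matSmooth_jacobian {τ : Plane → Plane} (hτ : ContDiffAt ℝ ∞ τ z) : MatSmooth (jacobian τ) z :=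
  fun a i => (contDiffAt_component hτ a).pd i

lemma fderiv_basisVec {τ : Plane → Plane} (hτ : DifferentiableAt ℝ τ z) (i : Fin 2) :
    fderiv ℝ τ z (basisVec i) = ∑ a, jacobian τ z a i • basisVec a := by
  have h : ∀ a, jacobian τ z a i = fderiv ℝ τ z (basisVec i) a := by
    intro a
    have h1 := ((EuclideanSpace.proj a : Plane →L[ℝ] ℝ).hasFDerivAt (x := τ z)).comp z hτ.hasFDerivAt
    have h2 : fderiv ℝ (fun w => τ w a) z = (EuclideanSpace.proj a : Plane →L[ℝ] ℝ).comp (fderiv ℝ τ z) :=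
      h1.fderiv
    rw [jacobian_apply, pd, h2]; rfl
  ext b
  fin_cases b <;> simp [h, basisVec, Fin.sum_univ_two]

/-- The chain rule for partial derivatives. -/
lemma pd_comp {F : Type*} [NormedAddCommGroup F] [NormedSpace ℝ F] {f : Plane → F} {τ : Plane → Plane}
    (hf : DifferentiableAt ℝ f (τ z)) (hτ : DifferentiableAt ℝ τ z) (i : Fin 2) :
    pd i (fun w => f (τ w)) z = ∑ a, jacobian τ z a i • pd a f (τ z) := by
  have : fderiv ℝ (fun w => f (τ w)) z = (fderiv ℝ f (τ z)).comp (fderiv ℝ τ z) :=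
    fderiv_comp z hf hτ
  rw [pd, this, ContinuousLinearMap.comp_apply, fderiv_basisVec hτ, map_sum]
  simp [pd]

lemma mpd_comp {τ : Plane → Plane} (hA : MatSmooth A (τ z)) (hτ : ContDiffAt ℝ ∞ τ z) (i : Fin 2) :
    mpd i (fun w => A (τ w)) z = ∑ a, jacobian τ z a i • mpd a A (τ z) := by
  ext b c
  rw [mpd_apply, pd_comp (f := fun w => A w b c) (hA b c).diffAt_top hτ.diffAt_top]
  simp [Fin.sum_univ_two, mpd_apply]

lemma MatSmooth.comp {τ : Plane → Plane} (hA : MatSmooth A (τ z)) (hτ : ContDiffAt ℝ ∞ τ z) :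
    MatSmooth (fun w => A (τ w)) z :=
  fun a b => (hA a b).comp z hτ

end MatrixCalculus

section Curvature

/-- The Christoffel symbols of a metric on the plane. -/
def planeChristoffel (g : Plane → Mat) (k i j : Fin 2) (y : Plane) : ℝ :=
  ∑ l : Fin 2, (1 / 2) * (g y)⁻¹ k l *
    (pd i (fun z => g z j l) y + pd j (fun z => g z i l) y - pd l (fun z => g z i j) y)

/-- The curvature tensor of a metric on the plane. -/
def planeCurvature (g : Plane → Mat) (i l j k : Fin 2) (y : Plane) : ℝ :=
  pd j (planeChristoffel g i k l) y - pd k (planeChristoffel g i j l) y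
    + ∑ m : Fin 2, planeChristoffel g m k l y * planeChristoffel g i j m y
    - ∑ m : Fin 2, planeChristoffel g m j l y * planeChristoffel g i k m y

/-- The scalar curvature of a metric on the plane. -/
def planeScalar (g : Plane → Mat) (y : Plane) : ℝ :=
  ∑ a : Fin 2, ∑ c : Fin 2, (g y)⁻¹ a c * ∑ i : Fin 2, planeCurvature g i a i c y

/-- The connection matrices `(Γᵢ)ᵏⱼ`. -/
def connection (g : Plane → Mat) (i : Fin 2) (y : Plane) : Mat :=
  Matrix.of fun k j => planeChristoffel g k i j y

/-- The lowered Christoffel symbols. -/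
def lowered (g : Plane → Mat) (i : Fin 2) (y : Plane) : Mat :=
  Matrix.of fun k j => (1 / 2) *
    (pd i (fun z => g z j k) y + pd j (fun z => g z i k) y - pd k (fun z => g z i j) y)

/-- The curvature matrix `R(∂₀, ∂₁)`. -/
def curvatureMatrix (g : Plane → Mat) (y : Plane) : Mat :=
  mpd 0 (connection g 1) y - mpd 1 (connection g 0) y
    + connection g 0 y * connection g 1 y - connection g 1 y * connection g 0 y

lemma connection_eq (g : Plane → Mat) (i : Fin 2) (y : Plane) :
    connection g i y = (g y)⁻¹ * lowered g i y := by
  ext k j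
  simp only [connection, lowered, planeChristoffel, Matrix.of_apply, Matrix.mul_apply]
  exact Finset.sum_congr rfl fun l _ => by ring

lemma planeScalar_eq (g : Plane → Mat) (y : Plane) :
    planeScalar g y = (curvatureMatrix g y * (g y)⁻¹) 0 1 - (curvatureMatrix g y * (g y)⁻¹) 1 0 := by
  have h : ∀ i l j k, planeCurvature g i l j k y = (mpd j (connection g k) y - mpd k (connection g j) y
      + connection g j y * connection g k y - connection g k y * connection g j y) i l := by
    intro i l j k
    simp only [planeCurvature, mpd, connection, Matrix.sub_apply, Matrix.add_apply, Matrix.of_apply,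
      Matrix.mul_apply, Fin.sum_univ_two]
    ring
  simp only [planeScalar, h, Fin.sum_univ_two, curvatureMatrix, Matrix.mul_apply, Matrix.sub_apply,
    Matrix.add_apply]
  ring

/-- Uniqueness of the Levi-Civita connection. -/
lemma lowered_eq_of_compatible {g : Plane → Mat} {y : Plane} {C : Fin 2 → Mat}
    (htors : ∀ i j k, C i k j = C j k i)
    (hcomp : ∀ i, mpd i g y = (g y * C i).transpose + g y * C i) (i : Fin 2) :
    lowered g i y = g y * C i := by
  have h : ∀ i j l, pd i (fun z => g z j l) y = (g y * C i) l j + (g y * C i) j l := fun i j l =>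
    congrFun (congrFun (hcomp i) j) l
  have hs : ∀ i j l, (g y * C i) l j = (g y * C j) l i := by
    intro i j l
    simp only [Matrix.mul_apply]
    exact Finset.sum_congr rfl fun m _ => by rw [htors i j m]
  ext k j
  simp only [lowered, Matrix.of_apply, h]
  linear_combination (1 / 2) * (hs j i k) + (1 / 2) * hs i k j + (1 / 2) * hs j k i

lemma matSmooth_lowered {g : Plane → Mat} {y : Plane} (hg : MatSmooth g y) (i : Fin 2) :
    MatSmooth (lowered g i) y := by
  intro a b
  exact contDiffAt_const.mul ((((hg b a).pd i).add ((hg i a).pd b)).sub ((hg i b).pd a))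

lemma matSmooth_connection {g : Plane → Mat} {y : Plane} (hg : MatSmooth g y) (hd : (g y).det ≠ 0)
    (i : Fin 2) : MatSmooth (connection g i) y := by
  have : connection g i = fun y => (g y)⁻¹ * lowered g i y := funext (connection_eq g i)
  rw [this]
  exact (hg.inv hd).mul (matSmooth_lowered hg i)

lemma connection_symm {g : Plane → Mat} {y : Plane} (hs : ∀ᶠ z in 𝓝 y, (g z).transpose = g z)
    (i j k : Fin 2) : connection g i y k j = connection g j y k i := by
  have h : ∀ a b i, pd i (fun z => g z a b) y = pd i (fun z => g z b a) y := fun a b i =>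
    pd_congr (hs.mono fun z hz => by
      have := congrFun (congrFun hz b) a
      simpa using this) i
  simp only [connection, planeChristoffel, Matrix.of_apply]
  refine Finset.sum_congr rfl fun l _ => ?_
  rw [h i j l]; ring

lemma mul_connection {g : Plane → Mat} {y : Plane} (hd : (g y).det ≠ 0) (i : Fin 2) :
    g y * connection g i y = lowered g i y := by
  rw [connection_eq, ← Matrix.mul_assoc, Matrix.mul_nonsing_inv _ (isUnit_iff_ne_zero.2 hd),
    Matrix.one_mul]

lemma connection_compatible {g : Plane → Mat} {y : Plane} (hs : ∀ᶠ z in 𝓝 y, (g z).transpose = g z)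
    (hd : (g y).det ≠ 0) (i : Fin 2) :
    mpd i g y = (g y * connection g i y).transpose + g y * connection g i y := by
  have h : ∀ a b i, pd i (fun z => g z a b) y = pd i (fun z => g z b a) y := fun a b i =>
    pd_congr (hs.mono fun z hz => by
      have := congrFun (congrFun hz b) a
      simpa using this) i
  rw [mul_connection hd]
  ext j l
  simp only [mpd_apply, Matrix.add_apply, Matrix.transpose_apply, lowered, Matrix.of_apply]
  rw [h l j i, h i j l, h i l j]
  ring

/-- The transformation law of the Levi-Civita connection. -/
lemma jacobian_mul_connection {g g' : Plane → Mat} {τ : Plane → Plane} {z : Plane}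
    (hτ : ContDiffAt ℝ ∞ τ z) (hJ : (jacobian τ z).det ≠ 0)
    (hg' : MatSmooth g' (τ z)) (hs : ∀ᶠ w in 𝓝 (τ z), (g' w).transpose = g' w)
    (hd : (g' (τ z)).det ≠ 0)
    (h : ∀ᶠ w in 𝓝 z, g w = (jacobian τ w).transpose * g' (τ w) * jacobian τ w) (i : Fin 2) :
    jacobian τ z * connection g i z
      = mpd i (jacobian τ) z + (∑ a, jacobian τ z a i • connection g' a (τ z)) * jacobian τ z := by
  have hJs := matSmooth_jacobian hτ
  set J := jacobian τ with hJdef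
  have hJu : IsUnit (J z).det := isUnit_iff_ne_zero.2 hJ
  set T : Fin 2 → Mat := fun i => ∑ a, J z a i • connection g' a (τ z) with hT
  set D : Fin 2 → Mat := fun i => mpd i J z + T i * J z with hD
  have hDs : ∀ i j k, D i k j = D j k i := by
    intro i j k
    have h1 : mpd i J z k j = mpd j J z k i := pd_comm (contDiffAt_component hτ k) i j
    have h2 : (T i * J z) k j = (T j * J z) k i := by
      have hc := fun a b c => connection_symm hs a b c
      simp only [hT, Matrix.mul_apply, Fin.sum_univ_two, Matrix.add_apply, Matrix.smul_apply,
        smul_eq_mul]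
      rw [hc 1 0 k]; ring
    simp only [hD, Matrix.add_apply, h1, h2]
  have hgz := h.self_of_nhds
  have hgd : IsUnit (g z).det := by
    rw [hgz, Matrix.det_mul, Matrix.det_mul, Matrix.det_transpose]
    exact isUnit_iff_ne_zero.2 (mul_ne_zero (mul_ne_zero hJ hd) hJ)
  have hgC : ∀ i, g z * ((J z)⁻¹ * D i) = (J z).transpose * g' (τ z) * D i := by
    intro i
    rw [hgz, Matrix.mul_assoc _ (J z), ← Matrix.mul_assoc (J z), Matrix.mul_nonsing_inv _ hJu,
      Matrix.one_mul]
  have key := lowered_eq_of_compatible (g := g) (y := z) (C := fun i => (J z)⁻¹ * D i)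
    (fun i j k => by
      simp only [Matrix.mul_apply]
      exact Finset.sum_congr rfl fun m _ => by rw [hDs i j m])
    (fun i => by
      have hst := hs.self_of_nhds
      rw [hgC, mpd_congr h, mpd_mul (hJs.transpose.mul (hg'.comp hτ)) hJs,
        mpd_mul hJs.transpose (hg'.comp hτ), mpd_transpose, mpd_comp hg' hτ]
      have : ∑ a, J z a i • mpd a g' (τ z) = (g' (τ z) * T i).transpose + g' (τ z) * T i := by
        simp only [hT, connection_compatible hs hd, Fin.sum_univ_two, Matrix.mul_add,
          Matrix.transpose_add, Matrix.mul_smul, Matrix.transpose_smul, smul_add]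
        abel
      rw [this]
      simp only [hD, Matrix.transpose_mul, Matrix.transpose_add, Matrix.transpose_transpose, hst]
      noncomm_ring) i
  have h3 : connection g i z = (J z)⁻¹ * D i := by
    rw [connection_eq, key, ← Matrix.mul_assoc, Matrix.nonsing_inv_mul _ hgd, Matrix.one_mul]
  rw [h3, ← Matrix.mul_assoc, Matrix.mul_nonsing_inv _ hJu, Matrix.one_mul]

/-- The scalar curvature is invariant under changes of coordinates. -/
theorem planeScalar_comp {g g' : Plane → Mat} {τ : Plane → Plane} {z₀ : Plane}
    (hτ : ∀ᶠ z in 𝓝 z₀, ContDiffAt ℝ ∞ τ z) (hJ : (jacobian τ z₀).det ≠ 0)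
    (hg' : ∀ᶠ z in 𝓝 (τ z₀), MatSmooth g' z) (hs : ∀ᶠ z in 𝓝 (τ z₀), (g' z).transpose = g' z)
    (hd : (g' (τ z₀)).det ≠ 0)
    (h : ∀ᶠ z in 𝓝 z₀, g z = (jacobian τ z).transpose * g' (τ z) * jacobian τ z) :
    planeScalar g z₀ = planeScalar g' (τ z₀) := by
  have hτ0 := hτ.self_of_nhds
  have hJs := matSmooth_jacobian hτ0
  have hcont : Tendsto τ (𝓝 z₀) (𝓝 (τ z₀)) := hτ0.continuousAt
  have hg0 := hg'.self_of_nhds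
  have hd' : ∀ᶠ z in 𝓝 (τ z₀), (g' z).det ≠ 0 := (hg0.det.continuousAt).eventually_ne hd
  have hJd : ∀ᶠ z in 𝓝 z₀, (jacobian τ z).det ≠ 0 := (hJs.det.continuousAt).eventually_ne hJ
  have hgauge : ∀ i, (fun z => jacobian τ z * connection g i z) =ᶠ[𝓝 z₀]
      fun z => mpd i (jacobian τ) z + (∑ a, jacobian τ z a i • connection g' a (τ z)) * jacobian τ z := by
    intro i
    filter_upwards [hτ, hJd, hcont.eventually hg', hcont.eventually hs.eventually_nhds,
      hcont.eventually hd', h.eventually_nhds] with z h1 h2 h3 h4 h5 h6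
    exact jacobian_mul_connection h1 h2 h3 h4 h5 h6 i
  have hg : MatSmooth g z₀ := by
    have := (hJs.transpose.mul (hg0.comp hτ0)).mul hJs
    intro a b
    exact (this a b).congr_of_eventuallyEq (h.mono fun z hz => by simp only [hz])
  have hgz := h.self_of_nhds
  set J := jacobian τ with hJdef
  have hgd : (g z₀).det ≠ 0 := by
    rw [hgz, Matrix.det_mul, Matrix.det_mul, Matrix.det_transpose]
    exact mul_ne_zero (mul_ne_zero hJ hd) hJ
  have hG' := fun a => matSmooth_connection hg0 hd a
  have hΓ := fun a => matSmooth_connection hg hgd a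
  let T : Fin 2 → Plane → Mat := fun i z => ∑ a, J z a i • connection g' a (τ z)
  have hTe : ∀ i, T i = fun z => J z 0 i • connection g' 0 (τ z) + J z 1 i • connection g' 1 (τ z) :=
    fun i => funext fun z => by simp [T, Fin.sum_univ_two]
  have hT : ∀ i, MatSmooth (T i) z₀ := fun i => by
    rw [hTe]
    exact (MatSmooth.smul (hJs 0 i) ((hG' 0).comp hτ0)).add (MatSmooth.smul (hJs 1 i) ((hG' 1).comp hτ0))
  have hdT : ∀ m i, mpd m (T i) z₀ = ∑ a, (mpd m J z₀ a i • connection g' a (τ z₀)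
      + J z₀ a i • ∑ b, J z₀ b m • mpd b (connection g' a) (τ z₀)) := by
    intro m i
    rw [hTe, mpd_add (MatSmooth.smul (hJs 0 i) ((hG' 0).comp hτ0))
      (MatSmooth.smul (hJs 1 i) ((hG' 1).comp hτ0)), mpd_smul (hJs 0 i) ((hG' 0).comp hτ0),
      mpd_smul (hJs 1 i) ((hG' 1).comp hτ0), mpd_comp (hG' 0) hτ0, mpd_comp (hG' 1) hτ0]
    simp [Fin.sum_univ_two, mpd_apply, hJdef]
  have h0 := (hgauge 0).self_of_nhds
  have h1 := (hgauge 1).self_of_nhds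
  have d1 : mpd 0 J z₀ * connection g 1 z₀ + J z₀ * mpd 0 (connection g 1) z₀
      = mpd 0 (mpd 1 J) z₀ + (mpd 0 (T 1) z₀ * J z₀ + T 1 z₀ * mpd 0 J z₀) := by
    rw [← mpd_mul hJs (hΓ 1), mpd_congr (hgauge 1), mpd_add (hJs.mpd 1) ((hT 1).mul hJs),
      mpd_mul (hT 1) hJs]
  have d0 : mpd 1 J z₀ * connection g 0 z₀ + J z₀ * mpd 1 (connection g 0) z₀
      = mpd 1 (mpd 0 J) z₀ + (mpd 1 (T 0) z₀ * J z₀ + T 0 z₀ * mpd 1 J z₀) := by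
    rw [← mpd_mul hJs (hΓ 0), mpd_congr (hgauge 0), mpd_add (hJs.mpd 0) ((hT 0).mul hJs),
      mpd_mul (hT 0) hJs]
  have hJF : J z₀ * curvatureMatrix g z₀
      = (mpd 0 (T 1) z₀ - mpd 1 (T 0) z₀ + T 0 z₀ * T 1 z₀ - T 1 z₀ * T 0 z₀) * J z₀ := by
    have e0 : mpd 0 J z₀ = J z₀ * connection g 0 z₀ - T 0 z₀ * J z₀ := eq_sub_of_add_eq h0.symm
    have e1 : mpd 1 J z₀ = J z₀ * connection g 1 z₀ - T 1 z₀ * J z₀ := eq_sub_of_add_eq h1.symm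
    have f1 : J z₀ * mpd 0 (connection g 1) z₀ = mpd 0 (mpd 1 J) z₀
        + (mpd 0 (T 1) z₀ * J z₀ + T 1 z₀ * mpd 0 J z₀) - mpd 0 J z₀ * connection g 1 z₀ :=
      eq_sub_of_add_eq' d1
    have f0 : J z₀ * mpd 1 (connection g 0) z₀ = mpd 1 (mpd 0 J) z₀
        + (mpd 1 (T 0) z₀ * J z₀ + T 0 z₀ * mpd 1 J z₀) - mpd 1 J z₀ * connection g 0 z₀ :=
      eq_sub_of_add_eq' d0
    rw [curvatureMatrix, Matrix.mul_sub, Matrix.mul_add, Matrix.mul_sub, f1, f0, mpd_comm hJs 0 1,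
      e0, e1]
    noncomm_ring
  have hT' : mpd 0 (T 1) z₀ - mpd 1 (T 0) z₀ + T 0 z₀ * T 1 z₀ - T 1 z₀ * T 0 z₀
      = (J z₀).det • curvatureMatrix g' (τ z₀) := by
    have hsym : ∀ a, mpd 0 J z₀ a 1 = mpd 1 J z₀ a 0 := fun a =>
      pd_comm (contDiffAt_component hτ0 a) 0 1
    rw [hdT, hdT, hTe, hTe, Matrix.det_fin_two]
    simp only [curvatureMatrix, Fin.sum_univ_two, hsym]
    ext a b
    simp only [Matrix.add_apply, Matrix.sub_apply, Matrix.smul_apply, Matrix.mul_apply,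
      Fin.sum_univ_two, smul_eq_mul]
    ring
  have hJu : IsUnit (J z₀).det := isUnit_iff_ne_zero.2 hJ
  have hJtu : IsUnit (J z₀).transpose.det := by rwa [Matrix.det_transpose]
  have hS : J z₀ * (curvatureMatrix g z₀ * (g z₀)⁻¹) * (J z₀).transpose
      = (J z₀).det • (curvatureMatrix g' (τ z₀) * (g' (τ z₀))⁻¹) := by
    rw [← Matrix.mul_assoc (J z₀), hJF, hT', hgz, Matrix.mul_inv_rev, Matrix.mul_inv_rev]
    rw [Matrix.smul_mul, Matrix.smul_mul, Matrix.smul_mul]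
    congr 1
    calc curvatureMatrix g' (τ z₀) * J z₀ * ((J z₀)⁻¹ * ((g' (τ z₀))⁻¹ * (J z₀).transpose⁻¹))
          * (J z₀).transpose
        = curvatureMatrix g' (τ z₀) * (J z₀ * (J z₀)⁻¹) * (g' (τ z₀))⁻¹
          * ((J z₀).transpose⁻¹ * (J z₀).transpose) := by noncomm_ring
      _ = _ := by
        rw [Matrix.mul_nonsing_inv _ hJu, Matrix.nonsing_inv_mul _ hJtu]; simp
  rw [planeScalar_eq, planeScalar_eq]
  have e1 := congrFun (congrFun hS 0) 1
  have e2 := congrFun (congrFun hS 1) 0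
  simp only [Matrix.mul_apply (M := J z₀), Matrix.mul_apply (N := (J z₀).transpose), Fin.sum_univ_two,
    Matrix.transpose_apply, Matrix.smul_apply, smul_eq_mul, Matrix.det_fin_two] at e1 e2
  rw [Matrix.det_fin_two] at hJ
  apply mul_left_cancel₀ hJ
  linear_combination e1 - e2

lemma pd_zero_of_axis_const {F : Type*} [NormedAddCommGroup F] [NormedSpace ℝ F] {f : Plane → F} {c : F}
    {x : ℝ} (hf : DifferentiableAt ℝ f (pt x 0)) (h : ∀ᶠ t in 𝓝 x, f (pt t 0) = c) :
    pd 0 f (pt x 0) = 0 := by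
  have h1 : HasDerivAt (fun t => f (pt t 0)) (pd 0 f (pt x 0)) x := hasDerivAt_pt_zero hf
  have h2 : HasDerivAt (fun _ : ℝ => c) (0 : F) x := hasDerivAt_const x c
  exact (h2.congr_of_eventuallyEq h).unique h1 |>.symm

/-- The scalar curvature at a point of the first axis, in coordinates in which the metric is
a multiple of the identity to first order up to a trace-free diagonal part. -/
theorem planeScalar_axis {g : Plane → Mat} {x c : ℝ} (hgn : ∀ᶠ z in 𝓝 (pt x 0), MatSmooth g z)
    (hc : c ≠ 0)
    (hs : ∀ᶠ z in 𝓝 (pt x 0), g z 1 0 = g z 0 1)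
    (haxis : ∀ᶠ t in 𝓝 x, g (pt t 0) = c • (1 : Mat))
    (h01 : ∀ᶠ t in 𝓝 x, pd 1 (fun z => g z 0 1) (pt t 0) = 0)
    (htr : pd 1 (fun z => g z 0 0) (pt x 0) + pd 1 (fun z => g z 1 1) (pt x 0) = 0) :
    planeScalar g (pt x 0) = - pd 1 (pd 1 (fun z => g z 0 0)) (pt x 0) / c ^ 2 := by
  have hgx := haxis.self_of_nhds
  have hg := hgn.self_of_nhds
  have hd : (g (pt x 0)).det ≠ 0 := by rw [hgx]; simp [hc]
  have hgnear : ∀ᶠ t in 𝓝 x, ∀ a b, ContDiffAt ℝ ∞ (fun z => g z a b) (pt t 0) := by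
    have hp : Tendsto (fun t : ℝ => pt t 0) (𝓝 x) (𝓝 (pt x 0)) :=
      (contDiff_pt.comp (contDiff_id.prodMk (contDiff_const (c := (0 : ℝ))))).continuous.tendsto x
    exact (hp.eventually hgn).mono fun t ht => ht
  have hD0 : ∀ᶠ t in 𝓝 x, ∀ a b, pd 0 (fun z => g z a b) (pt t 0) = 0 := by
    filter_upwards [hgnear, haxis.eventually_nhds] with t h1 h2 a b
    exact pd_zero_of_axis_const (h1 a b).diffAt_top (c := (c • (1 : Mat)) a b)
      (h2.mono fun t ht => by rw [ht])
  have hD00 : ∀ a b, pd 0 (pd 0 (fun z => g z a b)) (pt x 0) = 0 := fun a b =>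
    pd_zero_of_axis_const ((hg a b).pd 0).diffAt_top (c := 0) (hD0.mono fun t ht => ht a b)
  have hD01 : pd 0 (pd 1 (fun z => g z 0 1)) (pt x 0) = 0 :=
    pd_zero_of_axis_const ((hg 0 1).pd 1).diffAt_top (c := 0) h01
  have hD10 : pd 1 (pd 0 (fun z => g z 0 1)) (pt x 0) = 0 := by rw [pd_comm (hg 0 1)]; exact hD01
  have hs' : ∀ i, pd i (fun z => g z 1 0) =ᶠ[𝓝 (pt x 0)] pd i (fun z => g z 0 1) := fun i =>
    hs.eventually_nhds.mono fun z hz => pd_congr hz i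
  have hs0 : ∀ i, pd i (fun z => g z 1 0) (pt x 0) = pd i (fun z => g z 0 1) (pt x 0) := fun i =>
    (hs' i).self_of_nhds
  have hs2 : ∀ m i, pd m (pd i (fun z => g z 1 0)) (pt x 0) = pd m (pd i (fun z => g z 0 1)) (pt x 0) :=
    fun m i => pd_congr (hs' i) m
  have hdl : ∀ m i k j, mpd m (lowered g i) (pt x 0) k j = (1 / 2) * (pd m (pd i (fun z => g z j k)) (pt x 0)
      + pd m (pd j (fun z => g z i k)) (pt x 0) - pd m (pd k (fun z => g z i j)) (pt x 0)) := by
    intro m i k j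
    have d := fun a b e => ((hg a b).pd e).diffAt_top
    simp only [mpd_apply, lowered, Matrix.of_apply]
    refine (pd_mul (differentiableAt_const _) (((d j k i).add (d i k j)).sub (d i j k)) m).trans ?_
    rw [pd_const, zero_mul, zero_add]
    congr 1
    refine (pd_sub ((d j k i).add (d i k j)) (d i j k) m).trans ?_
    congr 1
    exact pd_add (d j k i) (d i k j) m
  have hΓ := fun a => matSmooth_connection hg hd a
  have hgΓ : ∀ i, (fun z => g z * connection g i z) =ᶠ[𝓝 (pt x 0)] lowered g i := fun i =>
    (hg.det.continuousAt.eventually_ne hd).mono fun z hz => mul_connection hz i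
  have e : ∀ m i a b, (mpd m g (pt x 0) * connection g i (pt x 0)) a b
      + c * mpd m (connection g i) (pt x 0) a b = mpd m (lowered g i) (pt x 0) a b := by
    intro m i a b
    rw [← mpd_congr (hgΓ i), mpd_mul hg (hΓ i), hgx]
    simp
  have hC : ∀ i a b, connection g i (pt x 0) a b = c⁻¹ * lowered g i (pt x 0) a b := by
    intro i a b
    rw [← mul_connection hd, hgx]
    simp [hc]
  have h01' := h01.self_of_nhds
  have hD0' := hD0.self_of_nhds
  have hinv : (g (pt x 0))⁻¹ = c⁻¹ • (1 : Mat) := by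
    rw [hgx]
    refine Matrix.inv_eq_left_inv ?_
    simp [hc]
  have q1 := e 0 1 0 1
  have q2 := e 0 1 1 0
  have q3 := e 1 0 0 1
  have q4 := e 1 0 1 0
  simp only [Matrix.mul_apply, Fin.sum_univ_two, hdl, hC, lowered, Matrix.of_apply, hs2, hs0,
    hD00, hD01, hD10, hD0', h01', mpd_apply _ g] at q1 q2 q3 q4
  rw [planeScalar_eq, hinv]
  simp only [curvatureMatrix, Matrix.mul_apply, Fin.sum_univ_two, Matrix.add_apply, Matrix.sub_apply, hC,
    lowered, Matrix.of_apply, hs0, hD0', h01', Matrix.smul_apply, Matrix.one_apply, smul_eq_mul]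
  have h11 : pd 1 (fun z => g z 1 1) (pt x 0) = - pd 1 (fun z => g z 0 0) (pt x 0) := by linarith
  simp only [h11] at q1 q2 q3 q4 ⊢
  set p := pd 1 (fun z => g z 0 0) (pt x 0)
  set r := pd 1 (pd 1 (fun z => g z 0 0)) (pt x 0)
  field_simp at q1 q2 q3 q4 ⊢
  norm_num [hc] at q1 q2 q3 q4 ⊢
  rw [q1, q2]
  linear_combination (-2) * q3 + 2 * q4

end Curvature

section LocalParametrization

variable {H : Type*} [TopologicalSpace H] (I : ModelWithCorners ℝ Plane H)
  {M : Type*} [TopologicalSpace M] [ChartedSpace H M]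

/-- The vector `∂ᵢΘ` of a map of the plane into a surface. -/
def paramVec (Θ : Plane → M) (z : Plane) (i : Fin 2) : TangentSpace I (Θ z) :=
  mfderiv 𝓘(ℝ, Plane) I Θ z (basisVec i)

/-- The components of the pull-back of a 1-form. -/
def pullForm (A : ∀ x : M, TangentSpace I x →L[ℝ] ℝ) (Θ : Plane → M) (i : Fin 2) (z : Plane) : ℝ :=
  A (Θ z) (paramVec I Θ z i)

/-- The matrix of the pull-back of the metric. -/
def pullMetric [RiemannianBundle (fun x : M => TangentSpace I x)] (Θ : Plane → M) (z : Plane) : Mat :=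
  Matrix.of fun i j => inner ℝ (paramVec I Θ z i) (paramVec I Θ z j)

/-- A diffeomorphism of an open subset of the plane onto an open subset of the interior of
a surface. -/
structure IsLocalParam (Θ : Plane → M) (Ξ : M → Plane) (U : Set Plane) : Prop where
  isOpen : IsOpen U
  smooth : ContMDiffOn 𝓘(ℝ, Plane) I ∞ Θ U
  smooth_inv : ContMDiffOn I 𝓘(ℝ, Plane) ∞ Ξ (Θ '' U)
  left_inv : ∀ z ∈ U, Ξ (Θ z) = z
  isOpen_image : IsOpen (Θ '' U)
  image_subset : Θ '' U ⊆ I.interior M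

section Transition

variable {I}

lemma mfderiv_comp_basisVec {N : Type*} {E' : Type*} [NormedAddCommGroup E'] [NormedSpace ℝ E']
    {H' : Type*} [TopologicalSpace H'] {I' : ModelWithCorners ℝ E' H'} [TopologicalSpace N]
    [ChartedSpace H' N] {Θ Θ' : Plane → N} {τ : Plane → Plane} {z : Plane}
    (hτ : DifferentiableAt ℝ τ z) (hΘ : MDifferentiableAt 𝓘(ℝ, Plane) I' Θ' (τ z))
    (h : Θ =ᶠ[𝓝 z] fun w => Θ' (τ w)) (i : Fin 2) :
    (mfderiv 𝓘(ℝ, Plane) I' Θ z (basisVec i) : E')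
      = ∑ a, jacobian τ z a i • (mfderiv 𝓘(ℝ, Plane) I' Θ' (τ z) (basisVec a) : E') := by
  have h1 : mfderiv 𝓘(ℝ, Plane) I' Θ z = mfderiv 𝓘(ℝ, Plane) I' (Θ' ∘ τ) z := h.mfderiv_eq
  have h2 : mfderiv 𝓘(ℝ, Plane) I' (Θ' ∘ τ) z
      = (mfderiv 𝓘(ℝ, Plane) I' Θ' (τ z)).comp (mfderiv 𝓘(ℝ, Plane) 𝓘(ℝ, Plane) τ z) :=
    mfderiv_comp z hΘ hτ.mdifferentiableAt
  have h3 : (mfderiv 𝓘(ℝ, Plane) I' Θ z (basisVec i) : E')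
      = mfderiv 𝓘(ℝ, Plane) I' Θ' (τ z) (fderiv ℝ τ z (basisVec i)) := by
    rw [← mfderiv_eq_fderiv]
    exact congrArg (fun L : Plane →L[ℝ] E' => L (basisVec i)) (h1.trans h2)
  rw [h3, fderiv_basisVec hτ]
  exact (map_sum (mfderiv 𝓘(ℝ, Plane) I' Θ' (τ z)) _ _).trans
    (Finset.sum_congr rfl fun a _ => map_smul (mfderiv 𝓘(ℝ, Plane) I' Θ' (τ z)) _ _)

lemma pullForm_comp {A : ∀ x : M, TangentSpace I x →L[ℝ] ℝ} {Θ Θ' : Plane → M} {τ : Plane → Plane}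
    {z : Plane} (hτ : DifferentiableAt ℝ τ z) (hΘ : MDifferentiableAt 𝓘(ℝ, Plane) I Θ' (τ z))
    (h : Θ =ᶠ[𝓝 z] fun w => Θ' (τ w)) (i : Fin 2) :
    pullForm I A Θ i z = ∑ a, jacobian τ z a i * pullForm I A Θ' a (τ z) := by
  have key := mfderiv_comp_basisVec hτ hΘ h i
  let A' : M → Plane →L[ℝ] ℝ := A
  have h1 : pullForm I A Θ i z = A' (Θ' (τ z)) (paramVec I Θ z i : Plane) := by
    have hz : Θ z = Θ' (τ z) := h.self_of_nhds
    rw [← hz]; rfl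
  exact (h1.trans (congrArg (A' (Θ' (τ z))) key)).trans ((map_sum (A' (Θ' (τ z))) _ _).trans
    (Finset.sum_congr rfl fun a _ => map_smul (A' (Θ' (τ z))) _ _))

lemma pullMetric_comp [RiemannianBundle (fun x : M => TangentSpace I x)]
    {Θ Θ' : Plane → M} {τ : Plane → Plane}
    {z : Plane} (hτ : DifferentiableAt ℝ τ z) (hΘ : MDifferentiableAt 𝓘(ℝ, Plane) I Θ' (τ z))
    (h : Θ =ᶠ[𝓝 z] fun w => Θ' (τ w)) :
    pullMetric I Θ z = (jacobian τ z).transpose * pullMetric I Θ' (τ z) * jacobian τ z := by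
  have key := mfderiv_comp_basisVec hτ hΘ h
  let met : M → Plane → Plane → ℝ := fun x v w => inner ℝ (E := TangentSpace I x) v w
  have h1 : ∀ i j, pullMetric I Θ z i j
      = met (Θ' (τ z)) (paramVec I Θ z i : Plane) (paramVec I Θ z j : Plane) := by
    intro i j
    have hz : Θ z = Θ' (τ z) := h.self_of_nhds
    rw [← hz]; rfl
  ext i j
  rw [h1]
  have h2 : met (Θ' (τ z)) (paramVec I Θ z i : Plane) (paramVec I Θ z j : Plane)
      = inner ℝ (∑ a, jacobian τ z a i • paramVec I Θ' (τ z) a)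
        (∑ a, jacobian τ z a j • paramVec I Θ' (τ z) a) :=
    congrArg₂ (met (Θ' (τ z))) (key i) (key j)
  rw [h2]
  simp only [Fin.sum_univ_two, inner_add_left, inner_add_right, real_inner_smul_left,
    real_inner_smul_right, Matrix.mul_apply, Matrix.transpose_apply, pullMetric, Matrix.of_apply]
  ring

end Transition

section Chart

variable {I}
variable [IsManifold I ∞ M]

lemma extChartAt_mem_interior {x q : M} (hx : I.IsInteriorPoint x) (hq : x ∈ (extChartAt I q).source) :
    (extChartAt I q).target ∈ 𝓝 (extChartAt I q x) := by
  rw [extChartAt_source] at hq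
  have := (I.isInteriorPoint_iff_of_mem_atlas (n := ∞) (by simp) (chart_mem_atlas H q) hq).1 hx
  exact mem_interior_iff_mem_nhds.1 this

lemma range_mem_nhds_extChartAt {x q : M} (hx : I.IsInteriorPoint x) (hq : x ∈ (extChartAt I q).source) :
    range I ∈ 𝓝 (extChartAt I q x) :=
  mem_of_superset (extChartAt_mem_interior hx hq) (extChartAt_target_subset_range q)

lemma isLocalParam_extChart (q : M) :
    IsLocalParam I (extChartAt I q).symm (extChartAt I q) (interior (extChartAt I q).target) where
  isOpen := isOpen_interior
  smooth := (contMDiffOn_extChartAt_symm q).mono interior_subset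
  smooth_inv := by
    refine (contMDiffOn_extChartAt (x := q)).mono ?_
    rintro _ ⟨y, hy, rfl⟩
    have := (extChartAt I q).map_target (interior_subset hy)
    rwa [extChartAt_source] at this
  left_inv z hz := (extChartAt I q).right_inv (interior_subset hz)
  isOpen_image := by
    rw [(extChartAt I q).symm_image_eq_source_inter_preimage interior_subset, extChartAt_source]
    exact isOpen_extChartAt_preimage q isOpen_interior
  image_subset := by
    rintro _ ⟨y, hy, rfl⟩
    have h := (extChartAt I q).map_target (interior_subset hy)
    rw [extChartAt_source] at h
    refine (I.isInteriorPoint_iff_of_mem_atlas (n := ∞) (by simp) (chart_mem_atlas H q) h).2 ?_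
    have e := (extChartAt I q).right_inv (interior_subset hy)
    change extChartAt I q _ ∈ interior (extChartAt I q).target
    rw [e]; exact hy

lemma coordVec_eq {q : M} {y : Plane} (hy : range I ∈ 𝓝 y) (i : Fin 2) :
    coordVec I q y i = paramVec I (extChartAt I q).symm y i := by
  rw [coordVec, paramVec, mfderivWithin_of_mem_nhds hy]

lemma partialDeriv_eq {f : Plane → ℝ} {y : Plane} (hy : range I ∈ 𝓝 y) (i : Fin 2) :
    partialDeriv I i f y = pd i f y := by
  rw [partialDeriv, pd, fderivWithin_of_mem_nhds hy]

lemma coordForm_eq (A : ∀ x : M, TangentSpace I x →L[ℝ] ℝ) {q : M} {y : Plane} (hy : range I ∈ 𝓝 y)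
    (i : Fin 2) : coordForm I A q i y = pullForm I A (extChartAt I q).symm i y := by
  rw [coordForm, pullForm, coordVec_eq hy]

lemma eventually_coordForm_eq (A : ∀ x : M, TangentSpace I x →L[ℝ] ℝ) {q : M} {y : Plane}
    (hy : range I ∈ 𝓝 y) (i : Fin 2) :
    coordForm I A q i =ᶠ[𝓝 y] pullForm I A (extChartAt I q).symm i :=
  (eventually_mem_nhds_iff.2 hy).mono fun _ hz => coordForm_eq A hz i

variable [RiemannianBundle (fun x : M => TangentSpace I x)]

lemma gram_eq {q : M} {y : Plane} (hy : range I ∈ 𝓝 y) :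
    gram I q y = pullMetric I (extChartAt I q).symm y := by
  ext i j
  simp only [gram, pullMetric, Matrix.of_apply]
  rw [coordVec_eq hy, coordVec_eq hy]

lemma eventually_gram_eq {q : M} {y : Plane} (hy : range I ∈ 𝓝 y) :
    gram I q =ᶠ[𝓝 y] pullMetric I (extChartAt I q).symm :=
  (eventually_mem_nhds_iff.2 hy).mono fun _ hz => gram_eq hz

end Chart

namespace IsLocalParam

variable {I} {Θ : Plane → M} {Ξ : M → Plane} {U : Set Plane} {z : Plane}

lemma smoothAt (P : IsLocalParam I Θ Ξ U) (hz : z ∈ U) : ContMDiffAt 𝓘(ℝ, Plane) I ∞ Θ z :=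
  P.smooth.contMDiffAt (P.isOpen.mem_nhds hz)

lemma mdifferentiableAt (P : IsLocalParam I Θ Ξ U) (hz : z ∈ U) :
    MDifferentiableAt 𝓘(ℝ, Plane) I Θ z := (P.smoothAt hz).mdifferentiableAt (by simp)

lemma smoothAt_inv (P : IsLocalParam I Θ Ξ U) (hz : z ∈ U) :
    ContMDiffAt I 𝓘(ℝ, Plane) ∞ Ξ (Θ z) :=
  P.smooth_inv.contMDiffAt (P.isOpen_image.mem_nhds (mem_image_of_mem Θ hz))

lemma injOn (P : IsLocalParam I Θ Ξ U) : InjOn Θ U := fun z hz w hw h => by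
  rw [← P.left_inv z hz, h, P.left_inv w hw]

lemma isInteriorPoint (P : IsLocalParam I Θ Ξ U) (hz : z ∈ U) : I.IsInteriorPoint (Θ z) :=
  P.image_subset (mem_image_of_mem Θ hz)

lemma mono (P : IsLocalParam I Θ Ξ U) {V : Set Plane} (hV : IsOpen V) (h : V ⊆ U) :
    IsLocalParam I Θ Ξ V where
  isOpen := hV
  smooth := P.smooth.mono h
  smooth_inv := P.smooth_inv.mono (image_mono h)
  left_inv z hz := P.left_inv z (h hz)
  isOpen_image := by
    have : Θ '' V = Θ '' U ∩ Ξ ⁻¹' V := by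
      ext x; constructor
      · rintro ⟨z, hz, rfl⟩
        exact ⟨⟨z, h hz, rfl⟩, by rw [mem_preimage, P.left_inv z (h hz)]; exact hz⟩
      · rintro ⟨⟨z, hz, rfl⟩, hx⟩
        rw [mem_preimage, P.left_inv z hz] at hx
        exact ⟨z, hx, rfl⟩
    rw [this]
    exact P.smooth_inv.continuousOn.isOpen_inter_preimage P.isOpen_image hV
  image_subset := (image_mono h).trans P.image_subset

/-- The vectors `∂ᵢΘ` are linearly independent. -/
lemma mfderiv_inv_paramVec (P : IsLocalParam I Θ Ξ U) (hz : z ∈ U) (v : Plane) :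
    (mfderiv I 𝓘(ℝ, Plane) Ξ (Θ z) (mfderiv 𝓘(ℝ, Plane) I Θ z v) : Plane) = v := by
  have h1 : MDifferentiableAt I 𝓘(ℝ, Plane) Ξ (Θ z) := (P.smoothAt_inv hz).mdifferentiableAt (by simp)
  have h2 : mfderiv 𝓘(ℝ, Plane) 𝓘(ℝ, Plane) (Ξ ∘ Θ) z
      = (mfderiv I 𝓘(ℝ, Plane) Ξ (Θ z)).comp (mfderiv 𝓘(ℝ, Plane) I Θ z) :=
    mfderiv_comp z h1 (P.mdifferentiableAt hz)
  have h3 : (Ξ ∘ Θ) =ᶠ[𝓝 z] id := by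
    filter_upwards [P.isOpen.mem_nhds hz] with w hw using P.left_inv w hw
  have h4 : mfderiv 𝓘(ℝ, Plane) 𝓘(ℝ, Plane) (Ξ ∘ Θ) z = ContinuousLinearMap.id ℝ Plane := by
    rw [h3.mfderiv_eq]; exact mfderiv_id
  exact congrArg (fun L : Plane →L[ℝ] Plane => L v) (h2.symm.trans h4)

section Metric

variable [IsManifold I ∞ M]

lemma contMDiffAt_paramVec (P : IsLocalParam I Θ Ξ U) (hz : z ∈ U) (i : Fin 2) :
    ContMDiffAt 𝓘(ℝ, Plane) (I.prod 𝓘(ℝ, Plane)) ∞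
      (fun w => (TotalSpace.mk' Plane (Θ w) (paramVec I Θ w i) : TangentBundle I M)) z := by
  have : IsManifold I 1 M := IsManifold.of_le (n := ∞) (by simp)
  have h1 := P.smooth.contMDiffOn_tangentMapWithin (m := ∞) (by simp) P.isOpen.uniqueMDiffOn
  have h2 : ContMDiff 𝓘(ℝ, Plane) (𝓘(ℝ, Plane).prod 𝓘(ℝ, Plane)) ∞
      (fun w : Plane => (TotalSpace.mk' Plane w (basisVec i) : TangentBundle 𝓘(ℝ, Plane) Plane)) :=
    contMDiff_vectorSpace_iff_contDiff.2 contDiff_const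
  have h3 : ContMDiffOn 𝓘(ℝ, Plane) (I.prod 𝓘(ℝ, Plane)) ∞
      (fun w => tangentMapWithin 𝓘(ℝ, Plane) I Θ U (TotalSpace.mk' Plane w (basisVec i))) U :=
    h1.comp h2.contMDiffOn (fun w hw => hw)
  refine (h3.contMDiffAt (P.isOpen.mem_nhds hz)).congr_of_eventuallyEq ?_
  filter_upwards [P.isOpen.mem_nhds hz] with w hw
  simp only [tangentMapWithin, paramVec]
  rw [mfderivWithin_of_isOpen P.isOpen hw]

lemma contDiffAt_pullForm {A : ∀ x : M, TangentSpace I x →L[ℝ] ℝ} (hA : IsSmoothForm I A)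
    (P : IsLocalParam I Θ Ξ U) (hz : z ∈ U) (i : Fin 2) : ContDiffAt ℝ ∞ (pullForm I A Θ i) z := by
  have h1 := P.contMDiffAt_paramVec hz i
  have h2 : ContMDiffAt 𝓘(ℝ, Plane) (I.prod 𝓘(ℝ, Plane →L[ℝ] ℝ)) ∞
    (fun w => TotalSpace.mk' (Plane →L[ℝ] ℝ)
      (E := fun x : M => TangentSpace I x →L[ℝ] Bundle.Trivial M ℝ x) (Θ w) (A (Θ w))) z :=
    ContMDiffAt.comp z (hA (Θ z)) (P.smoothAt hz)
  have h3 := ContMDiffAt.clm_bundle_apply (F₁ := Plane) (F₂ := ℝ)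
    (E₁ := fun x : M => TangentSpace I x) (E₂ := Bundle.Trivial M ℝ) (b := Θ) h2 h1
  rw [contMDiffAt_totalSpace] at h3
  exact h3.2.contDiffAt

variable [RiemannianBundle (fun x : M => TangentSpace I x)]

lemma pullMetric_transpose (z : Plane) : (pullMetric I Θ z).transpose = pullMetric I Θ z := by
  ext i j
  simp only [pullMetric, Matrix.transpose_apply, Matrix.of_apply]
  exact real_inner_comm _ _

lemma det_pullMetric_pos (P : IsLocalParam I Θ Ξ U) (hz : z ∈ U) : 0 < (pullMetric I Θ z).det := by
  set e := paramVec I Θ z with he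
  have h0 : ∀ a b : ℝ, a • e 0 + b • e 1 = 0 → a = 0 ∧ b = 0 := by
    intro a b h
    have h1 : a • e 0 + b • e 1 = mfderiv 𝓘(ℝ, Plane) I Θ z (a • basisVec 0 + b • basisVec 1) :=
      ((map_add (mfderiv 𝓘(ℝ, Plane) I Θ z) _ _).trans (congrArg₂ (· + ·)
        (map_smul (mfderiv 𝓘(ℝ, Plane) I Θ z) a (basisVec 0))
        (map_smul (mfderiv 𝓘(ℝ, Plane) I Θ z) b (basisVec 1)))).symm
    have h2 := P.mfderiv_inv_paramVec hz (a • basisVec 0 + b • basisVec 1)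
    rw [← h1, h] at h2
    have h3 : (0 : Plane) = a • basisVec 0 + b • basisVec 1 := by
      refine Eq.trans ?_ h2
      exact (map_zero (mfderiv I 𝓘(ℝ, Plane) Ξ (Θ z))).symm
    constructor
    · have := congrArg (fun v : Plane => v 0) h3; simpa [basisVec] using this.symm
    · have := congrArg (fun v : Plane => v 1) h3; simpa [basisVec] using this.symm
  have hne : e 0 ≠ 0 := fun h => by simpa using (h0 1 0 (by simp [h])).1
  set p := inner ℝ (e 0) (e 0)
  set q := inner ℝ (e 0) (e 1)
  set r := inner ℝ (e 1) (e 1)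
  have hp : 0 < p := real_inner_self_pos.2 hne
  have hw : 0 < inner ℝ (q • e 0 - p • e 1) (q • e 0 - p • e 1) := by
    refine real_inner_self_pos.2 fun h => ?_
    have := (h0 q (-p) (by rw [← h]; module)).2
    linarith
  have hexp : inner ℝ (q • e 0 - p • e 1) (q • e 0 - p • e 1) = p * (p * r - q * q) := by
    simp only [inner_sub_left, inner_sub_right, real_inner_smul_left, real_inner_smul_right]
    rw [real_inner_comm (e 0) (e 1)]
    change q * (q * p) - q * (p * q) - (p * (q * q) - p * (p * r)) = _
    ring
  rw [hexp] at hw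
  have := (mul_pos_iff_of_pos_left hp).1 hw
  rw [Matrix.det_fin_two]
  have h10 : pullMetric I Θ z 1 0 = q := real_inner_comm (e 0) (e 1)
  rw [h10]
  exact this

variable [IsContMDiffRiemannianBundle I ∞ Plane (fun x : M => TangentSpace I x)]

lemma matSmooth_pullMetric (P : IsLocalParam I Θ Ξ U) (hz : z ∈ U) : MatSmooth (pullMetric I Θ) z := by
  intro i j
  exact (ContMDiffAt.inner_bundle (P.contMDiffAt_paramVec hz i) (P.contMDiffAt_paramVec hz j)).contDiffAt

end Metric

end IsLocalParam

end LocalParametrization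

section PlaneInvariants

/-- The coefficient of the exterior derivative of a 1-form on the plane. -/
def planeCurl (a : Fin 2 → Plane → ℝ) (z : Plane) : ℝ := pd 0 (a 1) z - pd 1 (a 0) z

lemma planeCurl_congr {a b : Fin 2 → Plane → ℝ} {z : Plane} (h : ∀ i, a i =ᶠ[𝓝 z] b i) :
    planeCurl a z = planeCurl b z := by
  rw [planeCurl, planeCurl, pd_congr (h 1), pd_congr (h 0)]

lemma planeCurl_comp {a a' : Fin 2 → Plane → ℝ} {τ : Plane → Plane} {z : Plane}
    (hτ : ContDiffAt ℝ ∞ τ z) (ha : ∀ i, ContDiffAt ℝ ∞ (a' i) (τ z))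
    (h : ∀ i, a i =ᶠ[𝓝 z] fun w => ∑ b, jacobian τ w b i * a' b (τ w)) :
    planeCurl a z = (jacobian τ z).det * planeCurl a' (τ z) := by
  have hJ := matSmooth_jacobian hτ
  have hJd : ∀ b i, DifferentiableAt ℝ (fun w => jacobian τ w b i) z := fun b i =>
    (hJ b i).diffAt_top
  have hac : ∀ b, DifferentiableAt ℝ (fun w => a' b (τ w)) z := fun b =>
    ((ha b).comp z hτ).diffAt_top
  have key : ∀ m i, pd m (a i) z = ∑ b, (pd m (fun w => jacobian τ w b i) z * a' b (τ z)
      + jacobian τ z b i * ∑ c, jacobian τ z c m * pd c (a' b) (τ z)) := by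
    intro m i
    rw [pd_congr (h i)]
    simp only [Fin.sum_univ_two]
    refine (pd_add ((hJd 0 i).mul (hac 0)) ((hJd 1 i).mul (hac 1)) m).trans ?_
    refine (congrArg₂ (· + ·) (pd_mul (hJd 0 i) (hac 0) m) (pd_mul (hJd 1 i) (hac 1) m)).trans ?_
    rw [pd_comp (ha 0).diffAt_top hτ.diffAt_top,
      pd_comp (ha 1).diffAt_top hτ.diffAt_top]
    simp [Fin.sum_univ_two]
  have hsym : ∀ b, pd 0 (fun w => jacobian τ w b 1) z = pd 1 (fun w => jacobian τ w b 0) z := fun b =>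
    pd_comm (contDiffAt_component hτ b) 0 1
  rw [planeCurl, planeCurl, key, key, Matrix.det_fin_two]
  simp only [Fin.sum_univ_two, hsym]
  ring

end PlaneInvariants

section ChartTransition

variable {H : Type*} [TopologicalSpace H] {I : ModelWithCorners ℝ Plane H}
  {M : Type*} [TopologicalSpace M] [ChartedSpace H M] [IsManifold I ∞ M]
  {Θ : Plane → M} {Ξ : M → Plane} {U : Set Plane} {z : Plane} {q : M}

lemma eventually_christoffel_eq [RiemannianBundle (fun x : M => TangentSpace I x)] {y : Plane}
    (hr : range I ∈ 𝓝 y) (k i j : Fin 2) : christoffel I q k i j =ᶠ[𝓝 y]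
      planeChristoffel (pullMetric I (extChartAt I q).symm) k i j := by
  filter_upwards [eventually_mem_nhds_iff.2 hr,
    (eventually_gram_eq (I := I) (q := q) hr).eventually_nhds] with w hw hw2
  have hp : ∀ m a b, partialDeriv I m (fun v => gram I q v a b) w
      = pd m (fun v => pullMetric I (extChartAt I q).symm v a b) w := fun m a b => by
    rw [partialDeriv_eq hw]
    exact pd_congr (hw2.mono fun v hv => by simp only [hv]) m
  simp only [christoffel, planeChristoffel, hp, hw2.self_of_nhds]

namespace IsLocalParam

lemma target_mem_nhds (P : IsLocalParam I Θ Ξ U) (hz : z ∈ U) (hq : Θ z ∈ (extChartAt I q).source) :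
    (extChartAt I q).target ∈ 𝓝 (extChartAt I q (Θ z)) :=
  extChartAt_mem_interior (P.isInteriorPoint hz) hq

lemma range_mem_nhds (P : IsLocalParam I Θ Ξ U) (hz : z ∈ U) (hq : Θ z ∈ (extChartAt I q).source) :
    range I ∈ 𝓝 (extChartAt I q (Θ z)) :=
  range_mem_nhds_extChartAt (P.isInteriorPoint hz) hq

lemma contDiffAt_transition (P : IsLocalParam I Θ Ξ U) (hz : z ∈ U)
    (hq : Θ z ∈ (extChartAt I q).source) : ContDiffAt ℝ ∞ (fun w => extChartAt I q (Θ w)) z := by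
  rw [extChartAt_source] at hq
  exact ((contMDiffAt_extChartAt' (I := I) (n := ∞) hq).comp z (P.smoothAt hz)).contDiffAt

lemma eventually_mem_source (P : IsLocalParam I Θ Ξ U) (hz : z ∈ U)
    (hq : Θ z ∈ (extChartAt I q).source) : ∀ᶠ w in 𝓝 z, w ∈ U ∧ Θ w ∈ (extChartAt I q).source :=
  Filter.Eventually.and (P.isOpen.mem_nhds hz)
    ((P.smoothAt hz).continuousAt.eventually ((isOpen_extChartAt_source q).mem_nhds hq))

lemma eventually_eq_symm_transition (P : IsLocalParam I Θ Ξ U) (hz : z ∈ U)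
    (hq : Θ z ∈ (extChartAt I q).source) :
    Θ =ᶠ[𝓝 z] fun w => (extChartAt I q).symm (extChartAt I q (Θ w)) :=
  (P.eventually_mem_source hz hq).mono fun _ hw => ((extChartAt I q).left_inv hw.2).symm

lemma isLocalParam_chart_mem (P : IsLocalParam I Θ Ξ U) (hz : z ∈ U)
    (hq : Θ z ∈ (extChartAt I q).source) :
    extChartAt I q (Θ z) ∈ interior (extChartAt I q).target :=
  mem_interior_iff_mem_nhds.2 (P.target_mem_nhds hz hq)

lemma pullForm_eq_transition (A : ∀ x : M, TangentSpace I x →L[ℝ] ℝ) (P : IsLocalParam I Θ Ξ U)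
    (hz : z ∈ U) (hq : Θ z ∈ (extChartAt I q).source) (i : Fin 2) :
    pullForm I A Θ i z = ∑ a, jacobian (fun w => extChartAt I q (Θ w)) z a i
      * pullForm I A (extChartAt I q).symm a (extChartAt I q (Θ z)) :=
  pullForm_comp (P.contDiffAt_transition hz hq).diffAt_top
    ((isLocalParam_extChart q).mdifferentiableAt (P.isLocalParam_chart_mem hz hq))
    (P.eventually_eq_symm_transition hz hq) i

variable [RiemannianBundle (fun x : M => TangentSpace I x)]

lemma pullMetric_eq_transition (P : IsLocalParam I Θ Ξ U)
    (hz : z ∈ U) (hq : Θ z ∈ (extChartAt I q).source) :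
    pullMetric I Θ z = (jacobian (fun w => extChartAt I q (Θ w)) z).transpose
      * pullMetric I (extChartAt I q).symm (extChartAt I q (Θ z))
      * jacobian (fun w => extChartAt I q (Θ w)) z :=
  pullMetric_comp (P.contDiffAt_transition hz hq).diffAt_top
    ((isLocalParam_extChart q).mdifferentiableAt (P.isLocalParam_chart_mem hz hq))
    (P.eventually_eq_symm_transition hz hq)

lemma det_pullMetric_eq_transition (P : IsLocalParam I Θ Ξ U)
    (hz : z ∈ U) (hq : Θ z ∈ (extChartAt I q).source) :
    (pullMetric I Θ z).det = (jacobian (fun w => extChartAt I q (Θ w)) z).det ^ 2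
      * (gram I q (extChartAt I q (Θ z))).det := by
  rw [P.pullMetric_eq_transition hz hq, gram_eq (P.range_mem_nhds hz hq), Matrix.det_mul,
    Matrix.det_mul, Matrix.det_transpose]
  ring

lemma det_jacobian_transition_ne_zero (P : IsLocalParam I Θ Ξ U)
    (hz : z ∈ U) (hq : Θ z ∈ (extChartAt I q).source) :
    (jacobian (fun w => extChartAt I q (Θ w)) z).det ≠ 0 := by
  intro h
  have h1 := P.det_pullMetric_pos hz
  rw [P.det_pullMetric_eq_transition hz hq, h] at h1
  simp at h1

lemma sqrt_det_pullMetric_eq_transition (P : IsLocalParam I Θ Ξ U)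
    (hz : z ∈ U) (hq : Θ z ∈ (extChartAt I q).source) :
    √(pullMetric I Θ z).det = |(jacobian (fun w => extChartAt I q (Θ w)) z).det|
      * √(gram I q (extChartAt I q (Θ z))).det := by
  rw [P.det_pullMetric_eq_transition hz hq, Real.sqrt_mul (sq_nonneg _), Real.sqrt_sq_eq_abs]

/-- The field strength in a local parametrization. -/
theorem abs_fieldStrength_eq {A : ∀ x : M, TangentSpace I x →L[ℝ] ℝ} (hA : IsSmoothForm I A)
    (P : IsLocalParam I Θ Ξ U) (hz : z ∈ U) :
    |fieldStrength I A (Θ z)| = |planeCurl (fun i => pullForm I A Θ i) z|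
      / √(pullMetric I Θ z).det := by
  set q := Θ z with hq'
  have hq : Θ z ∈ (extChartAt I q).source := mem_extChartAt_source q
  have hr := P.range_mem_nhds hz hq
  have h1 : planeCurl (fun i => pullForm I A Θ i) z = _ :=
    planeCurl_comp (a' := fun i => pullForm I A (extChartAt I q).symm i) (P.contDiffAt_transition hz hq)
      (fun i => (isLocalParam_extChart q).contDiffAt_pullForm hA
        (P.isLocalParam_chart_mem hz hq) i)
      (fun i => (P.eventually_mem_source hz hq).mono fun w hw =>
        P.pullForm_eq_transition A hw.1 hw.2 i)
  have h2 : fieldStrength I A q = planeCurl (fun i => pullForm I A (extChartAt I q).symm i)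
      (extChartAt I q (Θ z)) / √(gram I q (extChartAt I q (Θ z))).det := by
    rw [fieldStrength, partialDeriv_eq hr, partialDeriv_eq hr, pd_congr (eventually_coordForm_eq A hr 1),
      pd_congr (eventually_coordForm_eq A hr 0)]
    rfl
  have hJ := abs_pos.2 (P.det_jacobian_transition_ne_zero hz hq)
  rw [h1, h2, P.sqrt_det_pullMetric_eq_transition hz hq, abs_mul, abs_div,
    abs_of_nonneg (Real.sqrt_nonneg _), mul_div_mul_left _ _ hJ.ne']

/-- The scalar curvature in a local parametrization. -/
theorem scalarCurvature_eq [IsContMDiffRiemannianBundle I ∞ Plane (fun x : M => TangentSpace I x)]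
    (P : IsLocalParam I Θ Ξ U) (hz : z ∈ U) :
    scalarCurvature I (Θ z) = planeScalar (pullMetric I Θ) z := by
  set q := Θ z with hq'
  have hq : Θ z ∈ (extChartAt I q).source := mem_extChartAt_source q
  have hr := P.range_mem_nhds hz hq
  have hint := P.isLocalParam_chart_mem hz hq
  set y := extChartAt I q (Θ z) with hy
  have hC : ∀ k i j, christoffel I q k i j =ᶠ[𝓝 y]
      planeChristoffel (pullMetric I (extChartAt I q).symm) k i j := eventually_christoffel_eq hr
  have hR : ∀ i l j k, curvature I q i l j k y
      = planeCurvature (pullMetric I (extChartAt I q).symm) i l j k y := by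
    intro i l j k
    simp only [curvature, planeCurvature, partialDeriv_eq hr, pd_congr (hC _ _ _),
      (hC _ _ _).self_of_nhds]
  have h1 : scalarCurvature I q = planeScalar (pullMetric I (extChartAt I q).symm) y := by
    have hy2 : extChartAt I q q = y := rfl
    simp only [scalarCurvature, hy2, ricci, planeScalar, hR, gram_eq hr]
  have hint' : ∀ᶠ w in 𝓝 y, w ∈ interior (extChartAt I q).target := isOpen_interior.mem_nhds hint
  rw [h1]
  symm
  refine planeScalar_comp (g' := pullMetric I (extChartAt I q).symm)
    (τ := fun w => extChartAt I q (Θ w))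
    ((P.eventually_mem_source hz hq).mono fun w hw => P.contDiffAt_transition hw.1 hw.2)
    (P.det_jacobian_transition_ne_zero hz hq)
    (hint'.mono fun w hw => (isLocalParam_extChart (I := I) q).matSmooth_pullMetric hw)
    (Eventually.of_forall fun w => pullMetric_transpose (I := I) (Θ := (extChartAt I q).symm) w)
    ((isLocalParam_extChart (I := I) q).det_pullMetric_pos hint).ne'
    ((P.eventually_mem_source hz hq).mono fun w hw => P.pullMetric_eq_transition hw.1 hw.2)

end IsLocalParam

end ChartTransition

section Volume

lemma det_fderiv_eq {τ : Plane → Plane} {z : Plane} (hτ : DifferentiableAt ℝ τ z) :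
    (fderiv ℝ τ z).det = (jacobian τ z).det := by
  have h := LinearMap.det_toMatrix (EuclideanSpace.basisFun (Fin 2) ℝ).toBasis
    ((fderiv ℝ τ z : Plane →L[ℝ] Plane) : Plane →ₗ[ℝ] Plane)
  rw [ContinuousLinearMap.det, ← h]
  congr 1
  ext a i
  rw [LinearMap.toMatrix_apply]
  have h2 := fderiv_basisVec hτ i
  have h3 : (EuclideanSpace.basisFun (Fin 2) ℝ).toBasis i = basisVec i := by
    simp [basisVec]
  rw [h3]
  change ((EuclideanSpace.basisFun (Fin 2) ℝ).toBasis.repr (fderiv ℝ τ z (basisVec i))) a = _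
  rw [h2]
  fin_cases a <;> simp [basisVec, Fin.sum_univ_two]

lemma measurableSet_inter_preimage_of_continuousOn {X Y : Type*} [TopologicalSpace X] [MeasurableSpace X]
    [BorelSpace X] [TopologicalSpace Y] [MeasurableSpace Y] [BorelSpace Y] {f : X → Y} {U : Set X}
    (hU : MeasurableSet U) (hf : ContinuousOn f U) {S : Set Y} (hS : MeasurableSet S) :
    MeasurableSet (U ∩ f ⁻¹' S) := by
  have h : U ∩ f ⁻¹' S = Subtype.val '' ((U.restrict f) ⁻¹' S) := by
    ext x
    exact ⟨fun hx => ⟨⟨x, hx.1⟩, hx.2, rfl⟩, by rintro ⟨⟨y, hy⟩, h1, rfl⟩; exact ⟨hy, h1⟩⟩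
  rw [h]
  exact hU.subtype_image ((continuousOn_iff_continuous_restrict.1 hf).measurable hS)

variable {H : Type*} [TopologicalSpace H] {I : ModelWithCorners ℝ Plane H}
  {M : Type*} [TopologicalSpace M] [ChartedSpace H M] [IsManifold I ∞ M]
  [MeasurableSpace M] [BorelSpace M]
  [RiemannianBundle (fun x : M => TangentSpace I x)]
  {Θ : Plane → M} {Ξ : M → Plane} {U : Set Plane}

variable (I) in
/-- The pull-back of the area measure. -/
def pullVolume (Θ : Plane → M) (U : Set Plane) : Measure M :=
  ((volume.restrict U).withDensity
    (fun z => ENNReal.ofReal (√(pullMetric I Θ z).det))).map Θ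

namespace IsLocalParam

lemma aemeasurable (P : IsLocalParam I Θ Ξ U) (ρ : Plane → ENNReal) :
    AEMeasurable Θ ((volume.restrict U).withDensity ρ) :=
  (P.smooth.continuousOn.aemeasurable P.isOpen.measurableSet).mono_ac
    (withDensity_absolutelyContinuous _ _)

lemma pullVolume_apply (P : IsLocalParam I Θ Ξ U) {S : Set M} (hS : MeasurableSet S) :
    pullVolume I Θ U S
      = ∫⁻ z in U ∩ Θ ⁻¹' S, ENNReal.ofReal (√(pullMetric I Θ z).det) := by
  rw [pullVolume, Measure.map_apply_of_aemeasurable (P.aemeasurable _) hS, withDensity_apply',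
    Measure.restrict_restrict' P.isOpen.measurableSet, inter_comm]

lemma measurableSet_extChartAt_target (q : M) : MeasurableSet (extChartAt I q).target := by
  rw [extChartAt_target, inter_comm]
  refine I.isClosed_range.measurableSet.inter ?_
  exact ((chartAt H q).open_target.preimage I.continuous_symm).measurableSet

lemma chartVolume_apply_inter (P : IsLocalParam I Θ Ξ U) (q : M) {S : Set M} (hS : MeasurableSet S) :
    chartVolume I q (S ∩ Θ '' U) = ∫⁻ z in U ∩ Θ ⁻¹' (S ∩ (extChartAt I q).source),
      ENNReal.ofReal (√(pullMetric I Θ z).det) := by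
  have ht := measurableSet_extChartAt_target (I := I) q
  have hT : MeasurableSet (S ∩ Θ '' U) := hS.inter P.isOpen_image.measurableSet
  have hae : AEMeasurable (extChartAt I q).symm ((volume.restrict (extChartAt I q).target).withDensity
      (fun y => ENNReal.ofReal (√(gram I q y).det))) :=
    ((continuousOn_extChartAt_symm q).aemeasurable ht).mono_ac (withDensity_absolutelyContinuous _ _)
  set W := U ∩ Θ ⁻¹' (S ∩ (extChartAt I q).source) with hW
  have hWm : MeasurableSet W := measurableSet_inter_preimage_of_continuousOn P.isOpen.measurableSet
    P.smooth.continuousOn (hS.inter (isOpen_extChartAt_source q).measurableSet)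
  have himg : (extChartAt I q).symm ⁻¹' (S ∩ Θ '' U) ∩ (extChartAt I q).target
      = (fun z => extChartAt I q (Θ z)) '' W := by
    ext y; constructor
    · rintro ⟨⟨h1, z, hz, hzy⟩, h2⟩
      refine ⟨z, ⟨hz, ?_, ?_⟩, ?_⟩
      · rw [hzy]; exact h1
      · rw [hzy]; exact (extChartAt I q).map_target h2
      · simp only [hzy]; exact (extChartAt I q).right_inv h2
    · rintro ⟨z, ⟨hz, h1, h2⟩, rfl⟩
      have := (extChartAt I q).left_inv h2
      refine ⟨⟨?_, z, hz, this.symm⟩, (extChartAt I q).map_source h2⟩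
      rw [this]; exact h1
  have hd : ∀ z ∈ W, HasFDerivWithinAt (fun z => extChartAt I q (Θ z))
      (fderiv ℝ (fun z => extChartAt I q (Θ z)) z) W z := fun z hz =>
    (P.contDiffAt_transition hz.1 hz.2.2).diffAt_top.hasFDerivAt.hasFDerivWithinAt
  have hinj : InjOn (fun z => extChartAt I q (Θ z)) W := fun z hz w hw h =>
    P.injOn hz.1 hw.1 ((extChartAt I q).injOn hz.2.2 hw.2.2 h)
  rw [chartVolume, Measure.map_apply_of_aemeasurable hae hT, withDensity_apply',
    Measure.restrict_restrict' ht, himg,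
    lintegral_image_eq_lintegral_abs_det_fderiv_mul volume hWm hd hinj]
  refine setLIntegral_congr_fun hWm fun z hz => ?_
  rw [P.sqrt_det_pullMetric_eq_transition hz.1 hz.2.2, ENNReal.ofReal_mul (abs_nonneg _),
    det_fderiv_eq (P.contDiffAt_transition hz.1 hz.2.2).diffAt_top]

/-- The area measure in a local parametrization. -/
theorem riemannianVolume_restrict (P : IsLocalParam I Θ Ξ U) {p : M}
    (hp : Θ '' U ⊆ (extChartAt I p).source) :
    (riemannianVolume I M).restrict (Θ '' U) = pullVolume I Θ U := by
  have hΩ : MeasurableSet (Θ '' U) := P.isOpen_image.measurableSet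
  have hle : ∀ q, (chartVolume I q).restrict (Θ '' U) ≤ pullVolume I Θ U := by
    intro q
    refine Measure.le_iff.2 fun S hS => ?_
    rw [Measure.restrict_apply hS, P.chartVolume_apply_inter q hS, P.pullVolume_apply hS]
    exact lintegral_mono_set (inter_subset_inter_right _ (preimage_mono inter_subset_left))
  refine le_antisymm ?_ ?_
  · have h1 : riemannianVolume I M
        ≤ pullVolume I Θ U + (riemannianVolume I M).restrict (Θ '' U)ᶜ := by
      refine iSup_le fun q => ?_
      rw [← Measure.restrict_add_restrict_compl (μ := chartVolume I q) hΩ]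
      refine add_le_add (hle q) (Measure.restrict_mono subset_rfl ?_)
      exact le_iSup (fun p => chartVolume I p) q
    refine Measure.le_iff.2 fun S hS => ?_
    rw [Measure.restrict_apply hS]
    refine (h1 _).trans ?_
    rw [Measure.add_apply, Measure.restrict_apply (hS.inter hΩ)]
    have : S ∩ Θ '' U ∩ (Θ '' U)ᶜ = ∅ := by
      ext x; simp +contextual
    rw [this, measure_empty, add_zero]
    exact measure_mono inter_subset_left
  · refine Measure.le_iff.2 fun S hS => ?_
    rw [Measure.restrict_apply hS, P.pullVolume_apply hS]
    have h2 : U ∩ Θ ⁻¹' S = U ∩ Θ ⁻¹' (S ∩ (extChartAt I p).source) := by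
      ext z; constructor
      · rintro ⟨h1, h2⟩; exact ⟨h1, h2, hp ⟨z, h1, rfl⟩⟩
      · rintro ⟨h1, h2, -⟩; exact ⟨h1, h2⟩
    rw [h2, ← P.chartVolume_apply_inter p hS]
    exact (le_iSup (fun p => chartVolume I p) p : chartVolume I p ≤ riemannianVolume I M) _

/-- Integration in a local parametrization. -/
theorem integral_eq [IsContMDiffRiemannianBundle I ∞ Plane (fun x : M => TangentSpace I x)]
    (P : IsLocalParam I Θ Ξ U) {p : M}
    (hp : Θ '' U ⊆ (extChartAt I p).source) {E : Type*} [NormedAddCommGroup E] [NormedSpace ℝ E]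
    [SecondCountableTopology E] {f : M → E}
    (hf : ContinuousOn f (Θ '' U)) (h0 : ∀ x ∉ Θ '' U, f x = 0) :
    ∫ x, f x ∂(riemannianVolume I M) = ∫ z in U, √(pullMetric I Θ z).det • f (Θ z) := by
  borelize E
  have hΩ : MeasurableSet (Θ '' U) := P.isOpen_image.measurableSet
  rw [← setIntegral_eq_integral_of_forall_compl_eq_zero h0]
  have hae : AEStronglyMeasurable f (pullVolume I Θ U) := by
    rw [← P.riemannianVolume_restrict hp]
    exact (hf.aemeasurable hΩ).aestronglyMeasurable
  rw [P.riemannianVolume_restrict hp, pullVolume, integral_map (P.aemeasurable _) hae]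
  have hc : ContinuousOn (fun z => √(pullMetric I Θ z).det) U := fun z hz =>
    (Real.continuous_sqrt.continuousAt.comp
      (P.matSmooth_pullMetric hz).det.continuousAt).continuousWithinAt
  rw [integral_withDensity_eq_integral_toReal_smul₀]
  · refine integral_congr_ae (Eventually.of_forall fun z => ?_)
    simp only [ENNReal.toReal_ofReal (Real.sqrt_nonneg _)]
  · exact (hc.aemeasurable P.isOpen.measurableSet).ennreal_ofReal
  · exact Eventually.of_forall fun z => ENNReal.ofReal_lt_top

end IsLocalParam

end Volume

section FormProduct

/-- The scalar product of 1-forms in a frame that need not be orthonormal. -/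
lemma sum_orthonormalBasis_eq {V : Type*} [NormedAddCommGroup V] [InnerProductSpace ℝ V]
    {ι : Type*} [Fintype ι] (e : OrthonormalBasis ι ℝ V) (hι : Fintype.card ι = 2) (E : Fin 2 → V)
    (hG : (Matrix.of fun i j => inner ℝ (E i) (E j) : Mat).det ≠ 0)
    (α β : V →ₗ[ℝ] ℂ) :
    ∑ a, α (e a) * (starRingEnd ℂ) (β (e a))
      = ∑ i, ∑ j, (((Matrix.of fun i j => inner ℝ (E i) (E j) : Mat)⁻¹ i j : ℝ) : ℂ)
        * (α (E i) * (starRingEnd ℂ) (β (E j))) := by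
  classical
  set G : Mat := Matrix.of fun i j => inner ℝ (E i) (E j) with hGdef
  let m : Matrix ι (Fin 2) ℝ := Matrix.of fun a i => inner ℝ (e a) (E i)
  have hE : ∀ i, E i = ∑ a, m a i • e a := fun i => by
    conv_lhs => rw [← e.sum_repr' (E i)]
    rfl
  have hGm : G = m.transpose * m := by
    ext i j
    simp only [hGdef, Matrix.of_apply, Matrix.mul_apply, Matrix.transpose_apply, m]
    rw [← e.sum_inner_mul_inner (E i) (E j)]
    exact Finset.sum_congr rfl fun a _ => by rw [real_inner_comm]
  have h1 : (G⁻¹ * m.transpose) * m = 1 := by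
    rw [Matrix.mul_assoc, ← hGm, Matrix.nonsing_inv_mul _ (isUnit_iff_ne_zero.2 hG)]
  have h2 : m * (G⁻¹ * m.transpose) = 1 :=
    (Matrix.mul_eq_one_comm_of_card_eq _ _ _ (by rw [hι, Fintype.card_fin])).1 h1
  have hα : ∀ i, α (E i) = ∑ a, (m a i : ℂ) * α (e a) := fun i => by
    conv_lhs => rw [hE i]
    simp [map_sum]
  have hβ : ∀ i, (starRingEnd ℂ) (β (E i)) = ∑ a, (m a i : ℂ) * (starRingEnd ℂ) (β (e a)) := fun i => by
    conv_lhs => rw [hE i]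
    simp [map_sum]
  have h3 : ∀ a b, ∑ i, ∑ j, (G⁻¹ i j : ℂ) * (m a i * m b j) = if a = b then (1 : ℂ) else 0 := by
    intro a b
    have := congrFun (congrFun h2 a) b
    rw [Matrix.one_apply] at this
    have h4 : ∑ i, ∑ j, (G⁻¹ i j) * (m a i * m b j) = if a = b then (1 : ℝ) else 0 := by
      rw [← this, Matrix.mul_apply]
      refine Finset.sum_congr rfl fun i _ => ?_
      rw [Matrix.mul_apply, Finset.mul_sum]
      exact Finset.sum_congr rfl fun j _ => by rw [Matrix.transpose_apply]; ring
    have h5 := congrArg (fun x : ℝ => (x : ℂ)) h4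
    push_cast at h5
    rw [h5]
    split_ifs <;> simp
  have h6 : ∀ a, α (e a) * (starRingEnd ℂ) (β (e a))
      = ∑ b, (if a = b then (1 : ℂ) else 0) * (α (e a) * (starRingEnd ℂ) (β (e b))) := by
    intro a; simp
  simp only [hα, hβ, Fin.sum_univ_two]
  rw [Finset.sum_congr rfl fun a _ => h6 a]
  simp only [← h3, Fin.sum_univ_two, Finset.mul_sum, ← Finset.sum_add_distrib]
  rw [Finset.sum_comm]
  refine Finset.sum_congr rfl fun b _ => ?_
  simp only [Finset.sum_mul, Finset.mul_sum, ← Finset.sum_add_distrib]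
  refine Finset.sum_congr rfl fun a _ => ?_
  ring

variable {H : Type*} [TopologicalSpace H] {I : ModelWithCorners ℝ Plane H}
  {M : Type*} [TopologicalSpace M] [ChartedSpace H M]

lemma magneticDifferential_paramVec (A : ∀ x : M, TangentSpace I x →L[ℝ] ℝ) (h : ℝ) {u : M → ℂ}
    {Θ : Plane → M} {z : Plane} (hu : MDifferentiableAt I 𝓘(ℝ, ℂ) u (Θ z))
    (hΘ : MDifferentiableAt 𝓘(ℝ, Plane) I Θ z) (i : Fin 2) :
    magneticDifferential I A h u (Θ z) (paramVec I Θ z i)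
      = Complex.I * h * pd i (fun w => u (Θ w)) z + pullForm I A Θ i z * u (Θ z) := by
  have h2 : mfderiv 𝓘(ℝ, Plane) 𝓘(ℝ, ℂ) (u ∘ Θ) z
      = (mfderiv I 𝓘(ℝ, ℂ) u (Θ z)).comp (mfderiv 𝓘(ℝ, Plane) I Θ z) := mfderiv_comp z hu hΘ
  rw [mfderiv_eq_fderiv] at h2
  have h3 : pd i (fun w => u (Θ w)) z = mfderiv I 𝓘(ℝ, ℂ) u (Θ z) (paramVec I Θ z i) :=
    congrArg (fun L : Plane →L[ℝ] ℂ => L (basisVec i)) h2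
  rw [h3]
  rfl

/-- The magnetic differential at a point as a linear map. -/
def magneticLinear (A : ∀ x : M, TangentSpace I x →L[ℝ] ℝ) (h : ℝ) (u : M → ℂ) (x : M) :
    TangentSpace I x →ₗ[ℝ] ℂ where
  toFun := magneticDifferential I A h u x
  map_add' v w := by
    let D : TangentSpace I x →L[ℝ] ℂ := mfderiv I 𝓘(ℝ, ℂ) u x
    have hD : D (v + w) = D v + D w := map_add D v w
    change Complex.I * h * D (v + w) + (A x (v + w) : ℂ) * u x
      = (Complex.I * h * D v + (A x v : ℂ) * u x) + (Complex.I * h * D w + (A x w : ℂ) * u x)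
    rw [map_add (A x), Complex.ofReal_add]
    linear_combination (Complex.I * h) * hD
  map_smul' c v := by
    let D : TangentSpace I x →L[ℝ] ℂ := mfderiv I 𝓘(ℝ, ℂ) u x
    have hD : D (c • v) = c * D v := (map_smul D c v).trans Complex.real_smul
    change Complex.I * h * D (c • v) + (A x (c • v) : ℂ) * u x
      = c • (Complex.I * h * D v + (A x v : ℂ) * u x)
    rw [Complex.real_smul, map_smul (A x), smul_eq_mul, Complex.ofReal_mul]
    linear_combination (Complex.I * h) * hD

lemma formInner_magneticDifferential [RiemannianBundle (fun x : M => TangentSpace I x)]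
    (A : ∀ x : M, TangentSpace I x →L[ℝ] ℝ) (h : ℝ) {u v : M → ℂ}
    {Θ : Plane → M} {z : Plane} (hu : MDifferentiableAt I 𝓘(ℝ, ℂ) u (Θ z))
    (hv : MDifferentiableAt I 𝓘(ℝ, ℂ) v (Θ z))
    (hΘ : MDifferentiableAt 𝓘(ℝ, Plane) I Θ z) (hG : (pullMetric I Θ z).det ≠ 0) :
    formInner I (magneticDifferential I A h u) (magneticDifferential I A h v) (Θ z)
      = ∑ i, ∑ j, (((pullMetric I Θ z)⁻¹ i j : ℝ) : ℂ)
        * ((Complex.I * h * pd i (fun w => u (Θ w)) z + pullForm I A Θ i z * u (Θ z))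
          * (starRingEnd ℂ) (Complex.I * h * pd j (fun w => v (Θ w)) z + pullForm I A Θ j z * v (Θ z))) := by
  have key := sum_orthonormalBasis_eq (stdOrthonormalBasis ℝ (TangentSpace I (Θ z)))
    (by rw [Fintype.card_fin]; exact finrank_euclideanSpace_fin) (paramVec I Θ z) hG
    (magneticLinear A h u (Θ z)) (magneticLinear A h v (Θ z))
  have e1 := magneticDifferential_paramVec A h hu hΘ
  have e2 := magneticDifferential_paramVec A h hv hΘ
  simp only [← e1, ← e2]
  exact key

end FormProduct

section Lift

variable {H : Type*} [TopologicalSpace H] {I : ModelWithCorners ℝ Plane H}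
  {M : Type*} [TopologicalSpace M] [ChartedSpace H M]
  {Θ : Plane → M} {Ξ : M → Plane} {U : Set Plane} {θ : Plane → ℝ} {ρ : ℝ}

/-- The gauge factor. -/
def phase (θ : Plane → ℝ) (h : ℝ) (z : Plane) : ℂ := Complex.exp (Complex.I * (θ z / h : ℝ))

lemma phase_mul_conj (θ : Plane → ℝ) (h : ℝ) (z : Plane) :
    phase θ h z * (starRingEnd ℂ) (phase θ h z) = 1 := by
  rw [phase, ← Complex.exp_conj, ← Complex.exp_add, map_mul, Complex.conj_I, Complex.conj_ofReal]
  simp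

lemma norm_phase (θ : Plane → ℝ) (h : ℝ) (z : Plane) : ‖phase θ h z‖ = 1 := by
  rw [phase, mul_comm, Complex.norm_exp_ofReal_mul_I]

lemma contDiffAt_phase {z : Plane} (hθ : ContDiffAt ℝ ∞ θ z) (h : ℝ) :
    ContDiffAt ℝ ∞ (phase θ h) z := by
  have h1 : ContDiffAt ℝ ∞ (fun w => ((θ w / h : ℝ) : ℂ)) z :=
    Complex.ofRealCLM.contDiff.contDiffAt.comp z (hθ.div_const h)
  exact (contDiffAt_const.mul h1).cexp

lemma pd_phase {z : Plane} (hθ : ContDiffAt ℝ ∞ θ z) (h : ℝ) (i : Fin 2) :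
    pd i (phase θ h) z = Complex.I * (pd i θ z / h : ℝ) * phase θ h z := by
  have h1 : HasFDerivAt (fun w => Complex.I * ((θ w / h : ℝ) : ℂ))
      (Complex.I • (Complex.ofRealCLM.comp (h⁻¹ • fderiv ℝ θ z))) z := by
    have h2 : HasFDerivAt (fun w => θ w / h) (h⁻¹ • fderiv ℝ θ z) z := by
      have := hθ.diffAt_top.hasFDerivAt.const_mul h⁻¹
      simpa only [div_eq_inv_mul] using this
    exact (Complex.ofRealCLM.hasFDerivAt.comp z h2).const_mul Complex.I
  have h3 : fderiv ℝ (phase θ h) z = _ := h1.cexp.fderiv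
  rw [pd, h3]
  simp only [ContinuousLinearMap.smul_apply, ContinuousLinearMap.comp_apply, Complex.ofRealCLM_apply,
    smul_eq_mul, pd, phase]
  push_cast
  ring

open Classical in
/-- The function on the surface with given expression in a local parametrization and gauge. -/
def lift (Θ : Plane → M) (Ξ : M → Plane) (U : Set Plane) (θ : Plane → ℝ) (h : ℝ) (v : Plane → ℂ)
    (x : M) : ℂ :=
  if x ∈ Θ '' U then phase θ h (Ξ x) * v (Ξ x) else 0

namespace IsLocalParam

lemma lift_apply (P : IsLocalParam I Θ Ξ U) (θ : Plane → ℝ) (h : ℝ) (v : Plane → ℂ) {z : Plane}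
    (hz : z ∈ U) : lift Θ Ξ U θ h v (Θ z) = phase θ h z * v z := by
  rw [lift, if_pos (mem_image_of_mem Θ hz), P.left_inv z hz]

lemma lift_eq_zero (P : IsLocalParam I Θ Ξ U) (θ : Plane → ℝ) (h : ℝ) {v : Plane → ℂ}
    (hv : v ∈ testSpace ρ) {x : M} (hx : x ∉ Θ '' closedBall 0 ρ) :
    lift Θ Ξ U θ h v x = 0 := by
  by_cases hU : x ∈ Θ '' U
  · obtain ⟨z, hz, rfl⟩ := hU
    have h0 : v z = 0 := image_eq_zero_of_notMem_tsupport fun hz' => hx ⟨z, hv.2 hz', rfl⟩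
    rw [P.lift_apply θ h v hz, h0, mul_zero]
  · rw [lift, if_neg hU]

lemma isClosed_image_closedBall [T2Space M] (P : IsLocalParam I Θ Ξ U) (hρ : closedBall 0 ρ ⊆ U) :
    IsClosed (Θ '' closedBall 0 ρ) :=
  ((isCompact_closedBall 0 ρ).image_of_continuousOn (P.smooth.continuousOn.mono hρ)).isClosed

lemma eventually_lift_eq_zero [T2Space M] (P : IsLocalParam I Θ Ξ U) (hρ : closedBall 0 ρ ⊆ U)
    (θ : Plane → ℝ) (h : ℝ) {v : Plane → ℂ}
    (hv : v ∈ testSpace ρ) {x : M} (hx : x ∉ Θ '' closedBall 0 ρ) :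
    lift Θ Ξ U θ h v =ᶠ[𝓝 x] fun _ => 0 := by
  filter_upwards [(P.isClosed_image_closedBall hρ).isOpen_compl.mem_nhds hx] with y hy using
    P.lift_eq_zero θ h hv hy

lemma contMDiff_lift [T2Space M] (P : IsLocalParam I Θ Ξ U) (hρ : closedBall 0 ρ ⊆ U)
    (hθ : ContDiffOn ℝ ∞ θ U) (h : ℝ) {v : Plane → ℂ} (hv : v ∈ testSpace ρ) :
    ContMDiff I 𝓘(ℝ, ℂ) ∞ (lift Θ Ξ U θ h v) := by
  intro x
  by_cases hx : x ∈ Θ '' closedBall 0 ρ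
  · obtain ⟨z, hz, rfl⟩ := hx
    have hzU := hρ hz
    have h1 : ContDiffAt ℝ ∞ (fun w => phase θ h w * v w) (Ξ (Θ z)) := by
      rw [P.left_inv z hzU]
      exact (contDiffAt_phase (hθ.contDiffAt (P.isOpen.mem_nhds hzU)) h).mul hv.1.contDiffAt
    refine ((h1.contMDiffAt).comp (Θ z) (P.smoothAt_inv hzU)).congr_of_eventuallyEq ?_
    filter_upwards [P.isOpen_image.mem_nhds (mem_image_of_mem Θ hzU)] with y hy
    rw [lift, if_pos hy]; rfl
  · exact contMDiffAt_const.congr_of_eventuallyEq (P.eventually_lift_eq_zero hρ θ h hv hx)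

lemma isTestFunction_lift [T2Space M] (P : IsLocalParam I Θ Ξ U) (hρ : closedBall 0 ρ ⊆ U)
    (hθ : ContDiffOn ℝ ∞ θ U) (h : ℝ) {v : Plane → ℂ} (hv : v ∈ testSpace ρ) :
    IsTestFunction I (lift Θ Ξ U θ h v) where
  smooth := P.contMDiff_lift hρ hθ h hv
  support_subset := by
    refine Subset.trans ?_ ((image_mono hρ).trans P.image_subset)
    refine closure_minimal (fun x hx => ?_) (P.isClosed_image_closedBall hρ)
    by_contra h0
    exact hx (P.lift_eq_zero θ h hv h0)

variable [IsManifold I ∞ M] [MeasurableSpace M] [BorelSpace M]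
  [RiemannianBundle (fun x : M => TangentSpace I x)]
  [IsContMDiffRiemannianBundle I ∞ Plane (fun x : M => TangentSpace I x)]

/-- Integration of functions supported in a disc of a local parametrization. -/
lemma integral_eq_of_support (P : IsLocalParam I Θ Ξ U) {p : M} (hp : Θ '' U ⊆ (extChartAt I p).source)
    (hρ : closedBall 0 ρ ⊆ U) {β : Plane → ℝ}
    (hβ : ∀ z ∈ closedBall 0 ρ, β z = √(pullMetric I Θ z).det)
    {E : Type*} [NormedAddCommGroup E] [NormedSpace ℝ E] [SecondCountableTopology E]
    {f : M → E} {φ : Plane → E} (hφ : Continuous φ) (hf : ∀ z ∈ U, f (Θ z) = φ z)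
    (hφ0 : ∀ z ∉ closedBall 0 ρ, φ z = 0) (hf0 : ∀ x ∉ Θ '' closedBall 0 ρ, f x = 0) :
    ∫ x, f x ∂(riemannianVolume I M) = ∫ z, β z • φ z := by
  have hfc : ContinuousOn f (Θ '' U) := by
    refine (hφ.comp_continuousOn P.smooth_inv.continuousOn).congr ?_
    rintro _ ⟨z, hz, rfl⟩
    simp only [Function.comp_apply, P.left_inv z hz, hf z hz]
  have h1 : ∫ z in U, β z • φ z = ∫ z, β z • φ z :=
    setIntegral_eq_integral_of_forall_compl_eq_zero fun z hz => by
      rw [hφ0 z fun hz' => hz (hρ hz'), smul_zero]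
  rw [P.integral_eq hp hfc fun x hx => hf0 x fun hx' => hx (image_mono hρ hx'), ← h1]
  refine setIntegral_congr_fun P.isOpen.measurableSet fun z hz => ?_
  by_cases hz' : z ∈ closedBall 0 ρ
  · simp only [hf z hz, hβ z hz']
  · simp only [hf z hz, hφ0 z hz', smul_zero]

lemma eq_zero_of_mem_testSpace {v : Plane → ℂ} (hv : v ∈ testSpace ρ) {z : Plane}
    (hz : z ∉ closedBall 0 ρ) : v z = 0 :=
  image_eq_zero_of_notMem_tsupport fun h => hz (hv.2 h)

lemma l2Inner_lift (P : IsLocalParam I Θ Ξ U) {p : M} (hp : Θ '' U ⊆ (extChartAt I p).source)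
    (hρ : closedBall 0 ρ ⊆ U) {β : Plane → ℝ}
    (hβ : ∀ z ∈ closedBall 0 ρ, β z = √(pullMetric I Θ z).det) (h : ℝ)
    {v w : Plane → ℂ} (hv : v ∈ testSpace ρ) (hw : w ∈ testSpace ρ) :
    l2Inner I (lift Θ Ξ U θ h v) (lift Θ Ξ U θ h w) = ∫ z, (v z * (starRingEnd ℂ) (w z)) * β z := by
  rw [l2Inner, P.integral_eq_of_support hp hρ hβ (φ := fun z => v z * (starRingEnd ℂ) (w z))]
  · refine integral_congr_ae (Eventually.of_forall fun z => ?_)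
    simp only [Complex.real_smul]; ring
  · exact hv.1.continuous.mul (contDiff_conj hw.1).continuous
  · intro z hz
    rw [P.lift_apply θ h v hz, P.lift_apply θ h w hz, map_mul]
    linear_combination (v z * (starRingEnd ℂ) (w z)) * phase_mul_conj θ h z
  · intro z hz
    rw [eq_zero_of_mem_testSpace hv hz, zero_mul]
  · intro x hx
    rw [P.lift_eq_zero θ h hv hx, zero_mul]

lemma l2Norm_lift (P : IsLocalParam I Θ Ξ U) {p : M} (hp : Θ '' U ⊆ (extChartAt I p).source)
    (hρ : closedBall 0 ρ ⊆ U) {β : Plane → ℝ}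
    (hβ : ∀ z ∈ closedBall 0 ρ, β z = √(pullMetric I Θ z).det) (h : ℝ)
    {v : Plane → ℂ} (hv : v ∈ testSpace ρ) :
    l2Norm I (lift Θ Ξ U θ h v) = √(∫ z, ‖v z‖ ^ 2 * β z) := by
  rw [l2Norm, P.integral_eq_of_support hp hρ hβ (φ := fun z => ‖v z‖ ^ 2)]
  · congr 1
    refine integral_congr_ae (Eventually.of_forall fun z => ?_)
    simp only [smul_eq_mul]; ring
  · exact hv.1.continuous.norm.pow 2
  · intro z hz
    rw [P.lift_apply θ h v hz, norm_mul, norm_phase, one_mul]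
  · intro z hz
    rw [eq_zero_of_mem_testSpace hv hz]; simp
  · intro x hx
    rw [P.lift_eq_zero θ h hv hx]; simp

lemma magneticDifferential_eq_phase (A : ∀ x : M, TangentSpace I x →L[ℝ] ℝ) {z : Plane}
    (hθ : ContDiffAt ℝ ∞ θ z) {i : Fin 2}
    (ha : pullForm I A Θ i z = pd i θ z + if i = 0 then z 1 else 0) {h : ℝ} (hh : h ≠ 0) {u : M → ℂ}
    {v : Plane → ℂ} (hv : DifferentiableAt ℝ v z) (hu : (fun w => u (Θ w)) =ᶠ[𝓝 z] fun w => phase θ h w * v w) :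
    Complex.I * h * pd i (fun w => u (Θ w)) z + pullForm I A Θ i z * u (Θ z)
      = phase θ h z * momentum h i v z := by
  have hu0 : u (Θ z) = phase θ h z * v z := hu.self_of_nhds
  have hh' : (h : ℂ) ≠ 0 := by exact_mod_cast hh
  rw [pd_congr hu, pd_mul (contDiffAt_phase hθ h).diffAt_top hv, pd_phase hθ, hu0, ha, momentum]
  push_cast
  have hif : (((if i = 0 then z 1 else 0 : ℝ)) : ℂ) = if i = 0 then (z 1 : ℂ) else 0 := by
    split_ifs <;> simp
  rw [hif]
  field_simp
  ring_nf
  rw [Complex.I_sq]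
  ring

/-- The magnetic Schrödinger operator in a local parametrization. -/
theorem isMagneticSchrodinger_lift [T2Space M] (P : IsLocalParam I Θ Ξ U) {p : M}
    (hp : Θ '' U ⊆ (extChartAt I p).source) (hρ0 : 0 < ρ)
    (hρ : closedBall 0 (3 * ρ) ⊆ U) {β : Plane → ℝ} (hβs : ContDiff ℝ ∞ β) (hβpos : ∀ z, 0 < β z)
    (hβ : ∀ z ∈ closedBall 0 ρ, β z = √(pullMetric I Θ z).det)
    {G : Fin 2 → Fin 2 → Plane → ℝ} (hGs : ∀ i j, ContDiff ℝ ∞ (G i j)) (hsymm : ∀ i j, G i j = G j i)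
    (hG : ∀ z ∈ closedBall 0 ρ, ∀ i j, G i j z = β z * (pullMetric I Θ z)⁻¹ i j)
    (hθ : ContDiffOn ℝ ∞ θ U) {A : ∀ x : M, TangentSpace I x →L[ℝ] ℝ}
    (ha : ∀ z ∈ U, ∀ i, pullForm I A Θ i z = pd i θ z + if i = 0 then z 1 else 0)
    {h : ℝ} (hh : h ≠ 0) {v : Plane → ℂ} (hv : v ∈ testSpace ρ) :
    IsMagneticSchrodinger I A h (lift Θ Ξ U θ h v)
      (lift Θ Ξ U θ h fun z => ((β z)⁻¹ : ℂ) * magneticOp h G v z) := by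
  have hρ1 : closedBall (0 : Plane) ρ ⊆ U :=
    (Metric.closedBall_subset_closedBall (by linarith)).trans hρ
  have hw : (fun z => ((β z)⁻¹ : ℂ) * magneticOp h G v z) ∈ testSpace ρ :=
    (magneticEnd ρ hβs hβpos hGs h ⟨v, hv⟩).2
  refine ⟨P.contMDiff_lift hρ1 hθ h hw, fun u hu => ?_⟩
  have hχb : 2 * ρ < 3 * ρ := by linarith
  let χ : ContDiffBump (0 : Plane) := ⟨2 * ρ, 3 * ρ, by linarith, hχb⟩
  let W : Plane → ℂ := fun z => (χ z : ℂ) * ((starRingEnd ℂ) (phase θ h z) * u (Θ z))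
  have hWs : ContDiff ℝ ∞ W := by
    rw [contDiff_iff_contDiffAt]
    intro z
    by_cases hz : z ∈ closedBall 0 (3 * ρ)
    · have hzU := hρ hz
      have h1 : ContDiffAt ℝ ∞ (fun w => u (Θ w)) z :=
        ((hu.smooth (Θ z)).comp z (P.smoothAt hzU)).contDiffAt
      exact (contDiff_ofReal χ.contDiff).contDiffAt.mul ((Complex.conjCLE.contDiff.contDiffAt.comp z
        (contDiffAt_phase (hθ.contDiffAt (P.isOpen.mem_nhds hzU)) h)).mul h1)
    · refine contDiffAt_const (c := (0 : ℂ)) |>.congr_of_eventuallyEq ?_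
      have : z ∉ tsupport χ := by rw [χ.tsupport_eq]; exact hz
      filter_upwards [notMem_tsupport_iff_eventuallyEq.1 this] with w hw'
      simp only [W, hw']; simp
  have hWc : HasCompactSupport W := by
    refine χ.hasCompactSupport.mono fun z hz => ?_
    by_contra h0
    exact hz (by simp [W, Function.notMem_support.1 h0])
  have huW : ∀ z ∈ closedBall (0 : Plane) ρ, (fun w => u (Θ w)) =ᶠ[𝓝 z] fun w => phase θ h w * W w := by
    intro z hz
    have : ball (0 : Plane) (2 * ρ) ∈ 𝓝 z := Metric.isOpen_ball.mem_nhds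
      (Metric.closedBall_subset_ball (by linarith) hz)
    filter_upwards [this] with w hw'
    have h1 : χ w = 1 := χ.one_of_mem_closedBall (Metric.ball_subset_closedBall hw')
    simp only [W, h1]
    push_cast
    linear_combination (-(u (Θ w))) * phase_mul_conj θ h w
  have hmom0 : ∀ i, ∀ z ∉ closedBall (0 : Plane) ρ, momentum h i v z = 0 := by
    intro i z hz
    have h1 : v =ᶠ[𝓝 z] fun _ => 0 := notMem_tsupport_iff_eventuallyEq.1 fun h => hz (hv.2 h)
    rw [momentum, pd_congr h1, h1.self_of_nhds, pd_const]; simp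
  have hleft : l2Inner I (lift Θ Ξ U θ h fun z => ((β z)⁻¹ : ℂ) * magneticOp h G v z) u
      = ∫ z, magneticOp h G v z * (starRingEnd ℂ) (W z) := by
    rw [l2Inner, P.integral_eq_of_support hp hρ1 hβ
      (φ := fun z => (((β z)⁻¹ : ℂ) * magneticOp h G v z) * (starRingEnd ℂ) (W z))]
    · refine integral_congr_ae (Eventually.of_forall fun z => ?_)
      have : (β z : ℂ) ≠ 0 := by exact_mod_cast (hβpos z).ne'
      simp only [Complex.real_smul]
      field_simp
    · exact hw.1.continuous.mul (contDiff_conj hWs).continuous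
    · intro z hz
      rw [P.lift_apply θ h _ hz]
      by_cases hz' : z ∈ closedBall 0 ρ
      · have h1 : u (Θ z) = phase θ h z * W z := (huW z hz').self_of_nhds
        rw [h1, map_mul]
        linear_combination (((β z)⁻¹ : ℂ) * magneticOp h G v z * (starRingEnd ℂ) (W z))
          * phase_mul_conj θ h z
      · have : ((β z)⁻¹ : ℂ) * magneticOp h G v z = 0 := eq_zero_of_mem_testSpace hw hz'
        rw [this]; simp
    · intro z hz
      have : ((β z)⁻¹ : ℂ) * magneticOp h G v z = 0 := eq_zero_of_mem_testSpace hw hz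
      rw [this, zero_mul]
    · intro x hx
      rw [P.lift_eq_zero θ h hw hx, zero_mul]
  have hright : ∫ x, formInner I (magneticDifferential I A h (lift Θ Ξ U θ h v))
        (magneticDifferential I A h u) x ∂(riemannianVolume I M)
      = ∫ z, ∑ i, ∑ j, (G i j z : ℂ) * momentum h j v z * (starRingEnd ℂ) (momentum h i W z) := by
    rw [P.integral_eq_of_support hp hρ1 hβ (φ := fun z => ((β z)⁻¹ : ℂ) * ∑ i, ∑ j,
      (G i j z : ℂ) * momentum h j v z * (starRingEnd ℂ) (momentum h i W z))]
    · refine integral_congr_ae (Eventually.of_forall fun z => ?_)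
      have : (β z : ℂ) ≠ 0 := by exact_mod_cast (hβpos z).ne'
      simp only [Complex.real_smul]
      rw [mul_inv_cancel_left₀ this]
    · refine (contDiff_inv_ofReal hβs hβpos).continuous.mul ?_
      exact continuous_finsetSum _ fun i _ => continuous_finsetSum _ fun j _ =>
        (((contDiff_ofReal (hGs i j)).mul (contDiff_momentum hv.1 h j)).mul
          (contDiff_conj (contDiff_momentum hWs h i))).continuous
    · intro z hz
      have hlift : (fun w => lift Θ Ξ U θ h v (Θ w)) =ᶠ[𝓝 z] fun w => phase θ h w * v w := by
        filter_upwards [P.isOpen.mem_nhds hz] with w hw' using P.lift_apply θ h v hw'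
      have hθz := hθ.contDiffAt (P.isOpen.mem_nhds hz)
      rw [formInner_magneticDifferential A h ((P.contMDiff_lift hρ1 hθ h hv (Θ z)).mdifferentiableAt (by simp))
        ((hu.smooth (Θ z)).mdifferentiableAt (by simp)) (P.mdifferentiableAt hz)
        (P.det_pullMetric_pos hz).ne']
      have h1 := fun i => magneticDifferential_eq_phase A hθz (ha z hz i) hh
        (hv.1.diffAt_top z) hlift
      simp only [h1]
      by_cases hz' : z ∈ closedBall 0 ρ
      · have h2 := fun i => magneticDifferential_eq_phase A hθz (ha z hz i) hh
          (hWs.diffAt_top z) (huW z hz')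
        simp only [h2, map_mul]
        rw [Finset.sum_comm, Finset.mul_sum]
        refine Finset.sum_congr rfl fun i _ => ?_
        rw [Finset.mul_sum]
        refine Finset.sum_congr rfl fun j _ => ?_
        have hβ' : (β z : ℂ) ≠ 0 := by exact_mod_cast (hβpos z).ne'
        rw [hsymm i j, hG z hz' j i]
        push_cast
        field_simp
        linear_combination ((((pullMetric I Θ z)⁻¹ j i : ℝ) : ℂ) * momentum h j v z
          * (starRingEnd ℂ) (momentum h i W z)) * phase_mul_conj θ h z
      · simp [hmom0 _ z hz']
    · intro z hz
      simp [hmom0 _ z hz]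
    · intro x hx
      have h1 := P.eventually_lift_eq_zero hρ1 θ h hv hx
      have h2 : ∀ w : TangentSpace I x, magneticDifferential I A h (lift Θ Ξ U θ h v) x w = 0 := by
        intro w
        have h3 : mfderiv I 𝓘(ℝ, ℂ) (lift Θ Ξ U θ h v) x = 0 := by
          rw [h1.mfderiv_eq]; exact mfderiv_const
        rw [magneticDifferential, h1.self_of_nhds, h3]
        simp only [mul_zero, add_zero]
        exact mul_zero _
      simp only [formInner, h2, zero_mul, Finset.sum_const_zero]
  rw [hleft, hright, integral_magneticOp_mul_conj hv.1 hWs hWc h hGs]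

end IsLocalParam

end Lift

section Frame

variable {H : Type*} [TopologicalSpace H] {I : ModelWithCorners ℝ Plane H}
  {M : Type*} [TopologicalSpace M] [ChartedSpace H M]
  {Θ : Plane → M} {Ξ : M → Plane} {U : Set Plane} {z : Plane}

namespace IsLocalParam

lemma exists_eq_mfderiv (P : IsLocalParam I Θ Ξ U) (hz : z ∈ U) (v : TangentSpace I (Θ z)) :
    ∃ w : Plane, v = mfderiv 𝓘(ℝ, Plane) I Θ z w := by
  let T : Plane →L[ℝ] Plane := mfderiv 𝓘(ℝ, Plane) I Θ z
  have hinj : Function.Injective (T : Plane →ₗ[ℝ] Plane) := fun a b hab => by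
    have h1 := P.mfderiv_inv_paramVec hz a
    have h2 := P.mfderiv_inv_paramVec hz b
    rw [← h1, ← h2]
    exact congrArg (fun y : TangentSpace I (Θ z) => (mfderiv I 𝓘(ℝ, Plane) Ξ (Θ z) y : Plane)) hab
  obtain ⟨w, hw⟩ := LinearMap.injective_iff_surjective.1 hinj v
  exact ⟨w, hw.symm⟩

lemma norm_sq_mfderiv [RiemannianBundle (fun x : M => TangentSpace I x)] (Θ : Plane → M) (z w : Plane) :
    ‖(mfderiv 𝓘(ℝ, Plane) I Θ z w : TangentSpace I (Θ z))‖ ^ 2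
      = w 0 ^ 2 * pullMetric I Θ z 0 0 + 2 * w 0 * w 1 * pullMetric I Θ z 0 1
        + w 1 ^ 2 * pullMetric I Θ z 1 1 := by
  have hw : w = w 0 • basisVec 0 + w 1 • basisVec 1 := by
    ext i; fin_cases i <;> simp [basisVec]
  have h1 : (mfderiv 𝓘(ℝ, Plane) I Θ z w : TangentSpace I (Θ z))
      = w 0 • paramVec I Θ z 0 + w 1 • paramVec I Θ z 1 := by
    conv_lhs => rw [hw]
    exact (map_add (mfderiv 𝓘(ℝ, Plane) I Θ z) _ _).trans (congrArg₂ (· + ·)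
        (map_smul (mfderiv 𝓘(ℝ, Plane) I Θ z) (w 0) (basisVec 0))
        (map_smul (mfderiv 𝓘(ℝ, Plane) I Θ z) (w 1) (basisVec 1)))
  rw [h1, ← real_inner_self_eq_norm_sq]
  simp only [inner_add_left, inner_add_right, real_inner_smul_left, real_inner_smul_right]
  rw [real_inner_comm (paramVec I Θ z 0) (paramVec I Θ z 1)]
  simp only [pullMetric, Matrix.of_apply]
  ring

end IsLocalParam

end Frame

section Lipschitz

variable {H : Type*} [TopologicalSpace H] {I : ModelWithCorners ℝ Plane H}
  {M : Type*} [MetricSpace M] [ChartedSpace H M] [IsManifold I ∞ M]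
  [RiemannianBundle (fun x : M => TangentSpace I x)]

/-- A function with bounded differential is Lipschitz for the Riemannian distance. -/
lemma norm_sub_le_of_mfderiv_le [IsRiemannianManifold I M] {F : M → ℂ}
    (hF : ContMDiff I 𝓘(ℝ, ℂ) ∞ F) {C : ℝ} (hC : 0 < C)
    (hb : ∀ x, ∀ v : TangentSpace I x, ∀ d : ℂ, d = mfderiv I 𝓘(ℝ, ℂ) F x v → ‖d‖ ≤ C * ‖v‖)
    (x y : M) :
    ‖F x - F y‖ ≤ C * dist x y := by
  have h1 : ∀ r : ENNReal, edist x y < r → ‖F y - F x‖ₑ ≤ ENNReal.ofReal C * r := by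
    intro r hr
    rw [IsRiemannianManifold.out (I := I) x y] at hr
    obtain ⟨c, hc0, hc1, hc, hlen⟩ := exists_lt_of_riemannianEDist_lt hr
    have hFc : ContDiffOn ℝ 1 (fun t => F (c t)) (Icc 0 1) :=
      (((hF.of_le (by simp)).comp_contMDiffOn hc) : ContMDiffOn 𝓘(ℝ, ℝ) 𝓘(ℝ, ℂ) 1 (F ∘ c) (Icc 0 1)).contDiffOn
    have h2 := enorm_sub_le_lintegral_derivWithin_Icc_of_contDiffOn_Icc hFc zero_le_one
    rw [hc0, hc1] at h2
    refine h2.trans ?_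
    refine (le_trans ?_ (mul_le_mul_right hlen.le _))
    rw [Manifold.pathELength_eq_lintegral_mfderivWithin_Icc, ← lintegral_const_mul' _ _ ENNReal.ofReal_ne_top]
    refine setLIntegral_mono' measurableSet_Icc fun t ht => ?_
    have hd1 : MDifferentiableAt I 𝓘(ℝ, ℂ) F (c t) := (hF (c t)).mdifferentiableAt (by simp)
    have hd2 : MDifferentiableWithinAt 𝓘(ℝ, ℝ) I c (Icc 0 1) t := (hc t ht).mdifferentiableWithinAt (by simp)
    have hu : UniqueMDiffWithinAt 𝓘(ℝ, ℝ) (Icc (0 : ℝ) 1) t :=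
      (uniqueDiffOn_Icc zero_lt_one t ht).uniqueMDiffWithinAt
    have h3 : mfderivWithin 𝓘(ℝ, ℝ) 𝓘(ℝ, ℂ) (F ∘ c) (Icc 0 1) t
        = (mfderiv I 𝓘(ℝ, ℂ) F (c t)).comp (mfderivWithin 𝓘(ℝ, ℝ) I c (Icc 0 1) t) :=
      mfderiv_comp_mfderivWithin t hd1 hd2 hu
    have h4 : derivWithin (fun t => F (c t)) (Icc 0 1) t
        = mfderiv I 𝓘(ℝ, ℂ) F (c t) (mfderivWithin 𝓘(ℝ, ℝ) I c (Icc 0 1) t (1 : ℝ)) := by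
      rw [mfderivWithin_eq_fderivWithin] at h3
      exact congrArg (fun L : ℝ →L[ℝ] ℂ => L 1) h3
    rw [h4]
    let w : ℂ := mfderiv I 𝓘(ℝ, ℂ) F (c t) (mfderivWithin 𝓘(ℝ, ℝ) I c (Icc 0 1) t (1 : ℝ))
    have h5 : ‖w‖ ≤ C * ‖mfderivWithin 𝓘(ℝ, ℝ) I c (Icc 0 1) t (1 : ℝ)‖ := hb (c t) _ _ rfl
    have h6 := ENNReal.ofReal_le_ofReal h5
    rw [ENNReal.ofReal_mul hC.le, ofReal_norm_eq_enorm, ofReal_norm_eq_enorm] at h6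
    exact h6
  have h7 : ‖F y - F x‖ₑ ≤ ENNReal.ofReal C * edist x y := by
    refine le_of_forall_gt fun a ha => ?_
    have hC' : ENNReal.ofReal C ≠ 0 := by simpa using hC
    obtain ⟨r, hr1, hr2⟩ := exists_between ((ENNReal.lt_div_iff_mul_lt (Or.inl hC')
      (Or.inl ENNReal.ofReal_ne_top)).2 (by rwa [mul_comm] at ha))
    refine (h1 r hr1).trans_lt ?_
    rw [mul_comm]
    exact (ENNReal.lt_div_iff_mul_lt (Or.inl hC') (Or.inl ENNReal.ofReal_ne_top)).1 hr2
  rw [norm_sub_rev, ← ENNReal.ofReal_le_ofReal_iff (by positivity), ENNReal.ofReal_mul hC.le,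
    ofReal_norm_eq_enorm, ← edist_dist]
  exact h7

namespace IsLocalParam

variable {Θ : Plane → M} {Ξ : M → Plane} {U : Set Plane} {z : Plane} {ρ : ℝ}

/-- Functions supported in a local parametrization are Lipschitz for the Riemannian distance. -/
lemma exists_lipschitz_lift [IsRiemannianManifold I M]
    [IsContMDiffRiemannianBundle I ∞ Plane (fun x : M => TangentSpace I x)]
    (P : IsLocalParam I Θ Ξ U) (hρ : closedBall 0 ρ ⊆ U) {v : Plane → ℂ} (hv : v ∈ testSpace ρ) :
    ∃ C > 0, ∀ x y, ‖lift Θ Ξ U (fun _ => 0) 1 v x - lift Θ Ξ U (fun _ => 0) 1 v y‖ ≤ C * dist x y := by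
  set F := lift Θ Ξ U (fun _ => 0) 1 v with hFdef
  have hF : ContMDiff I 𝓘(ℝ, ℂ) ∞ F := P.contMDiff_lift hρ contDiffOn_const 1 hv
  let D : Plane → ℝ := fun z => (pullMetric I Θ z).det
  let B : Plane → ℝ := fun z => ‖pd 0 v z‖ * √(pullMetric I Θ z 1 1 / D z)
    + ‖pd 1 v z‖ * √(pullMetric I Θ z 0 0 / D z)
  have hB : ContinuousOn B (closedBall 0 ρ) := by
    intro z hz
    have hg := P.matSmooth_pullMetric (hρ hz)
    have hd := (P.det_pullMetric_pos (hρ hz)).ne'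
    have hc : ∀ i, ContinuousAt (fun z => ‖pd i v z‖) z := fun i => (hv.1.pd i).continuous.norm.continuousAt
    have hs : ∀ i, ContinuousAt (fun z => √(pullMetric I Θ z i i / D z)) z := fun i =>
      Real.continuous_sqrt.continuousAt.comp ((hg i i).continuousAt.div hg.det.continuousAt hd)
    exact (((hc 0).mul (hs 1)).add ((hc 1).mul (hs 0))).continuousWithinAt
  obtain ⟨K, hK⟩ := (isCompact_closedBall (0 : Plane) ρ).exists_bound_of_continuousOn hB
  refine ⟨|K| + 1, by positivity, norm_sub_le_of_mfderiv_le hF (by positivity) fun x w d hd => ?_⟩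
  by_cases hx : x ∈ Θ '' closedBall 0 ρ
  · obtain ⟨z, hz, rfl⟩ := hx
    have hzU := hρ hz
    obtain ⟨a, rfl⟩ := P.exists_eq_mfderiv hzU w
    set N := ‖(mfderiv 𝓘(ℝ, Plane) I Θ z a : TangentSpace I (Θ z))‖ with hN
    have hNs := norm_sq_mfderiv (I := I) Θ z a
    have hD := P.det_pullMetric_pos hzU
    have hDe : (pullMetric I Θ z).det = pullMetric I Θ z 0 0 * pullMetric I Θ z 1 1
        - pullMetric I Θ z 0 1 ^ 2 := by
      have : pullMetric I Θ z 1 0 = pullMetric I Θ z 0 1 :=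
        congrFun (congrFun (pullMetric_transpose (I := I) (Θ := Θ) z) 0) 1
      rw [Matrix.det_fin_two, this]; ring
    have hnn : ∀ i, 0 ≤ pullMetric I Θ z i i / D z := fun i =>
      div_nonneg (real_inner_self_nonneg (x := paramVec I Θ z i)) hD.le
    have e0 : |a 0| ≤ √(pullMetric I Θ z 1 1 / D z) * N := by
      refine abs_le_of_sq_le_sq ?_ (by positivity)
      rw [mul_pow, Real.sq_sqrt (hnn _), hNs, div_mul_eq_mul_div,
        le_div_iff₀ hD]
      simp only [hDe]
      nlinarith [sq_nonneg (pullMetric I Θ z 1 1 * a 1 + pullMetric I Θ z 0 1 * a 0)]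
    have e1 : |a 1| ≤ √(pullMetric I Θ z 0 0 / D z) * N := by
      refine abs_le_of_sq_le_sq ?_ (by positivity)
      rw [mul_pow, Real.sq_sqrt (hnn _), hNs, div_mul_eq_mul_div,
        le_div_iff₀ hD]
      simp only [hDe]
      nlinarith [sq_nonneg (pullMetric I Θ z 0 0 * a 0 + pullMetric I Θ z 0 1 * a 1)]
    have hcomp : mfderiv 𝓘(ℝ, Plane) 𝓘(ℝ, ℂ) (F ∘ Θ) z
        = (mfderiv I 𝓘(ℝ, ℂ) F (Θ z)).comp (mfderiv 𝓘(ℝ, Plane) I Θ z) :=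
      mfderiv_comp z ((hF (Θ z)).mdifferentiableAt (by simp)) (P.mdifferentiableAt hzU)
    have hFv : (F ∘ Θ) =ᶠ[𝓝 z] v := by
      filter_upwards [P.isOpen.mem_nhds hzU] with y hy
      rw [Function.comp_apply, hFdef, P.lift_apply _ _ _ hy]
      simp [phase]
    have hFd : d = fderiv ℝ v z a := by
      rw [hFv.mfderiv_eq, mfderiv_eq_fderiv] at hcomp
      exact hd.trans (congrArg (fun L : Plane →L[ℝ] ℂ => L a) hcomp).symm
    have ha : a = a 0 • basisVec 0 + a 1 • basisVec 1 := by
      ext i; fin_cases i <;> simp [basisVec]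
    have hfd : fderiv ℝ v z a = a 0 • pd 0 v z + a 1 • pd 1 v z := by
      conv_lhs => rw [ha]
      rw [map_add, map_smul, map_smul]; rfl
    rw [hFd, hfd]
    have hBK : B z ≤ |K| + 1 := (le_abs_self _).trans ((hK z hz).trans ((le_abs_self K).trans (by linarith)))
    calc ‖a 0 • pd 0 v z + a 1 • pd 1 v z‖ ≤ |a 0| * ‖pd 0 v z‖ + |a 1| * ‖pd 1 v z‖ := by
          refine (norm_add_le _ _).trans ?_
          rw [norm_smul, norm_smul, Real.norm_eq_abs, Real.norm_eq_abs]
      _ ≤ (√(pullMetric I Θ z 1 1 / D z) * N) * ‖pd 0 v z‖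
          + (√(pullMetric I Θ z 0 0 / D z) * N) * ‖pd 1 v z‖ := by gcongr
      _ = B z * N := by simp only [B]; ring
      _ ≤ (|K| + 1) * N := by gcongr
  · have h1 := P.eventually_lift_eq_zero hρ (fun _ => 0) 1 hv hx
    have h2 : mfderiv I 𝓘(ℝ, ℂ) F x = 0 := by rw [h1.mfderiv_eq]; exact mfderiv_const
    have h3 : d = 0 := by rw [hd, h2]; rfl
    rw [h3, norm_zero]
    positivity

end IsLocalParam

end Lipschitz

section IntegralCurves

/-- Smooth vector fields have smooth integral curves. -/
lemma exists_contDiffAt_integralCurve {E : Type*} [NormedAddCommGroup E] [NormedSpace ℝ E]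
    [CompleteSpace E] {F : E → E} {W : Set E} {x₀ : E} (hW : IsOpen W) (hx : x₀ ∈ W)
    (hF : ContDiffOn ℝ ∞ F W) :
    ∃ α : ℝ → E, α 0 = x₀ ∧ ContDiffAt ℝ ∞ α 0 ∧ ∀ᶠ t in 𝓝 (0 : ℝ), HasDerivAt α (F (α t)) t := by
  obtain ⟨α, h0, ε, hε, hα⟩ := ((hF.contDiffAt (hW.mem_nhds hx)).of_le (by simp :
    (1 : WithTop ℕ∞) ≤ ∞)).exists_forall_mem_closedBall_exists_eq_forall_mem_Ioo_hasDerivAt₀ 0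
  simp only [zero_sub, zero_add] at hα
  have hd : ∀ᶠ t in 𝓝 (0 : ℝ), HasDerivAt α (F (α t)) t :=
    (Ioo_mem_nhds (by linarith) hε : Ioo (-ε) ε ∈ 𝓝 (0 : ℝ)) |> fun h => mem_of_superset h hα
  have hc : ContinuousAt α 0 := hd.self_of_nhds.continuousAt
  have hmem : ∀ᶠ t in 𝓝 (0 : ℝ), α t ∈ W := hc.eventually (by rw [h0]; exact hW.mem_nhds hx)
  obtain ⟨S, hS, hSo, h0S⟩ := eventually_nhds_iff.1 (hd.and hmem)
  have key : ∀ n : ℕ, ContDiffOn ℝ n α S := by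
    intro n
    induction n with
    | zero => exact contDiffOn_zero.2 fun t ht => (hS t ht).1.continuousAt.continuousWithinAt
    | succ n ih =>
      push_cast
      refine (contDiffOn_succ_iff_deriv_of_isOpen hSo).2
        ⟨fun t ht => (hS t ht).1.differentiableAt.differentiableWithinAt, by simp, ?_⟩
      exact ((hF.of_le (by exact_mod_cast le_top)).comp ih fun t ht => (hS t ht).2).congr
        fun t ht => (hS t ht).1.deriv
  exact ⟨α, h0, (contDiffOn_infty.2 key).contDiffAt (hSo.mem_nhds h0S), hd⟩

lemma hasDerivAt_comp_plane {g : Plane → ℝ} {κ : ℝ → Plane} {κ' : Plane} {t : ℝ}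
    (hg : DifferentiableAt ℝ g (κ t)) (hκ : HasDerivAt κ κ' t) :
    HasDerivAt (fun r => g (κ r)) (κ' 0 * pd 0 g (κ t) + κ' 1 * pd 1 g (κ t)) t := by
  have h1 := hg.hasFDerivAt.comp_hasDerivAt t hκ
  have h2 : κ' = κ' 0 • basisVec 0 + κ' 1 • basisVec 1 := by
    ext i; fin_cases i <;> simp [basisVec]
  have h3 : fderiv ℝ g (κ t) κ' = κ' 0 * pd 0 g (κ t) + κ' 1 * pd 1 g (κ t) := by
    conv_lhs => rw [h2]
    rw [map_add, map_smul, map_smul]; rfl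
  rw [← h3]
  exact h1

lemma hasDerivAt_component {κ : ℝ → Plane} {κ' : Plane} {t : ℝ} (hκ : HasDerivAt κ κ' t) (i : Fin 2) :
    HasDerivAt (fun r => κ r i) (κ' i) t :=
  (EuclideanSpace.proj i : Plane →L[ℝ] ℝ).hasFDerivAt.comp_hasDerivAt t hκ

/-- Second derivative along a curve through a critical point. -/
lemma iteratedDeriv_two_comp_plane {f : Plane → ℝ} {κ : ℝ → Plane} (hf : ContDiffAt ℝ ∞ f (κ 0))
    (hκ : ContDiffAt ℝ ∞ κ 0) (h0 : pd 0 f (κ 0) = 0) (h1 : pd 1 f (κ 0) = 0) (hκ0 : deriv κ 0 0 = 0) :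
    iteratedDeriv 2 (fun t => f (κ t)) 0 = (deriv κ 0 1) ^ 2 * pd 1 (pd 1 f) (κ 0) := by
  have hκ1 : ∀ᶠ t in 𝓝 (0 : ℝ), ContDiffAt ℝ 1 κ t := (hκ.of_le (by simp)).eventually (by simp)
  have hf1 : ∀ᶠ t in 𝓝 (0 : ℝ), ContDiffAt ℝ 1 f (κ t) :=
    hκ.continuousAt.eventually ((hf.of_le (by simp)).eventually (by simp))
  have e1 : deriv (fun t => f (κ t)) =ᶠ[𝓝 0]
      fun t => deriv κ t 0 * pd 0 f (κ t) + deriv κ t 1 * pd 1 f (κ t) := by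
    filter_upwards [hκ1, hf1] with t ht ht'
    exact (hasDerivAt_comp_plane (ht'.differentiableAt (by simp))
      (ht.differentiableAt (by simp)).hasDerivAt).deriv
  rw [iteratedDeriv_succ, iteratedDeriv_one, e1.deriv_eq]
  have d1 : HasDerivAt κ (deriv κ 0) 0 := hκ.diffAt_top.hasDerivAt
  have d2 : HasDerivAt (deriv κ) (deriv (deriv κ) 0) 0 := by
    have h3 : ContDiffAt ℝ ∞ (fun t => fderiv ℝ κ t 1) 0 :=
      (hκ.fderiv_right (m := ∞) (by simp)).clm_apply contDiffAt_const
    exact (h3.diffAt_top).hasDerivAt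
  have p := fun i => hasDerivAt_comp_plane (hf.pd i).diffAt_top d1
  have := ((hasDerivAt_component d2 0).mul (p 0)).add ((hasDerivAt_component d2 1).mul (p 1))
  refine this.deriv.trans ?_
  rw [h0, h1, hκ0]
  ring

/-- The geodesic equation has smooth solutions. -/
lemma exists_geodesic_plane {Γ : Fin 2 → Fin 2 → Fin 2 → Plane → ℝ} {W : Set Plane} (hW : IsOpen W)
    (hΓ : ∀ k i j, ContDiffOn ℝ ∞ (Γ k i j) W) {y₀ : Plane} (hy : y₀ ∈ W) (v₀ : Plane) :
    ∃ y : ℝ → Plane, y 0 = y₀ ∧ deriv y 0 = v₀ ∧ ContDiffAt ℝ ∞ y 0 ∧ ∀ᶠ t in 𝓝 (0 : ℝ), ∀ k,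
      iteratedDeriv 2 (fun r => y r k) t
        + ∑ i, ∑ j, Γ k i j (y t) * deriv (fun r => y r i) t * deriv (fun r => y r j) t = 0 := by
  let F : Plane × Plane → Plane × Plane := fun p =>
    (p.2, WithLp.toLp 2 fun k => -∑ i, ∑ j, Γ k i j p.1 * p.2 i * p.2 j)
  have hF : ContDiffOn ℝ ∞ F (W ×ˢ univ) := by
    refine contDiffOn_snd.prodMk ?_
    rw [contDiffOn_euclidean]
    intro k
    refine ContDiffOn.neg (ContDiffOn.sum fun i _ => ContDiffOn.sum fun j _ => ?_)
    have hc : ∀ i : Fin 2, ContDiffOn ℝ ∞ (fun p : Plane × Plane => p.2 i) (W ×ˢ univ) := fun i =>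
      ((contDiff_coord i).comp contDiff_snd).contDiffOn
    exact (((hΓ k i j).comp contDiffOn_fst fun p hp => hp.1).mul (hc i)).mul (hc j)
  obtain ⟨α, h0, hα, hd⟩ := exists_contDiffAt_integralCurve (x₀ := (y₀, v₀)) (hW.prod isOpen_univ)
    ⟨hy, mem_univ _⟩ hF
  have hd1 : ∀ᶠ t in 𝓝 (0 : ℝ), HasDerivAt (fun r => (α r).1) (α t).2 t := hd.mono fun t ht => ht.fst
  have hd2 : ∀ᶠ t in 𝓝 (0 : ℝ), HasDerivAt (fun r => (α r).2) (F (α t)).2 t := hd.mono fun t ht => ht.snd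
  refine ⟨fun t => (α t).1, by simp [h0], ?_, hα.fst, ?_⟩
  · rw [hd1.self_of_nhds.deriv, h0]
  · filter_upwards [hd1.eventually_nhds, hd2] with t ht1 ht2 k
    have e1 : ∀ i, deriv (fun r => (α r).1 i) =ᶠ[𝓝 t] fun r => (α r).2 i := fun i =>
      ht1.mono fun r hr => (hasDerivAt_component hr i).deriv
    rw [iteratedDeriv_succ, iteratedDeriv_one, (e1 k).deriv_eq, (hasDerivAt_component ht2 k).deriv]
    simp only [(e1 _).self_of_nhds, F]
    exact neg_add_cancel _

end IntegralCurves

section Geodesics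

variable {H : Type*} [TopologicalSpace H] {I : ModelWithCorners ℝ Plane H}
  {M : Type*} [TopologicalSpace M] [ChartedSpace H M]

lemma velocity_eq {c : ℝ → M} {Θ : Plane → M} {κ : ℝ → Plane} {t : ℝ}
    (hκ : DifferentiableAt ℝ κ t) (hΘ : MDifferentiableAt 𝓘(ℝ, Plane) I Θ (κ t))
    (h : c =ᶠ[𝓝 t] fun r => Θ (κ r)) :
    (velocity I c t : Plane) = mfderiv 𝓘(ℝ, Plane) I Θ (κ t) (deriv κ t) := by
  have h1 : mfderiv 𝓘(ℝ, ℝ) I c t = mfderiv 𝓘(ℝ, ℝ) I (Θ ∘ κ) t := h.mfderiv_eq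
  have h2 : mfderiv 𝓘(ℝ, ℝ) I (Θ ∘ κ) t
      = (mfderiv 𝓘(ℝ, Plane) I Θ (κ t)).comp (mfderiv 𝓘(ℝ, ℝ) 𝓘(ℝ, Plane) κ t) :=
    mfderiv_comp t hΘ hκ.mdifferentiableAt
  rw [mfderiv_eq_fderiv] at h2
  exact congrArg (fun L : ℝ →L[ℝ] Plane => L 1) (h1.trans h2)

variable [IsManifold I ∞ M] [RiemannianBundle (fun x : M => TangentSpace I x)]

/-- Existence of normal geodesics. -/
lemma exists_isNormalGeodesic [IsContMDiffRiemannianBundle I ∞ Plane (fun x : M => TangentSpace I x)]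
    {γ : ℝ → M} {s : ℝ} (hint : I.IsInteriorPoint (γ s)) (e : TangentSpace I (γ s)) (he : ‖e‖ = 1)
    (hn : inner ℝ e (velocity I γ s) = 0) : ∃ c, IsNormalGeodesic I γ s c := by
  have hqs : (γ s) ∈ (extChartAt I (γ s)).source := mem_extChartAt_source (γ s)
  have P := isLocalParam_extChart (I := I) (γ s)
  have hy : extChartAt I (γ s) (γ s) ∈ interior (extChartAt I (γ s)).target :=
    mem_interior_iff_mem_nhds.2 (extChartAt_mem_interior hint hqs)
  have hΓ : ∀ k i j, ContDiffOn ℝ ∞ (christoffel I (γ s) k i j) (interior (extChartAt I (γ s)).target) := by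
    intro k i j y hy
    have hr : range I ∈ 𝓝 y :=
      mem_of_superset (mem_interior_iff_mem_nhds.1 hy) (extChartAt_target_subset_range (γ s))
    exact ((matSmooth_connection (P.matSmooth_pullMetric hy) (P.det_pullMetric_pos hy).ne' i k
      j).congr_of_eventuallyEq (eventually_christoffel_eq hr k i j)).contDiffWithinAt
  have hsymm : (extChartAt I (γ s)).symm (extChartAt I (γ s) (γ s)) = (γ s) := extChartAt_to_inv (γ s)
  obtain ⟨v₀, hv₀⟩ : ∃ v : Plane, (e : Plane)
      = mfderiv 𝓘(ℝ, Plane) I (extChartAt I (γ s)).symm (extChartAt I (γ s) (γ s)) v :=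
    IsLocalParam.exists_eq_mfderiv P hy (show TangentSpace I ((extChartAt I (γ s)).symm (extChartAt I (γ s) (γ s))) from (e : Plane))
  obtain ⟨y, hy0, hyv, hys, hgeo⟩ := exists_geodesic_plane isOpen_interior hΓ hy v₀
  let c : ℝ → M := fun t => (extChartAt I (γ s)).symm (y t)
  have hc0 : c 0 = (γ s) := by simp only [c, hy0, hsymm]
  have hy0' : y 0 ∈ interior (extChartAt I (γ s)).target := by rw [hy0]; exact hy
  have hvel : (velocity I c 0 : Plane) = e := by
    have h1 := velocity_eq (I := I) (c := c) hys.diffAt_top (P.mdifferentiableAt hy0')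
      (Eventually.of_forall fun _ => rfl)
    have h2 : ∀ w v : Plane, w = extChartAt I (γ s) (γ s) → v = v₀ →
        (mfderiv 𝓘(ℝ, Plane) I (extChartAt I (γ s)).symm w v : Plane) = e := by
      rintro w v rfl rfl; exact hv₀.symm
    exact h1.trans (h2 _ _ hy0 hyv)
  have hmem : ∀ᶠ t in 𝓝 (0 : ℝ), y t ∈ interior (extChartAt I (γ s)).target :=
    hys.continuousAt.eventually (isOpen_interior.mem_nhds hy0')
  have hcoord : (fun t => extChartAt I (c 0) (c t)) =ᶠ[𝓝 0] y := by
    rw [hc0]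
    filter_upwards [hmem] with t ht using (extChartAt I (γ s)).right_inv (interior_subset ht)
  let N : M → Plane → ℝ := fun x v => ‖(show TangentSpace I x from v)‖
  refine ⟨c, hc0, (P.smoothAt hy0').comp 0 hys.contMDiffAt, ?_, ?_, ?_⟩
  · have h1 : N (c 0) (velocity I c 0) = N (γ s) e := by rw [hc0, hvel]
    exact h1.trans he
  · let met : Plane → ℝ := fun v => inner ℝ (E := TangentSpace I (γ s)) v (velocity I γ s)
    exact (congrArg met hvel).trans hn
  · filter_upwards [hgeo, hcoord.eventually_nhds] with t ht ht2 k
    have h1 : ∀ i, (fun r => extChartAt I (c 0) (c r) i) =ᶠ[𝓝 t] fun r => y r i := fun i =>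
      ht2.mono fun r hr => by simp only [hr]
    refine Eq.trans ?_ (ht k)
    have h3 : extChartAt I (c 0) (c t) = y t := ht2.self_of_nhds
    rw [(h1 k).iteratedDeriv_eq 2, h3]
    have hd : ∀ i, deriv (fun r => extChartAt I (c 0) (c r) i) t = deriv (fun r => y r i) t :=
      fun i => (h1 i).deriv_eq
    simp only [hd]
    rw [hc0]

namespace IsLocalParam

variable {Θ : Plane → M} {Ξ : M → Plane} {U : Set Plane} {z : Plane}

lemma right_inv (P : IsLocalParam I Θ Ξ U) {x : M} (hx : x ∈ Θ '' U) : Θ (Ξ x) = x := by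
  obtain ⟨w, hw, rfl⟩ := hx
  rw [P.left_inv w hw]

/-- The second normal derivative in a local parametrization adapted to the curve. -/
lemma secondNormalDeriv_eq [IsContMDiffRiemannianBundle I ∞ Plane (fun x : M => TangentSpace I x)]
    (P : IsLocalParam I Θ Ξ U) (hz : z ∈ U) {γ : ℝ → M} {s m a : ℝ} (hm : 0 < m) (ha : a ≠ 0)
    (hγ : γ s = Θ z) (hv : (velocity I γ s : Plane) = a • (paramVec I Θ z 0 : Plane))
    (hg : pullMetric I Θ z = m⁻¹ • (1 : Mat)) {f : M → ℝ}
    (hf : ContDiffAt ℝ ∞ (fun w => f (Θ w)) z) (h0 : pd 0 (fun w => f (Θ w)) z = 0)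
    (h1 : pd 1 (fun w => f (Θ w)) z = 0) :
    secondNormalDeriv I γ f s = m * pd 1 (pd 1 fun w => f (Θ w)) z := by
  let met : M → Plane → Plane → ℝ := fun x v w => inner ℝ (E := TangentSpace I x) v w
  have hg' : ∀ i j, met (Θ z) (paramVec I Θ z i) (paramVec I Θ z j)
      = (m⁻¹ • (1 : Mat)) i j := fun i j => by rw [← hg]; rfl
  have hex : ∃ c, IsNormalGeodesic I γ s c := by
    have hint : I.IsInteriorPoint (γ s) := by rw [hγ]; exact P.isInteriorPoint hz
    let e : Plane := √m • (paramVec I Θ z 1 : Plane)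
    refine exists_isNormalGeodesic hint (show TangentSpace I (γ s) from e) ?_ ?_
    · have h2 : met (γ s) e e = 1 := by
        rw [hγ]
        change inner ℝ (√m • paramVec I Θ z 1) (√m • paramVec I Θ z 1) = 1
        rw [real_inner_smul_left, real_inner_smul_right]
        have := hg' 1 1
        simp only [Matrix.smul_apply, Matrix.one_apply_eq, smul_eq_mul, mul_one] at this
        change √m * (√m * met (Θ z) (paramVec I Θ z 1) (paramVec I Θ z 1)) = 1
        rw [this, ← mul_assoc, Real.mul_self_sqrt hm.le, mul_inv_cancel₀ hm.ne']
      have h3 : ‖(show TangentSpace I (γ s) from e)‖ ^ 2 = 1 :=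
        (real_inner_self_eq_norm_sq (show TangentSpace I (γ s) from e)).symm.trans h2
      exact (pow_eq_one_iff_of_nonneg (norm_nonneg _) two_ne_zero).1 h3
    · have h2 : met (γ s) e (velocity I γ s) = met (Θ z) e (a • (paramVec I Θ z 0 : Plane)) := by
        rw [hv, hγ]
      refine h2.trans ?_
      change inner ℝ (√m • paramVec I Θ z 1) (a • paramVec I Θ z 0) = 0
      rw [real_inner_smul_left, real_inner_smul_right]
      have := hg' 1 0
      simp only [Matrix.smul_apply, Matrix.one_apply, one_ne_zero, if_false, smul_zero] at this
      change √m * (a * met (Θ z) (paramVec I Θ z 1) (paramVec I Θ z 0)) = 0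
      rw [this, mul_zero, mul_zero]
  rw [secondNormalDeriv, dif_pos hex]
  generalize hex.choose_spec = hc
  revert hc
  generalize hex.choose = c
  intro hc
  have hc0 : c 0 = Θ z := hc.start.trans hγ
  let κ : ℝ → Plane := fun t => Ξ (c t)
  have hκ0 : κ 0 = z := by simp only [κ, hc0, P.left_inv z hz]
  have hκ : ContDiffAt ℝ ∞ κ 0 := by
    have h2 : ContMDiffAt I 𝓘(ℝ, Plane) ∞ Ξ (c 0) := by rw [hc0]; exact P.smoothAt_inv hz
    exact (h2.comp 0 hc.smooth).contDiffAt
  have hcΘ : c =ᶠ[𝓝 0] fun t => Θ (κ t) := by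
    have : ∀ᶠ t in 𝓝 (0 : ℝ), c t ∈ Θ '' U := hc.smooth.continuousAt.eventually (by
      rw [hc0]; exact P.isOpen_image.mem_nhds (mem_image_of_mem Θ hz))
    exact this.mono fun t ht => (P.right_inv ht).symm
  set w := deriv κ 0 with hw
  have hvel : (velocity I c 0 : Plane) = mfderiv 𝓘(ℝ, Plane) I Θ z w := by
    have h2 := velocity_eq (I := I) hκ.diffAt_top
      (by rw [hκ0]; exact P.mdifferentiableAt hz) hcΘ
    have h3 : ∀ y : Plane, y = z → (mfderiv 𝓘(ℝ, Plane) I Θ y w : Plane) = mfderiv 𝓘(ℝ, Plane) I Θ z w := by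
      rintro y rfl; rfl
    exact h2.trans (h3 _ hκ0)
  have hexp : (mfderiv 𝓘(ℝ, Plane) I Θ z w : Plane)
      = w 0 • (paramVec I Θ z 0 : Plane) + w 1 • (paramVec I Θ z 1 : Plane) := by
    have h2 : w = w 0 • basisVec 0 + w 1 • basisVec 1 := by ext i; fin_cases i <;> simp [basisVec]
    conv_lhs => rw [h2]
    exact (map_add (mfderiv 𝓘(ℝ, Plane) I Θ z) _ _).trans (congrArg₂ (· + ·)
      (map_smul (mfderiv 𝓘(ℝ, Plane) I Θ z) (w 0) (basisVec 0))
      (map_smul (mfderiv 𝓘(ℝ, Plane) I Θ z) (w 1) (basisVec 1)))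
  have hw0 : w 0 = 0 := by
    have h2 : met (γ s) (velocity I c 0) (velocity I γ s) = 0 := hc.normal
    rw [hvel, hexp, hv, hγ] at h2
    change inner ℝ (w 0 • paramVec I Θ z 0 + w 1 • paramVec I Θ z 1) (a • paramVec I Θ z 0) = 0 at h2
    rw [inner_add_left, real_inner_smul_left, real_inner_smul_left, real_inner_smul_right,
      real_inner_smul_right] at h2
    change w 0 * (a * met (Θ z) (paramVec I Θ z 0) (paramVec I Θ z 0))
      + w 1 * (a * met (Θ z) (paramVec I Θ z 1) (paramVec I Θ z 0)) = 0 at h2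
    rw [hg', hg'] at h2
    simpa [ha, hm.ne'] using h2
  have hw1 : w 1 ^ 2 = m := by
    let N : M → Plane → ℝ := fun x v => ‖(show TangentSpace I x from v)‖
    have h2 : N (Θ z) (mfderiv 𝓘(ℝ, Plane) I Θ z w) = 1 := by
      rw [← hvel, ← hc0]; exact hc.unit
    have h3 := norm_sq_mfderiv (I := I) Θ z w
    have h4 : ‖(mfderiv 𝓘(ℝ, Plane) I Θ z w : TangentSpace I (Θ z))‖ = 1 := h2
    rw [h4, hw0, hg] at h3
    simp at h3
    field_simp at h3
    exact h3.symm
  have hfc : (fun t => f (c t)) =ᶠ[𝓝 0] fun t => (fun y => f (Θ y)) (κ t) :=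
    hcΘ.mono fun t ht => by simp only [ht]
  rw [hfc.iteratedDeriv_eq 2]
  refine (iteratedDeriv_two_comp_plane (f := fun y => f (Θ y)) (by rw [hκ0]; exact hf) hκ
    (by rw [hκ0]; exact h0) (by rw [hκ0]; exact h1) hw0).trans ?_
  rw [hκ0, ← hw1]

end IsLocalParam

end Geodesics

section Calculus

/-- Quadratic growth at a minimum point makes the second derivative positive. -/
lemma deriv_eq_zero_and_iteratedDeriv_two_pos {f : ℝ → ℝ} (hf : ContDiffAt ℝ ∞ f 0) {c : ℝ} (hc : 0 < c)
    (h : ∀ᶠ x in 𝓝 (0 : ℝ), f 0 + c * x ^ 2 ≤ f x) : deriv f 0 = 0 ∧ 0 < iteratedDeriv 2 f 0 := by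
  let g : ℝ → ℝ := fun x => f x - c / 2 * x ^ 2
  have hg : ∀ᶠ x in 𝓝 (0 : ℝ), g 0 + c / 2 * x ^ 2 ≤ g x := h.mono fun x hx => by
    simp only [g]; linarith
  have hq : ∀ x, HasDerivAt (fun x : ℝ => c / 2 * x ^ 2) (c * x) x := fun x => by
    have := (hasDerivAt_pow 2 x).const_mul (c / 2)
    rwa [show c / 2 * (((2 : ℕ) : ℝ) * x ^ (2 - 1)) = c * x by norm_num; ring] at this
  have hfd : ∀ᶠ x in 𝓝 (0 : ℝ), DifferentiableAt ℝ f x :=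
    ((hf.of_le (m := 1) (by simp)).eventually (by simp)).mono fun x hx => hx.differentiableAt (by simp)
  have hgd : deriv g =ᶠ[𝓝 0] fun x => deriv f x - c * x := hfd.mono fun x hx =>
    (hx.hasDerivAt.sub (hq x)).deriv
  have hmin : IsLocalMin g 0 := hg.mono fun x hx => by nlinarith [sq_nonneg x]
  have h0 : deriv g 0 = 0 := hmin.deriv_eq_zero
  have hf1 : deriv f 0 = 0 := by
    have := hgd.self_of_nhds
    simp only [mul_zero, sub_zero] at this
    rw [← this, h0]
  refine ⟨hf1, ?_⟩
  have hfd2 : DifferentiableAt ℝ (deriv f) 0 :=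
    ((hf.fderiv_right (m := ∞) (by simp)).clm_apply (contDiffAt_const (c := (1 : ℝ)))).diffAt_top
  have hg2 : deriv (deriv g) 0 = deriv (deriv f) 0 - c := by
    rw [hgd.deriv_eq]
    have := hfd2.hasDerivAt.sub ((hasDerivAt_id' (0 : ℝ)).const_mul c)
    rw [mul_one] at this
    exact this.deriv
  have hgc : ContinuousAt g 0 := (hf.continuousAt).sub (by fun_prop)
  have h2 : 0 ≤ deriv (deriv g) 0 := by
    by_contra hlt
    have hmax : IsLocalMax g 0 := isLocalMax_of_deriv_deriv_neg (not_le.1 hlt) h0 hgc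
    have h3 : ∀ᶠ x in 𝓝[≠] (0 : ℝ), False := by
      filter_upwards [hmax.filter_mono nhdsWithin_le_nhds, hg.filter_mono nhdsWithin_le_nhds,
        self_mem_nhdsWithin] with x h1 h2 h3
      have : 0 < x ^ 2 := by have : x ≠ 0 := h3; positivity
      nlinarith
    exact h3.exists.choose_spec
  rw [iteratedDeriv_succ, iteratedDeriv_one]
  linarith

lemma contDiffAt_comp_pt_zero {f : Plane → ℝ} {x : ℝ} (hf : ContDiffAt ℝ ∞ f (pt x 0)) :
    ContDiffAt ℝ ∞ (fun t => f (pt t 0)) x :=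
  hf.comp x (contDiff_pt.comp (contDiff_id.prodMk (contDiff_const (c := (0 : ℝ))))).contDiffAt

lemma contDiffAt_comp_pt_one {f : Plane → ℝ} {x y : ℝ} (hf : ContDiffAt ℝ ∞ f (pt x y)) :
    ContDiffAt ℝ ∞ (fun t => f (pt x t)) y :=
  hf.comp y (contDiff_pt.comp ((contDiff_const (c := x)).prodMk contDiff_id)).contDiffAt

lemma iteratedDeriv_two_pt_one {f : Plane → ℝ} {x y : ℝ} (hf : ContDiffAt ℝ ∞ f (pt x y)) :
    iteratedDeriv 2 (fun t => f (pt x t)) y = pd 1 (pd 1 f) (pt x y) := by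
  have h1 : ∀ᶠ z in 𝓝 (pt x y), DifferentiableAt ℝ f z :=
    ((hf.of_le (m := 1) (by simp)).eventually (by simp)).mono fun x hx => hx.differentiableAt (by simp)
  have hc : ContinuousAt (fun t => pt x t) y :=
    (contDiff_pt.comp ((contDiff_const (c := x)).prodMk contDiff_id)).continuous.continuousAt
  have h2 : deriv (fun t => f (pt x t)) =ᶠ[𝓝 y] fun t => pd 1 f (pt x t) :=
    (hc.eventually h1).mono fun t ht => (hasDerivAt_pt_one ht).deriv
  rw [iteratedDeriv_succ, iteratedDeriv_one, h2.deriv_eq]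
  exact (hasDerivAt_pt_one (hf.pd 1).diffAt_top).deriv

lemma pd_pd_mul {f g : Plane → ℝ} {z : Plane} (hf : ContDiffAt ℝ ∞ f z) (hg : ContDiffAt ℝ ∞ g z)
    (i : Fin 2) : pd i (pd i fun w => f w * g w) z
      = pd i (pd i f) z * g z + 2 * (pd i f z * pd i g z) + f z * pd i (pd i g) z := by
  have hn : ∀ {f : Plane → ℝ}, ContDiffAt ℝ ∞ f z → ∀ᶠ w in 𝓝 z, DifferentiableAt ℝ f w := fun hf =>
    ((hf.of_le (m := 1) (by simp)).eventually (by simp)).mono fun x hx => hx.differentiableAt (by simp)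
  have h1 : pd i (fun w => f w * g w) =ᶠ[𝓝 z] fun w => pd i f w * g w + f w * pd i g w := by
    filter_upwards [hn hf, hn hg] with w h1 h2 using pd_mul h1 h2 i
  have df := hf.diffAt_top
  have dg := hg.diffAt_top
  have df' := (hf.pd i).diffAt_top
  have dg' := (hg.pd i).diffAt_top
  refine (pd_congr h1 i).trans ((pd_add (df'.fun_mul dg) (df.fun_mul dg') i).trans ?_)
  rw [pd_mul df' dg, pd_mul df dg']
  ring

/-- The second derivative of `1 / f` at a critical point of `f`. -/
lemma pd_pd_inv {f : Plane → ℝ} {z : Plane} (hf : ContDiffAt ℝ ∞ f z) (h0 : f z ≠ 0) (i : Fin 2)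
    (h1 : pd i f z = 0) : pd i (pd i fun w => (f w)⁻¹) z = -pd i (pd i f) z / f z ^ 2 := by
  have hi : ContDiffAt ℝ ∞ (fun w => (f w)⁻¹) z := hf.inv h0
  have h2 : (fun w => f w * (f w)⁻¹) =ᶠ[𝓝 z] fun _ => 1 :=
    (hf.continuousAt.eventually_ne h0).mono fun w hw => mul_inv_cancel₀ hw
  have h3 : pd i (fun w => f w * (f w)⁻¹) =ᶠ[𝓝 z] fun _ => 0 :=
    h2.eventually_nhds.mono fun w hw => (pd_congr hw i).trans (pd_const 1 i w)
  have h4 := (pd_pd_mul hf hi i).symm.trans ((pd_congr h3 i).trans (pd_const 0 i z))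
  rw [h1] at h4
  field_simp at h4 ⊢
  linarith

lemma contDiff_mul_of_tsupport_subset {χ f : Plane → ℝ} {U : Set Plane} (hχ : ContDiff ℝ ∞ χ)
    (hs : tsupport χ ⊆ U) (hf : ∀ z ∈ U, ContDiffAt ℝ ∞ f z) : ContDiff ℝ ∞ fun z => χ z * f z := by
  rw [contDiff_iff_contDiffAt]
  intro z
  by_cases hz : z ∈ tsupport χ
  · exact hχ.contDiffAt.mul (hf z (hs hz))
  · have : (fun z => χ z * f z) =ᶠ[𝓝 z] fun _ => 0 :=
      (notMem_tsupport_iff_eventuallyEq.1 hz).mono fun w hw => by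
        simp only [hw, Pi.zero_apply, zero_mul]
    exact contDiffAt_const.congr_of_eventuallyEq this

lemma exists_cutoff {ρ r : ℝ} (hρ : 0 < ρ) (hr : ρ < r) : ∃ χ : Plane → ℝ, ContDiff ℝ ∞ χ ∧
    (∀ z ∈ closedBall 0 ρ, χ z = 1) ∧ (∀ z, 0 ≤ χ z) ∧ (∀ z, χ z ≤ 1) ∧
      tsupport χ ⊆ closedBall 0 r := by
  let f : ContDiffBump (0 : Plane) := ⟨ρ, r, hρ, hr⟩
  exact ⟨f, f.contDiff, fun z hz => f.one_of_mem_closedBall hz, fun _ => f.nonneg, fun _ => f.le_one,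
    f.tsupport_eq.le⟩

/-- Extension of a positive smooth function from a disc to the plane. -/
lemma exists_pos_extension {β : Plane → ℝ} {U : Set Plane} (hβ : ∀ z ∈ U, ContDiffAt ℝ ∞ β z)
    (hpos : ∀ z ∈ U, 0 < β z) {ρ r : ℝ} (hρ : 0 < ρ) (hr : ρ < r) (hU : closedBall 0 r ⊆ U) :
    ∃ B : Plane → ℝ, ContDiff ℝ ∞ B ∧ (∀ z ∈ closedBall 0 ρ, B z = β z) ∧
      ∃ c > 0, ∀ z, c ≤ B z := by
  obtain ⟨χ, hχ, h1, h0, hle, hs⟩ := exists_cutoff hρ hr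
  obtain ⟨c, hc, hcβ⟩ : ∃ c > 0, ∀ z ∈ closedBall (0 : Plane) r, c ≤ β z := by
    obtain ⟨z, hz, hm⟩ := (isCompact_closedBall (0 : Plane) r).exists_isMinOn
      ⟨0, Metric.mem_closedBall_self (by linarith)⟩ (fun z hz => (hβ z (hU hz)).continuousAt.continuousWithinAt)
    exact ⟨β z, hpos z (hU hz), fun w hw => hm hw⟩
  refine ⟨fun z => χ z * β z + (1 - χ z) * c,
    (contDiff_mul_of_tsupport_subset hχ (hs.trans hU) hβ).add ((contDiff_const.sub hχ).mul contDiff_const),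
    fun z hz => by simp [h1 z hz], c, hc, fun z => ?_⟩
  by_cases hz : z ∈ tsupport χ
  · nlinarith [hcβ z (hs hz), h0 z]
  · simp [image_eq_zero_of_notMem_tsupport hz]

end Calculus

section Adapted

variable {H : Type*} [TopologicalSpace H] (I : ModelWithCorners ℝ Plane H)
  {M : Type*} [MetricSpace M] [ChartedSpace H M]
  [RiemannianBundle (fun x : M => TangentSpace I x)]

/-- The density of the area form in a parametrization. -/
def areaDensity (Θ : Plane → M) (z : Plane) : ℝ := √(pullMetric I Θ z).det

/-- The coefficients `√(det g) gⁱʲ` of the Laplace operator in a parametrization. -/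
def conormal (Θ : Plane → M) (i j : Fin 2) (z : Plane) : ℝ := areaDensity I Θ z * (pullMetric I Θ z)⁻¹ i j

/-- A local parametrization in which the magnetic potential is `y dx` up to gauge, `γ` runs along the
first axis, and the metric is in normal form along this axis. -/
structure IsAdaptedParam (A : ∀ x : M, TangentSpace I x →L[ℝ] ℝ) (b₀ : ℝ) (γ : ℝ → M) (s₀ : ℝ)
    (Θ : Plane → M) (Ξ : M → Plane) (U : Set Plane) (θ : Plane → ℝ) : Prop where
  param : IsLocalParam I Θ Ξ U
  zero_mem : (0 : Plane) ∈ U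
  image_subset : ∃ p, Θ '' U ⊆ (extChartAt I p).source
  smooth_phase : ContDiffOn ℝ ∞ θ U
  form_eq : ∀ z ∈ U, ∀ i, pullForm I A Θ i z = pd i θ z + if i = 0 then z 1 else 0
  axis : ∀ᶠ x in 𝓝 (0 : ℝ), Θ (pt x 0) = γ (s₀ + x / √b₀)
  metric_axis : ∀ᶠ x in 𝓝 (0 : ℝ), pullMetric I Θ (pt x 0) = b₀⁻¹ • (1 : Mat)
  cross_axis : ∀ᶠ x in 𝓝 (0 : ℝ), pd 1 (fun z => pullMetric I Θ z 0 1) (pt x 0) = 0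

variable {I} {Θ : Plane → M} {Ξ : M → Plane} {U : Set Plane} {z : Plane} {θ : Plane → ℝ}

variable [IsManifold I ∞ M]

namespace IsLocalParam

lemma areaDensity_pos (P : IsLocalParam I Θ Ξ U) (hz : z ∈ U) : 0 < areaDensity I Θ z :=
  Real.sqrt_pos.2 (P.det_pullMetric_pos hz)

lemma areaDensity_sq (P : IsLocalParam I Θ Ξ U) (hz : z ∈ U) :
    areaDensity I Θ z ^ 2 = (pullMetric I Θ z).det :=
  Real.sq_sqrt (P.det_pullMetric_pos hz).le

lemma conormal_eq (P : IsLocalParam I Θ Ξ U) (hz : z ∈ U) (i j : Fin 2) :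
    conormal I Θ i j z = (areaDensity I Θ z)⁻¹ * (pullMetric I Θ z).adjugate i j := by
  have := (P.areaDensity_pos hz).ne'
  rw [conormal, inv_apply_eq, ← P.areaDensity_sq hz]
  field_simp

lemma pullMetric_symm (z : Plane) : pullMetric I Θ z 1 0 = pullMetric I Θ z 0 1 :=
  congrFun (congrFun (pullMetric_transpose (I := I) (Θ := Θ) z) 0) 1

lemma conormal_symm (i j : Fin 2) (z : Plane) : conormal I Θ i j z = conormal I Θ j i z := by
  have h := pullMetric_symm (I := I) (Θ := Θ) z
  simp only [conormal, inv_apply_eq]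
  fin_cases i <;> fin_cases j <;> simp [Matrix.adjugate_fin_two, h]

lemma det_conormal (P : IsLocalParam I Θ Ξ U) (hz : z ∈ U) :
    conormal I Θ 0 0 z * conormal I Θ 1 1 z - conormal I Θ 0 1 z ^ 2 = 1 := by
  have h := P.areaDensity_sq hz
  have h0 := (P.areaDensity_pos hz).ne'
  have hs := pullMetric_symm (I := I) (Θ := Θ) z
  rw [Matrix.det_fin_two, hs] at h
  simp only [P.conormal_eq hz, Matrix.adjugate_fin_two, Matrix.of_apply, Matrix.cons_val', Matrix.cons_val_zero,
    Matrix.cons_val_one, Matrix.empty_val', Matrix.cons_val_fin_one]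
  field_simp
  linarith

variable [IsContMDiffRiemannianBundle I ∞ Plane (fun x : M => TangentSpace I x)]

lemma contDiffAt_areaDensity (P : IsLocalParam I Θ Ξ U) (hz : z ∈ U) :
    ContDiffAt ℝ ∞ (areaDensity I Θ) z :=
  (P.matSmooth_pullMetric hz).det.sqrt (P.det_pullMetric_pos hz).ne'

lemma contDiffAt_conormal (P : IsLocalParam I Θ Ξ U) (hz : z ∈ U) (i j : Fin 2) :
    ContDiffAt ℝ ∞ (conormal I Θ i j) z :=
  (P.contDiffAt_areaDensity hz).mul ((P.matSmooth_pullMetric hz).inv (P.det_pullMetric_pos hz).ne' i j)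

end IsLocalParam

namespace IsAdaptedParam

variable {A : ∀ x : M, TangentSpace I x →L[ℝ] ℝ} {b₀ s₀ : ℝ} {γ : ℝ → M}

lemma eventually_mem (P : IsAdaptedParam I A b₀ γ s₀ Θ Ξ U θ) : ∀ᶠ x in 𝓝 (0 : ℝ), pt x 0 ∈ U :=
  continuous_pt_zero.continuousAt.eventually (P.param.isOpen.mem_nhds (by
    simpa only [pt_zero_zero] using P.zero_mem))

lemma pt_zero_mem (P : IsAdaptedParam I A b₀ γ s₀ Θ Ξ U θ) : pt 0 0 ∈ U := by
  rw [pt_zero_zero]; exact P.zero_mem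

lemma apply_zero (P : IsAdaptedParam I A b₀ γ s₀ Θ Ξ U θ) : Θ 0 = γ s₀ := by
  have := P.axis.self_of_nhds
  rwa [pt_zero_zero, zero_div, add_zero] at this

lemma areaDensity_axis (P : IsAdaptedParam I A b₀ γ s₀ Θ Ξ U θ) (hb : 0 < b₀) :
    ∀ᶠ x in 𝓝 (0 : ℝ), areaDensity I Θ (pt x 0) = b₀⁻¹ := P.metric_axis.mono fun x hx => by
  rw [areaDensity, hx, Real.sqrt_eq_iff_mul_self_eq_of_pos (by positivity)]
  simp [sq]

lemma velocity_eq_smul (P : IsAdaptedParam I A b₀ γ s₀ Θ Ξ U θ) (hb : 0 < b₀) :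
    ∀ᶠ x in 𝓝 (0 : ℝ), (velocity I γ (s₀ + x / √b₀) : Plane) = √b₀ • (paramVec I Θ (pt x 0) 0 : Plane) := by
  have hs : √b₀ ≠ 0 := (Real.sqrt_pos.2 hb).ne'
  filter_upwards [P.axis.eventually_nhds, P.eventually_mem] with x hx hU
  let κ : ℝ → Plane := fun r => pt (√b₀ * (r - s₀)) 0
  have hpar : √b₀ * (s₀ + x / √b₀ - s₀) = x := by field_simp; ring
  have hκx : κ (s₀ + x / √b₀) = pt x 0 := by simp only [κ, hpar]
  have hlin : HasDerivAt (fun r : ℝ => √b₀ * (r - s₀)) (√b₀) (s₀ + x / √b₀) := by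
    simpa using ((hasDerivAt_id' (s₀ + x / √b₀)).sub_const s₀).const_mul (√b₀)
  have hκ : HasDerivAt κ (√b₀ • basisVec 0) (s₀ + x / √b₀) := by
    have h1 : HasDerivAt (fun t => pt t 0) (basisVec 0) (√b₀ * (s₀ + x / √b₀ - s₀)) := by
      refine (hasDerivAt_pt_zero (f := fun w => w) differentiableAt_id).congr_deriv ?_
      rw [pd]; simp
    exact h1.scomp (s₀ + x / √b₀) hlin
  have hcurve : γ =ᶠ[𝓝 (s₀ + x / √b₀)] fun r => Θ (κ r) := by
    have hx' : ∀ᶠ t in 𝓝 (√b₀ * (s₀ + x / √b₀ - s₀)), Θ (pt t 0) = γ (s₀ + t / √b₀) := by rw [hpar]; exact hx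
    have := hlin.continuousAt.eventually hx'
    filter_upwards [this] with r hr
    rw [show κ r = pt (√b₀ * (r - s₀)) 0 from rfl, hr, mul_div_cancel_left₀ _ hs, add_sub_cancel]
  have h2 := velocity_eq (I := I) hκ.differentiableAt (by rw [hκx]; exact P.param.mdifferentiableAt hU) hcurve
  have h3 : ∀ w v : Plane, w = pt x 0 → v = √b₀ • basisVec 0 → (mfderiv 𝓘(ℝ, Plane) I Θ w v : Plane)
      = √b₀ • (paramVec I Θ (pt x 0) 0 : Plane) := by
    rintro w v rfl rfl
    exact map_smul (mfderiv 𝓘(ℝ, Plane) I Θ (pt x 0)) (√b₀) (basisVec 0)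
  exact h2.trans (h3 _ _ hκx hκ.deriv)

lemma conormal_axis (P : IsAdaptedParam I A b₀ γ s₀ Θ Ξ U θ) (hb : 0 < b₀) :
    ∀ᶠ x in 𝓝 (0 : ℝ), conormal I Θ 0 0 (pt x 0) = 1 ∧ conormal I Θ 1 1 (pt x 0) = 1
      ∧ conormal I Θ 0 1 (pt x 0) = 0 := by
  filter_upwards [P.metric_axis, P.areaDensity_axis hb, P.eventually_mem] with x h1 h2 h3
  simp only [P.param.conormal_eq h3, h1, h2, Matrix.adjugate_fin_two]
  simp [hb.ne']

variable [IsContMDiffRiemannianBundle I ∞ Plane (fun x : M => TangentSpace I x)]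

lemma abs_fieldStrength_eq (P : IsAdaptedParam I A b₀ γ s₀ Θ Ξ U θ) (hA : IsSmoothForm I A) (hz : z ∈ U) :
    |fieldStrength I A (Θ z)| = (areaDensity I Θ z)⁻¹ := by
  have hθ : ContDiffAt ℝ ∞ θ z := P.smooth_phase.contDiffAt (P.param.isOpen.mem_nhds hz)
  have h1 : planeCurl (fun i => pullForm I A Θ i) z = -1 := by
    have h2 : planeCurl (fun i => pullForm I A Θ i) z
        = planeCurl (fun i w => pd i θ w + if i = 0 then w 1 else 0) z :=
      planeCurl_congr fun i => by
        filter_upwards [P.param.isOpen.mem_nhds hz] with w hw using P.form_eq w hw i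
    rw [h2, planeCurl]
    have h3 : pd 1 (fun w => pd 0 θ w + w 1) z = pd 1 (pd 0 θ) z + 1 := by
      rw [pd_add (hθ.pd 0).diffAt_top (contDiff_coord 1).contDiffAt.diffAt_top, pd_coord,
        if_pos rfl]
    have h4 : pd 0 (fun w => pd 1 θ w + 0) z = pd 0 (pd 1 θ) z := by simp only [add_zero]
    simp only [if_true, one_ne_zero, if_false]
    rw [h3, h4, pd_comm hθ 0 1]
    ring
  rw [IsLocalParam.abs_fieldStrength_eq hA P.param hz, h1, areaDensity]
  simp

lemma areaDensity_le (P : IsAdaptedParam I A b₀ γ s₀ Θ Ξ U θ) (hA : IsSmoothForm I A) (hb : 0 < b₀)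
    (hmin : ∀ x, b₀ ≤ |fieldStrength I A x|) (hz : z ∈ U) : areaDensity I Θ z ≤ b₀⁻¹ := by
  have := hmin (Θ z)
  rw [P.abs_fieldStrength_eq hA hz] at this
  exact (le_inv_comm₀ hb (P.param.areaDensity_pos hz)).1 this

lemma pd_areaDensity_axis (P : IsAdaptedParam I A b₀ γ s₀ Θ Ξ U θ) (hA : IsSmoothForm I A) (hb : 0 < b₀)
    (hmin : ∀ x, b₀ ≤ |fieldStrength I A x|) :
    ∀ᶠ x in 𝓝 (0 : ℝ), ∀ i, pd i (areaDensity I Θ) (pt x 0) = 0 := by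
  filter_upwards [P.areaDensity_axis hb, P.eventually_mem] with x h1 h2 i
  have : IsLocalMax (areaDensity I Θ) (pt x 0) := by
    filter_upwards [P.param.isOpen.mem_nhds h2] with w hw
    rw [h1]; exact P.areaDensity_le hA hb hmin hw
  rw [pd, this.fderiv_eq_zero]; rfl

lemma pd_trace_axis (P : IsAdaptedParam I A b₀ γ s₀ Θ Ξ U θ) (hA : IsSmoothForm I A) (hb : 0 < b₀)
    (hmin : ∀ x, b₀ ≤ |fieldStrength I A x|) : ∀ᶠ x in 𝓝 (0 : ℝ),
      pd 1 (fun z => pullMetric I Θ z 0 0) (pt x 0) + pd 1 (fun z => pullMetric I Θ z 1 1) (pt x 0) = 0 := by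
  filter_upwards [P.pd_areaDensity_axis hA hb hmin, P.eventually_mem, P.metric_axis] with x h1 h2 h3
  have hg := P.param.matSmooth_pullMetric h2
  have hd := fun i j => (hg i j).diffAt_top
  have hD := (P.param.contDiffAt_areaDensity h2).diffAt_top
  have e1 : (fun z => areaDensity I Θ z * areaDensity I Θ z) =ᶠ[𝓝 (pt x 0)] fun z =>
      pullMetric I Θ z 0 0 * pullMetric I Θ z 1 1 - pullMetric I Θ z 0 1 * pullMetric I Θ z 1 0 := by
    filter_upwards [P.param.isOpen.mem_nhds h2] with w hw
    rw [← sq, P.param.areaDensity_sq hw, Matrix.det_fin_two]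
  have e2 := pd_congr e1 1
  rw [pd_mul hD hD, h1 1, pd_sub ((hd 0 0).fun_mul (hd 1 1)) ((hd 0 1).fun_mul (hd 1 0)),
    pd_mul (hd 0 0) (hd 1 1), pd_mul (hd 0 1) (hd 1 0), h3] at e2
  simp only [Matrix.smul_apply, Matrix.one_apply_eq, Matrix.one_apply, smul_eq_mul] at e2
  simp at e2
  have hb' : b₀⁻¹ ≠ 0 := inv_ne_zero hb.ne'
  have : b₀⁻¹ * (pd 1 (fun z => pullMetric I Θ z 0 0) (pt x 0) + pd 1 (fun z => pullMetric I Θ z 1 1) (pt x 0)) = 0 := by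
    linarith
  exact (mul_eq_zero.1 this).resolve_left hb'

lemma pd_conormal_axis (P : IsAdaptedParam I A b₀ γ s₀ Θ Ξ U θ) :
    ∀ᶠ x in 𝓝 (0 : ℝ), pd 1 (conormal I Θ 0 1) (pt x 0) = 0 := by
  filter_upwards [P.cross_axis, P.metric_axis, P.eventually_mem] with x h1 h2 h3
  have e : conormal I Θ 0 1 =ᶠ[𝓝 (pt x 0)] fun z => -(areaDensity I Θ z)⁻¹ * pullMetric I Θ z 0 1 := by
    filter_upwards [P.param.isOpen.mem_nhds h3] with w hw
    rw [P.param.conormal_eq hw, Matrix.adjugate_fin_two]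
    simp
  have hD : DifferentiableAt ℝ (fun z => -(areaDensity I Θ z)⁻¹) (pt x 0) :=
    ((P.param.contDiffAt_areaDensity h3).inv (P.param.areaDensity_pos h3).ne').neg.diffAt_top
  rw [pd_congr e, pd_mul hD (P.param.matSmooth_pullMetric h3 0 1).diffAt_top, h1, h2]
  simp

lemma beta₂_eq (P : IsAdaptedParam I A b₀ γ s₀ Θ Ξ U θ) (hA : IsSmoothForm I A) (hb : 0 < b₀)
    (hmin : ∀ x, b₀ ≤ |fieldStrength I A x|) : ∀ᶠ x in 𝓝 (0 : ℝ),
      beta₂ I A γ (s₀ + x / √b₀) = -b₀ ^ 3 * pd 1 (pd 1 (areaDensity I Θ)) (pt x 0) := by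
  filter_upwards [P.pd_areaDensity_axis hA hb hmin, P.eventually_mem, P.metric_axis, P.areaDensity_axis hb,
    P.velocity_eq_smul hb, P.axis] with x h1 h2 h3 h4 h5 h6
  have hD := P.param.contDiffAt_areaDensity h2
  have hD0 := (P.param.areaDensity_pos h2).ne'
  have e : (fun w => |fieldStrength I A (Θ w)|) =ᶠ[𝓝 (pt x 0)] fun w => (areaDensity I Θ w)⁻¹ := by
    filter_upwards [P.param.isOpen.mem_nhds h2] with w hw using P.abs_fieldStrength_eq hA hw
  have e1 : ∀ i, pd i (fun w => |fieldStrength I A (Θ w)|) (pt x 0) = 0 := fun i => by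
    have : IsLocalMin (fun w => |fieldStrength I A (Θ w)|) (pt x 0) := by
      refine Eventually.of_forall fun w => ?_
      change |fieldStrength I A (Θ (pt x 0))| ≤ _
      rw [P.abs_fieldStrength_eq hA h2, h4, inv_inv]
      exact hmin _
    rw [pd, this.fderiv_eq_zero]; rfl
  have e2 : pd 1 (fun w => |fieldStrength I A (Θ w)|) =ᶠ[𝓝 (pt x 0)] pd 1 fun w => (areaDensity I Θ w)⁻¹ :=
    e.eventually_nhds.mono fun w hw => pd_congr hw 1
  rw [beta₂, P.param.secondNormalDeriv_eq h2 hb (Real.sqrt_pos.2 hb).ne' h6.symm h5 h3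
    (((hD.inv hD0)).congr_of_eventuallyEq e) (e1 0) (e1 1), pd_congr e2, pd_pd_inv hD hD0 1 (h1 1), h4]
  field_simp

lemma potential_eq (P : IsAdaptedParam I A b₀ γ s₀ Θ Ξ U θ) (hA : IsSmoothForm I A) (hb : 0 < b₀)
    (hmin : ∀ x, b₀ ≤ |fieldStrength I A x|) (k : ℕ) : ∀ᶠ x in 𝓝 (0 : ℝ),
      potential I A b₀ γ k (s₀ + x / √b₀) =
        b₀ * (-((k : ℝ) ^ 2 + k) * (pd 1 (pd 1 (conormal I Θ 1 1)) (pt x 0) / 2)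
          + (2 * k + 1) * b₀ * (k + 1 / 2) * (-(pd 1 (pd 1 (areaDensity I Θ)) (pt x 0)) / 2)) := by
  filter_upwards [P.beta₂_eq hA hb hmin, P.pd_areaDensity_axis hA hb hmin, P.eventually_mem,
    P.metric_axis.eventually_nhds, P.areaDensity_axis hb, P.axis, P.pd_trace_axis hA hb hmin,
    P.cross_axis.eventually_nhds, P.conormal_axis hb] with x h0 h1 h2 h3 h4 h5 h6 h7 h8
  have hU := P.param.isOpen.mem_nhds h2
  have e : (fun w => pullMetric I Θ w 0 0) =ᶠ[𝓝 (pt x 0)] fun w => areaDensity I Θ w * conormal I Θ 1 1 w := by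
    filter_upwards [hU] with w hw
    have := (P.param.areaDensity_pos hw).ne'
    rw [P.param.conormal_eq hw, Matrix.adjugate_fin_two]
    simp [this]
  have e2 : pd 1 (fun w => pullMetric I Θ w 0 0) =ᶠ[𝓝 (pt x 0)]
      pd 1 fun w => areaDensity I Θ w * conormal I Θ 1 1 w :=
    e.eventually_nhds.mono fun w hw => pd_congr hw 1
  have hR : scalarCurvature I (γ (s₀ + x / √b₀)) = -b₀ ^ 2 * (pd 1 (pd 1 (areaDensity I Θ)) (pt x 0)
      + b₀⁻¹ * pd 1 (pd 1 (conormal I Θ 1 1)) (pt x 0)) := by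
    rw [← h5, P.param.scalarCurvature_eq h2,
      planeScalar_axis (by filter_upwards [hU] with w hw using P.param.matSmooth_pullMetric hw)
        (inv_ne_zero hb.ne') (Eventually.of_forall fun w => IsLocalParam.pullMetric_symm w) h3 h7 h6,
      pd_congr e2, pd_pd_mul (P.param.contDiffAt_areaDensity h2) (P.param.contDiffAt_conormal h2 1 1), h1 1,
      h4, h8.2.1]
    field_simp
    ring
  rw [potential, h0, hR]
  field_simp
  ring

end IsAdaptedParam

variable [IsContMDiffRiemannianBundle I ∞ Plane (fun x : M => TangentSpace I x)]

lemma ofReal_mul_coord_mem_testSpace {χ : Plane → ℝ} {r : ℝ} (hχ : ContDiff ℝ ∞ χ)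
    (hs : tsupport χ ⊆ closedBall 0 r) (i : Fin 2) :
    (fun z : Plane => ((χ z * z i : ℝ) : ℂ)) ∈ testSpace r := by
  refine ⟨Complex.ofRealCLM.contDiff.comp (hχ.mul (contDiff_coord i)), (closure_mono fun z hz h0 => ?_).trans hs⟩
  simp [h0] at hz

/-- A coordinate of a local parametrization agrees near `0` with a Lipschitz function on the surface. -/
lemma IsLocalParam.exists_lipschitz_coord [IsRiemannianManifold I M] (P : IsLocalParam I Θ Ξ U) {ρ r : ℝ}
    (hρ : 0 < ρ) (hr : ρ < r) (hU : closedBall 0 r ⊆ U) (i : Fin 2) :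
    ∃ F : M → ℂ, ∃ C > 0, (∀ x y, ‖F x - F y‖ ≤ C * dist x y) ∧
      (∀ z ∈ closedBall 0 ρ, F (Θ z) = (z i : ℂ)) ∧
      ∀ x, (∀ z ∈ closedBall 0 r, Θ z = x → z i = 0) → F x = 0 := by
  obtain ⟨χ, hχ, h1, -, -, hs⟩ := exists_cutoff hρ hr
  have hv := ofReal_mul_coord_mem_testSpace hχ hs i
  obtain ⟨C, hC, hL⟩ := P.exists_lipschitz_lift hU hv
  have hp : ∀ z, phase (fun _ => 0) 1 z = 1 := fun z => by simp [phase]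
  refine ⟨_, C, hC, hL, fun z hz => ?_, fun x hx => ?_⟩
  · rw [P.lift_apply _ _ _ (hU (Metric.closedBall_subset_closedBall hr.le hz)), h1 z hz, hp]
    simp
  · by_cases h : x ∈ Θ '' closedBall 0 r
    · obtain ⟨z, hz, rfl⟩ := h
      rw [P.lift_apply _ _ _ (hU hz), hx z hz rfl]
      simp
    · exact P.lift_eq_zero _ _ hv h

/-- A closed curve returns to a small neighbourhood of a point only near the corresponding times. -/
lemma IsClosedCurve.eventually_near {γ : ℝ → M} {L : ℝ} (hγ : IsClosedCurve I γ L) (s₀ : ℝ) {δ : ℝ}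
    (hδ : 0 < δ) : ∀ᶠ x in 𝓝 (γ s₀), ∀ s, γ s = x → ∃ s', |s' - s₀| ≤ δ ∧ γ s' = γ s := by
  have hcont : Continuous γ := hγ.smooth.continuous
  have hK : IsCompact (γ '' Icc (s₀ + δ) (s₀ + L - δ)) := isCompact_Icc.image hcont
  have hmem : γ s₀ ∉ γ '' Icc (s₀ + δ) (s₀ + L - δ) := by
    rintro ⟨s, hs, he⟩
    obtain ⟨n, hn, -⟩ := existsUnique_sub_zsmul_mem_Ico hγ.length_pos s 0
    obtain ⟨m, hm, -⟩ := existsUnique_sub_zsmul_mem_Ico hγ.length_pos s₀ 0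
    rw [zero_add] at hn hm
    have h1 : s - n • L = s₀ - m • L := hγ.injective hn hm (by
      rw [hγ.periodic.sub_zsmul_eq, hγ.periodic.sub_zsmul_eq, he])
    have h2 : s - s₀ = ((n - m : ℤ) : ℝ) * L := by
      rw [zsmul_eq_mul, zsmul_eq_mul] at h1; push_cast; linarith
    have h3 : (0 : ℝ) < ((n - m : ℤ) : ℝ) := by
      by_contra h; nlinarith [hs.1, hγ.length_pos]
    have h4 : ((n - m : ℤ) : ℝ) < 1 := by
      by_contra h; nlinarith [hs.2, hγ.length_pos]
    have h5 : 0 < n - m := by exact_mod_cast h3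
    have h6 : n - m < 1 := by exact_mod_cast h4
    omega
  filter_upwards [hK.isClosed.isOpen_compl.mem_nhds hmem] with x hx s hs
  obtain ⟨s', hs', he⟩ := hγ.periodic.exists_mem_Ico hγ.length_pos s (s₀ - δ)
  refine ⟨s', ?_, he.symm⟩
  have h1 : s' < s₀ + δ ∨ s₀ + L - δ < s' := by
    by_contra! h
    exact hx ⟨s', h, by rw [← he, hs]⟩
  rcases h1 with h1 | h1
  · rw [abs_le]; constructor <;> linarith [hs'.1]
  · linarith [hs'.2]

namespace IsAdaptedParam

variable {A : ∀ x : M, TangentSpace I x →L[ℝ] ℝ} {b₀ s₀ L : ℝ} {γ : ℝ → M} {k : ℕ}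

lemma potential_nondegenerate [IsRiemannianManifold I M] (P : IsAdaptedParam I A b₀ γ s₀ Θ Ξ U θ)
    (hA : IsSmoothForm I A) (hγ : IsDegenerateWell I A b₀ γ L)
    (hmin : IsUniqueNondegenerateMin γ (potential I A b₀ γ k) s₀) :
    deriv (fun x => potential I A b₀ γ k (s₀ + x / √b₀)) 0 = 0 ∧
      0 < iteratedDeriv 2 (fun x => potential I A b₀ γ k (s₀ + x / √b₀)) 0 := by
  have hb := hγ.pos
  have hle : ∀ x, b₀ ≤ |fieldStrength I A x| := fun x => hγ.isLeast.2 ⟨x, rfl⟩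
  obtain ⟨R, hR, hU⟩ := Metric.nhds_basis_closedBall.mem_iff.1 (P.param.isOpen.mem_nhds P.zero_mem)
  obtain ⟨F, C, hC, hL, hF, -⟩ := P.param.exists_lipschitz_coord (half_pos hR) (half_lt_self hR) hU 0
  obtain ⟨c, hc, hV⟩ := hmin.nondegenerate
  have hsm : ContDiffAt ℝ ∞ (fun x => potential I A b₀ γ k (s₀ + x / √b₀)) 0 := by
    refine ContDiffAt.congr_of_eventuallyEq ?_ (P.potential_eq hA hb hle k)
    have h1 := contDiffAt_comp_pt_zero (((P.param.contDiffAt_conormal P.pt_zero_mem 1 1).pd 1).pd 1)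
    have h2 := contDiffAt_comp_pt_zero (((P.param.contDiffAt_areaDensity P.pt_zero_mem).pd 1).pd 1)
    exact contDiffAt_const.mul ((contDiffAt_const.mul (h1.div_const 2)).add
      (contDiffAt_const.mul (h2.neg.div_const 2)))
  refine deriv_eq_zero_and_iteratedDeriv_two_pos hsm (c := c * (C⁻¹) ^ 2) (by positivity) ?_
  have hcont : ContinuousAt (fun x : ℝ => γ (s₀ + x / √b₀)) 0 :=
    (hγ.curve.smooth.continuous.comp (by fun_prop)).continuousAt
  have hball : ∀ᶠ x in 𝓝 (0 : ℝ), pt x 0 ∈ closedBall (0 : Plane) (R / 2) :=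
    continuous_pt_zero.continuousAt.eventually_mem (by
      rw [pt_zero_zero]; exact Metric.closedBall_mem_nhds (0 : Plane) (half_pos hR))
  filter_upwards [hcont.eventually (p := fun x => ∀ s, γ s = x → c * dist x (γ s₀) ^ 2
      ≤ potential I A b₀ γ k s - potential I A b₀ γ k s₀ ∧ _) (by
        simpa only [zero_div, add_zero] using hV), hball, P.axis] with x h1 h2 h3
  have h4 := (h1 _ rfl).1
  have h5 := hL (Θ (pt x 0)) (Θ 0)
  rw [hF _ h2, hF 0 (Metric.mem_closedBall_self (half_pos hR).le), h3, P.apply_zero] at h5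
  have h6 : |x| ≤ C * dist (γ (s₀ + x / √b₀)) (γ s₀) := by
    have : ((pt x 0 0 : ℝ) : ℂ) - (((0 : Plane) 0 : ℝ) : ℂ) = (x : ℂ) := by simp [pt]
    rw [this, Complex.norm_real] at h5
    exact h5
  have h7 : C⁻¹ * |x| ≤ dist (γ (s₀ + x / √b₀)) (γ s₀) := by
    rwa [inv_mul_le_iff₀ hC]
  have h8 : (C⁻¹) ^ 2 * x ^ 2 ≤ dist (γ (s₀ + x / √b₀)) (γ s₀) ^ 2 := by
    rw [← sq_abs x, ← mul_pow]
    exact pow_le_pow_left₀ (by positivity) h7 2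
  simp only [zero_div, add_zero]
  nlinarith [mul_le_mul_of_nonneg_left h8 hc.le]

lemma pd_pd_areaDensity_neg [IsRiemannianManifold I M] (P : IsAdaptedParam I A b₀ γ s₀ Θ Ξ U θ)
    (hA : IsSmoothForm I A) (hγ : IsDegenerateWell I A b₀ γ L) :
    pd 1 (pd 1 (areaDensity I Θ)) 0 < 0 := by
  have hb := hγ.pos
  have hle : ∀ x, b₀ ≤ |fieldStrength I A x| := fun x => hγ.isLeast.2 ⟨x, rfl⟩
  have hs : 0 < √b₀ := Real.sqrt_pos.2 hb
  obtain ⟨η, hη, haxis⟩ := Metric.eventually_nhds_iff.1 (P.axis.and P.eventually_mem)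
  have hnear := hγ.curve.eventually_near s₀ (δ := η / (2 * √b₀)) (by positivity)
  have hnear' : ∀ᶠ z in 𝓝 (0 : Plane), ∀ s, γ s = Θ z →
      ∃ s', |s' - s₀| ≤ η / (2 * √b₀) ∧ γ s' = γ s :=
    (P.param.smoothAt P.zero_mem).continuousAt.eventually (by rw [P.apply_zero]; exact hnear)
  obtain ⟨R, hR, hU⟩ := Metric.nhds_basis_closedBall.mem_iff.1
    (inter_mem hnear' (P.param.isOpen.mem_nhds P.zero_mem))
  obtain ⟨F, C, hC, hL, hF, hF0⟩ := P.param.exists_lipschitz_coord (half_pos hR) (half_lt_self hR)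
    (hU.trans inter_subset_right) 1
  have hγF : ∀ s, F (γ s) = 0 := fun s => hF0 _ fun z hz he => by
    obtain ⟨s', hs', he'⟩ := (hU hz).1 s he.symm
    have hx : dist (√b₀ * (s' - s₀)) 0 < η := by
      rw [Real.dist_0_eq_abs, abs_mul, abs_of_pos hs]
      have := mul_le_mul_of_nonneg_left hs' hs.le
      rw [show √b₀ * (η / (2 * √b₀)) = η / 2 by field_simp] at this
      linarith
    obtain ⟨h1, h2⟩ := haxis hx
    rw [mul_div_cancel_left₀ _ hs.ne', add_sub_cancel, he', ← he] at h1
    rw [← P.param.injOn h2 (hU hz).2 h1]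
    simp [pt]
  have hdist : ∀ᶠ y in 𝓝 (0 : ℝ), C⁻¹ * |y| ≤ Metric.infDist (Θ (pt 0 y)) (range γ) := by
    have hc : Continuous fun y : ℝ => pt 0 y :=
      (contDiff_pt.comp ((contDiff_const (c := (0 : ℝ))).prodMk contDiff_id)).continuous
    have hball : ∀ᶠ y in 𝓝 (0 : ℝ), pt 0 y ∈ closedBall (0 : Plane) (R / 2) :=
      hc.continuousAt.eventually_mem (by
        rw [pt_zero_zero]; exact Metric.closedBall_mem_nhds (0 : Plane) (half_pos hR))
    filter_upwards [hball] with y hy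
    rw [Metric.le_infDist (range_nonempty γ)]
    rintro _ ⟨s, rfl⟩
    have h5 := hL (Θ (pt 0 y)) (γ s)
    rw [hF _ hy, hγF s, sub_zero, Complex.norm_real] at h5
    rw [inv_mul_le_iff₀ hC]
    exact h5
  obtain ⟨c, hc, hq⟩ := hγ.quadratic
  have hq' : ∀ᶠ x in 𝓝 (γ s₀), c⁻¹ * Metric.infDist x (range γ) ^ 2 ≤ |fieldStrength I A x| - b₀ :=
    (hq.filter_mono (nhds_le_nhdsSet (mem_range_self s₀))).mono fun x hx => hx.1
  have hD := P.param.contDiffAt_areaDensity P.pt_zero_mem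
  have hD0 := (P.param.areaDensity_pos P.pt_zero_mem).ne'
  have hDi : ContDiffAt ℝ ∞ (fun w => (areaDensity I Θ w)⁻¹) (pt 0 0) := hD.inv hD0
  have key := deriv_eq_zero_and_iteratedDeriv_two_pos (contDiffAt_comp_pt_one hDi)
    (c := c⁻¹ * (C⁻¹) ^ 2) (by positivity) (by
      have hc1 : ContinuousAt (fun y : ℝ => pt 0 y) 0 :=
        (contDiff_pt.comp ((contDiff_const (c := (0 : ℝ))).prodMk contDiff_id)).continuous.continuousAt
      have hc2 : ContinuousAt (fun y : ℝ => Θ (pt 0 y)) 0 :=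
        ContinuousAt.comp (P.param.smoothAt P.pt_zero_mem).continuousAt hc1
      have h0 : Θ (pt 0 0) = γ s₀ := by rw [pt_zero_zero, P.apply_zero]
      have hq'' : ∀ᶠ x in 𝓝 (Θ (pt 0 0)),
          c⁻¹ * Metric.infDist x (range γ) ^ 2 ≤ |fieldStrength I A x| - b₀ := by rw [h0]; exact hq'
      filter_upwards [hdist, hc2.eventually hq'',
        hc1.eventually_mem (P.param.isOpen.mem_nhds P.pt_zero_mem)] with y h1 h2 h3
      rw [(P.areaDensity_axis hb).self_of_nhds, inv_inv]
      rw [P.abs_fieldStrength_eq hA h3] at h2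
      have h8 : (C⁻¹) ^ 2 * y ^ 2 ≤ Metric.infDist (Θ (pt 0 y)) (range γ) ^ 2 := by
        rw [← sq_abs y, ← mul_pow]
        exact pow_le_pow_left₀ (by positivity) h1 2
      have := mul_le_mul_of_nonneg_left h8 (inv_pos.2 hc).le
      linarith)
  have h2 := key.2
  rw [iteratedDeriv_two_pt_one hDi,
    pd_pd_inv hD hD0 1 ((P.pd_areaDensity_axis hA hb hle).self_of_nhds 1), pt_zero_zero] at h2
  have h3 : 0 < areaDensity I Θ 0 ^ 2 := by rw [pt_zero_zero] at hD0; positivity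
  have := (div_pos_iff_of_pos_right h3).1 h2
  linarith

end IsAdaptedParam

lemma iteratedDeriv_two_comp_affine (f : ℝ → ℝ) (s c : ℝ) :
    iteratedDeriv 2 (fun x => f (s + x / c)) 0 = iteratedDeriv 2 f s / c ^ 2 := by
  have h : ∀ g : ℝ → ℝ, deriv (fun x => g (s + x / c)) = fun x => c⁻¹ * deriv g (s + x / c) := fun g => by
    funext x
    have e : (fun x => g (s + x / c)) = fun x => (fun y => g (s + y)) (c⁻¹ * x) := by
      funext x; simp only [div_eq_inv_mul]
    refine (congrFun (congrArg deriv e) x).trans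
      ((deriv_comp_mul_left c⁻¹ (fun y => g (s + y)) x).trans ?_)
    rw [deriv_comp_const_add, smul_eq_mul, div_eq_inv_mul]
  rw [iteratedDeriv_succ, iteratedDeriv_one, iteratedDeriv_succ, iteratedDeriv_one, h,
    deriv_const_mul_field, h]
  simp only [zero_div, add_zero]
  rw [← mul_assoc, div_eq_inv_mul, ← sq, inv_pow]

lemma lift_sub_mul (Θ : Plane → M) (Ξ : M → Plane) (U : Set Plane) (θ : Plane → ℝ) (h : ℝ)
    (v w : Plane → ℂ) (c : ℂ) (x : M) :
    lift Θ Ξ U θ h v x - c * lift Θ Ξ U θ h w x = lift Θ Ξ U θ h (fun z => v z - c * w z) x := by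
  unfold lift
  split_ifs
  · ring
  · simp

namespace IsAdaptedParam

variable {A : ∀ x : M, TangentSpace I x →L[ℝ] ℝ} {b₀ s₀ L : ℝ} {γ : ℝ → M} {k : ℕ}

/-- Quasimodes in the discs of an adapted parametrization. -/
theorem exists_local_quasimodes [IsRiemannianManifold I M] (P : IsAdaptedParam I A b₀ γ s₀ Θ Ξ U θ)
    (hA : IsSmoothForm I A) (hγ : IsDegenerateWell I A b₀ γ L)
    (hmin : IsUniqueNondegenerateMin γ (potential I A b₀ γ k) s₀) {ρ r : ℝ} (hρ : 0 < ρ) (hr : ρ < r)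
    (hU : closedBall 0 r ⊆ U) :
    ∃ (G : Fin 2 → Fin 2 → Plane → ℝ) (β : Plane → ℝ), (∀ i j, ContDiff ℝ ∞ (G i j)) ∧
      (∀ i j, G i j = G j i) ∧ ContDiff ℝ ∞ β ∧ (∀ z, 0 < β z) ∧
      (∀ z ∈ closedBall 0 ρ, β z = areaDensity I Θ z) ∧
      (∀ z ∈ closedBall 0 ρ, ∀ i j, G i j z = conormal I Θ i j z) ∧
      ∃ u : ℕ → ℝ → Plane → ℂ, (∀ j ε, u j ε ∈ testSpace ρ) ∧ ∀ j, ∃ C, 0 ≤ C ∧ ∃ ε₀ > (0 : ℝ),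
        ∀ ε ∈ Ioc 0 ε₀, ∫ z, ‖u j ε z‖ ^ 2 * β z = 1 ∧
        (∀ i < j, ∫ z, (u j ε z * (starRingEnd ℂ) (u i ε z)) * β z = 0) ∧
        ∫ z, ‖((β z)⁻¹ : ℂ) * magneticOp (ε ^ 4) G (u j ε) z
          - (approxEigenvalue I A b₀ γ s₀ j k (ε ^ 4) : ℂ) * u j ε z‖ ^ 2 * β z ≤ (C * ε ^ 11) ^ 2 := by
  have hb := hγ.pos
  have hs : 0 < √b₀ := Real.sqrt_pos.2 hb
  have hle : ∀ x, b₀ ≤ |fieldStrength I A x| := fun x => hγ.isLeast.2 ⟨x, rfl⟩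
  obtain ⟨β, hβ, hβe, c₀, hc₀, hcβ⟩ := exists_pos_extension (fun z hz => P.param.contDiffAt_areaDensity hz)
    (fun z hz => P.param.areaDensity_pos hz) hρ hr hU
  obtain ⟨χ, hχ, hχ1, -, -, hχs⟩ := exists_cutoff hρ hr
  let G : Fin 2 → Fin 2 → Plane → ℝ := fun i j z => χ z * conormal I Θ i j z
  have hG : ∀ i j, ContDiff ℝ ∞ (G i j) := fun i j =>
    contDiff_mul_of_tsupport_subset hχ (hχs.trans hU) fun z hz => P.param.contDiffAt_conormal hz i j
  have hsymm : ∀ i j, G i j = G j i := fun i j => by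
    funext z; simp only [G, IsLocalParam.conormal_symm i j z]
  have hGe : ∀ z ∈ closedBall 0 ρ, ∀ i j, G i j z = conormal I Θ i j z := fun z hz i j => by
    simp only [G, hχ1 z hz, one_mul]
  have hball : ∀ z ∈ ball (0 : Plane) ρ, ∀ᶠ w in 𝓝 z, w ∈ closedBall (0 : Plane) ρ :=
    fun z hz => mem_of_superset (Metric.isOpen_ball.mem_nhds hz) Metric.ball_subset_closedBall
  have hβn : ∀ z ∈ ball 0 ρ, β =ᶠ[𝓝 z] areaDensity I Θ := fun z hz => (hball z hz).mono hβe
  have hGn : ∀ z ∈ ball 0 ρ, ∀ i j, G i j =ᶠ[𝓝 z] conormal I Θ i j := fun z hz i j =>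
    (hball z hz).mono fun w hw => hGe w hw i j
  have hβn' : ∀ z ∈ ball 0 ρ, pd 1 β =ᶠ[𝓝 z] pd 1 (areaDensity I Θ) := fun z hz =>
    (hβn z hz).eventually_nhds.mono fun w hw => pd_congr hw 1
  have hGn' : ∀ z ∈ ball 0 ρ, ∀ i j, pd 1 (G i j) =ᶠ[𝓝 z] pd 1 (conormal I Θ i j) := fun z hz i j =>
    (hGn z hz i j).eventually_nhds.mono fun w hw => pd_congr hw 1
  have h0ρ : (0 : Plane) ∈ ball (0 : Plane) ρ := Metric.mem_ball_self hρ
  have hx : ∀ᶠ x in 𝓝 (0 : ℝ), pt x 0 ∈ ball (0 : Plane) ρ :=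
    continuous_pt_zero.continuousAt.eventually_mem (by
      rw [pt_zero_zero]; exact Metric.ball_mem_nhds 0 hρ)
  let V : ℝ → ℝ := fun x => potential I A b₀ γ k (s₀ + x / √b₀)
  have hV : V =ᶠ[𝓝 0] fun x => b₀ * (-((k : ℝ) ^ 2 + k) * (pd 1 (pd 1 (G 1 1)) (pt x 0) / 2)
      + (2 * k + 1) * b₀ * (k + 1 / 2) * (-(pd 1 (pd 1 β) (pt x 0)) / 2)) := by
    filter_upwards [P.potential_eq hA hb hle k, hx] with x h1 h2
    rw [pd_congr (hGn' _ h2 1 1), pd_congr (hβn' _ h2)]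
    exact h1
  obtain ⟨hV1, hV2⟩ := P.potential_nondegenerate hA hγ hmin
  have hβ2e : pd 1 (pd 1 β) 0 = pd 1 (pd 1 (areaDensity I Θ)) 0 := pd_congr (hβn' 0 h0ρ) 1
  have hβ2 : pd 1 (pd 1 β) 0 < 0 := hβ2e ▸ P.pd_pd_areaDensity_neg hA hγ
  have hbeta : beta₂ I A γ s₀ = -b₀ ^ 3 * pd 1 (pd 1 β) 0 := by
    have := (P.beta₂_eq hA hb hle).self_of_nhds
    rwa [zero_div, add_zero, pt_zero_zero, ← hβ2e] at this
  let g : ℝ := √((2 * k + 1) * b₀ ^ 2 * (-(pd 1 (pd 1 β) 0) / 2) * iteratedDeriv 2 V 0 / 2)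
  have hgpos : 0 < g := by
    have : 0 < -(pd 1 (pd 1 β) 0) := neg_pos.2 hβ2
    have h2 : 0 < iteratedDeriv 2 V 0 := hV2
    exact Real.sqrt_pos.2 (by positivity)
  let μ : ℕ → ℝ → ℝ := fun j ε =>
    (2 * k + 1) * b₀ * ε ^ 4 + V 0 * ε ^ 8 + g * (2 * j + 1) * ε ^ 10
  have hμ : ∀ j, ∀ ε > 0, approxEigenvalue I A b₀ γ s₀ j k (ε ^ 4) = μ j ε := by
    intro j ε hε
    have e1 : (ε ^ 4 : ℝ) ^ (5 / 2 : ℝ) = ε ^ 10 := by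
      rw [← Real.rpow_natCast, ← Real.rpow_mul hε.le, ← Real.rpow_natCast]; norm_num
    have e2 : V 0 = potential I A b₀ γ k s₀ := by simp only [V, zero_div, add_zero]
    have e3 : iteratedDeriv 2 V 0 = iteratedDeriv 2 (potential I A b₀ γ k) s₀ / b₀ := by
      rw [show V = fun x => potential I A b₀ γ k (s₀ + x / √b₀) from rfl, iteratedDeriv_two_comp_affine,
        Real.sq_sqrt hb.le]
    have e4 : 0 < iteratedDeriv 2 (potential I A b₀ γ k) s₀ := by
      have h2 : 0 < iteratedDeriv 2 V 0 := hV2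
      rw [e3] at h2
      exact (div_pos_iff_of_pos_right hb).1 h2
    have e5 : 0 ≤ beta₂ I A γ s₀ := by rw [hbeta]; nlinarith [pow_pos hb 3]
    have e6 : g = 1 / (2 * b₀) * √(iteratedDeriv 2 (potential I A b₀ γ k) s₀) * √(beta₂ I A γ s₀)
        * √(2 * (k : ℝ) + 1) := by
      refine (Real.sqrt_eq_iff_eq_sq (by
        have : 0 < -(pd 1 (pd 1 β) 0) := neg_pos.2 hβ2
        have h2 : 0 < iteratedDeriv 2 V 0 := hV2
        positivity) (by positivity)).2 ?_
      rw [mul_pow, mul_pow, mul_pow, Real.sq_sqrt e4.le, Real.sq_sqrt e5, Real.sq_sqrt (by positivity), e3,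
        hbeta]
      field_simp
    rw [approxEigenvalue, e1, ← e2, ← e6]
    simp only [μ]
    ring
  obtain ⟨u, hu, hprop⟩ := exists_orthonormal_plane_quasimodes hG hsymm hβ
    (fun z => hc₀.trans_le (hcβ z)) μ (g := 2 * g) (by positivity) (fun i j ε => by simp only [μ]; ring)
    (fun j => exists_plane_quasimode hG hβ hc₀ hcβ (hsymm 1 0)
      (by
        filter_upwards [hball 0 h0ρ] with z hz
        rw [hGe z hz, hGe z hz, hGe z hz]
        exact P.param.det_conormal (hU (Metric.closedBall_subset_closedBall hr.le hz))) hb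
      (by
        filter_upwards [hx, P.conormal_axis hb] with x h1 h2
        rw [(hGn _ h1 0 0).self_of_nhds, h2.1])
      (by
        filter_upwards [hx, P.conormal_axis hb] with x h1 h2
        rw [(hGn _ h1 1 1).self_of_nhds, h2.2.1])
      (by
        filter_upwards [hx, P.conormal_axis hb] with x h1 h2
        rw [(hGn _ h1 0 1).self_of_nhds, h2.2.2])
      (by
        filter_upwards [hx, P.pd_conormal_axis] with x h1 h2
        rw [(hGn' _ h1 0 1).self_of_nhds, h2])
      (by
        filter_upwards [hx, P.areaDensity_axis hb] with x h1 h2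
        rw [(hβn _ h1).self_of_nhds, h2])
      (by
        filter_upwards [hx, P.pd_areaDensity_axis hA hb hle] with x h1 h2
        rw [(hβn' _ h1).self_of_nhds, h2])
      k hV hV1 hV2 hβ2 j hρ)
  refine ⟨G, β, hG, hsymm, hβ, fun z => hc₀.trans_le (hcβ z), hβe, hGe, u, hu, fun j => ?_⟩
  obtain ⟨C, hC, ε₀, hε₀, h⟩ := hprop j
  refine ⟨C, hC, ε₀, hε₀, fun ε hε => ?_⟩
  rw [hμ j ε hε.1]
  exact h ε hε

theorem exists_quasimodes [IsRiemannianManifold I M] [MeasurableSpace M] [BorelSpace M]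
    (P : IsAdaptedParam I A b₀ γ s₀ Θ Ξ U θ) (hA : IsSmoothForm I A) (hγ : IsDegenerateWell I A b₀ γ L)
    (hmin : IsUniqueNondegenerateMin γ (potential I A b₀ γ k) s₀) :
    ∃ u : ℕ → ℝ → M → ℂ,
      (∀ j : ℕ, ∀ h : ℝ, 0 < h → IsTestFunction I (u j h)) ∧
      (∀ j₁ j₂ : ℕ, ∃ C > (0 : ℝ), ∃ h₀ > (0 : ℝ), ∀ h ∈ Ioc 0 h₀,
        ‖l2Inner I (u j₁ h) (u j₂ h) - (if j₁ = j₂ then 1 else 0)‖ ≤ C * h) ∧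
      (∀ j : ℕ, ∃ C > (0 : ℝ), ∃ h₀ > (0 : ℝ), ∀ h ∈ Ioc 0 h₀,
        ∃ f : M → ℂ, IsMagneticSchrodinger I A h (u j h) f ∧
          l2Norm I (fun x => f x - (approxEigenvalue I A b₀ γ s₀ j k h : ℂ) * u j h x)
            ≤ C * h ^ (11 / 4 : ℝ) * l2Norm I (u j h)) := by
  obtain ⟨R, hR, hU⟩ := Metric.nhds_basis_closedBall.mem_iff.1 (P.param.isOpen.mem_nhds P.zero_mem)
  obtain ⟨p, hp⟩ := P.image_subset
  have hρ : 0 < R / 3 := by positivity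
  have hU3 : closedBall (0 : Plane) (3 * (R / 3)) ⊆ U := by
    rwa [mul_div_cancel₀ R (three_ne_zero)]
  have hU1 : closedBall (0 : Plane) (R / 3) ⊆ U :=
    (Metric.closedBall_subset_closedBall (by linarith)).trans hU
  obtain ⟨G, β, hG, hsymm, hβ, hβpos, hβe, hGe, v, hv, hprop⟩ :=
    P.exists_local_quasimodes hA hγ hmin hρ (by linarith : R / 3 < R) hU
  let root : ℝ → ℝ := fun h => h ^ (1 / 4 : ℝ)
  have hroot : ∀ h > 0, root h ^ 4 = h := fun h hh => by
    rw [← Real.rpow_natCast, ← Real.rpow_mul hh.le]; norm_num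
  have hroot_mem : ∀ {ε₀ h : ℝ}, 0 < ε₀ → h ∈ Ioc 0 (ε₀ ^ 4) → root h ∈ Ioc 0 ε₀ := fun {ε₀ h} h0 hh =>
    ⟨Real.rpow_pos_of_pos hh.1 _, le_of_pow_le_pow_left₀ four_ne_zero h0.le (by
      rw [hroot h hh.1]; exact hh.2)⟩
  have hGe' : ∀ z ∈ closedBall 0 (R / 3), ∀ i j, G i j z = β z * (pullMetric I Θ z)⁻¹ i j :=
    fun z hz i j => by rw [hGe z hz, hβe z hz]; rfl
  have hnorm : ∀ h : ℝ, ∀ w ∈ testSpace (R / 3),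
      l2Norm I (lift Θ Ξ U θ h w) = √(∫ z, ‖w z‖ ^ 2 * β z) := fun h w hw =>
    P.param.l2Norm_lift hp hU1 hβe h hw
  refine ⟨fun j h => lift Θ Ξ U θ h (v j (root h)),
    fun j h _ => P.param.isTestFunction_lift hU1 P.smooth_phase h (hv j _), fun j₁ j₂ => ?_, fun j => ?_⟩
  · obtain ⟨C₁, -, ε₁, hε₁, h₁⟩ := hprop j₁
    obtain ⟨C₂, -, ε₂, hε₂, h₂⟩ := hprop j₂
    refine ⟨1, one_pos, min ε₁ ε₂ ^ 4, by positivity, fun h hh => ?_⟩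
    have hr := hroot_mem (lt_min hε₁ hε₂) hh
    obtain ⟨n₁, o₁, -⟩ := h₁ (root h) ⟨hr.1, hr.2.trans (min_le_left _ _)⟩
    obtain ⟨n₂, o₂, -⟩ := h₂ (root h) ⟨hr.1, hr.2.trans (min_le_right _ _)⟩
    have key : l2Inner I (lift Θ Ξ U θ h (v j₁ (root h))) (lift Θ Ξ U θ h (v j₂ (root h)))
        = if j₁ = j₂ then 1 else 0 := by
      rw [P.param.l2Inner_lift hp hU1 hβe h (hv j₁ _) (hv j₂ _)]
      rcases lt_trichotomy j₁ j₂ with hj | rfl | hj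
      · rw [if_neg hj.ne]
        have h3 := congrArg (starRingEnd ℂ) (o₂ j₁ hj)
        rw [← integral_conj, map_zero] at h3
        rw [← h3]
        refine integral_congr_ae (Eventually.of_forall fun z => ?_)
        simp only [map_mul, Complex.conj_conj, Complex.conj_ofReal]
        ring
      · rw [if_pos rfl, ← Complex.ofReal_one, ← n₁, ← integral_complex_ofReal]
        refine integral_congr_ae (Eventually.of_forall fun z => ?_)
        simp only [Complex.mul_conj, Complex.normSq_eq_norm_sq]
        push_cast
        rfl
      · rw [if_neg hj.ne', o₁ j₂ hj]
    rw [key, sub_self, norm_zero, one_mul]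
    exact hh.1.le
  · obtain ⟨C, hC, ε₀, hε₀, hj⟩ := hprop j
    refine ⟨C + 1, by positivity, ε₀ ^ 4, by positivity, fun h hh => ?_⟩
    have hr := hroot_mem hε₀ hh
    obtain ⟨n, -, e⟩ := hj (root h) hr
    rw [hroot h hh.1] at e
    refine ⟨_, P.param.isMagneticSchrodinger_lift hp hρ hU3 hβ hβpos hβe hG hsymm hGe' P.smooth_phase P.form_eq
      hh.1.ne' (hv j _), ?_⟩
    have hop : (fun z => ((β z)⁻¹ : ℂ) * magneticOp h G (v j (root h)) z) ∈ testSpace (R / 3) :=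
      (magneticEnd (R / 3) hβ hβpos hG h ⟨_, hv j (root h)⟩).2
    have hres : (fun z => ((β z)⁻¹ : ℂ) * magneticOp h G (v j (root h)) z
        - (approxEigenvalue I A b₀ γ s₀ j k h : ℂ) * v j (root h) z) ∈ testSpace (R / 3) :=
      Submodule.sub_mem _ hop (Submodule.smul_mem _ (approxEigenvalue I A b₀ γ s₀ j k h : ℂ) (hv j (root h)))
    simp only [lift_sub_mul]
    rw [hnorm h _ hres, hnorm h _ (hv j _), n, Real.sqrt_one, mul_one]
    have h11 : h ^ (11 / 4 : ℝ) = root h ^ 11 := by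
      rw [← Real.rpow_natCast, ← Real.rpow_mul hh.1.le]; norm_num
    rw [h11]
    have hr0 := hr.1.le
    refine (Real.sqrt_le_sqrt e).trans ?_
    rw [Real.sqrt_sq (by positivity)]
    gcongr
    linarith

end IsAdaptedParam

end Adapted

section Primitives

/-- Smooth dependence of integrals on parameters. -/
lemma contDiff_integral_param (n : ℕ) : ∀ {F : Type} [NormedAddCommGroup F] [NormedSpace ℝ F]
    {f : Plane → ℝ → F} (_ : ContDiff ℝ ∞ (Function.uncurry f)),
    ContDiff ℝ n fun x => ∫ t in (0 : ℝ)..1, f x t := by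
  induction n with
  | zero =>
    intro F _ _ f hf
    exact contDiff_zero.2 (intervalIntegral.continuous_parametric_intervalIntegral_of_continuous' hf.continuous 0 1)
  | succ n ih =>
    intro F _ _ f hf
    let f' : Plane → ℝ → Plane →L[ℝ] F := fun x t => fderiv ℝ (fun y => f y t) x
    have hf' : ContDiff ℝ ∞ (Function.uncurry f') :=
      ContDiff.fderiv (m := ∞) (f := fun (p : Plane × ℝ) (y : Plane) => f y p.2)
        (hf.comp (contDiff_snd.prodMk (contDiff_snd.comp contDiff_fst))) contDiff_fst (by simp)
    have hd : ∀ t x, HasFDerivAt (fun y => f y t) (f' x t) x := fun t x =>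
      (ContDiff.diffAt_top (f := fun y => f y t)
        (hf.comp (contDiff_id.prodMk contDiff_const)) x).hasFDerivAt
    have hcont : ∀ x, Continuous (f x) := fun x => hf.continuous.comp (Continuous.prodMk_right x)
    have hcont' : ∀ x, Continuous (f' x) := fun x => hf'.continuous.comp (Continuous.prodMk_right x)
    rw [Nat.cast_succ, contDiff_succ_iff_hasFDerivAt]
    refine ⟨fun x => ∫ t in (0 : ℝ)..1, f' x t, ih hf', fun x => ?_⟩
    obtain ⟨C, hC⟩ := ((isCompact_closedBall x 1).prod (isCompact_Icc (a := (0 : ℝ)) (b := 1))).exists_bound_of_continuousOn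
      hf'.continuous.continuousOn
    refine intervalIntegral.hasFDerivAt_integral_of_dominated_of_fderiv_le (bound := fun _ => C)
      (Metric.ball_mem_nhds x one_pos) (Eventually.of_forall fun y => (hcont y).aestronglyMeasurable)
      ((hcont x).intervalIntegrable 0 1) (hcont' x).aestronglyMeasurable
      (Eventually.of_forall fun t ht y hy => hC (y, t) ⟨Metric.ball_subset_closedBall hy, ?_⟩)
      intervalIntegrable_const (Eventually.of_forall fun t _ y _ => hd t y)
    rw [uIoc_of_le zero_le_one] at ht
    exact ⟨ht.1.le, ht.2⟩

/-- Primitives in the second variable. -/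
lemma exists_primitive {f : Plane → ℝ} (hf : ContDiff ℝ ∞ f) :
    ∃ F : Plane → ℝ, ContDiff ℝ ∞ F ∧ (∀ x, F (pt x 0) = 0) ∧ ∀ z, pd 1 F z = f z := by
  let F : Plane → ℝ := fun z => z 1 * ∫ t in (0 : ℝ)..1, f (pt (z 0) (t * z 1))
  have h1 : ContDiff ℝ ∞ fun z : Plane => ∫ t in (0 : ℝ)..1, f (pt (z 0) (t * z 1)) := by
    refine contDiff_infty.2 fun n => contDiff_integral_param n ?_
    exact hf.comp (contDiff_pt.comp (((contDiff_coord 0).comp contDiff_fst).prodMk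
      (contDiff_snd.mul ((contDiff_coord 1).comp contDiff_fst))))
  have hF : ContDiff ℝ ∞ F := (contDiff_coord 1).mul h1
  refine ⟨F, hF, fun x => by simp [F, pt], fun z => ?_⟩
  have hc : Continuous fun t => f (pt (z 0) t) :=
    hf.continuous.comp (contDiff_pt.continuous.comp (Continuous.prodMk_right (z 0)))
  have h2 : HasDerivAt (fun t => F (pt (z 0) t)) (f (pt (z 0) (z 1))) (z 1) := by
    have e : (fun t => F (pt (z 0) t)) = fun t => ∫ r in (0 : ℝ)..t, f (pt (z 0) r) := by
      funext t
      have := intervalIntegral.mul_integral_comp_mul_right (f := fun r => f (pt (z 0) r)) (a := 0) (b := 1) t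
      rw [zero_mul, one_mul] at this
      exact this
    rw [e]
    exact hc.integral_hasStrictDerivAt 0 (z 1) |>.hasDerivAt
  have h3 := hasDerivAt_pt_one (f := F) (x := z 0) (y := z 1) (ContDiff.diffAt_top hF _)
  rw [pt_eta] at h2 h3
  exact h3.unique h2

/-- A 1-form on the plane is `dθ + Y dx` with `Y = 0` on the first axis. -/
lemma exists_gauge {a : Fin 2 → Plane → ℝ} (ha : ∀ i, ContDiff ℝ ∞ (a i)) :
    ∃ θ Y : Plane → ℝ, ContDiff ℝ ∞ θ ∧ ContDiff ℝ ∞ Y ∧ (∀ x, Y (pt x 0) = 0) ∧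
      (∀ z, pd 1 Y z = -planeCurl a z) ∧ (∀ z, a 0 z = pd 0 θ z + Y z) ∧ ∀ z, a 1 z = pd 1 θ z := by
  obtain ⟨Y, hY, hY0, hY1⟩ := exists_primitive (f := fun z => -planeCurl a z)
    (((ha 1).pd 0).sub ((ha 0).pd 1)).neg
  obtain ⟨η, hη, -, hη1⟩ := exists_primitive (ha 1)
  have hd : ∀ {f : Plane → ℝ}, ContDiff ℝ ∞ f → ∀ z, DifferentiableAt ℝ f z := fun hf z =>
    ContDiff.diffAt_top hf z
  let D : Plane → ℝ := fun z => a 0 z - pd 0 η z - Y z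
  have hD : ContDiff ℝ ∞ D := ((ha 0).sub (hη.pd 0)).sub hY
  have hD1 : ∀ z, pd 1 D z = 0 := fun z => by
    rw [pd_sub ((hd (ha 0) z).fun_sub (hd (hη.pd 0) z)) (hd hY z), pd_sub (hd (ha 0) z) (hd (hη.pd 0) z),
      pd_comm hη.contDiffAt 1 0, pd_congr (Eventually.of_forall hη1) 0, hY1, planeCurl]
    ring
  have hDx : ∀ z, D z = D (pt (z 0) 0) := fun z => by
    have := is_const_of_deriv_eq_zero (f := fun t => D (pt (z 0) t))
      (fun t => (hasDerivAt_pt_one (hd hD _)).differentiableAt)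
      (fun t => (hasDerivAt_pt_one (hd hD _)).deriv.trans (hD1 _)) (z 1) 0
    simpa only [pt_eta] using this
  let q : ℝ → ℝ := fun x => ∫ t in (0 : ℝ)..x, D (pt t 0)
  have hDc : ContDiff ℝ ∞ fun t => D (pt t 0) := contDiff_axis hD
  have hq : ∀ x, HasDerivAt q (D (pt x 0)) x := fun x =>
    (hDc.continuous.integral_hasStrictDerivAt 0 x).hasDerivAt
  have hqs : ContDiff ℝ ∞ q := contDiff_infty_iff_deriv.2 ⟨fun x => (hq x).differentiableAt, by
    rwa [funext fun x => (hq x).deriv]⟩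
  have hQ : ContDiff ℝ ∞ fun z : Plane => q (z 0) := hqs.comp (contDiff_coord 0)
  have hQ0 : ∀ z, pd 0 (fun z : Plane => q (z 0)) z = D z := fun z => by
    have h1 := hasDerivAt_pt_zero (f := fun z : Plane => q (z 0)) (x := z 0) (y := z 1) (hd hQ _)
    rw [pt_eta] at h1
    rw [hDx]
    exact h1.unique (hq (z 0))
  have hQ1 : ∀ z, pd 1 (fun z : Plane => q (z 0)) z = 0 := fun z => by
    have h1 := hasDerivAt_pt_one (f := fun z : Plane => q (z 0)) (x := z 0) (y := z 1) (hd hQ _)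
    rw [pt_eta] at h1
    exact h1.unique (hasDerivAt_const (z 1) (q (z 0)))
  refine ⟨fun z => η z + q (z 0), Y, hη.add hQ, hY, hY0, hY1, fun z => ?_, fun z => ?_⟩
  · rw [pd_add (hd hη z) (hd hQ z), hQ0]
    simp only [D]
    ring
  · rw [pd_add (hd hη z) (hd hQ z), hQ1, hη1, add_zero]

lemma exists_equiv_of_det_ne_zero {τ : Plane → Plane} {z : Plane} (hτ : DifferentiableAt ℝ τ z)
    (h : (jacobian τ z).det ≠ 0) : ∃ L : Plane ≃L[ℝ] Plane, HasFDerivAt τ (L : Plane →L[ℝ] Plane) z := by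
  have hv : ∀ v a, fderiv ℝ τ z v a = (jacobian τ z).mulVec (fun i => v i) a := fun v a => by
    have h2 : v = v 0 • basisVec 0 + v 1 • basisVec 1 := by ext i; fin_cases i <;> simp [basisVec]
    conv_lhs => rw [h2, map_add, map_smul, map_smul, fderiv_basisVec hτ, fderiv_basisVec hτ]
    fin_cases a <;> simp [basisVec, Matrix.mulVec, dotProduct, Fin.sum_univ_two] <;> ring
  have hinj : Function.Injective (fderiv ℝ τ z : Plane →ₗ[ℝ] Plane) := by
    rw [← LinearMap.ker_eq_bot, LinearMap.ker_eq_bot']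
    intro v hv0
    have h3 : (jacobian τ z).mulVec (fun i => v i) = 0 := by
      funext a; rw [← hv]; exact congrArg (fun w : Plane => w a) hv0
    have h4 := Matrix.eq_zero_of_mulVec_eq_zero h h3
    ext i; exact congrFun h4 i
  refine ⟨(LinearEquiv.ofInjectiveEndo _ hinj).toContinuousLinearEquiv, ?_⟩
  convert hτ.hasFDerivAt using 1
  ext v
  rfl

/-- The inverse function theorem. -/
lemma exists_isLocalParam {τ : Plane → Plane} {V : Set Plane} {z₀ : Plane} (hV : IsOpen V) (h0 : z₀ ∈ V)
    (hτ : ∀ z ∈ V, ContDiffAt ℝ ∞ τ z) (hdet : (jacobian τ z₀).det ≠ 0) :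
    ∃ W ⊆ V, z₀ ∈ W ∧ ∃ σ, IsLocalParam 𝓘(ℝ, Plane) τ σ W := by
  obtain ⟨L, hL⟩ := exists_equiv_of_det_ne_zero (hτ z₀ h0).diffAt_top hdet
  let e := (hτ z₀ h0).toOpenPartialHomeomorph τ hL (by simp)
  have hdc : ContinuousOn (fun z => (jacobian τ z).det) V := fun z hz =>
    (matSmooth_jacobian (hτ z hz)).det.continuousAt.continuousWithinAt
  let W := e.source ∩ (V ∩ (fun z => (jacobian τ z).det) ⁻¹' {0}ᶜ)
  have hW : IsOpen W := e.open_source.inter (hdc.isOpen_inter_preimage hV isOpen_compl_singleton)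
  refine ⟨W, fun z hz => hz.2.1, ⟨(hτ z₀ h0).mem_toOpenPartialHomeomorph_source hL _, h0, hdet⟩, e.symm, ?_⟩
  exact
    { isOpen := hW
      smooth := ContDiffOn.contMDiffOn fun z hz => (hτ z hz.2.1).contDiffWithinAt
      smooth_inv := by
        refine ContDiffOn.contMDiffOn ?_
        rintro _ ⟨z, hz, rfl⟩
        obtain ⟨L', hL'⟩ := exists_equiv_of_det_ne_zero (hτ z hz.2.1).diffAt_top hz.2.2
        have he : e.symm (τ z) = z := e.left_inv hz.1
        exact (e.contDiffAt_symm (f₀' := L') (e.map_source hz.1) (by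
          rw [show e.symm (e z) = z from he]; exact hL') (by
          rw [show e.symm (e z) = z from he]; exact hτ z hz.2.1)).contDiffWithinAt
      left_inv := fun z hz => e.left_inv hz.1
      isOpen_image := e.isOpen_image_of_subset_source hW inter_subset_left
      image_subset := by rw [ModelWithCorners.interior_eq_univ]; exact subset_univ _ }

end Primitives

section AxisParam

variable {H : Type*} [TopologicalSpace H] {I : ModelWithCorners ℝ Plane H}
  {M : Type*} [MetricSpace M] [ChartedSpace H M]
  {Θ : Plane → M} {Ξ : M → Plane} {U : Set Plane} {τ σ : Plane → Plane} {V : Set Plane}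

namespace IsLocalParam

lemma contDiffAt (hτ : IsLocalParam 𝓘(ℝ, Plane) τ σ V) {z : Plane} (hz : z ∈ V) : ContDiffAt ℝ ∞ τ z :=
  (hτ.smoothAt hz).contDiffAt

lemma symm (hτ : IsLocalParam 𝓘(ℝ, Plane) τ σ V) : IsLocalParam 𝓘(ℝ, Plane) σ τ (τ '' V) := by
  have h : σ '' (τ '' V) = V := by
    rw [image_image]
    exact (image_congr fun z hz => hτ.left_inv z hz).trans (image_id V)
  exact
    { isOpen := hτ.isOpen_image
      smooth := hτ.smooth_inv
      smooth_inv := by rw [h]; exact hτ.smooth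
      left_inv := by rintro _ ⟨z, hz, rfl⟩; rw [hτ.left_inv z hz]
      isOpen_image := by rw [h]; exact hτ.isOpen
      image_subset := by rw [ModelWithCorners.interior_eq_univ]; exact subset_univ _ }

lemma comp (P : IsLocalParam I Θ Ξ U) (hτ : IsLocalParam 𝓘(ℝ, Plane) τ σ V) :
    IsLocalParam I (fun z => Θ (τ z)) (fun x => σ (Ξ x)) (V ∩ τ ⁻¹' U) := by
  have hW : IsOpen (V ∩ τ ⁻¹' U) := hτ.smooth.continuousOn.isOpen_inter_preimage hτ.isOpen P.isOpen
  have hτW := hτ.mono hW inter_subset_left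
  have hsub : τ '' (V ∩ τ ⁻¹' U) ⊆ U := by rintro _ ⟨z, hz, rfl⟩; exact hz.2
  have PW := P.mono hτW.isOpen_image hsub
  have him : (fun z => Θ (τ z)) '' (V ∩ τ ⁻¹' U) = Θ '' (τ '' (V ∩ τ ⁻¹' U)) := (image_image _ _ _).symm
  exact
    { isOpen := hW
      smooth := P.smooth.comp hτW.smooth fun z hz => hz.2
      smooth_inv := by
        rw [him]
        refine hτW.smooth_inv.comp PW.smooth_inv ?_
        rintro _ ⟨w, hw, rfl⟩
        rw [mem_preimage, PW.left_inv w hw]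
        exact hw
      left_inv := fun z hz => by simp only [P.left_inv _ hz.2, hτ.left_inv z hz.1]
      isOpen_image := by rw [him]; exact PW.isOpen_image
      image_subset := by rw [him]; exact PW.image_subset }

end IsLocalParam

variable [RiemannianBundle (fun x : M => TangentSpace I x)]

variable (I) in
/-- A local parametrization in which `γ` runs along the first axis, where the metric is a multiple of
the identity and the exterior derivative of the potential is `-dx ∧ dy`. -/
structure IsAxisParam (A : ∀ x : M, TangentSpace I x →L[ℝ] ℝ) (b₀ : ℝ) (γ : ℝ → M) (s₀ : ℝ)
    (Θ : Plane → M) (Ξ : M → Plane) (U : Set Plane) : Prop where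
  param : IsLocalParam I Θ Ξ U
  zero_mem : (0 : Plane) ∈ U
  image_subset : ∃ p, Θ '' U ⊆ (extChartAt I p).source
  axis : ∀ᶠ x in 𝓝 (0 : ℝ), Θ (pt x 0) = γ (s₀ + x / √b₀)
  metric_axis : ∀ᶠ x in 𝓝 (0 : ℝ), pullMetric I Θ (pt x 0) = b₀⁻¹ • (1 : Mat)
  curl_axis : ∀ᶠ x in 𝓝 (0 : ℝ), planeCurl (fun i => pullForm I A Θ i) (pt x 0) = -1

lemma eventually_pt_mem (hV : IsOpen V) (h0 : (0 : Plane) ∈ V) : ∀ᶠ x in 𝓝 (0 : ℝ), pt x 0 ∈ V :=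
  continuous_pt_zero.continuousAt.eventually_mem (hV.mem_nhds (by simpa only [pt_zero_zero] using h0))

namespace IsAxisParam

variable {A : ∀ x : M, TangentSpace I x →L[ℝ] ℝ} {b₀ s₀ L : ℝ} {γ : ℝ → M}

lemma mono (P : IsAxisParam I A b₀ γ s₀ Θ Ξ U) (hV : IsOpen V) (h0 : 0 ∈ V) (h : V ⊆ U) :
    IsAxisParam I A b₀ γ s₀ Θ Ξ V where
  param := P.param.mono hV h
  zero_mem := h0
  image_subset := P.image_subset.imp fun _ hp => (image_mono h).trans hp
  axis := P.axis
  metric_axis := P.metric_axis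
  curl_axis := P.curl_axis

variable [IsManifold I ∞ M] [IsContMDiffRiemannianBundle I ∞ Plane (fun x : M => TangentSpace I x)]

/-- Changes of the parametrization that are tangent to the identity along the axis. -/
lemma comp (P : IsAxisParam I A b₀ γ s₀ Θ Ξ U) (hA : IsSmoothForm I A)
    (hτ : IsLocalParam 𝓘(ℝ, Plane) τ σ V) (h0 : 0 ∈ V) (hax : ∀ᶠ x in 𝓝 (0 : ℝ), τ (pt x 0) = pt x 0)
    (hJ : ∀ᶠ x in 𝓝 (0 : ℝ), jacobian τ (pt x 0) = 1) :
    IsAxisParam I A b₀ γ s₀ (fun z => Θ (τ z)) (fun x => σ (Ξ x)) (V ∩ τ ⁻¹' U) ∧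
      ∀ᶠ x in 𝓝 (0 : ℝ), pd 1 (fun z => pullMetric I (fun z => Θ (τ z)) z 0 1) (pt x 0)
        = pd 1 (fun z => pullMetric I Θ z 0 1) (pt x 0) + b₀⁻¹ * pd 1 (pd 1 fun w => τ w 0) (pt x 0) := by
  have h0' : τ 0 = 0 := by have := hax.self_of_nhds; rwa [pt_zero_zero] at this
  have hmem : ∀ᶠ x in 𝓝 (0 : ℝ), pt x 0 ∈ V ∧ pt x 0 ∈ U :=
    (eventually_pt_mem hτ.isOpen h0).and (eventually_pt_mem P.param.isOpen P.zero_mem)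
  have hmet : ∀ z ∈ V ∩ τ ⁻¹' U, pullMetric I (fun z => Θ (τ z)) z
      = (jacobian τ z).transpose * pullMetric I Θ (τ z) * jacobian τ z := fun z hz =>
    pullMetric_comp (hτ.contDiffAt hz.1).diffAt_top (P.param.mdifferentiableAt hz.2)
      (Eventually.of_forall fun _ => rfl)
  have Q := P.param.comp hτ
  refine ⟨⟨Q, ⟨h0, by rw [mem_preimage, h0']; exact P.zero_mem⟩, ?_, ?_, ?_, ?_⟩, ?_⟩
  · obtain ⟨p, hp⟩ := P.image_subset
    refine ⟨p, ?_⟩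
    rintro _ ⟨z, hz, rfl⟩
    exact hp (mem_image_of_mem Θ hz.2)
  · filter_upwards [hax, P.axis] with x h1 h2
    rw [h1, h2]
  · filter_upwards [hax, hJ, hmem, P.metric_axis] with x h1 h2 h3 h4
    rw [hmet _ ⟨h3.1, by rw [mem_preimage, h1]; exact h3.2⟩, h2, h1, h4]
    simp
  · filter_upwards [hax, hJ, hmem, P.curl_axis] with x h1 h2 h3 h4
    have hU : pt x 0 ∈ V ∩ τ ⁻¹' U := ⟨h3.1, by rw [mem_preimage, h1]; exact h3.2⟩
    rw [planeCurl_comp (a' := fun i => pullForm I A Θ i) (hτ.contDiffAt h3.1)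
      (fun i => by rw [h1]; exact P.param.contDiffAt_pullForm hA h3.2 i)
      (fun i => by
        filter_upwards [Q.isOpen.mem_nhds hU] with w hw
        exact pullForm_comp (hτ.contDiffAt hw.1).diffAt_top (P.param.mdifferentiableAt hw.2)
          (Eventually.of_forall fun _ => rfl) i), h2, h1, h4]
    simp
  · filter_upwards [hax, hJ.eventually_nhds, hmem, P.metric_axis] with x h1 h2 h3 h4
    have hU : pt x 0 ∈ V ∩ τ ⁻¹' U := ⟨h3.1, by rw [mem_preimage, h1]; exact h3.2⟩
    have hτs := hτ.contDiffAt h3.1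
    have hJs := matSmooth_jacobian hτs
    have hg := P.param.matSmooth_pullMetric h3.2
    have hgτ : MatSmooth (fun w => pullMetric I Θ (τ w)) (pt x 0) :=
      MatSmooth.comp (by rw [h1]; exact hg) hτs
    have hJx := h2.self_of_nhds
    have e1 : mpd 1 (pullMetric I fun z => Θ (τ z)) (pt x 0) = _ :=
      mpd_congr (by filter_upwards [Q.isOpen.mem_nhds hU] with w hw using hmet w hw) 1
    have e2 : pd 1 (fun z => jacobian τ z 1 0) (pt x 0) = 0 := by
      have h5 : pd 1 (pd 0 fun w => τ w 1) (pt x 0) = pd 0 (pd 1 fun w => τ w 1) (pt x 0) :=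
        pd_comm (contDiffAt_component hτs 1) 1 0
      refine h5.trans (pd_zero_of_axis_const ((contDiffAt_component hτs 1).pd 1).diffAt_top
        (c := 1) (h2.mono fun t ht => ?_))
      have := congrFun (congrFun ht 1) 1
      rwa [Matrix.one_apply_eq] at this
    rw [mpd_mul (hJs.transpose.mul hgτ) hJs, mpd_mul hJs.transpose hgτ, mpd_transpose,
      mpd_comp (by rw [h1]; exact hg) hτs, hJx, h1, h4] at e1
    have e3 := congrFun (congrFun e1 0) 1
    rw [mpd_apply] at e3
    rw [e3]
    simp [Matrix.add_apply, Matrix.one_apply, mpd_apply, e2]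
    exact Or.inl rfl

/-- In an axis parametrization the last normalization is achieved along the fibres. -/
theorem exists_cross_axis (P : IsAxisParam I A b₀ γ s₀ Θ Ξ U) (hA : IsSmoothForm I A) (hb : 0 < b₀) :
    ∃ Θ' Ξ' U', IsAxisParam I A b₀ γ s₀ Θ' Ξ' U' ∧
      ∀ᶠ x in 𝓝 (0 : ℝ), pd 1 (fun z => pullMetric I Θ' z 0 1) (pt x 0) = 0 := by
  let N : Set ℝ := (fun x => pt x 0) ⁻¹' U
  have hN : IsOpen N := P.param.isOpen.preimage continuous_pt_zero
  let V : Set Plane := {z | z 0 ∈ N}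
  have hV : IsOpen V := hN.preimage (contDiff_coord 0).continuous
  have h0V : (0 : Plane) ∈ V := by
    change pt 0 0 ∈ U
    rw [pt_zero_zero]; exact P.zero_mem
  let c : ℝ → ℝ := fun x => -(b₀ / 2) * pd 1 (fun z => pullMetric I Θ z 0 1) (pt x 0)
  have hc : ∀ x ∈ N, ContDiffAt ℝ ∞ c x := fun x hx =>
    contDiffAt_const.mul (contDiffAt_comp_pt_zero ((P.param.matSmooth_pullMetric hx 0 1).pd 1))
  let τ : Plane → Plane := fun z => pt (z 0 + c (z 0) * (z 1 * z 1)) (z 1)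
  have hcz : ∀ z ∈ V, ContDiffAt ℝ ∞ (fun z : Plane => c (z 0)) z := fun z hz =>
    ContDiffAt.comp (g := c) z (hc _ hz) (contDiff_coord 0).contDiffAt
  have hco : ∀ (i : Fin 2) z, DifferentiableAt ℝ (fun w : Plane => w i) z := fun i z =>
    ContDiff.diffAt_top (contDiff_coord i) z
  have hsq : ContDiff ℝ ∞ fun z : Plane => z 1 * z 1 := (contDiff_coord 1).mul (contDiff_coord 1)
  have hsqd : ∀ z, DifferentiableAt ℝ (fun w : Plane => w 1 * w 1) z := fun z =>
    ContDiff.diffAt_top hsq z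
  have hτ : ∀ z ∈ V, ContDiffAt ℝ ∞ τ z := fun z hz =>
    contDiff_pt.contDiffAt.comp z (((contDiff_coord 0).contDiffAt.add ((hcz z hz).mul hsq.contDiffAt)).prodMk
      (contDiff_coord 1).contDiffAt)
  have hax : ∀ x, τ (pt x 0) = pt x 0 := fun x => by simp [τ, pt]
  have hpd : ∀ z ∈ V, ∀ i, pd i (fun w => τ w 0) z = pd i (fun w : Plane => w 0) z
      + (pd i (fun w : Plane => c (w 0)) z * (z 1 * z 1) + c (z 0) * pd i (fun w : Plane => w 1 * w 1) z) := by
    intro z hz i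
    have hcd := (hcz z hz).diffAt_top
    exact (pd_add (hco 0 z) (hcd.fun_mul (hsqd z)) i).trans
      (congrArg₂ (· + ·) rfl (pd_mul hcd (hsqd z) i))
  have hsqp : ∀ i z, pd i (fun w : Plane => w 1 * w 1) z = 2 * (if i = 1 then 1 else 0) * z 1 := fun i z => by
    rw [pd_mul (hco 1 z) (hco 1 z), pd_coord]; ring
  have hJ : ∀ᶠ x in 𝓝 (0 : ℝ), jacobian τ (pt x 0) = 1 := by
    filter_upwards [eventually_pt_mem hV h0V] with x hx
    have h1 : pt x 0 1 = 0 := rfl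
    have h2 : ∀ i, pd i (fun w => τ w 1) (pt x 0) = if i = 1 then 1 else 0 := fun i => pd_coord i 1 _
    ext a i
    rw [jacobian_apply]
    fin_cases a
    · refine (hpd _ hx i).trans ?_
      rw [hsqp, h1, pd_coord]
      fin_cases i <;> simp
    · refine (h2 i).trans ?_
      fin_cases i <;> simp
  have hdet : (jacobian τ 0).det ≠ 0 := by
    have := hJ.self_of_nhds
    rw [pt_zero_zero] at this
    rw [this]; simp
  obtain ⟨W, hWV, h0W, σ, hW⟩ := exists_isLocalParam hV h0V hτ hdet
  obtain ⟨Q, hQ⟩ := P.comp hA hW h0W (Eventually.of_forall hax) hJ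
  refine ⟨_, _, _, Q, ?_⟩
  filter_upwards [hQ, eventually_pt_mem hV h0V] with x h1 h2
  have h3 : pd 1 (pd 1 fun w => τ w 0) (pt x 0) = 2 * c x := by
    have hcx := hcz _ h2
    have e : pd 1 (fun w => τ w 0) =ᶠ[𝓝 (pt x 0)] fun z =>
        pd 1 (fun w : Plane => c (w 0)) z * (z 1 * z 1) + c (z 0) * (2 * z 1) := by
      filter_upwards [hV.mem_nhds h2] with w hw
      rw [hpd w hw, hsqp, pd_coord]
      simp
    have hcp := (hcx.pd 1).diffAt_top
    have hcd := hcx.diffAt_top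
    have h2d : DifferentiableAt ℝ (fun z : Plane => 2 * z 1) (pt x 0) := (hco 1 _).const_mul 2
    have h4 : pd 1 (fun z : Plane => 2 * z 1) (pt x 0) = 2 := by
      rw [pd_mul (differentiableAt_const 2) (hco 1 _), pd_const, pd_coord]; simp
    refine (pd_congr e 1).trans ((pd_add (hcp.fun_mul (hsqd _)) (hcd.fun_mul h2d) 1).trans ?_)
    rw [pd_mul hcp (hsqd _), pd_mul hcd h2d, hsqp, h4]
    simp [pt]
    ring
  rw [h1, h3]
  simp only [c]
  field_simp
  ring

end IsAxisParam

end AxisParam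

section Existence

variable {H : Type*} [TopologicalSpace H] {I : ModelWithCorners ℝ Plane H}
  {M : Type*} [MetricSpace M] [ChartedSpace H M] [IsManifold I ∞ M]
  [RiemannianBundle (fun x : M => TangentSpace I x)]
  [IsContMDiffRiemannianBundle I ∞ Plane (fun x : M => TangentSpace I x)]
  {Θ : Plane → M} {Ξ : M → Plane} {U : Set Plane}
  {A : ∀ x : M, TangentSpace I x →L[ℝ] ℝ} {b₀ s₀ L : ℝ} {γ : ℝ → M}

/-- The potential is put in the form `dθ + y dx` by a change of the normal coordinate. -/
theorem IsAxisParam.exists_isAdaptedParam (P : IsAxisParam I A b₀ γ s₀ Θ Ξ U) (hA : IsSmoothForm I A)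
    (hcross : ∀ᶠ x in 𝓝 (0 : ℝ), pd 1 (fun z => pullMetric I Θ z 0 1) (pt x 0) = 0) :
    ∃ Θ' Ξ' U' θ, IsAdaptedParam I A b₀ γ s₀ Θ' Ξ' U' θ := by
  obtain ⟨R, hR, hU⟩ := Metric.nhds_basis_closedBall.mem_iff.1 (P.param.isOpen.mem_nhds P.zero_mem)
  obtain ⟨χ, hχ, hχ1, -, -, hχs⟩ := exists_cutoff (half_pos hR) (half_lt_self hR)
  obtain ⟨θ, Y, hθ, hY, hY0, hY1, hθ0, hθ1⟩ := exists_gauge (a := fun i z => χ z * pullForm I A Θ i z)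
    fun i => contDiff_mul_of_tsupport_subset hχ (hχs.trans hU) fun z hz => P.param.contDiffAt_pullForm hA hz i
  have hB : ball (0 : Plane) (R / 2) ⊆ U :=
    (Metric.ball_subset_closedBall.trans (Metric.closedBall_subset_closedBall (half_le_self hR.le))).trans hU
  have hform : ∀ z ∈ ball (0 : Plane) (R / 2), ∀ i, χ z * pullForm I A Θ i z = pullForm I A Θ i z :=
    fun z hz i => by rw [hχ1 z (Metric.ball_subset_closedBall hz), one_mul]
  have h0B : (0 : Plane) ∈ ball (0 : Plane) (R / 2) := Metric.mem_ball_self (half_pos hR)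
  let Q : Plane → Plane := fun z => pt (z 0) (Y z)
  have hQ : ContDiff ℝ ∞ Q := contDiff_pt.comp ((contDiff_coord 0).prodMk hY)
  have hQax : ∀ x, Q (pt x 0) = pt x 0 := fun x => by simp only [Q, hY0]; rfl
  have hQ0 : Q 0 = 0 := by have := hQax 0; rwa [pt_zero_zero] at this
  have hQJ : ∀ᶠ x in 𝓝 (0 : ℝ), jacobian Q (pt x 0) = 1 := by
    filter_upwards [P.curl_axis, eventually_pt_mem Metric.isOpen_ball h0B] with x h1 h2
    have e : planeCurl (fun i z => χ z * pullForm I A Θ i z) (pt x 0) = -1 :=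
      (planeCurl_congr fun i => by
        filter_upwards [Metric.isOpen_ball.mem_nhds h2] with w hw using hform w hw i).trans h1
    ext a i
    rw [jacobian_apply]
    fin_cases a
    · refine (pd_coord i 0 _).trans ?_
      fin_cases i <;> simp
    · change pd i Y (pt x 0) = _
      fin_cases i
      · exact pd_zero_of_axis_const (ContDiff.diffAt_top hY _) (c := 0) (Eventually.of_forall hY0)
      · refine (hY1 _).trans ?_
        rw [e]; simp
  obtain ⟨W, -, h0W, σ, hW⟩ := exists_isLocalParam isOpen_univ (mem_univ (0 : Plane))
    (fun z _ => hQ.contDiffAt) (by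
      have := hQJ.self_of_nhds
      rw [pt_zero_zero] at this
      rw [this]; simp)
  have hσ := hW.symm
  have h0σ : (0 : Plane) ∈ Q '' W := ⟨0, h0W, hQ0⟩
  have hWm := eventually_pt_mem hW.isOpen h0W
  have hσax : ∀ᶠ x in 𝓝 (0 : ℝ), σ (pt x 0) = pt x 0 := hWm.mono fun x hx => by
    conv_lhs => rw [← hQax x]
    exact hW.left_inv _ hx
  have hQσ : ∀ z ∈ Q '' W, Q (σ z) = z := by
    rintro _ ⟨w, hw, rfl⟩; rw [hW.left_inv w hw]
  have hσ0 : ∀ z ∈ Q '' W, σ z 0 = z 0 := fun z hz => by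
    have := congrArg (fun w : Plane => w 0) (hQσ z hz)
    exact this
  have hσ0' : ∀ z ∈ Q '' W, ∀ i, pd i (fun w => σ w 0) z = if i = 0 then 1 else 0 := fun z hz i => by
    rw [pd_congr (g := fun w : Plane => w 0)
      (by filter_upwards [hσ.isOpen.mem_nhds hz] with w hw using hσ0 w hw), pd_coord]
  have hσJ : ∀ᶠ x in 𝓝 (0 : ℝ), jacobian σ (pt x 0) = 1 := by
    filter_upwards [hWm, hQJ] with x h1 h2
    ext a i
    have e : (fun w => σ (Q w) a) =ᶠ[𝓝 (pt x 0)] fun w => w a := by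
      filter_upwards [hW.isOpen.mem_nhds h1] with w hw
      rw [hW.left_inv w hw]
    have h3 := pd_comp (f := fun w => σ w a) 
      (contDiffAt_component (hσ.contDiffAt (mem_image_of_mem Q h1)) a).diffAt_top
      (ContDiff.diffAt_top hQ _) i
    rw [pd_congr e, pd_coord, h2, hQax] at h3
    rw [jacobian_apply]
    fin_cases i <;> fin_cases a <;> simp [Matrix.one_apply] at h3 ⊢ <;> exact h3.symm
  obtain ⟨P', hP'⟩ := (P.mono Metric.isOpen_ball h0B hB).comp hA hσ h0σ hσax hσJ
  refine ⟨_, _, _, fun z => θ (σ z), P'.param, P'.zero_mem, P'.image_subset, ?_, ?_, P'.axis, P'.metric_axis, ?_⟩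
  · exact fun z hz => (hθ.contDiffAt.comp z (hσ.contDiffAt hz.1)).contDiffWithinAt
  · intro z hz i
    have hσz := (hσ.contDiffAt hz.1).diffAt_top
    rw [pullForm_comp hσz (P.param.mdifferentiableAt (hB hz.2)) (Eventually.of_forall fun _ => rfl),
      pd_comp (ContDiff.diffAt_top hθ _) hσz]
    have hY' : Y (σ z) = z 1 := by
      have := congrArg (fun w : Plane => w 1) (hQσ z hz.1)
      exact this
    have hJ0 : jacobian σ z 0 i = if i = 0 then 1 else 0 := hσ0' z hz.1 i
    have e0 := hθ0 (σ z)
    have e1 := hθ1 (σ z)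
    simp only [hform _ hz.2] at e0 e1
    simp only [Fin.sum_univ_two, e0, e1, hY', hJ0, smul_eq_mul]
    split_ifs <;> ring
  · filter_upwards [hP', hcross, hWm] with x h1 h2 h3
    have hx : pt x 0 ∈ Q '' W := ⟨_, h3, hQax x⟩
    have e : pd 1 (fun w => σ w 0) =ᶠ[𝓝 (pt x 0)] fun _ => 0 := by
      filter_upwards [hσ.isOpen.mem_nhds hx] with w hw
      rw [hσ0' w hw]; rfl
    rw [h1, h2, pd_congr e, pd_const]
    simp

/-- The frame formed by a unit vector `p` and a unit normal vector for the metric `g`. -/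
lemma frame_gram {g : Mat} (hs : g 1 0 = g 0 1) {p₀ p₁ D r ς : ℝ} (hr : r ≠ 0) (hD : D ≠ 0)
    (hdet : D ^ 2 = g.det) (hς : ς ^ 2 = 1)
    (hp : g 0 0 * p₀ ^ 2 + 2 * (g 0 1 * (p₀ * p₁)) + g 1 1 * p₁ ^ 2 = 1) :
    let J : Mat := !![r⁻¹ * p₀, -(ς / (r * D)) * (g 1 0 * p₀ + g 1 1 * p₁);
      r⁻¹ * p₁, ς / (r * D) * (g 0 0 * p₀ + g 0 1 * p₁)]
    J.transpose * g * J = (r ^ 2)⁻¹ • (1 : Mat) ∧ J.det = ς / (r ^ 2 * D) := by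
  rw [Matrix.det_fin_two, hs] at hdet
  refine ⟨?_, ?_⟩
  · ext i j
    fin_cases i <;> fin_cases j <;>
      simp [Matrix.mul_apply, Fin.sum_univ_two, Matrix.transpose_apply, hs] <;> field_simp
    · linear_combination hp
    · ring
    · ring
    · linear_combination (g 0 0 * p₀ ^ 2 + 2 * (g 0 1 * (p₀ * p₁)) + g 1 1 * p₁ ^ 2)
        * (g 0 0 * g 1 1 - g 0 1 ^ 2) * hς + D ^ 2 * hp
        - (g 0 0 * p₀ ^ 2 + 2 * (g 0 1 * (p₀ * p₁)) + g 1 1 * p₁ ^ 2) * hdet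
  · simp only [Matrix.det_fin_two, Matrix.of_apply, Matrix.cons_val', Matrix.cons_val_zero, Matrix.cons_val_one,
      Matrix.cons_val_fin_one, hs]
    field_simp
    linear_combination ς * hp

/-- Coordinates along `γ` in which the metric is conformal on the curve. -/
theorem exists_isAxisParam (hA : IsSmoothForm I A) (hγ : IsDegenerateWell I A b₀ γ L) (s₀ : ℝ) :
    ∃ Θ Ξ U, IsAxisParam I A b₀ γ s₀ Θ Ξ U := by
  have hb := hγ.pos
  have hr : √b₀ ≠ 0 := (Real.sqrt_pos.2 hb).ne'
  have hqs : γ s₀ ∈ (extChartAt I (γ s₀)).source := mem_extChartAt_source (γ s₀)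
  have P := isLocalParam_extChart (I := I) (γ s₀)
  set Ψ := (extChartAt I (γ s₀)).symm with hΨ
  set φ := extChartAt I (γ s₀) with hφ
  set W₀ := interior φ.target with hW₀
  have hcs := hγ.curve.smooth
  let S : Set ℝ := γ ⁻¹' (Ψ '' W₀)
  have hS : IsOpen S := P.isOpen_image.preimage hcs.continuous
  have h0S : s₀ ∈ S := ⟨φ (γ s₀), mem_interior_iff_mem_nhds.2
    (extChartAt_mem_interior (hγ.subset_interior ⟨s₀, rfl⟩) hqs), extChartAt_to_inv (γ s₀)⟩
  let c : ℝ → Plane := fun s => φ (γ s)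
  have hΨc : ∀ s ∈ S, Ψ (c s) = γ s := fun s hs => P.right_inv hs
  have hcW : ∀ s ∈ S, c s ∈ W₀ := by
    rintro s ⟨w, hw, he⟩
    have : c s = w := by simp only [c, ← he]; exact P.left_inv w hw
    rwa [this]
  have hc : ∀ s ∈ S, ContDiffAt ℝ ∞ c s := fun s hs =>
    ((P.smooth_inv.contMDiffAt (P.isOpen_image.mem_nhds hs)).comp s hcs.contMDiffAt).contDiffAt
  have hci : ∀ s ∈ S, ∀ i, ContDiffAt ℝ ∞ (fun r => c r i) s := fun s hs i =>
    (contDiff_coord i).contDiffAt.comp s (hc s hs)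
  let p : Fin 2 → ℝ → ℝ := fun i s => deriv (fun r => c r i) s
  have hp : ∀ s ∈ S, ∀ i, ContDiffAt ℝ ∞ (p i) s := fun s hs i =>
    ((hci s hs i).fderiv_right (m := ∞) (by simp)).clm_apply contDiffAt_const
  let g : ℝ → Mat := fun s => pullMetric I Ψ (c s)
  have hg : ∀ s ∈ S, ∀ i j, ContDiffAt ℝ ∞ (fun r => g r i j) s := fun s hs i j =>
    ContDiffAt.comp (g := fun z => pullMetric I Ψ z i j) s (P.matSmooth_pullMetric (hcW s hs) i j) (hc s hs)
  let D : ℝ → ℝ := fun s => areaDensity I Ψ (c s)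
  have hD0 : ∀ s ∈ S, 0 < D s := fun s hs => P.areaDensity_pos (hcW s hs)
  have hD : ∀ s ∈ S, ContDiffAt ℝ ∞ D s := fun s hs =>
    (P.contDiffAt_areaDensity (hcW s hs)).comp s (hc s hs)
  have hunit : ∀ s ∈ S, g s 0 0 * p 0 s ^ 2 + 2 * (g s 0 1 * (p 0 s * p 1 s)) + g s 1 1 * p 1 s ^ 2 = 1 := by
    intro s hs
    have hpi : ∀ i, deriv c s i = p i s := fun i =>
      (hasDerivAt_component (hc s hs).diffAt_top.hasDerivAt i).deriv.symm
    have hv := velocity_eq (I := I) (hc s hs).diffAt_top (P.mdifferentiableAt (hcW s hs))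
      (show γ =ᶠ[𝓝 s] fun r => Ψ (c r) by
        filter_upwards [hS.mem_nhds hs] with r hr using (hΨc r hr).symm)
    let N : M → Plane → ℝ := fun x v => ‖(show TangentSpace I x from v)‖
    have h1 : N (Ψ (c s)) (mfderiv 𝓘(ℝ, Plane) I Ψ (c s) (deriv c s)) = 1 := by
      rw [← hv, hΨc s hs]; exact hγ.curve.unit_speed s
    have h2 := IsLocalParam.norm_sq_mfderiv (I := I) Ψ (c s) (deriv c s)
    have h3 := (congrArg (· ^ 2) h1).symm.trans h2
    rw [hpi, hpi] at h3
    simp only [g]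
    linarith
  let B : ℝ → ℝ := fun s => planeCurl (fun i => pullForm I A Ψ i) (c s)
  have hB : ContinuousAt B s₀ := by
    have h1 := fun i => P.contDiffAt_pullForm hA (hcW s₀ h0S) i
    exact ContinuousAt.comp (g := planeCurl fun i => pullForm I A Ψ i)
      (((h1 1).pd 0).sub ((h1 0).pd 1)).continuousAt (hc s₀ h0S).continuousAt
  have hfield : ∀ s, |fieldStrength I A (γ s)| = b₀ := fun s => by
    have : γ s ∈ {x | |fieldStrength I A x| = b₀} := hγ.range_eq ▸ mem_range_self s
    exact this
  have hB0 : B s₀ ≠ 0 := by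
    intro h
    have h1 := hfield s₀
    rw [← hΨc s₀ h0S, IsLocalParam.abs_fieldStrength_eq hA P (hcW s₀ h0S)] at h1
    change |B s₀| / _ = b₀ at h1
    rw [h] at h1
    simp at h1
    exact hb.ne h1
  obtain ⟨ς, hς, hςB⟩ : ∃ ς : ℝ, ς ^ 2 = 1 ∧ ς * B s₀ < 0 := by
    rcases lt_or_gt_of_ne hB0 with h | h
    · exact ⟨1, by norm_num, by linarith⟩
    · exact ⟨-1, by norm_num, by linarith⟩
  let n : Fin 2 → ℝ → ℝ := ![fun s => -(ς / (√b₀ * D s)) * (g s 1 0 * p 0 s + g s 1 1 * p 1 s),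
    fun s => ς / (√b₀ * D s) * (g s 0 0 * p 0 s + g s 0 1 * p 1 s)]
  have hn : ∀ s ∈ S, ∀ i, ContDiffAt ℝ ∞ (n i) s := by
    intro s hs i
    have h1 : ContDiffAt ℝ ∞ (fun s => ς / (√b₀ * D s)) s :=
      contDiffAt_const.div (contDiffAt_const.mul (hD s hs)) (mul_ne_zero hr (hD0 s hs).ne')
    fin_cases i
    · exact h1.neg.mul (((hg s hs 1 0).mul (hp s hs 0)).add ((hg s hs 1 1).mul (hp s hs 1)))
    · exact h1.mul (((hg s hs 0 0).mul (hp s hs 0)).add ((hg s hs 0 1).mul (hp s hs 1)))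
  let l : ℝ → ℝ := fun x => s₀ + x / √b₀
  have hl : ContDiff ℝ ∞ l := contDiff_const.add (contDiff_id.div_const _)
  have hld : ∀ x, HasDerivAt l (√b₀)⁻¹ x := fun x => by
    exact (((hasDerivAt_id' x).div_const (√b₀)).const_add s₀).congr_deriv (one_div _)
  let V : Set Plane := {z | l (z 0) ∈ S}
  have hV : IsOpen V := hS.preimage (hl.continuous.comp (contDiff_coord 0).continuous)
  have h0V : (0 : Plane) ∈ V := by
    change s₀ + 0 / √b₀ ∈ S
    rwa [zero_div, add_zero]
  let τc : Fin 2 → Plane → ℝ := fun i z => c (l (z 0)) i + z 1 * n i (l (z 0))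
  let τ : Plane → Plane := fun z => pt (τc 0 z) (τc 1 z)
  have hτc : ∀ i z, τ z i = τc i z := fun i z => by fin_cases i <;> rfl
  have hcl : ∀ f : ℝ → ℝ, (∀ s ∈ S, ContDiffAt ℝ ∞ f s) → ∀ z ∈ V, ContDiffAt ℝ ∞ (fun z => f (l (z 0))) z :=
    fun f hf z hz => ContDiffAt.comp (g := f) z (hf _ hz) (hl.comp (contDiff_coord 0)).contDiffAt
  have hτcs : ∀ z ∈ V, ∀ i, ContDiffAt ℝ ∞ (τc i) z := fun z hz i =>
    (hcl _ (fun s hs => hci s hs i) z hz).add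
      ((contDiff_coord 1).contDiffAt.mul (hcl _ (fun s hs => hn s hs i) z hz))
  have hτ : ∀ z ∈ V, ContDiffAt ℝ ∞ τ z := fun z hz =>
    contDiff_pt.contDiffAt.comp z ((hτcs z hz 0).prodMk (hτcs z hz 1))
  have hVx : ∀ {x : ℝ}, pt x 0 ∈ V → l x ∈ S := fun hx => hx
  have hax : ∀ x, τ (pt x 0) = c (l x) := fun x => by
    ext i
    rw [hτc]
    simp only [τc]
    rw [show pt x 0 1 = 0 from rfl, zero_mul, add_zero]; rfl
  have hJ : ∀ x, pt x 0 ∈ V → jacobian τ (pt x 0)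
      = !![(√b₀)⁻¹ * p 0 (l x), -(ς / (√b₀ * D (l x))) * (g (l x) 1 0 * p 0 (l x) + g (l x) 1 1 * p 1 (l x));
        (√b₀)⁻¹ * p 1 (l x), ς / (√b₀ * D (l x)) * (g (l x) 0 0 * p 0 (l x) + g (l x) 0 1 * p 1 (l x))] := by
    intro x hx
    have hd := fun a => (hτcs _ hx a).diffAt_top
    have h0 : ∀ a, pd 0 (τc a) (pt x 0) = (√b₀)⁻¹ * p a (l x) := fun a => by
      have h1 : HasDerivAt (fun t => τc a (pt t 0)) ((√b₀)⁻¹ * p a (l x)) x := by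
        have e : (fun t => τc a (pt t 0)) = fun t => (fun r => c r a) (l t) := by
          funext t; rw [← hτc, hax]
        rw [e, mul_comm]
        exact ((hci _ (hVx hx) a).diffAt_top.hasDerivAt).comp x (hld x)
      exact (hasDerivAt_pt_zero (hd a)).unique h1
    have h1 : ∀ a, pd 1 (τc a) (pt x 0) = n a (l x) := fun a => by
      have h2 : HasDerivAt (fun t => τc a (pt x t)) (n a (l x)) 0 := by
        exact (((hasDerivAt_id' (0 : ℝ)).mul_const (n a (l x))).const_add (c (l x) a)).congr_deriv (one_mul _)
      exact (hasDerivAt_pt_one (hd a)).unique h2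
    ext a i
    rw [jacobian_apply]
    simp only [hτc]
    fin_cases a <;> fin_cases i
    · exact h0 0
    · exact h1 0
    · exact h0 1
    · exact h1 1
  have hframe := fun x (hx : pt x 0 ∈ V) => frame_gram (IsLocalParam.pullMetric_symm (I := I) (Θ := Ψ) (c (l x)))
    hr (hD0 _ (hVx hx)).ne' (P.areaDensity_sq (hcW _ (hVx hx))) hς (hunit _ (hVx hx))
  have hdet : (jacobian τ 0).det ≠ 0 := by
    have h1 : pt 0 0 ∈ V := by rw [pt_zero_zero]; exact h0V
    rw [← pt_zero_zero, hJ 0 h1, (hframe 0 h1).2]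
    have : ς ≠ 0 := by rintro rfl; norm_num at hς
    have := (hD0 _ (hVx h1)).ne'
    positivity
  obtain ⟨W, hWV, h0W, σ, hW⟩ := exists_isLocalParam hV h0V hτ hdet
  have Q := P.comp hW
  have h0Q : (0 : Plane) ∈ W ∩ τ ⁻¹' W₀ := ⟨h0W, by
    have := hax 0
    rw [pt_zero_zero] at this
    rw [mem_preimage, this]; exact hcW _ h0V⟩
  have hQm := eventually_pt_mem Q.isOpen h0Q
  have haxis : ∀ᶠ x in 𝓝 (0 : ℝ), Ψ (τ (pt x 0)) = γ (s₀ + x / √b₀) := hQm.mono fun x hx => by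
    rw [hax]; exact hΨc _ (hVx (hWV hx.1))
  have hmetric : ∀ᶠ x in 𝓝 (0 : ℝ), pullMetric I (fun z => Ψ (τ z)) (pt x 0) = b₀⁻¹ • (1 : Mat) := by
    filter_upwards [hQm] with x hx
    rw [pullMetric_comp (hτ _ (hWV hx.1)).diffAt_top (P.mdifferentiableAt hx.2)
      (Eventually.of_forall fun _ => rfl), hJ x (hWV hx.1), hax]
    have := (hframe x (hWV hx.1)).1
    rwa [Real.sq_sqrt hb.le] at this
  refine ⟨_, _, _, Q, h0Q, ⟨γ s₀, ?_⟩, haxis, hmetric, ?_⟩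
  · rintro _ ⟨z, hz, rfl⟩
    exact φ.map_target (interior_subset hz.2)
  · have hlim : Tendsto l (𝓝 0) (𝓝 s₀) := by
      have := hl.continuous.tendsto 0
      simpa only [l, zero_div, add_zero] using this
    filter_upwards [hQm, hmetric, haxis,
      hlim.eventually ((continuousAt_const.mul hB).eventually_lt_const hςB)] with x h1 h2 h3 h4
    have hxV := hWV h1.1
    have h5 : planeCurl (fun i => pullForm I A (fun z => Ψ (τ z)) i) (pt x 0)
        = ς / (√b₀ ^ 2 * D (l x)) * B (l x) := by
      rw [planeCurl_comp (a' := fun i => pullForm I A Ψ i) (hτ _ hxV)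
        (fun i => P.contDiffAt_pullForm hA h1.2 i) (fun i => by
          filter_upwards [Q.isOpen.mem_nhds h1] with w hw
          exact pullForm_comp (hτ _ (hWV hw.1)).diffAt_top (P.mdifferentiableAt hw.2)
            (Eventually.of_forall fun _ => rfl) i), hJ x hxV, (hframe x hxV).2, hax]
    have h6 := IsLocalParam.abs_fieldStrength_eq hA Q h1
    rw [h2, h3, hfield] at h6
    have hneg : planeCurl (fun i => pullForm I A (fun z => Ψ (τ z)) i) (pt x 0) < 0 := by
      rw [h5, div_mul_eq_mul_div]
      have := hD0 _ (hVx hxV)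
      exact div_neg_of_neg_of_pos h4 (by positivity)
    rw [abs_of_neg hneg] at h6
    have h7 : √(b₀⁻¹ • (1 : Mat)).det = b₀⁻¹ := by
      rw [Real.sqrt_eq_iff_mul_self_eq_of_pos (by positivity)]
      simp [sq]
    rw [h7, div_inv_eq_mul] at h6
    have h8 := mul_right_cancel₀ hb.ne' ((one_mul b₀).trans h6)
    linarith

end Existence

end MagneticWell

end

open MagneticWell in
theorem theorem4p1
    {H : Type*} [TopologicalSpace H] (I : ModelWithCorners ℝ (EuclideanSpace ℝ (Fin 2)) H)
    {M : Type*} [MetricSpace M] [CompactSpace M] [ConnectedSpace M]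
    [MeasurableSpace M] [BorelSpace M]
    [ChartedSpace H M] [IsManifold I ∞ M]
    [RiemannianBundle (fun x : M => TangentSpace I x)]
    [IsContMDiffRiemannianBundle I ∞ (EuclideanSpace ℝ (Fin 2)) (fun x : M => TangentSpace I x)]
    [IsRiemannianManifold I M]
    (A : ∀ x : M, TangentSpace I x →L[ℝ] ℝ) (hA : IsSmoothForm I A)
    (b₀ : ℝ) (γ : ℝ → M) (L : ℝ) (hγ : IsDegenerateWell I A b₀ γ L)
    (k : ℕ) (s₀ : ℝ) (hmin : IsUniqueNondegenerateMin γ (potential I A b₀ γ k) s₀) :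
    ∃ u : ℕ → ℝ → M → ℂ,
      (∀ j : ℕ, ∀ h : ℝ, 0 < h → IsTestFunction I (u j h)) ∧
      (∀ j₁ j₂ : ℕ, ∃ C > (0 : ℝ), ∃ h₀ > (0 : ℝ), ∀ h ∈ Ioc 0 h₀,
        ‖l2Inner I (u j₁ h) (u j₂ h) - (if j₁ = j₂ then 1 else 0)‖ ≤ C * h) ∧
      (∀ j : ℕ, ∃ C > (0 : ℝ), ∃ h₀ > (0 : ℝ), ∀ h ∈ Ioc 0 h₀,
        ∃ f : M → ℂ, IsMagneticSchrodinger I A h (u j h) f ∧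
          l2Norm I (fun x => f x - (approxEigenvalue I A b₀ γ s₀ j k h : ℂ) * u j h x)
            ≤ C * h ^ (11 / 4 : ℝ) * l2Norm I (u j h)) := by
  obtain ⟨Θ, Ξ, U, P⟩ := exists_isAxisParam hA hγ s₀
  obtain ⟨Θ, Ξ, U, P, hcross⟩ := P.exists_cross_axis hA hγ.pos
  obtain ⟨Θ, Ξ, U, θ, P⟩ := P.exists_isAdaptedParam hA hcross
  exact P.exists_quasimodes hA hγ hmin
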